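/- Let $b\in\mathbb R$, $\vec k=(0,0,1)$, $\mathbb S^2=\{y\in\mathbb R^3:|y|=1\}$, and for $u=u(x,t):\mathbb R^2\times[0,T]\to\mathbb S^2$ consider the Landau–Lifshitz equation with helicity term $$\partial_t u=u\times(-\Delta u+b\,\nabla\times u),\qquad \nabla\times u=(\partial_2u_3,\,-\partial_1u_3,\,\partial_1u_2-\partial_2u_1).\tag{1}$$ By a solution on $[0,T]$, $0<T<\infty$, we mean a weak solution of (1) in the class $C([0,T];\vec k+L^2\cap L^\infty)\cap L^\infty([0,T];\vec k+H^2)$. Let $u^{(0)},u^{(1)}$ be two solutions on $[0,T]$ such that $u^{(0)}(x,t)$ and $u^{(1)}(x,t)$ are never antipodal, uniformly: their geodesic distance on $\mathbb S^2$ is at most $\theta$ for every $t\in[0,T]$ and almost every $x$, where $\theta<\pi$ is fixed. Let $\gamma(\cdot,x,t):[0,1]\to\mathbb S^2$ be the minimal geodesic from $u^{(0)}(x,t)$ to $u^{(1)}(x,t)$, so that $\partial_{ss}\gamma+(\gamma_s\cdot\gamma_s)\gamma=0$, and let $X(1,0)$ be the parallel transport along it from $u^{(0)}(x,t)$ to $u^{(1)}(x,t)$,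 that is, $X(1,0)\xi=F(1)$, where $F$ solves $\partial_sF+(F\cdot\gamma_s)\gamma=0$, $F(0)=\xi$. Set $q=u^{(0)}-u^{(1)}$, $V_m=X(1,0)\partial_mu^{(0)}-\partial_mu^{(1)}$ for $m=1,2$, and, for $0\le\tau\le T$, $$G(\tau)=\|q\|_{L^\infty([0,\tau];L^2)}^2+\sum_{m=1,2}\|V_m\|_{L^\infty([0,\tau];L^2)}^2,$$ so that $G(0)$ is the value at the initial time. **Proposition 3.1.** For every $b$ and every $\theta<\pi$ there is a function $M\mapsto C(M)\in(0,\infty)$ such that, for all $T>0$, all solutions $u^{(0)},u^{(1)}$ on $[0,T]$ as above, and all real $M$ with $$\|u^{(0)}-\vec k\|_{L^\infty([0,T];H^2)}+\|u^{(1)}-\vec k\|_{L^\infty([0,T];H^2)}\le M,$$ one has $G(T)<\infty$ and, for every $p\in(2,\infty)$, $$G(T)\le\bigl(G(0)^{1/p}+C(M)\,T\bigr)^p.$$ In particular, $C(M)$ is independent of $p$, of $T$ and of the solutions. Moreover, solutions are unique: if $u^{(0)},u^{(1)}$ are any two solutions on $[0,T]$ (without the condition on their distance) and $u^{(0)}(\cdot,0)=u^{(1)}(\cdot,0)$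 almost everywhere, then $u^{(0)}(\cdot,t)=u^{(1)}(\cdot,t)$ almost everywhere for every $t\in[0,T]$. -/

import Mathlib

open MeasureTheory Set Filter Topology
open scoped ENNReal ContDiff

namespace LLHelicity

/-- The plane `ℝ²` with its Euclidean norm. -/
abbrev Plane : Type := EuclideanSpace ℝ (Fin 2)

/-- The space `ℝ³` with its Euclidean norm; the target sphere is its unit sphere. -/
abbrev Space : Type := EuclideanSpace ℝ (Fin 3)

/-- The vector `k = (0,0,1)`. -/
noncomputable def kVec : Space := !₂[0, 0, 1]

/-- The vector product of `ℝ³`. -/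
noncomputable def cross (a c : Space) : Space :=
  WithLp.toLp 2 (crossProduct (WithLp.ofLp a) (WithLp.ofLp c))

/-! ### Weak derivatives and the Sobolev space of order two -/

/-- `g` is the weak partial derivative of `f` in the `i`-th coordinate direction:
`∫ (∂ᵢ φ) f = - ∫ φ g` for all smooth compactly supported real functions `φ`. -/
def HasWeakPartial (i : Fin 2) (f g : Plane → Space) : Prop :=
  LocallyIntegrable f volume ∧ LocallyIntegrable g volume ∧
    ∀ φ : Plane → ℝ, ContDiff ℝ ∞ φ → HasCompactSupport φ →
      ∫ x, (fderiv ℝ φ x (EuclideanSpace.single i 1)) • f x = - ∫ x, φ x • g x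

open Classical in
/-- The weak partial derivative of `f` (unique up to null sets), and `0` if there is none. -/
noncomputable def weakPartial (i : Fin 2) (f : Plane → Space) : Plane → Space :=
  if h : ∃ g, HasWeakPartial i f g then h.choose else 0

/-- `f` lies in `H²(ℝ²; ℝ³)`: it has weak derivatives up to order two, and they are
square-integrable together with `f`. -/
def MemH2 (f : Plane → Space) : Prop :=
  MemLp f 2 volume ∧
    (∀ i, (∃ g, HasWeakPartial i f g) ∧ MemLp (weakPartial i f) 2 volume) ∧
    ∀ i j, (∃ g, HasWeakPartial i (weakPartial j f) g) ∧
      MemLp (weakPartial i (weakPartial j f)) 2 volume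

open Classical in
/-- The norm of `H²(ℝ²; ℝ³)`, with value `∞` outside this space. -/
noncomputable def h2Norm (f : Plane → Space) : ℝ≥0∞ :=
  if MemH2 f then
    (eLpNorm f 2 volume ^ 2 + ∑ i, eLpNorm (weakPartial i f) 2 volume ^ 2 +
      ∑ i, ∑ j, eLpNorm (weakPartial i (weakPartial j f)) 2 volume ^ 2) ^ (1 / 2 : ℝ)
  else ⊤

/-- The norm `‖u - k‖` in `L^∞(0,T; H²)`: the essential supremum over the times in `[0,T]` of
the `H²` norm. -/
noncomputable def linftyH2 (T : ℝ) (u : ℝ → Plane → Space) : ℝ≥0∞ :=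
  essSup (fun t => h2Norm (fun x => u t x - kVec)) (volume.restrict (Icc 0 T))

/-! ### The Landau-Lifshitz equation with helicity term -/

/-- `∇ × u = (∂₂ u₃, - ∂₁ u₃, ∂₁ u₂ - ∂₂ u₁)` for maps of two variables. -/
noncomputable def curl (u : Plane → Space) (x : Plane) : Space :=
  !₂[weakPartial 1 u x 2, - weakPartial 0 u x 2, weakPartial 0 u x 1 - weakPartial 1 u x 0]

/-- The Laplacian in the weak sense. -/
noncomputable def weakLaplacian (u : Plane → Space) (x : Plane) : Space :=
  ∑ i, weakPartial i (weakPartial i u) x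

/-- The right-hand side `u × (-Δu + b ∇×u)`. -/
noncomputable def llRHS (b : ℝ) (u : Plane → Space) (x : Plane) : Space :=
  cross (u x) (- weakLaplacian u x + b • curl u x)

/-- `u` (with `u t x` its value at time `t` and position `x`) is a weak solution on `[0,T]` of
`∂ₜ u = u × (-Δu + b ∇×u)` with values in the unit sphere, in the class
`C([0,T]; k + L² ∩ L^∞) ∩ L^∞([0,T]; k + H²)`. The equation is tested against smooth compactly
supported functions of the position and integrated in time, which for maps of this class is
equivalent to the equation in the sense of distributions on `(0,T) × ℝ²`. -/
structure IsSolution (b T : ℝ) (u : ℝ → Plane → Space) : Prop where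
  sphere : ∀ t ∈ Icc 0 T, ∀ᵐ x, ‖u t x‖ = 1
  memL2 : ∀ t ∈ Icc 0 T, MemLp (fun x => u t x - kVec) 2 volume
  continuous_L2 : ∀ t ∈ Icc 0 T,
    Tendsto (fun s => eLpNorm (fun x => u s x - u t x) 2 volume) (𝓝[Icc 0 T] t) (𝓝 0)
  continuous_Linfty : ∀ t ∈ Icc 0 T,
    Tendsto (fun s => eLpNorm (fun x => u s x - u t x) ⊤ volume) (𝓝[Icc 0 T] t) (𝓝 0)
  bounded_H2 : linftyH2 T u < ⊤
  equation : ∀ φ : Plane → ℝ, ContDiff ℝ ∞ φ → HasCompactSupport φ → ∀ t ∈ Icc 0 T,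
    ∫ x, φ x • (u t x - u 0 x) = ∫ s in (0 : ℝ)..t, ∫ x, φ x • llRHS b (u s) x

/-! ### Geodesics of the sphere and parallel transport -/

/-- `γ : [0,1] → 𝕊²`, with velocity `γ'`, is a minimal geodesic from `p` to `q`:
`γ'' + (γ' · γ') γ = 0`, and the (constant) speed of `γ`, hence its length, is the distance
`arccos (p · q)` of `p` and `q` on the sphere. -/
structure IsMinimalGeodesic (p q : Space) (γ γ' : ℝ → Space) : Prop where
  source : γ 0 = p
  target : γ 1 = q
  sphere : ∀ s ∈ Icc (0 : ℝ) 1, ‖γ s‖ = 1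
  velocity : ∀ s ∈ Icc (0 : ℝ) 1, HasDerivWithinAt γ (γ' s) (Icc 0 1) s
  geodesic : ∀ s ∈ Icc (0 : ℝ) 1,
    HasDerivWithinAt γ' (- (inner ℝ (γ' s) (γ' s)) • γ s) (Icc 0 1) s
  minimal : ∀ s ∈ Icc (0 : ℝ) 1, ‖γ' s‖ = InnerProductGeometry.angle p q

/-- `F` is parallel along `γ`: `D_s F = ∂_s F + (F · γ') γ = 0`. -/
def IsParallelAlong (γ γ' F : ℝ → Space) : Prop :=
  ∀ s ∈ Icc (0 : ℝ) 1, HasDerivWithinAt F (- (inner ℝ (F s) (γ' s)) • γ s) (Icc 0 1) s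

/-- `η` is the parallel transport of `ξ` along a minimal geodesic from `p` to `q`. -/
def IsTransport (p q ξ η : Space) : Prop :=
  ∃ γ γ' F : ℝ → Space, IsMinimalGeodesic p q γ γ' ∧ IsParallelAlong γ γ' F ∧ F 0 = ξ ∧ F 1 = η

open Classical in
/-- The operator `X(1,0)`: parallel transport from `p` to `q` along the minimal geodesic. For
points of the sphere that are not antipodal, this geodesic and the transported vector are unique;
the default value `0` occurs only if there is no geodesic. -/
noncomputable def transport (p q ξ : Space) : Space :=
  if h : ∃ η, IsTransport p q ξ η then h.choose else 0

/-- `V_m = X(1,0) ∂_m u - ∂_m v` for two maps `u`, `v` from the plane to the sphere. -/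
noncomputable def gradDiff (m : Fin 2) (u v : Plane → Space) (x : Plane) : Space :=
  transport (u x) (v x) (weakPartial m u x) - weakPartial m v x

/-- `G(T) = ‖q‖² + ∑ₘ ‖V_m‖²`, with the norms of `L^∞(0,T; L²)`. For solutions `q` and `V_m` are
continuous in time with values in `L²`, so that the supremum over `[0,T]` is the essential
supremum, and `G(0)` is the value at the initial time. -/
noncomputable def G (T : ℝ) (u v : ℝ → Plane → Space) : ℝ≥0∞ :=
  (⨆ t ∈ Icc 0 T, eLpNorm (fun x => u t x - v t x) 2 volume) ^ 2 +
    ∑ m, (⨆ t ∈ Icc 0 T, eLpNorm (gradDiff m (u t) (v t)) 2 volume) ^ 2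

end LLHelicity

/-! Write w = (u₀ + u₁)/2 and q = u₀ - u₁. Parallel transport on the sphere is explicit, Xξ = ξ -
(ξ·u₁)/(1 + u₀·u₁) (u₀ + u₁), so |V_m|² is an algebraic expression in q, ∂_m w, ∂_m q
(`normSq_transport_sub`): it is |∂_m q|² with two corrections quadratic in q, multiplied by ζ = 1/(1
+ u₀·u₁), which stays bounded because the points stay away from being antipodal. Half of its
integral is `Jet.energy`.

The corrections make the energy estimate close. Differentiating ½‖∂_m q‖² along the equation leaves
triple products such as [q, ∂_kk w, ∂_mm q], which carry second derivatives twice and only one small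
factor. The constraints w·q = 0 and |w|² + |q|²/4 = 1, differentiated up to twice, control the
components along w of the derivatives of w and q. Three vectors orthogonal to w lie in a plane and
have zero triple product, so Cramer's rule leaves only those components. What does not become small
at once either cancels against the corrections or belongs to a null form or to an exact divergence,
both of integral zero (`Pair.core_identity` is not needed as a separate principle: `core_identity`,
`Pair.integral_nullForm` and `Pair.integral_flux` together carry this). The rest is bounded by the
square of |q|(1 + |D²| + |D|²) + |∇q|(1 + |D|), the function `errWeight`, which is linear in the
difference of the solutions (`Pair.density_bound`, `Pair.integral_density_le`). The helicity term
becomes -b(u·∇)u by |u| = 1 and is handled by integration by parts.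

The integral of `errWeight`² is the two-dimensional borderline case: it asks for the supremum of q
and for the product |∇w||∇q| in L², while only q in H¹ may be used. Splitting a function at scale ε
by a kernel that is a divergence gives the Brezis-Gallouet inequality (`log_sup`) and a product
version of it (`log_product`): both cost a factor log(1/ε) and leave a remainder of size ε. Hence,
with x the squared distance, the growth rate of x is at most C((1 + log(1/ε)) x + ε) for every ε
(`Jet.IsPair.exists_errJet_le`). Optimising ε bounds it by C p x^(1-1/p) with C independent of p
(`le_rpow_of_log_bound`); then x^(1/p) grows at most linearly, also for the sum of separate suprema
that defines `G` (`sum_sSup_le`).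

Solutions are only weakly continuous in H², so the energies are not differentiated in time. Instead
their increments between two times are written exactly as pairings of L² functions with the
increments of q and w (`Jet.IsPair.energy_sub`). The equation, extended to arbitrary L² test
functions (`IsSolution.evolution`), turns these into time integrals, and summing over finer and
finer partitions yields the growth estimate (`sub_le_of_increments`). Weak convergence of the second
derivatives suffices in the limit because they enter the factors linearly.

For uniqueness, two solutions that agree at one time stay uniformly close for a short time by
continuity in L^∞. The estimate then gives x ≤ (CT)^p for all p > 2; on intervals with CT ≤ 1/2,
letting p tend to infinity gives x = 0. A continuation argument covers [0,T]. -/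

namespace LLHelicity

/-- The inner product as a bounded bilinear map. -/
noncomputable def innerB : Space →L[ℝ] Space →L[ℝ] ℝ := innerSL ℝ

lemma innerB_apply (a b : Space) : innerB a b = inner ℝ a b := rfl

set_option linter.unusedSectionVars false

/-! ### Limits in Lebesgue spaces, and weak derivatives with Hölder exponents graded by order -/

section Calculus

variable {ι : Type*} {E F G : Type*} [NormedAddCommGroup E] [NormedSpace ℝ E]
  [NormedAddCommGroup F] [NormedSpace ℝ F] [NormedAddCommGroup G] [NormedSpace ℝ G]

/-- The classical partial derivative in the `i`-th coordinate direction. -/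
noncomputable def pd (i : Fin 2) (f : Plane → E) (x : Plane) : E :=
  fderiv ℝ f x (EuclideanSpace.single i 1)

/-- The exponent `4 / j`, with `lp 0 = ∞`. -/
noncomputable def lp (j : ℕ) : ℝ≥0∞ := ((j : ℝ≥0∞) / 4)⁻¹

/-- The index counts derivatives: for a map in k + H² of the plane the map is of order 0, its
gradient of order 1 and its Hessian of order 2. Reciprocal exponents are proportional to the order,
so Hölder's inequality adds orders, and a product of total order 4 is integrable. -/
instance lp_holderTriple (i j : ℕ) : ENNReal.HolderTriple (lp i) (lp j) (lp (i + j)) where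
  inv_add_inv_eq_inv := by
    simp only [lp, inv_inv, Nat.cast_add]
    rw [ENNReal.div_add_div_same]

lemma lp_zero : lp 0 = ⊤ := by simp [lp]

lemma lp_two : lp 2 = 2 := by
  rw [lp, show ((2 : ℕ) : ℝ≥0∞) / 4 = 2⁻¹ by
    rw [show (4 : ℝ≥0∞) = 2 * 2 by norm_num, Nat.cast_ofNat, ENNReal.div_eq_inv_mul,
      ENNReal.mul_inv (by simp) (by simp), mul_assoc, ENNReal.inv_mul_cancel (by simp) (by simp),
      mul_one], inv_inv]

lemma lp_one : lp 1 = 4 := by simp [lp]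

lemma lp_four : lp 4 = 1 := by
  simp [lp, ENNReal.div_self]

lemma one_le_lp {j : ℕ} (h : j ≤ 4) : 1 ≤ lp j := by
  rw [lp, ENNReal.one_le_inv]
  refine ENNReal.div_le_of_le_mul ?_
  rw [one_mul]
  exact_mod_cast h

/-- `F n` converges to `f` in `L^p` along the filter `l`. -/
structure TL (p : ℝ≥0∞) (l : Filter ι) (F : ι → Plane → E) (f : Plane → E) : Prop where
  memF : ∀ᶠ n in l, MemLp (F n) p volume
  mem : MemLp f p volume
  lim : Tendsto (fun n => eLpNorm (fun x => F n x - f x) p volume) l (𝓝 0)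

namespace TL

variable {l : Filter ι} {p q r : ℝ≥0∞} {f f' : Plane → E} {g g' : Plane → F}
  {A : ι → Plane → E} {B : ι → Plane → F}

lemma const (hf : MemLp f p volume) : TL p l (fun _ => f) f :=
  ⟨.of_forall fun _ => hf, hf, by simpa using tendsto_const_nhds⟩

lemma comp {κ : Type*} {l' : Filter κ} {k : κ → ι} (h : TL p l A f) (hk : Tendsto k l' l) :
    TL p l' (fun n => A (k n)) f :=
  ⟨hk.eventually h.memF, h.mem, h.lim.comp hk⟩

lemma congr (h : TL p l A f) (hf : f =ᵐ[volume] f') : TL p l A f' := by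
  refine ⟨h.memF, (memLp_congr_ae hf).1 h.mem, h.lim.congr fun n => ?_⟩
  exact eLpNorm_congr_ae (by filter_upwards [hf] with x hx; rw [hx])

lemma congr_left {A' : ι → Plane → E} (h : TL p l A f)
    (hA : ∀ᶠ n in l, A n =ᵐ[volume] A' n) : TL p l A' f := by
  refine ⟨?_, h.mem, h.lim.congr' ?_⟩
  · filter_upwards [h.memF, hA] with n h1 h2 using (memLp_congr_ae h2).1 h1
  · filter_upwards [hA] with n h2
    exact eLpNorm_congr_ae (by filter_upwards [h2] with x hx; rw [hx])

/-- Expand b(A,B) - b(f,g) as b(A-f,B-g) + b(A-f,g) + b(f,B-g) and apply Hölder to each term. -/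
lemma bilin [ENNReal.HolderTriple p q r] (hr : 1 ≤ r) (b : E →L[ℝ] F →L[ℝ] G)
    (hA : TL p l A f) (hB : TL q l B g) :
    TL r l (fun n x => b (A n x) (B n x)) (fun x => b (f x) (g x)) := by
  refine ⟨?_, b.memLp_of_bilin r hA.mem hB.mem, ?_⟩
  · filter_upwards [hA.memF, hB.memF] with n h1 h2 using b.memLp_of_bilin r h1 h2
  have hbd : ∀ (x : E) (y : F), ‖b x y‖₊ ≤ ‖b‖₊ * ‖x‖₊ * ‖y‖₊ := fun x y => b.le_opNorm₂ x y
  have key : ∀ᶠ n in l, eLpNorm (fun x => b (A n x) (B n x) - b (f x) (g x)) r volume ≤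
      ‖b‖₊ * eLpNorm (fun x => A n x - f x) p volume *
        (eLpNorm (fun x => B n x - g x) q volume) +
      (‖b‖₊ * eLpNorm (fun x => A n x - f x) p volume * eLpNorm g q volume +
      ‖b‖₊ * eLpNorm f p volume * eLpNorm (fun x => B n x - g x) q volume) := by
    filter_upwards [hA.memF, hB.memF] with n h1 h2
    have e : (fun x => b (A n x) (B n x) - b (f x) (g x)) =
        (fun x => b (A n x - f x) (B n x - g x)) +
          ((fun x => b (A n x - f x) (g x)) + (fun x => b (f x) (B n x - g x))) := by
      ext x; simp only [Pi.add_apply, map_sub, sub_apply]; abel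
    have m1 := (h1.sub hA.mem).1
    have m2 := (h2.sub hB.mem).1
    rw [e]
    refine (eLpNorm_add_le (b.aestronglyMeasurable_comp₂ m1 m2)
      ((b.aestronglyMeasurable_comp₂ m1 hB.mem.1).add
        (b.aestronglyMeasurable_comp₂ hA.mem.1 m2)) hr).trans ?_
    refine add_le_add ?_ ((eLpNorm_add_le (b.aestronglyMeasurable_comp₂ m1 hB.mem.1)
      (b.aestronglyMeasurable_comp₂ hA.mem.1 m2) hr).trans (add_le_add ?_ ?_))
    · exact eLpNorm_le_eLpNorm_mul_eLpNorm_of_nnnorm m1 m2 (b · ·) ‖b‖₊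
        (.of_forall fun x => hbd _ _)
    · exact eLpNorm_le_eLpNorm_mul_eLpNorm_of_nnnorm m1 hB.mem.1 (b · ·) ‖b‖₊
        (.of_forall fun x => hbd _ _)
    · exact eLpNorm_le_eLpNorm_mul_eLpNorm_of_nnnorm hA.mem.1 m2 (b · ·) ‖b‖₊
        (.of_forall fun x => hbd _ _)
  refine tendsto_of_tendsto_of_tendsto_of_le_of_le' tendsto_const_nhds ?_
    (.of_forall fun _ => zero_le) key
  have t1 : Tendsto (fun n => (‖b‖₊ : ℝ≥0∞) * eLpNorm (fun x => A n x - f x) p volume) l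
      (𝓝 0) := by
    simpa using ENNReal.Tendsto.const_mul hA.lim (Or.inr (ENNReal.coe_ne_top (r := ‖b‖₊)))
  have t2 : Tendsto (fun n => (‖b‖₊ : ℝ≥0∞) * eLpNorm (fun x => A n x - f x) p volume *
      eLpNorm (fun x => B n x - g x) q volume) l (𝓝 0) := by
    simpa using ENNReal.Tendsto.mul t1 (Or.inr (by simp)) hB.lim (Or.inr (by simp))
  have t3 := ENNReal.Tendsto.mul_const (b := eLpNorm g q volume) t1 (Or.inr hB.mem.2.ne)
  have t4 := ENNReal.Tendsto.const_mul (a := ‖b‖₊ * eLpNorm f p volume) hB.lim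
    (Or.inr (ENNReal.mul_ne_top ENNReal.coe_ne_top hA.mem.2.ne))
  simpa using t2.add (t3.add t4)

lemma add {A' : ι → Plane → E} (hp : 1 ≤ p) (hA : TL p l A f) (hA' : TL p l A' f') :
    TL p l (fun n x => A n x + A' n x) (fun x => f x + f' x) := by
  refine ⟨?_, hA.mem.add hA'.mem, ?_⟩
  · filter_upwards [hA.memF, hA'.memF] with n h1 h2 using h1.add h2
  have h := hA.lim.add hA'.lim
  rw [add_zero] at h
  refine tendsto_of_tendsto_of_tendsto_of_le_of_le' tendsto_const_nhds h
    (.of_forall fun _ => zero_le) ?_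
  filter_upwards [hA.memF, hA'.memF] with n h1 h2
  refine le_trans (le_of_eq ?_) (eLpNorm_add_le (h1.sub hA.mem).1 (h2.sub hA'.mem).1 hp)
  congr 1; ext x; simp only [Pi.add_apply]; abel

lemma clm (L : E →L[ℝ] F) (hA : TL p l A f) :
    TL p l (fun n x => L (A n x)) (fun x => L (f x)) := by
  refine ⟨?_, L.comp_memLp' hA.mem, ?_⟩
  · filter_upwards [hA.memF] with n h1 using L.comp_memLp' h1
  have h := ENNReal.Tendsto.const_mul (a := ‖L‖ₑ) hA.lim (Or.inr (by simp))
  rw [mul_zero] at h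
  refine tendsto_of_tendsto_of_tendsto_of_le_of_le tendsto_const_nhds h
    (fun _ => zero_le) fun n => ?_
  have := eLpNorm_le_mul_eLpNorm_of_ae_le_mul' (μ := (volume : Measure Plane)) (c := ‖L‖₊)
    (f := fun x => L (A n x) - L (f x)) (g := fun x => A n x - f x)
    (.of_forall fun x => by rw [← map_sub]; exact L.le_opENorm _) p
  exact this

lemma neg (hA : TL p l A f) : TL p l (fun n x => - A n x) (fun x => - f x) := by
  simpa using hA.clm (-(ContinuousLinearMap.id ℝ E))

lemma smul (c : ℝ) (hA : TL p l A f) : TL p l (fun n x => c • A n x) (fun x => c • f x) := by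
  simpa using hA.clm (c • (ContinuousLinearMap.id ℝ E))

lemma sub {A' : ι → Plane → E} (hp : 1 ≤ p) (hA : TL p l A f) (hA' : TL p l A' f') :
    TL p l (fun n x => A n x - A' n x) (fun x => f x - f' x) := by
  simpa [sub_eq_add_neg] using hA.add hp hA'.neg

lemma tendsto_eLpNorm (hp : 1 ≤ p) (hA : TL p l A f) :
    Tendsto (fun n => eLpNorm (A n) p volume) l (𝓝 (eLpNorm f p volume)) := by
  have hfin := hA.mem.2.ne
  have h1 : Tendsto (fun n => eLpNorm f p volume + eLpNorm (fun x => A n x - f x) p volume) l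
      (𝓝 (eLpNorm f p volume)) := by
    simpa using tendsto_const_nhds.add hA.lim
  have h2 : Tendsto (fun n => eLpNorm f p volume - eLpNorm (fun x => A n x - f x) p volume) l
      (𝓝 (eLpNorm f p volume)) := by
    simpa using ENNReal.Tendsto.sub tendsto_const_nhds hA.lim (Or.inl hfin)
  refine tendsto_of_tendsto_of_tendsto_of_le_of_le' h2 h1 ?_ ?_
  · filter_upwards [hA.memF] with n hn
    rw [tsub_le_iff_right]
    have := eLpNorm_sub_le hn.1 (hn.sub hA.mem).1 hp
    refine le_trans (le_of_eq ?_) this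
    congr 1; ext x; simp
  · filter_upwards [hA.memF] with n hn
    have := eLpNorm_add_le hA.mem.1 (hn.sub hA.mem).1 hp
    refine le_trans (le_of_eq ?_) this
    congr 1; ext x; simp

lemma integral (hA : TL 1 l A f) : Tendsto (fun n => ∫ x, A n x) l (𝓝 (∫ x, f x)) := by
  refine tendsto_integral_of_L1 f (memLp_one_iff_integrable.1 hA.mem).aestronglyMeasurable ?_ ?_
  · filter_upwards [hA.memF] with n hn using memLp_one_iff_integrable.1 hn
  · simpa only [eLpNorm_one_eq_lintegral_enorm] using hA.lim

end TL

/-- A `C¹` function and its partial derivative, approximable by `C¹` functions in `L^{4/j}` and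
`L^{4/(j+1)}`: then `f'` is the weak `i`-th partial derivative of `f`. -/
def W (i : Fin 2) (j : ℕ) (f f' : Plane → E) : Prop :=
  ∃ A : ℕ → Plane → E, (∀ n, ContDiff ℝ 1 (A n)) ∧ TL (lp j) atTop A f ∧
    TL (lp (j + 1)) atTop (fun n => pd i (A n)) f'

lemma pd_bilin (i : Fin 2) (b : E →L[ℝ] F →L[ℝ] G) {f : Plane → E} {g : Plane → F}
    (hf : Differentiable ℝ f) (hg : Differentiable ℝ g) (x : Plane) :
    pd i (fun x => b (f x) (g x)) x = b (pd i f x) (g x) + b (f x) (pd i g x) := by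
  have := (b.hasFDerivAt_of_bilinear (hf x).hasFDerivAt (hg x).hasFDerivAt).fderiv
  unfold pd
  rw [this]
  simp [add_comm]

lemma pd_clm (i : Fin 2) (L : E →L[ℝ] F) {f : Plane → E} (hf : Differentiable ℝ f) (x : Plane) :
    pd i (fun x => L (f x)) x = L (pd i f x) := by
  have h : HasFDerivAt (fun x => L (f x)) (L.comp (fderiv ℝ f x)) x :=
    L.hasFDerivAt.comp x (hf x).hasFDerivAt
  unfold pd
  rw [h.fderiv]
  rfl

lemma pd_add (i : Fin 2) {f g : Plane → E} (hf : Differentiable ℝ f) (hg : Differentiable ℝ g)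
    (x : Plane) : pd i (fun x => f x + g x) x = pd i f x + pd i g x := by
  unfold pd; rw [fderiv_fun_add (hf x) (hg x)]; rfl

lemma pd_continuous {i : Fin 2} {f : Plane → E} (hf : ContDiff ℝ 1 f) : Continuous (pd i f) :=
  (hf.continuous_fderiv (by simp)).clm_apply continuous_const

lemma pd_contDiff {i : Fin 2} {f : Plane → E} (hf : ContDiff ℝ ∞ f) : ContDiff ℝ ∞ (pd i f) :=
  (hf.fderiv_right (m := ∞) (by simp)).clm_apply contDiff_const

lemma pd_hasCompactSupport {i : Fin 2} {f : Plane → E} (hf : HasCompactSupport f) :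
    HasCompactSupport (pd i f) :=
  (hf.fderiv (𝕜 := ℝ)).comp_left (g := fun L : Plane →L[ℝ] E => L (EuclideanSpace.single i 1))
    (by simp)

namespace W

variable {i : Fin 2} {j k : ℕ} {f f' f₁ f₁' : Plane → E} {g g' : Plane → F}

lemma mem (h : W i j f f') : MemLp f (lp j) volume := by
  obtain ⟨A, -, h1, -⟩ := h; exact h1.mem

lemma mem' (h : W i j f f') : MemLp f' (lp (j + 1)) volume := by
  obtain ⟨A, -, -, h1⟩ := h; exact h1.mem

lemma congr (h : W i j f f') (e : f =ᵐ[volume] f₁) (e' : f' =ᵐ[volume] f₁') : W i j f₁ f₁' := by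
  obtain ⟨A, h1, h2, h3⟩ := h
  exact ⟨A, h1, h2.congr e, h3.congr e'⟩

lemma const (c : E) : W i 0 (fun _ => c) (fun _ => (0 : E)) := by
  refine ⟨fun _ _ => c, fun _ => contDiff_const, TL.const ?_, ?_⟩
  · rw [lp_zero]; exact memLp_top_const c
  · have : (fun n : ℕ => pd i (fun _ : Plane => c)) = fun _ _ => 0 := by
      ext n x; simp [pd]
    rw [this]
    exact TL.const MemLp.zero'

/-- The product of the approximations approximates the product, and orders add. The bound 3 on the
total order keeps the exponent 4/(j+k+1) of the derivative at least 1. -/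
lemma bilin (b : E →L[ℝ] F →L[ℝ] G) (hf : W i j f f') (hg : W i k g g')
    (h : j + k ≤ 3 := by norm_num) :
    W i (j + k) (fun x => b (f x) (g x)) (fun x => b (f' x) (g x) + b (f x) (g' x)) := by
  obtain ⟨A, hA, hA0, hA1⟩ := hf
  obtain ⟨B, hB, hB0, hB1⟩ := hg
  have e1 : j + 1 + k = j + k + 1 := by omega
  refine ⟨fun n x => b (A n x) (B n x), fun n => b.isBoundedBilinearMap.contDiff.comp₂ (hA n) (hB n),
    hA0.bilin (one_le_lp (by omega)) b hB0, ?_⟩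
  have h1 : TL (lp (j + k + 1)) atTop (fun n x => b (pd i (A n) x) (B n x))
      (fun x => b (f' x) (g x)) := by
    rw [← e1]; exact hA1.bilin (one_le_lp (by omega)) b hB0
  have h2 : TL (lp (j + k + 1)) atTop (fun n x => b (A n x) (pd i (B n) x))
      (fun x => b (f x) (g' x)) := hA0.bilin (one_le_lp (by omega)) b hB1
  refine (h1.add (one_le_lp (by omega)) h2).congr_left (.of_forall fun n => .of_forall fun x => ?_)
  exact (pd_bilin i b ((hA n).differentiable (by simp)) ((hB n).differentiable (by simp)) x).symm

lemma clm (L : E →L[ℝ] F) (hf : W i j f f') : W i j (fun x => L (f x)) (fun x => L (f' x)) := by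
  obtain ⟨A, hA, hA0, hA1⟩ := hf
  refine ⟨fun n x => L (A n x), fun n => L.contDiff.comp (hA n), hA0.clm L, ?_⟩
  refine (hA1.clm L).congr_left (.of_forall fun n => .of_forall fun x => ?_)
  exact (pd_clm i L ((hA n).differentiable (by simp)) x).symm

lemma add (hf : W i j f f') (hg : W i j f₁ f₁') (h : j ≤ 3 := by norm_num) :
    W i j (fun x => f x + f₁ x) (fun x => f' x + f₁' x) := by
  obtain ⟨A, hA, hA0, hA1⟩ := hf
  obtain ⟨B, hB, hB0, hB1⟩ := hg
  refine ⟨fun n x => A n x + B n x, fun n => (hA n).add (hB n),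
    hA0.add (one_le_lp (by omega)) hB0, ?_⟩
  refine (hA1.add (one_le_lp (by omega)) hB1).congr_left (.of_forall fun n => .of_forall fun x => ?_)
  exact (pd_add i ((hA n).differentiable (by simp)) ((hB n).differentiable (by simp)) x).symm

lemma neg (hf : W i j f f') : W i j (fun x => - f x) (fun x => - f' x) := by
  simpa using hf.clm (-(ContinuousLinearMap.id ℝ E))

lemma smul (c : ℝ) (hf : W i j f f') : W i j (fun x => c • f x) (fun x => c • f' x) := by
  simpa using hf.clm (c • (ContinuousLinearMap.id ℝ E))

lemma sub (hf : W i j f f') (hg : W i j f₁ f₁') (h : j ≤ 3 := by norm_num) :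
    W i j (fun x => f x - f₁ x) (fun x => f' x - f₁' x) := by
  simpa [sub_eq_add_neg] using hf.add hg.neg h

end W

lemma integral_pd_eq_zero (i : Fin 2) {f : Plane → E} (hf : ContDiff ℝ 1 f)
    (hc : HasCompactSupport f) : ∫ x, pd i f x = 0 := by
  have h1 : Integrable f := hf.continuous.integrable_of_hasCompactSupport hc
  have h2 : Integrable (fun x => fderiv ℝ f x (EuclideanSpace.single i 1)) :=
    (pd_continuous hf).integrable_of_hasCompactSupport (pd_hasCompactSupport hc)
  have := integral_smul_fderiv_eq_neg_fderiv_smul_of_integrable (μ := (volume : Measure Plane))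
    (f := fun _ => (1 : ℝ)) (g := f) (v := EuclideanSpace.single i 1) (by simp)
    (by simpa using h2) (by simpa using h1) (by intros; fun_prop)
    (fun x _ => hf.differentiable (by simp) x)
  simpa [pd] using this

namespace W

variable {i : Fin 2} {j k : ℕ} {f f' f₁ f₁' : Plane → E} {g g' : Plane → F}

lemma memLp_test {φ : Plane → E} (hφ : Continuous φ) (hc : HasCompactSupport φ) (p : ℝ≥0∞) :
    MemLp φ p volume := hφ.memLp_of_hasCompactSupport hc

/-- Weak differentiability in the sense of distributions. -/
lemma weak [CompleteSpace E] (h : W i j f f') (hj : j ≤ 3) {φ : Plane → ℝ} (hφ : ContDiff ℝ 1 φ)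
    (hc : HasCompactSupport φ) : ∫ x, pd i φ x • f x = - ∫ x, φ x • f' x := by
  obtain ⟨A, hA, hA0, hA1⟩ := h
  have t1 : TL (lp (4 - j + j)) atTop (fun n x => pd i φ x • A n x) (fun x => pd i φ x • f x) :=
    (TL.const (l := atTop) (memLp_test (pd_continuous hφ) (pd_hasCompactSupport hc)
      (lp (4 - j)))).bilin (one_le_lp (by omega)) (ContinuousLinearMap.lsmul ℝ ℝ) hA0
  have t2 : TL (lp (4 - (j + 1) + (j + 1))) atTop (fun n x => φ x • pd i (A n) x)
      (fun x => φ x • f' x) :=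
    (TL.const (l := atTop) (memLp_test hφ.continuous hc (lp (4 - (j + 1))))).bilin
      (one_le_lp (by omega)) (ContinuousLinearMap.lsmul ℝ ℝ) hA1
  rw [show 4 - j + j = 4 by omega, lp_four] at t1
  rw [show 4 - (j + 1) + (j + 1) = 4 by omega, lp_four] at t2
  refine tendsto_nhds_unique t1.integral ?_
  refine t2.integral.neg.congr fun n => ?_
  rw [neg_eq_iff_add_eq_zero, ← integral_add]
  · rw [← integral_pd_eq_zero i (f := fun x => φ x • A n x) (hφ.smul (hA n)) (hc.smul_right)]
    congr 1; ext x
    have := pd_bilin i (ContinuousLinearMap.lsmul ℝ ℝ) (hφ.differentiable (by simp))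
      ((hA n).differentiable (by simp)) x
    simp only [ContinuousLinearMap.lsmul_apply] at this
    rw [this, add_comm]
  · exact (hφ.continuous.smul (pd_continuous (hA n))).integrable_of_hasCompactSupport hc.smul_right
  · exact ((pd_continuous hφ).smul (hA n).continuous).integrable_of_hasCompactSupport
      (pd_hasCompactSupport hc).smul_right

lemma locallyIntegrable' (h : W i j f f') (hj : j ≤ 3) : LocallyIntegrable f' volume :=
  h.mem'.locallyIntegrable (one_le_lp (by omega))

/-- Both candidates have the same pairing with every test function. The orders may differ, which
allows a pointwise constraint to be differentiated: a product rule of positive order is compared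
with the zero derivative of a constant of order 0. -/
lemma unique [CompleteSpace E] (h : W i j f f') (h₁ : W i k f f₁') (hj : j ≤ 3 := by norm_num)
    (hk : k ≤ 3 := by norm_num) : f' =ᵐ[volume] f₁' := by
  refine ae_eq_of_integral_contDiff_smul_eq (h.locallyIntegrable' hj) (h₁.locallyIntegrable' hk) ?_
  intro φ hφ hc
  have a := h.weak hj (hφ.of_le (by simp)) hc
  have b := h₁.weak hk (hφ.of_le (by simp)) hc
  exact neg_injective (a.symm.trans b)

end W

/-- Cut-off functions: smooth, compactly supported, with values in `[0,1]`, equal to one on the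
ball of radius `n+1`, with first and second derivatives decaying. -/
lemma exists_cutoff : ∃ (χ : ℕ → Plane → ℝ) (C : ℝ), (∀ n, ContDiff ℝ ∞ (χ n)) ∧
    (∀ n, HasCompactSupport (χ n)) ∧ (∀ n x, 0 ≤ χ n x ∧ χ n x ≤ 1) ∧
    (∀ (n : ℕ) x, ‖x‖ ≤ (n : ℝ) + 1 → χ n x = 1) ∧ (∀ i (n : ℕ) x, |pd i (χ n) x| ≤ C / ((n : ℝ) + 1)) ∧
    (∀ i j (n : ℕ) x, |pd i (pd j (χ n)) x| ≤ C / ((n : ℝ) + 1)) := by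
  let B : ContDiffBump (0 : Plane) := ⟨1, 2, by norm_num, by norm_num⟩
  have hB : ContDiff ℝ ∞ (B : Plane → ℝ) := B.contDiff
  have hc : HasCompactSupport (B : Plane → ℝ) := B.hasCompactSupport
  have bd : ∀ f : Plane → ℝ, Continuous f → HasCompactSupport f → ∃ C, ∀ x, ‖f x‖ ≤ C :=
    fun f h1 h2 => h2.exists_bound_of_continuous h1
  choose C1 hC1 using fun i => bd (pd i B) (pd_continuous (hB.of_le (by simp)))
    (pd_hasCompactSupport hc)
  choose C2 hC2 using fun i j => bd (pd i (pd j B)) (pd_continuous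
    ((pd_contDiff hB).of_le (by simp))) (pd_hasCompactSupport (pd_hasCompactSupport hc))
  have n1 : ∀ i, 0 ≤ C1 i := fun i => (norm_nonneg _).trans (hC1 i 0)
  have n2 : ∀ i j, 0 ≤ C2 i j := fun i j => (norm_nonneg _).trans (hC2 i j 0)
  have pdscale : ∀ (f : Plane → ℝ), Differentiable ℝ f → ∀ (c : ℝ) i,
      pd i (fun x => f (c • x)) = fun x => c * pd i f (c • x) := by
    intro f hf c i
    ext x
    unfold pd
    have h := (hf (c • x)).hasFDerivAt.comp x ((hasFDerivAt_id x).const_smul c)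
    have h' : HasFDerivAt (fun x => f (c • x)) _ x := h
    rw [h'.fderiv]
    simp
  -- Dilating one bump by n+1 gives a factor 1/(n+1) for each derivative; for second derivatives one
  -- of the two factors is discarded.
  refine ⟨fun n x => B (((n : ℝ) + 1)⁻¹ • x), ∑ i, C1 i + ∑ i, ∑ j, C2 i j, ?_, ?_, ?_, ?_, ?_, ?_⟩
  · intro n; exact hB.comp (contDiff_const_smul _)
  · intro n
    exact hc.comp_homeomorph (Homeomorph.smulOfNeZero (((n : ℝ) + 1)⁻¹) (by positivity))
  · intro n x; exact ⟨B.nonneg, B.le_one⟩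
  · intro n x hx
    apply B.one_of_mem_closedBall
    have : (0 : ℝ) < n + 1 := by positivity
    rw [mem_closedBall_zero_iff, norm_smul, norm_inv, Real.norm_of_nonneg this.le,
      inv_mul_le_iff₀ this]
    simpa [B] using hx
  · intro i n x
    have : (0 : ℝ) < n + 1 := by positivity
    rw [pdscale _ (hB.differentiable (by simp)), abs_mul, abs_of_pos (by positivity), div_eq_inv_mul]
    refine mul_le_mul_of_nonneg_left ((hC1 i _).trans ?_) (by positivity)
    refine (Finset.single_le_sum (fun i _ => n1 i) (Finset.mem_univ i)).trans ?_
    exact le_add_of_nonneg_right (Finset.sum_nonneg fun i _ => Finset.sum_nonneg fun j _ => n2 i j)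
  · intro i j n x
    have : (0 : ℝ) < n + 1 := by positivity
    rw [pdscale _ (hB.differentiable (by simp))]
    have h2 : pd i (fun x => ((n : ℝ) + 1)⁻¹ * pd j B (((n : ℝ) + 1)⁻¹ • x)) =
        fun x => ((n : ℝ) + 1)⁻¹ * (((n : ℝ) + 1)⁻¹ * pd i (pd j B) (((n : ℝ) + 1)⁻¹ • x)) := by
      have h3 := pdscale (pd j B) ((pd_contDiff hB).differentiable (by simp)) ((n : ℝ) + 1)⁻¹ i
      ext x
      rw [← congrFun h3 x]
      exact pd_clm i (((n : ℝ) + 1)⁻¹ • ContinuousLinearMap.id ℝ ℝ) (f := fun x => pd j B (((n : ℝ) + 1)⁻¹ • x))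
        (((pd_contDiff hB).differentiable (by simp)).comp (by fun_prop : Differentiable ℝ fun x : Plane => ((n : ℝ) + 1)⁻¹ • x)) x
    rw [h2, abs_mul, abs_mul, abs_of_pos (by positivity), div_eq_inv_mul]
    refine mul_le_mul_of_nonneg_left ?_ (by positivity)
    have h1 : ((n : ℝ) + 1)⁻¹ ≤ 1 := inv_le_one_of_one_le₀ (by simp)
    refine (mul_le_of_le_one_left (abs_nonneg _) h1).trans ((hC2 i j _).trans ?_)
    refine (Finset.single_le_sum (fun j _ => n2 i j) (Finset.mem_univ j)).trans ?_
    refine (Finset.single_le_sum (f := fun i => ∑ j, C2 i j)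
      (fun i _ => Finset.sum_nonneg fun j _ => n2 i j) (Finset.mem_univ i)).trans ?_
    exact le_add_of_nonneg_left (Finset.sum_nonneg fun i _ => n1 i)

end Calculus
end LLHelicity

namespace LLHelicity
set_option linter.unusedSectionVars false

/-! ### Integration by parts on the whole plane -/

section ByParts

variable {E F G : Type*} [NormedAddCommGroup E] [NormedSpace ℝ E]
  [NormedAddCommGroup F] [NormedSpace ℝ F] [NormedAddCommGroup G] [NormedSpace ℝ G]
  [CompleteSpace E] [CompleteSpace G]

lemma tendsto_cutoff_integral {χ : ℕ → Plane → ℝ} (h0 : ∀ n, ContDiff ℝ ∞ (χ n))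
    (h1 : ∀ n x, 0 ≤ χ n x ∧ χ n x ≤ 1)
    (h2 : ∀ (n : ℕ) x, ‖x‖ ≤ (n : ℝ) + 1 → χ n x = 1) {f : Plane → E} (hf : Integrable f) :
    Tendsto (fun n => ∫ x, χ n x • f x) atTop (𝓝 (∫ x, f x)) := by
  refine tendsto_integral_of_dominated_convergence (fun x => ‖f x‖) (fun n => ?_) hf.norm
    (fun n => .of_forall fun x => ?_) (.of_forall fun x => ?_)
  · exact (h0 n).continuous.aestronglyMeasurable.smul hf.1
  · rw [norm_smul, Real.norm_of_nonneg (h1 n x).1]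
    exact mul_le_of_le_one_left (norm_nonneg _) (h1 n x).2
  · refine tendsto_const_nhds.congr' ?_
    filter_upwards [eventually_ge_atTop ⌈‖x‖⌉₊] with n hn
    rw [h2 n x, one_smul]
    have := Nat.ceil_le.1 hn
    linarith

/-- Test with the cut-off functions: the boundary term is at most C/(n+1) times the L¹ norm of f, so
integrability of f and f' replaces compact support. -/
lemma W.integral_eq_zero {i : Fin 2} {j : ℕ} {f f' : Plane → E} (h : W i j f f')
    (hf : MemLp f 1 volume) (hf' : MemLp f' 1 volume) (hj : j ≤ 3 := by norm_num) :
    ∫ x, f' x = 0 := by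
  obtain ⟨χ, C, h0, hc, h1, h2, h3, -⟩ := exists_cutoff
  have hf := memLp_one_iff_integrable.1 hf
  have t := tendsto_cutoff_integral h0 h1 h2 (memLp_one_iff_integrable.1 hf')
  refine tendsto_nhds_unique t ?_
  have e : ∀ n, ∫ x, χ n x • f' x = - ∫ x, pd i (χ n) x • f x := fun n => by
    rw [h.weak hj ((h0 n).of_le (by simp)) (hc n), neg_neg]
  simp only [e]
  rw [tendsto_zero_iff_norm_tendsto_zero]
  have lim : Tendsto (fun n : ℕ => C / ((n : ℝ) + 1) * ∫ x, ‖f x‖) atTop (𝓝 0) := by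
    have := (tendsto_const_div_atTop_nhds_zero_nat C).comp (tendsto_add_atTop_nat 1)
    simpa using this.mul_const (∫ x, ‖f x‖)
  refine squeeze_zero (fun _ => norm_nonneg _) (fun n => ?_) lim
  rw [norm_neg, ← integral_const_mul]
  refine norm_integral_le_of_norm_le (hf.norm.const_mul _) (.of_forall fun x => ?_)
  rw [norm_smul]
  exact mul_le_mul_of_nonneg_right (h3 i n x) (norm_nonneg _)

lemma memLp_one_bilin (b : E →L[ℝ] F →L[ℝ] G) {f : Plane → E} {g : Plane → F}
    (hf : MemLp f (lp 2) volume) (hg : MemLp g (lp 2) volume) :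
    MemLp (fun x => b (f x) (g x)) 1 volume := by
  rw [← lp_four]
  exact b.memLp_of_bilin (lp (2 + 2)) hf hg

/-- Integration by parts. -/
lemma W.ibp {i : Fin 2} {j k : ℕ} {f f' : Plane → E} {g g' : Plane → F} (b : E →L[ℝ] F →L[ℝ] G)
    (hf : W i j f f') (hg : W i k g g') (f2 : MemLp f (lp 2) volume) (f2' : MemLp f' (lp 2) volume)
    (g2 : MemLp g (lp 2) volume) (g2' : MemLp g' (lp 2) volume) (h : j + k ≤ 3 := by norm_num) :
    ∫ x, b (f' x) (g x) = - ∫ x, b (f x) (g' x) := by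
  have m1 := memLp_one_bilin b f2' g2
  have m2 := memLp_one_bilin b f2 g2'
  have := (hf.bilin b hg h).integral_eq_zero (memLp_one_bilin b f2 g2) (m1.add m2) h
  rw [integral_add (memLp_one_iff_integrable.1 m1) (memLp_one_iff_integrable.1 m2)] at this
  exact eq_neg_of_add_eq_zero_left this

end ByParts

/-! ### Sobolev inequalities for smooth compactly supported maps -/

/-- The sum of the squared `L²` norms of the partial derivatives. -/
noncomputable def gradSq (f : Plane → Space) : ℝ := ∑ i, ∫ x, ‖pd i f x‖ ^ 2

noncomputable def hessSq (f : Plane → Space) : ℝ := ∑ i, ∑ j, ∫ x, ‖pd i (pd j f) x‖ ^ 2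

noncomputable def l2Sq (f : Plane → Space) : ℝ := ∫ x, ‖f x‖ ^ 2

lemma norm_fderiv_le {E : Type*} [NormedAddCommGroup E] [NormedSpace ℝ E] (f : Plane → E)
    (x : Plane) : ‖fderiv ℝ f x‖ ≤ ∑ i, ‖pd i f x‖ := by
  refine ContinuousLinearMap.opNorm_le_bound _ (by positivity) fun v => ?_
  have hv : v = ∑ i, v i • EuclideanSpace.single i (1 : ℝ) := by
    ext k; fin_cases k <;> simp
  conv_lhs => rw [hv]
  rw [map_sum, Finset.sum_mul]
  refine (norm_sum_le _ _).trans (Finset.sum_le_sum fun i _ => ?_)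
  rw [map_smul, norm_smul, mul_comm]
  exact mul_le_mul_of_nonneg_left (PiLp.norm_apply_le v i) (norm_nonneg _)

section Smooth

variable {f : Plane → Space}

lemma integrable_of_cc {E : Type*} [NormedAddCommGroup E] {f : Plane → E} (hf : Continuous f)
    (hc : HasCompactSupport f) : Integrable f := hf.integrable_of_hasCompactSupport hc

lemma integrable_normSq (hf : Continuous f) (hc : HasCompactSupport f) :
    Integrable (fun x => ‖f x‖ ^ 2) :=
  integrable_of_cc (hf.norm.pow 2) (hc.comp_left (g := fun y => ‖y‖ ^ 2) (by simp))

/-- Cauchy-Schwarz for square-integrable functions. -/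
lemma integral_mul_le_sqrt {α : Type*} [MeasurableSpace α] {μ : Measure α} {f g : α → ℝ}
    (hf : MemLp f 2 μ) (hg : MemLp g 2 μ) :
    ∫ x, |f x| * |g x| ∂μ ≤ Real.sqrt (∫ x, f x ^ 2 ∂μ) * Real.sqrt (∫ x, g x ^ 2 ∂μ) := by
  have := integral_mul_norm_le_Lp_mul_Lq (μ := μ) (f := f) (g := g)
    (Real.HolderConjugate.two_two) (by simpa using hf) (by simpa using hg)
  simpa [Real.sqrt_eq_rpow] using this


lemma eLpNorm_two_eq {α E : Type*} [MeasurableSpace α] {μ : Measure α} [NormedAddCommGroup E]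
    {f : α → E} (hf : MemLp f 2 μ) : eLpNorm f 2 μ = ENNReal.ofReal (√(∫ x, ‖f x‖ ^ 2 ∂μ)) := by
  rw [hf.eLpNorm_eq_integral_rpow_norm (by simp) (by simp)]
  simp [Real.sqrt_eq_rpow]

/-- This is the embedding of W^{1,1} in L² of the plane, applied to |f|², whose gradient is
controlled by 2|f||∇f| and Cauchy-Schwarz. -/
lemma ladyzhenskaya : ∃ C : ℝ, 0 ≤ C ∧ ∀ f : Plane → Space, ContDiff ℝ 1 f → HasCompactSupport f →
    ∫ x, ‖f x‖ ^ 4 ≤ C * l2Sq f * gradSq f := by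
  -- The 8 is 4 times 2: the factor 2 of the gradient of |f|² squared, and (a + b)² ≤ 2(a² + b²) for
  -- the two directions.
  refine ⟨(eLpNormLESNormFDerivOneConst (volume : Measure Plane) 2 : ℝ) ^ 2 * 8, by positivity,
    fun f hf hc => ?_⟩
  set K := eLpNormLESNormFDerivOneConst (volume : Measure Plane) 2
  let u : Plane → ℝ := fun x => ‖f x‖ ^ 2
  have hu : ContDiff ℝ 1 u := hf.norm_sq ℝ
  have hcu : HasCompactSupport u := hc.comp_left (g := fun y => ‖y‖ ^ 2) (by simp)
  have h2 : MemLp f 2 volume := hf.continuous.memLp_of_hasCompactSupport hc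
  have hpd : ∀ i, MemLp (pd i f) 2 volume := fun i =>
    (pd_continuous hf).memLp_of_hasCompactSupport (pd_hasCompactSupport hc)
  have key := eLpNorm_le_eLpNorm_fderiv_one (volume : Measure Plane) hu hcu (p := 2)
    (by rw [finrank_euclideanSpace_fin]
        exact NNReal.HolderConjugate.two_two)
  have m2 : MemLp u 2 volume := hu.continuous.memLp_of_hasCompactSupport hcu
  rw [show ((2 : NNReal) : ℝ≥0∞) = 2 by simp, eLpNorm_two_eq m2] at key
  have hdi : Integrable (fderiv ℝ u) :=
    (hu.continuous_fderiv (by simp)).integrable_of_hasCompactSupport (hcu.fderiv (𝕜 := ℝ))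
  have e1 : eLpNorm (fderiv ℝ u) 1 volume = ENNReal.ofReal (∫ x, ‖fderiv ℝ u x‖) := by
    rw [eLpNorm_one_eq_lintegral_enorm, ofReal_integral_norm_eq_lintegral_enorm hdi]
  rw [e1, ← ENNReal.ofReal_coe_nnreal, ← ENNReal.ofReal_mul (by positivity),
    ENNReal.ofReal_le_ofReal_iff (by positivity)] at key
  have hpu : ∀ i x, ‖pd i u x‖ ≤ 2 * (|‖f x‖| * |‖pd i f x‖|) := by
    intro i x
    have h := ((hf.differentiable (by simp) x).hasFDerivAt.norm_sq).fderiv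
    have : pd i u x = 2 * inner ℝ (f x) (pd i f x) := by
      unfold pd; rw [h]; simp
    rw [this, norm_mul, abs_norm, abs_norm]
    norm_num
    exact abs_real_inner_le_norm _ _
  have bd : ∫ x, ‖fderiv ℝ u x‖ ≤ ∑ i, 2 * (√(l2Sq f) * √(∫ x, ‖pd i f x‖ ^ 2)) := by
    have int : ∀ i, Integrable (fun x => |‖f x‖| * |‖pd i f x‖|) := fun i =>
      integrable_of_cc (by
        have := pd_continuous (i := i) hf
        have := hf.continuous
        fun_prop) ((hc.norm).comp_left (g := fun y : ℝ => |y|) (by simp)).mul_right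
    calc ∫ x, ‖fderiv ℝ u x‖ ≤ ∫ x, ∑ i, 2 * (|‖f x‖| * |‖pd i f x‖|) := by
          refine integral_mono hdi.norm (integrable_finsetSum _ fun i _ => (int i).const_mul 2) fun x => ?_
          exact (norm_fderiv_le u x).trans (Finset.sum_le_sum fun i _ => hpu i x)
      _ = ∑ i, 2 * ∫ x, |‖f x‖| * |‖pd i f x‖| := by
          rw [integral_finsetSum _ fun i _ => (int i).const_mul 2]
          simp only [integral_const_mul]
      _ ≤ _ := Finset.sum_le_sum fun i _ =>
          mul_le_mul_of_nonneg_left (integral_mul_le_sqrt h2.norm (hpd i).norm) (by norm_num)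
  have e4 : ∫ x, ‖f x‖ ^ 4 = ∫ x, ‖u x‖ ^ 2 := by
    congr 1; ext x; simp only [u, norm_pow, norm_norm]; ring
  rw [e4]
  have n0 : ∀ i, 0 ≤ ∫ x, ‖pd i f x‖ ^ 2 := fun i => integral_nonneg fun x => by positivity
  have nl : 0 ≤ l2Sq f := integral_nonneg fun x => by positivity
  have := Real.sqrt_le_iff.1 (key.trans (mul_le_mul_of_nonneg_left bd (by positivity)))
  refine this.2.trans ?_
  rw [mul_pow, mul_assoc, mul_assoc]
  refine mul_le_mul_of_nonneg_left ?_ (by positivity)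
  simp only [Fin.sum_univ_two, gradSq]
  set A := ∫ x, ‖pd 0 f x‖ ^ 2
  set B := ∫ x, ‖pd 1 f x‖ ^ 2
  have := Real.sq_sqrt nl
  have := Real.sq_sqrt (n0 0)
  have := Real.sq_sqrt (n0 1)
  calc (2 * (√(l2Sq f) * √A) + 2 * (√(l2Sq f) * √B)) ^ 2
      = 4 * (√(l2Sq f) ^ 2 * (√A + √B) ^ 2) := by ring
    _ ≤ 4 * (l2Sq f * (2 * (√A ^ 2 + √B ^ 2))) := by
        rw [Real.sq_sqrt nl]
        have : (√A + √B) ^ 2 ≤ 2 * (√A ^ 2 + √B ^ 2) := by nlinarith [sq_nonneg (√A - √B)]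
        gcongr
    _ = _ := by rw [Real.sq_sqrt (n0 0), Real.sq_sqrt (n0 1)]; ring

/-- The measure-preserving identification of `ℝ × ℝ` with the plane. -/
noncomputable def ofPair (z : ℝ × ℝ) : Plane := WithLp.toLp 2 ![z.1, z.2]

lemma ofPair_measurePreserving : MeasurePreserving ofPair volume volume :=
  (PiLp.volume_preserving_toLp (Fin 2)).comp (volume_preserving_finTwoArrow ℝ).symm

lemma ofPair_measurableEmbedding : MeasurableEmbedding ofPair :=
  (MeasurableEquiv.toLp 2 (Fin 2 → ℝ)).measurableEmbedding.comp
    (MeasurableEquiv.finTwoArrow (α := ℝ)).symm.measurableEmbedding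

lemma ofPair_surj (x : Plane) : ofPair (x 0, x 1) = x := by
  ext k; fin_cases k <;> simp [ofPair]

lemma norm_le_integral_deriv {g : ℝ → ℝ} (hg : ContDiff ℝ 1 g) (hc : HasCompactSupport g) (x : ℝ) :
    ‖g x‖ ≤ ∫ s, ‖deriv g s‖ := by
  have hi : Integrable (deriv g) :=
    (hg.continuous_deriv (by simp)).integrable_of_hasCompactSupport hc.deriv
  rw [← hc.integral_Iic_deriv_eq hg x]
  exact (norm_integral_le_integral_norm _).trans
    (setIntegral_le_integral hi.norm (.of_forall fun _ => norm_nonneg _))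

lemma ofPair_hasFDerivAt_left (a b : ℝ) :
    HasDerivAt (fun s => ofPair (s, b)) (EuclideanSpace.single 0 1) a := by
  have : (fun s => ofPair (s, b)) = fun s => s • EuclideanSpace.single 0 (1 : ℝ) + ofPair (0, b) := by
    ext s k; fin_cases k <;> simp [ofPair]
  rw [this]
  simpa using ((hasDerivAt_id a).smul_const (EuclideanSpace.single (0 : Fin 2) (1 : ℝ))).add_const
    (ofPair (0, b))

lemma ofPair_hasFDerivAt_right (a b : ℝ) :
    HasDerivAt (fun s => ofPair (a, s)) (EuclideanSpace.single 1 1) b := by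
  have : (fun s => ofPair (a, s)) = fun s => s • EuclideanSpace.single 1 (1 : ℝ) + ofPair (a, 0) := by
    ext s k; fin_cases k <;> simp [ofPair]
  rw [this]
  simpa using ((hasDerivAt_id b).smul_const (EuclideanSpace.single (1 : Fin 2) (1 : ℝ))).add_const
    (ofPair (a, 0))

lemma ofPair_contDiff : ContDiff ℝ ∞ ofPair := by
  unfold ofPair
  refine (PiLp.continuousLinearEquiv 2 ℝ (fun _ : Fin 2 => ℝ)).symm.contDiff.comp ?_
  rw [contDiff_pi]
  intro k; fin_cases k
  · exact contDiff_fst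
  · exact contDiff_snd

lemma ofPair_slice_left_compact {h : Plane → ℝ} (hc : HasCompactSupport h) (b : ℝ) :
    HasCompactSupport (fun s => h (ofPair (s, b))) := by
  refine HasCompactSupport.of_support_subset_isCompact
    (hc.image (f := fun x : Plane => x 0) (by fun_prop)) ?_
  intro s hs
  exact ⟨ofPair (s, b), subset_tsupport _ hs, by simp [ofPair]⟩

lemma ofPair_slice_right_compact {h : Plane → ℝ} (hc : HasCompactSupport h) (a : ℝ) :
    HasCompactSupport (fun s => h (ofPair (a, s))) := by
  refine HasCompactSupport.of_support_subset_isCompact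
    (hc.image (f := fun x : Plane => x 1) (by fun_prop)) ?_
  intro s hs
  exact ⟨ofPair (a, s), subset_tsupport _ hs, by simp [ofPair]⟩

/-- The fundamental theorem of calculus in each of the two variables in turn, along lines through x.
-/
lemma abs_le_integral_mixed {h : Plane → ℝ} (hh : ContDiff ℝ ∞ h) (hc : HasCompactSupport h)
    (x : Plane) : |h x| ≤ ∫ y, |pd 0 (pd 1 h) y| := by
  have d0 : ∀ (g : Plane → ℝ), ContDiff ℝ ∞ g → ∀ a b, deriv (fun s => g (ofPair (s, b))) a =
      pd 0 g (ofPair (a, b)) := fun g hg a b =>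
    ((hg.differentiable (by simp) _).hasFDerivAt.comp_hasDerivAt a
      (ofPair_hasFDerivAt_left a b)).deriv
  have d1 : ∀ (g : Plane → ℝ), ContDiff ℝ ∞ g → ∀ a b, deriv (fun s => g (ofPair (a, s))) b =
      pd 1 g (ofPair (a, b)) := fun g hg a b =>
    ((hg.differentiable (by simp) _).hasFDerivAt.comp_hasDerivAt b
      (ofPair_hasFDerivAt_right a b)).deriv
  have h1 := pd_contDiff (i := 1) hh
  have c1 := pd_hasCompactSupport (i := 1) hc
  have h2 := pd_contDiff (i := 0) h1
  have c2 := pd_hasCompactSupport (i := 0) c1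
  have int : Integrable (fun y => ‖pd 0 (pd 1 h) y‖) :=
    (integrable_of_cc h2.continuous c2).norm
  have intp : Integrable (fun z => ‖pd 0 (pd 1 h) (ofPair z)‖) :=
    (ofPair_measurePreserving.integrable_comp_emb ofPair_measurableEmbedding).2 int
  have e : ∫ y, |pd 0 (pd 1 h) y| = ∫ s, ∫ r, ‖pd 0 (pd 1 h) (ofPair (r, s))‖ := by
    rw [← ofPair_measurePreserving.integral_comp ofPair_measurableEmbedding]
    exact integral_prod_symm _ intp
  rw [e, ← ofPair_surj x]
  have s1 : ∀ s, ‖pd 1 h (ofPair (x 0, s))‖ ≤ ∫ r, ‖pd 0 (pd 1 h) (ofPair (r, s))‖ := by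
    intro s
    have := norm_le_integral_deriv (g := fun r => pd 1 h (ofPair (r, s)))
      ((h1.comp (ofPair_contDiff.comp (contDiff_id.prodMk contDiff_const))).of_le (by simp))
      (ofPair_slice_left_compact c1 s) (x 0)
    simpa only [d0 _ h1] using this
  have s2 := norm_le_integral_deriv (g := fun s => h (ofPair (x 0, s)))
      ((hh.comp (ofPair_contDiff.comp (contDiff_const.prodMk contDiff_id))).of_le (by simp))
      (ofPair_slice_right_compact hc (x 0)) (x 1)
  simp only [d1 _ hh] at s2
  refine s2.trans (integral_mono ?_ intp.integral_prod_right s1)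
  have cont : Continuous fun s => pd 1 h (ofPair (x 0, s)) :=
    h1.continuous.comp (ofPair_contDiff.continuous.comp (by fun_prop))
  exact (cont.integrable_of_hasCompactSupport (ofPair_slice_right_compact c1 (x 0))).norm

/-- Apply the bound by the mixed second derivative to |f|²; the product rule gives ∂₀f·∂₁f and
f·∂₀∂₁f, and each is estimated by Cauchy-Schwarz. The product structure is used later: one factor of
each product may be small while the other is merely bounded. -/
lemma agmon (hf : ContDiff ℝ ∞ f) (hc : HasCompactSupport f) (x : Plane) :
    ‖f x‖ ^ 2 ≤ 2 * (√(∫ x, ‖pd 0 f x‖ ^ 2) * √(∫ x, ‖pd 1 f x‖ ^ 2) +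
      √(l2Sq f) * √(∫ x, ‖pd 0 (pd 1 f) x‖ ^ 2)) := by
  have hf1 := fun i => pd_contDiff (i := i) hf
  have hf2 := fun i j => pd_contDiff (i := i) (pd_contDiff (i := j) hf)
  have c1 := fun i => pd_hasCompactSupport (i := i) hc
  have c2 := fun i j => pd_hasCompactSupport (i := i) (pd_hasCompactSupport (i := j) hc)
  have L2 : ∀ {g : Plane → Space}, ContDiff ℝ ∞ g → HasCompactSupport g →
      MemLp (fun x => ‖g x‖) 2 volume := fun h1 h2 =>
    (h1.continuous.memLp_of_hasCompactSupport h2).norm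
  have h := abs_le_integral_mixed (hf.norm_sq ℝ) (hc.comp_left (g := fun y => ‖y‖ ^ 2) (by simp)) x
  have e1 : pd 1 (fun x => ‖f x‖ ^ 2) = fun x => (2 : ℝ) • innerB (f x) (pd 1 f x) := by
    ext x
    have h := ((hf.differentiable (by simp) x).hasFDerivAt.norm_sq).fderiv
    unfold pd; rw [h]; simp [innerB_apply]
  have e2 : ∀ x, pd 0 (pd 1 (fun x => ‖f x‖ ^ 2)) x =
      2 * (inner ℝ (pd 0 f x) (pd 1 f x) + inner ℝ (f x) (pd 0 (pd 1 f) x)) := by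
    intro x
    rw [e1]
    have := pd_bilin 0 ((2 : ℝ) • innerB) (hf.differentiable (by simp))
      ((hf1 1).differentiable (by simp)) x
    refine this.trans ?_
    simp only [smul_apply, innerB_apply, smul_eq_mul]; ring
  rw [abs_of_nonneg (by positivity)] at h
  refine h.trans ?_
  have i1 : Integrable (fun x => |‖pd 0 f x‖| * |‖pd 1 f x‖|) :=
    integrable_of_cc ((hf1 0).continuous.norm.abs.mul (hf1 1).continuous.norm.abs)
      ((c1 0).norm.comp_left (g := fun y : ℝ => |y|) (by simp)).mul_right
  have i2 : Integrable (fun x => |‖f x‖| * |‖pd 0 (pd 1 f) x‖|) :=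
    integrable_of_cc (hf.continuous.norm.abs.mul (hf2 0 1).continuous.norm.abs)
      (hc.norm.comp_left (g := fun y : ℝ => |y|) (by simp)).mul_right
  calc ∫ y, |pd 0 (pd 1 (fun x => ‖f x‖ ^ 2)) y|
      ≤ ∫ y, 2 * (|‖pd 0 f y‖| * |‖pd 1 f y‖| + |‖f y‖| * |‖pd 0 (pd 1 f) y‖|) := by
        refine integral_mono_of_nonneg (.of_forall fun _ => abs_nonneg _)
          ((i1.add i2).const_mul 2) (.of_forall fun y => ?_)
        simp only [e2, abs_mul, abs_norm, abs_two]
        refine mul_le_mul_of_nonneg_left ((abs_add_le _ _).trans ?_) (by norm_num)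
        exact add_le_add (abs_real_inner_le_norm _ _) (abs_real_inner_le_norm _ _)
    _ = 2 * ((∫ y, |‖pd 0 f y‖| * |‖pd 1 f y‖|) + ∫ y, |‖f y‖| * |‖pd 0 (pd 1 f) y‖|) := by
        rw [integral_const_mul, integral_add i1 i2]
    _ ≤ _ := by
        refine mul_le_mul_of_nonneg_left (add_le_add ?_ ?_) (by norm_num)
        · exact integral_mul_le_sqrt (L2 (hf1 0) (c1 0)) (L2 (hf1 1) (c1 1))
        · exact integral_mul_le_sqrt (L2 hf hc) (L2 (hf2 0 1) (c2 0 1))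

end Smooth
end LLHelicity

namespace LLHelicity
set_option linter.unusedSectionVars false

/-! ### Logarithmic inequalities -/

/-- The length of the unit circle. -/
noncomputable def circleLen : ℝ := 2 * volume.real (Metric.ball (0 : Plane) 1)

lemma circleLen_pos : 0 < circleLen := by
  unfold circleLen
  have : 0 < volume.real (Metric.ball (0 : Plane) 1) :=
    ENNReal.toReal_pos (Metric.measure_ball_pos _ _ (by norm_num)).ne' measure_ball_lt_top.ne
  positivity

/-- In polar coordinates the integrand becomes r f(r), and a primitive g with a limit at infinity
supplies both integrability and the value. -/
lemma radial_integral {f g : ℝ → ℝ} {m : ℝ} (hg : ∀ r ∈ Ici (0 : ℝ), HasDerivAt g (r * f r) r)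
    (hf : ∀ r ∈ Ioi (0 : ℝ), 0 ≤ f r) (hm : Tendsto g atTop (𝓝 m)) :
    Integrable (fun y : Plane => f ‖y‖) ∧ ∫ y : Plane, f ‖y‖ = circleLen * (m - g 0) := by
  have hd : Module.finrank ℝ Plane - 1 = 1 := by simp
  have nn : ∀ r ∈ Ioi (0 : ℝ), 0 ≤ r * f r := fun r hr => mul_nonneg (le_of_lt hr) (hf r hr)
  constructor
  · rw [integrable_fun_norm_addHaar, hd]
    simpa using integrableOn_Ioi_deriv_of_nonneg' hg nn hm
  · rw [integral_fun_norm_addHaar, hd]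
    simp only [pow_one, smul_eq_mul]
    rw [integral_Ioi_of_hasDerivAt_of_nonneg' hg nn hm]
    simp [circleLen, mul_assoc]

/-- An approximate identity of total mass `circleLen`. -/
noncomputable def rho (ε : ℝ) (y : Plane) : ℝ := 2 * ε ^ 2 / (‖y‖ ^ 2 + ε ^ 2) ^ 2

/-- The gradient of ½ log(|y|² + ε²); its divergence is `rho`, so averaging f with `rho` can be
written in terms of the gradient of f. -/
noncomputable def kern (ε : ℝ) (i : Fin 2) (y : Plane) : ℝ := y i / (‖y‖ ^ 2 + ε ^ 2)

/-! ### Mass, moment and square integrals of the kernels -/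

section Kernel

variable {ε : ℝ}

lemma rho_nonneg (ε : ℝ) (y : Plane) : 0 ≤ rho ε y := by unfold rho; positivity

lemma rho_integral (hε : 0 < ε) : Integrable (rho ε) ∧ ∫ y, rho ε y = circleLen := by
  have := radial_integral (f := fun r => 2 * ε ^ 2 / (r ^ 2 + ε ^ 2) ^ 2)
    (g := fun r => - (ε ^ 2 / (r ^ 2 + ε ^ 2))) (m := 0) (fun r _ => ?_) (fun r _ => by positivity) ?_
  · refine ⟨this.1, this.2.trans ?_⟩
    have : ε ≠ 0 := hε.ne'
    field_simp; ring
  · have h : r ^ 2 + ε ^ 2 ≠ 0 := by positivity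
    have h1 : HasDerivAt (fun r => r ^ 2 + ε ^ 2) (2 * r) r := by
      simpa using (hasDerivAt_pow 2 r).add_const (ε ^ 2)
    have h2 := ((hasDerivAt_const r (ε ^ 2)).div h1 h).neg
    refine h2.congr_deriv ?_
    field_simp; ring
  · have : Tendsto (fun r : ℝ => r ^ 2 + ε ^ 2) atTop atTop :=
      tendsto_atTop_add_const_right _ _ (tendsto_pow_atTop (by norm_num))
    simpa using (this.const_div_atTop (ε ^ 2)).neg

/-- The first moment is of size ε. This is the source of the small factor in the remainders of the
logarithmic inequalities. -/
lemma rho_moment (hε : 0 < ε) : Integrable (fun y => rho ε y * ‖y‖) ∧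
    ∫ y, rho ε y * ‖y‖ = circleLen * (ε * (Real.pi / 2)) := by
  have := radial_integral (f := fun r => 2 * ε ^ 2 / (r ^ 2 + ε ^ 2) ^ 2 * r)
    (g := fun r => ε * Real.arctan (r / ε) - ε ^ 2 * r / (r ^ 2 + ε ^ 2)) (m := ε * (Real.pi / 2))
    (fun r hr => ?_)
    (fun r hr => by have : (0 : ℝ) < r := hr; positivity) ?_
  · refine ⟨this.1, this.2.trans ?_⟩
    simp
  · have h : r ^ 2 + ε ^ 2 ≠ 0 := by positivity
    have h1 : HasDerivAt (fun r => r ^ 2 + ε ^ 2) (2 * r) r := by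
      simpa using (hasDerivAt_pow 2 r).add_const (ε ^ 2)
    have h0 : HasDerivAt (fun r => ε ^ 2 * r) (ε ^ 2) r := by
      simpa using (hasDerivAt_id r).const_mul (ε ^ 2)
    have h2 := h0.div h1 h
    have h3 := ((hasDerivAt_id r).div_const ε).arctan.const_mul ε
    refine (h3.sub h2).congr_deriv ?_
    have : ε ≠ 0 := hε.ne'
    have h' : 1 + (r / ε) ^ 2 ≠ 0 := by positivity
    have e : 1 + (r / ε) ^ 2 = (r ^ 2 + ε ^ 2) / ε ^ 2 := by field_simp; ring
    simp only [id]
    rw [e]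
    field_simp; ring
  · have t1 : Tendsto (fun r : ℝ => ε * Real.arctan (r / ε)) atTop (𝓝 (ε * (Real.pi / 2))) :=
      ((tendsto_nhds_of_tendsto_nhdsWithin Real.tendsto_arctan_atTop).comp
        (tendsto_id.atTop_div_const hε)).const_mul ε
    have t2 : Tendsto (fun r : ℝ => ε ^ 2 * r / (r ^ 2 + ε ^ 2)) atTop (𝓝 0) := by
      have h : Tendsto (fun r : ℝ => ε ^ 2 / r) atTop (𝓝 0) := tendsto_id.const_div_atTop _
      refine squeeze_zero' ?_ ?_ h
      · filter_upwards [eventually_gt_atTop 0] with r hr; positivity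
      · filter_upwards [eventually_gt_atTop 0] with r hr
        rw [div_le_div_iff₀ (by positivity) hr]
        nlinarith [pow_pos hε 4]
    simpa using t1.sub t2

/-- The primitive ½ log((r² + ε²)/(r² + 1)) vanishes at infinity and equals log ε at 0, which is
where the logarithm in the final estimates comes from. -/
lemma kern_diff_bound (hε : 0 < ε) (h1 : ε ≤ 1) :
    Integrable (fun y : Plane => 1 / (‖y‖ ^ 2 + ε ^ 2) - 1 / (‖y‖ ^ 2 + 1)) ∧
    ∫ y : Plane, (1 / (‖y‖ ^ 2 + ε ^ 2) - 1 / (‖y‖ ^ 2 + 1)) = circleLen * Real.log (1 / ε) := by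
  have := radial_integral (f := fun r => 1 / (r ^ 2 + ε ^ 2) - 1 / (r ^ 2 + 1))
    (g := fun r => (1 / 2) * Real.log ((r ^ 2 + ε ^ 2) / (r ^ 2 + 1))) (m := 0)
    (fun r hr => ?_) (fun r hr => ?_) ?_
  · refine ⟨this.1, this.2.trans ?_⟩
    simp
  · have h : r ^ 2 + ε ^ 2 ≠ 0 := by positivity
    have h' : r ^ 2 + 1 ≠ 0 := by positivity
    have h1 : ∀ c : ℝ, HasDerivAt (fun r => r ^ 2 + c) (2 * r) r := fun c => by
      simpa using (hasDerivAt_pow 2 r).add_const c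
    have h2 := (((h1 (ε ^ 2)).div (h1 1) h').log (div_ne_zero h h')).const_mul (1 / 2)
    refine h2.congr_deriv ?_
    simp only [Pi.div_apply]
    field_simp
  · have : ε ^ 2 ≤ 1 := by nlinarith
    rw [sub_nonneg]
    exact one_div_le_one_div_of_le (by positivity) (by linarith)
  · have t : Tendsto (fun r : ℝ => (r ^ 2 + ε ^ 2) / (r ^ 2 + 1)) atTop (𝓝 1) := by
      have h : Tendsto (fun r : ℝ => 1 + (ε ^ 2 - 1) / (r ^ 2 + 1)) atTop (𝓝 (1 + 0)) := by
        refine tendsto_const_nhds.add (Tendsto.const_div_atTop ?_ _)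
        exact tendsto_atTop_add_const_right _ _ (tendsto_pow_atTop (by norm_num))
      rw [add_zero] at h
      refine h.congr fun r => ?_
      have : r ^ 2 + 1 ≠ 0 := by positivity
      field_simp; ring
    have := (t.log (by norm_num)).const_mul (1 / 2)
    simpa using this

lemma kern_contDiff (hε : 0 < ε) (i : Fin 2) : ContDiff ℝ ∞ (kern ε i) := by
  unfold kern
  refine ContDiff.div ?_ ((contDiff_norm_sq ℝ).add contDiff_const) fun y => by positivity
  exact (EuclideanSpace.proj (𝕜 := ℝ) i : Plane →L[ℝ] ℝ).contDiff

lemma kern_div (hε : 0 < ε) (y : Plane) : ∑ i, pd i (kern ε i) y = rho ε y := by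
  have h : ‖y‖ ^ 2 + ε ^ 2 ≠ 0 := by positivity
  have hN : HasFDerivAt (fun y : Plane => ‖y‖ ^ 2 + ε ^ 2) (2 • innerSL ℝ y) y := by
    simpa using ((hasFDerivAt_id y).norm_sq).add_const (ε ^ 2)
  have e : ∀ i, pd i (kern ε i) y =
      1 / (‖y‖ ^ 2 + ε ^ 2) - 2 * y i ^ 2 / (‖y‖ ^ 2 + ε ^ 2) ^ 2 := by
    intro i
    have hp : HasFDerivAt (fun y : Plane => y i) (EuclideanSpace.proj (𝕜 := ℝ) i : Plane →L[ℝ] ℝ) y :=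
      (EuclideanSpace.proj (𝕜 := ℝ) i : Plane →L[ℝ] ℝ).hasFDerivAt
    have hd := hp.mul ((hasDerivAt_inv h).comp_hasFDerivAt y hN)
    have hk : kern ε i = (fun y : Plane => y i) * (Inv.inv ∘ fun y : Plane => ‖y‖ ^ 2 + ε ^ 2) := by
      ext y; simp [kern, div_eq_mul_inv]
    unfold pd
    have hi : inner ℝ y (EuclideanSpace.single i (1 : ℝ)) = y i := by
      simp [EuclideanSpace.inner_single_right]
    rw [hk, hd.fderiv]
    simp [hi]
    field_simp
    ring
  have hs : ‖y‖ ^ 2 = y 0 ^ 2 + y 1 ^ 2 := by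
    rw [EuclideanSpace.norm_sq_eq]; simp
  simp only [Fin.sum_univ_two, e, rho]
  field_simp
  rw [hs]; ring

/-- A single kernel decays like 1/|y| and is not square-integrable; the difference of two scales is.
With d the difference of the two radial factors, y_i² d ≤ 1, so the square y_i² d² is dominated by
d, whose integral is known. -/
lemma kern_diff_sq (hε : 0 < ε) (h1 : ε ≤ 1) (i : Fin 2) :
    MemLp (fun y => kern ε i y - kern 1 i y) 2 volume ∧
    ∫ y, (kern ε i y - kern 1 i y) ^ 2 ≤ circleLen * Real.log (1 / ε) := by
  obtain ⟨hi, hI⟩ := kern_diff_bound hε h1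
  have bd : ∀ y, (kern ε i y - kern 1 i y) ^ 2 ≤
      1 / (‖y‖ ^ 2 + ε ^ 2) - 1 / (‖y‖ ^ 2 + 1) := by
    intro y
    have hyi : y i ^ 2 ≤ ‖y‖ ^ 2 := by
      have := PiLp.norm_apply_le y i
      rw [Real.norm_eq_abs] at this
      rw [← sq_abs]; gcongr
    have hε2 : ε ^ 2 ≤ 1 := by nlinarith
    have e : kern ε i y - kern 1 i y =
        y i * (1 / (‖y‖ ^ 2 + ε ^ 2) - 1 / (‖y‖ ^ 2 + 1)) := by
      simp only [kern]; ring
    set d := 1 / (‖y‖ ^ 2 + ε ^ 2) - 1 / (‖y‖ ^ 2 + 1) with hd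
    have d0 : 0 ≤ d := sub_nonneg.2 (one_div_le_one_div_of_le (by positivity) (by linarith))
    have d1 : y i ^ 2 * d ≤ 1 := by
      have : d ≤ 1 / (‖y‖ ^ 2 + ε ^ 2) := sub_le_self _ (by positivity)
      calc y i ^ 2 * d ≤ ‖y‖ ^ 2 * (1 / (‖y‖ ^ 2 + ε ^ 2)) := by gcongr
        _ ≤ 1 := by
          rw [mul_one_div, div_le_one (by positivity)]; nlinarith
    rw [e, mul_pow, pow_two d, ← mul_assoc]
    exact mul_le_of_le_one_left d0 d1
  have c : Continuous fun y => kern ε i y - kern 1 i y :=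
    ((kern_contDiff hε i).sub (kern_contDiff one_pos i)).continuous
  have int : Integrable (fun y => (kern ε i y - kern 1 i y) ^ 2) :=
    hi.mono' (c.pow 2).aestronglyMeasurable (.of_forall fun y => by
      rw [Real.norm_of_nonneg (sq_nonneg _)]; exact bd y)
  exact ⟨(memLp_two_iff_integrable_sq c.aestronglyMeasurable).2 int,
    (integral_mono int hi bd).trans hI.le⟩

lemma rho_one_sq : MemLp (rho 1) 2 volume ∧ ∫ y, rho 1 y ^ 2 ≤ 2 * circleLen := by
  obtain ⟨hi, hI⟩ := rho_integral one_pos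
  have bd : ∀ y, rho 1 y ^ 2 ≤ 2 * rho 1 y := by
    intro y
    have : rho 1 y ≤ 2 := by
      unfold rho
      rw [div_le_iff₀ (by positivity)]
      nlinarith [sq_nonneg (‖y‖), sq_nonneg (‖y‖ ^ 2)]
    nlinarith [rho_nonneg 1 y]
  have int : Integrable (fun y => rho 1 y ^ 2) :=
    (hi.const_mul 2).mono' (hi.1.pow 2) (.of_forall fun y => by
      rw [Real.norm_of_nonneg (sq_nonneg _)]; exact bd y)
  refine ⟨(memLp_two_iff_integrable_sq hi.1).2 int, (integral_mono int (hi.const_mul 2) bd).trans ?_⟩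
  rw [integral_const_mul, hI]

end Kernel

/-! ### Logarithmic sup and product inequalities for test functions -/

section Pointwise

variable {f : Plane → Space}

lemma l2Sq_nonneg (f : Plane → Space) : 0 ≤ l2Sq f := integral_nonneg fun x => by positivity
lemma gradSq_nonneg (f : Plane → Space) : 0 ≤ gradSq f :=
  Finset.sum_nonneg fun _ _ => integral_nonneg fun x => by positivity
lemma hessSq_nonneg (f : Plane → Space) : 0 ≤ hessSq f :=
  Finset.sum_nonneg fun _ _ => Finset.sum_nonneg fun _ _ => integral_nonneg fun x => by positivity

lemma pd_reflect (i : Fin 2) (hf : Differentiable ℝ f) (x y : Plane) :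
    pd i (fun y => f (x - y)) y = - pd i f (x - y) := by
  have h : HasFDerivAt (fun y => f (x - y)) _ y :=
    (hf (x - y)).hasFDerivAt.comp y ((hasFDerivAt_id y).const_sub x)
  unfold pd
  rw [h.fderiv]; simp

lemma reflect_compact {E : Type*} [NormedAddCommGroup E] {f : Plane → E} (hc : HasCompactSupport f)
    (x : Plane) : HasCompactSupport (fun y => f (x - y)) :=
  hc.comp_homeomorph (Homeomorph.subLeft x)

lemma norm_integral_smul_le {k : Plane → ℝ} {g : Plane → Space} (hk : MemLp k 2 volume)
    (hg : MemLp g 2 volume) : ‖∫ y, k y • g y‖ ≤ √(∫ y, k y ^ 2) * √(∫ y, ‖g y‖ ^ 2) := by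
  refine (norm_integral_le_integral_norm _).trans ?_
  simp only [norm_smul, Real.norm_eq_abs]
  simpa using integral_mul_le_sqrt hk hg.norm

lemma hasCompactSupport_smul {k : Plane → ℝ} {g : Plane → Space} (hc : HasCompactSupport g) :
    HasCompactSupport (fun y => k y • g y) := by
  refine hc.mono fun y hy => ?_
  contrapose! hy
  simp only [Function.mem_support, not_not] at hy ⊢
  rw [hy, smul_zero]

lemma integrable_smul_cc {k : Plane → ℝ} {g : Plane → Space} (hk : Continuous k)
    (hg : Continuous g) (hc : HasCompactSupport g) : Integrable (fun y => k y • g y) :=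
  (hk.smul hg).integrable_of_hasCompactSupport (hasCompactSupport_smul hc)

/-- The average kernel is a divergence, and integration by parts moves the derivatives to f; the
sign of the reflection y ↦ x - y cancels the sign of the integration by parts. -/
lemma kern_convolution {ε : ℝ} (hε : 0 < ε) (hf : ContDiff ℝ 1 f) (hc : HasCompactSupport f)
    (x : Plane) : ∫ y, rho ε y • f (x - y) = ∑ i, ∫ y, kern ε i y • pd i f (x - y) := by
  have hr : ContDiff ℝ 1 (fun y => f (x - y)) := hf.comp (contDiff_const.sub contDiff_id)
  have hcr := reflect_compact hc x
  have hk := fun i => (kern_contDiff hε i).of_le (m := 1) (by simp)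
  have cp : ∀ i, Continuous fun y => pd i f (x - y) := fun i => by
    have := pd_continuous (i := i) hf
    fun_prop
  have i1 : ∀ i, Integrable fun y => kern ε i y • pd i f (x - y) := fun i =>
    integrable_smul_cc (hk i).continuous (cp i) (reflect_compact (pd_hasCompactSupport hc) x)
  have i2 : ∀ i, Integrable fun y => pd i (kern ε i) y • f (x - y) := fun i =>
    integrable_smul_cc (pd_continuous (hk i)) hr.continuous hcr
  have e : ∀ i, ∫ y, pd i (kern ε i) y • f (x - y) = ∫ y, kern ε i y • pd i f (x - y) := by
    intro i
    have h := integral_pd_eq_zero i (f := fun y => kern ε i y • f (x - y)) ((hk i).smul hr)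
      (hasCompactSupport_smul hcr)
    have h' : pd i (fun y => kern ε i y • f (x - y)) = fun y => pd i (kern ε i) y • f (x - y) -
        kern ε i y • pd i f (x - y) := by
      ext1 y
      have := pd_bilin i (ContinuousLinearMap.lsmul ℝ ℝ) ((hk i).differentiable (by simp))
        (hr.differentiable (by simp)) y
      simp only [ContinuousLinearMap.lsmul_apply] at this
      refine this.trans ?_
      rw [pd_reflect i (hf.differentiable (by simp)), smul_neg, ← sub_eq_add_neg]
    rw [h', integral_sub (i2 i) (i1 i)] at h
    exact sub_eq_zero.1 h
  simp only [← e]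
  rw [← integral_finsetSum _ fun i _ => i2 i]
  congr 1; ext1 y
  rw [← Finset.sum_smul, kern_div hε]

lemma sq_add_three_le {x a b c l A B L k : ℝ} (hl : 0 ≤ l) (hA : 0 ≤ A) (hB : 0 ≤ B) (hL : 0 ≤ L)
    (hk : 0 ≤ k) (hx : 0 ≤ x) (h : x ≤ a + b + c) (ha : a = √(2 * k) * √l) (hb : b = √(k * L) * √A)
    (hc : c = √(k * L) * √B) : x ^ 2 ≤ 6 * k * (1 + L) * (l + (A + B)) := by
  have h1 : x ^ 2 ≤ (a + b + c) ^ 2 := by gcongr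
  have ea : a ^ 2 = 2 * k * l := by
    rw [ha, mul_pow, Real.sq_sqrt (by positivity), Real.sq_sqrt hl]
  have eb : b ^ 2 = k * L * A := by
    rw [hb, mul_pow, Real.sq_sqrt (by positivity), Real.sq_sqrt hA]
  have ec : c ^ 2 = k * L * B := by
    rw [hc, mul_pow, Real.sq_sqrt (by positivity), Real.sq_sqrt hB]
  have h2 : (a + b + c) ^ 2 ≤ 3 * (a ^ 2 + b ^ 2 + c ^ 2) := by
    nlinarith [sq_nonneg (a - b), sq_nonneg (b - c), sq_nonneg (a - c)]
  have p1 : 0 ≤ k * L * l := by positivity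
  have p2 : 0 ≤ k * L * A := by positivity
  have p3 : 0 ≤ k * L * B := by positivity
  have p4 : 0 ≤ k * A := by positivity
  have p5 : 0 ≤ k * B := by positivity
  rw [ea, eb, ec] at h2
  nlinarith

/-- Compare the average at scale ε with the average at scale 1: their difference is the convolution
of ∇f with a difference of kernels whose L² norm squared is of size log(1/ε). The average at scale 1
only needs the L² norm of f. -/
lemma mollified_bound {ε : ℝ} (hε : 0 < ε) (h1 : ε ≤ 1) (hf : ContDiff ℝ 1 f)
    (hc : HasCompactSupport f) (x : Plane) : ‖∫ y, rho ε y • f (x - y)‖ ^ 2 ≤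
      6 * circleLen * (1 + Real.log (1 / ε)) * (l2Sq f + gradSq f) := by
  have hk := fun {ε : ℝ} (hε : 0 < ε) i => (kern_contDiff hε i).continuous
  have cp : ∀ i, Continuous fun y => pd i f (x - y) := fun i => by
    have := pd_continuous (i := i) hf
    fun_prop
  have cc := fun i => reflect_compact (pd_hasCompactSupport (i := i) hc) x
  have i1 : ∀ {ε : ℝ} (_ : 0 < ε) i, Integrable fun y => kern ε i y • pd i f (x - y) :=
    fun hε i => integrable_smul_cc (hk hε i) (cp i) (cc i)
  have e : ∫ y, rho ε y • f (x - y) = (∫ y, rho 1 y • f (x - y)) +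
      ∑ i, ∫ y, (kern ε i y - kern 1 i y) • pd i f (x - y) := by
    rw [kern_convolution hε hf hc, kern_convolution one_pos hf hc, ← Finset.sum_add_distrib]
    refine Finset.sum_congr rfl fun i _ => ?_
    simp only [sub_smul]
    rw [integral_sub (i1 hε i) (i1 one_pos i)]; abel
  have log0 : 0 ≤ Real.log (1 / ε) := Real.log_nonneg (by rw [le_div_iff₀ hε]; linarith)
  have cl := circleLen_pos
  have b0 : ‖∫ y, rho 1 y • f (x - y)‖ ≤ √(2 * circleLen) * √(l2Sq f) := by
    refine (norm_integral_smul_le rho_one_sq.1 ((hf.continuous.comp (by fun_prop :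
      Continuous fun y => x - y)).memLp_of_hasCompactSupport (reflect_compact hc x))).trans ?_
    refine mul_le_mul (Real.sqrt_le_sqrt rho_one_sq.2) (le_of_eq ?_) (by positivity) (by positivity)
    congr 1
    exact integral_sub_left_eq_self (fun y => ‖f y‖ ^ 2) volume x
  have bi : ∀ i, ‖∫ y, (kern ε i y - kern 1 i y) • pd i f (x - y)‖ ≤
      √(circleLen * Real.log (1 / ε)) * √(∫ y, ‖pd i f y‖ ^ 2) := by
    intro i
    refine (norm_integral_smul_le (kern_diff_sq hε h1 i).1
      ((cp i).memLp_of_hasCompactSupport (cc i))).trans ?_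
    refine mul_le_mul (Real.sqrt_le_sqrt (kern_diff_sq hε h1 i).2) (le_of_eq ?_) (by positivity)
      (by positivity)
    congr 1
    exact integral_sub_left_eq_self (fun y => ‖pd i f y‖ ^ 2) volume x
  rw [e, Fin.sum_univ_two]
  have n := fun i => integral_nonneg (μ := (volume : Measure Plane)) (f := fun y => ‖pd i f y‖ ^ 2)
    (fun x => by positivity)
  have nl := l2Sq_nonneg f
  have tri := norm_add₃_le (a := ∫ y, rho 1 y • f (x - y))
    (b := ∫ y, (kern ε 0 y - kern 1 0 y) • pd 0 f (x - y))
    (c := ∫ y, (kern ε 1 y - kern 1 1 y) • pd 1 f (x - y))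
  rw [← add_assoc]
  simp only [gradSq, Fin.sum_univ_two]
  exact sq_add_three_le nl (n 0) (n 1) log0 cl.le (norm_nonneg _)
    (tri.trans (add_le_add (add_le_add b0 (bi 0)) (bi 1))) rfl rfl rfl

/-- Split f(x), up to the total mass, into its average and the average of f(x) - f(x-y). The first
part is `mollified_bound`; the second is kept as a weighted square by Cauchy-Schwarz for the finite
measure `rho ε`, and is estimated in different ways below. -/
lemma log_pointwise {ε : ℝ} (hε : 0 < ε) (h1 : ε ≤ 1) (hf : ContDiff ℝ 1 f)
    (hc : HasCompactSupport f) (x : Plane) : circleLen ^ 2 * ‖f x‖ ^ 2 ≤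
      12 * circleLen * (1 + Real.log (1 / ε)) * (l2Sq f + gradSq f) +
      2 * circleLen * ∫ y, rho ε y * ‖f x - f (x - y)‖ ^ 2 := by
  obtain ⟨hr, hR⟩ := rho_integral hε
  have cr : Continuous (rho ε) := by
    unfold rho
    exact continuous_const.div (by fun_prop) fun y => by positivity
  have cf : Continuous fun y => f x - f (x - y) := by
    have := hf.continuous; fun_prop
  obtain ⟨Cb, hCb⟩ := hc.exists_bound_of_continuous hf.continuous
  have bd : ∀ y, ‖f x - f (x - y)‖ ≤ Cb + Cb := fun y =>
    (norm_sub_le _ _).trans (add_le_add (hCb _) (hCb _))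
  have i1 : Integrable fun y => rho ε y • f (x - y) :=
    integrable_smul_cc cr (hf.continuous.comp (by fun_prop)) (reflect_compact hc x)
  have i2 : Integrable fun y => rho ε y • (f x - f (x - y)) := by
    refine (hr.mul_const (Cb + Cb)).mono' (cr.smul cf).aestronglyMeasurable (.of_forall fun y => ?_)
    rw [norm_smul, Real.norm_of_nonneg (rho_nonneg _ _)]
    exact mul_le_mul_of_nonneg_left (bd y) (rho_nonneg _ _)
  have i3 : Integrable fun y => rho ε y * ‖f x - f (x - y)‖ ^ 2 := by
    refine (hr.mul_const ((Cb + Cb) ^ 2)).mono' (cr.mul (cf.norm.pow 2)).aestronglyMeasurable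
      (.of_forall fun y => ?_)
    rw [norm_mul, Real.norm_of_nonneg (rho_nonneg _ _), norm_pow, norm_norm]
    exact mul_le_mul_of_nonneg_left (pow_le_pow_left₀ (norm_nonneg _) (bd y) 2) (rho_nonneg _ _)
  have e : circleLen • f x = (∫ y, rho ε y • f (x - y)) + ∫ y, rho ε y • (f x - f (x - y)) := by
    rw [← integral_add i1 i2, ← hR, ← integral_smul_const]
    congr 1; ext1 y
    rw [← smul_add]; congr 1; abel
  have b2 : ‖∫ y, rho ε y • (f x - f (x - y))‖ ^ 2 ≤
      circleLen * ∫ y, rho ε y * ‖f x - f (x - y)‖ ^ 2 := by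
    have m1 : MemLp (fun y => √(rho ε y)) 2 volume := by
      rw [memLp_two_iff_integrable_sq cr.sqrt.aestronglyMeasurable]
      simpa only [Real.sq_sqrt (rho_nonneg _ _)] using hr
    have m2 : MemLp (fun y => √(rho ε y) • (f x - f (x - y))) 2 volume := by
      have cm : Continuous fun y => √(rho ε y) • (f x - f (x - y)) := cr.sqrt.smul cf
      refine (memLp_norm_iff cm.aestronglyMeasurable).1 ?_
      rw [memLp_two_iff_integrable_sq cm.norm.aestronglyMeasurable]
      simpa only [norm_smul, mul_pow, Real.norm_eq_abs, sq_abs, Real.sq_sqrt (rho_nonneg _ _)] using i3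
    have h := norm_integral_smul_le m1 m2
    simp only [smul_smul, Real.mul_self_sqrt (rho_nonneg _ _), norm_smul, mul_pow, Real.norm_eq_abs,
      sq_abs, Real.sq_sqrt (rho_nonneg _ _)] at h
    rw [hR] at h
    calc _ ≤ (√circleLen * √(∫ y, rho ε y * ‖f x - f (x - y)‖ ^ 2)) ^ 2 := by gcongr
      _ = _ := by
        rw [mul_pow, Real.sq_sqrt circleLen_pos.le, Real.sq_sqrt]
        exact integral_nonneg fun y => mul_nonneg (rho_nonneg _ _) (by positivity)
  have b1 := mollified_bound hε h1 hf hc x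
  have n : circleLen ^ 2 * ‖f x‖ ^ 2 = ‖circleLen • f x‖ ^ 2 := by
    rw [norm_smul, mul_pow, Real.norm_of_nonneg circleLen_pos.le]
  rw [n, e]
  have := norm_add_le (∫ y, rho ε y • f (x - y)) (∫ y, rho ε y • (f x - f (x - y)))
  have h2 := pow_le_pow_left₀ (norm_nonneg _) this 2
  refine h2.trans ?_
  nlinarith [sq_nonneg (‖∫ y, rho ε y • f (x - y)‖ - ‖∫ y, rho ε y • (f x - f (x - y))‖)]

/-- The translation difference quotient bound in `L²`. -/
lemma translation_sq (hf : ContDiff ℝ 1 f) (hc : HasCompactSupport f) (y : Plane) :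
    ∫ x, ‖f x - f (x - y)‖ ^ 2 ≤ 2 * ‖y‖ ^ 2 * gradSq f := by
  have cp : ∀ i, Continuous (pd i f) := fun i => pd_continuous hf
  have hint : ∀ i, Integrable fun x => ‖pd i f x‖ ^ 2 := fun i =>
    integrable_normSq (cp i) (pd_hasCompactSupport hc)
  -- pointwise bound
  have pt : ∀ x, ‖f x - f (x - y)‖ ^ 2 ≤
      2 * ‖y‖ ^ 2 * ∑ i, ∫ s in (0 : ℝ)..1, ‖pd i f (x - s • y)‖ ^ 2 := by
    intro x
    have hd : ∀ s, HasDerivAt (fun s : ℝ => f (x - s • y)) (fderiv ℝ f (x - s • y) (-y)) s := by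
      intro s
      have h1 : HasDerivAt (fun s : ℝ => x - s • y) (-y) s := by
        simpa using ((hasDerivAt_id s).smul_const y).const_sub x
      exact ((hf.differentiable (by simp) _).hasFDerivAt).comp_hasDerivAt s h1
    have cs : Continuous fun s : ℝ => fderiv ℝ f (x - s • y) :=
      (hf.continuous_fderiv (by simp)).comp (by fun_prop)
    have csy : Continuous fun s : ℝ => fderiv ℝ f (x - s • y) (-y) := cs.clm_apply continuous_const
    have ftc := intervalIntegral.integral_eq_sub_of_hasDerivAt (fun s _ => hd s)
      (csy.intervalIntegrable 0 1)
    simp only [one_smul, zero_smul, sub_zero] at ftc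
    have m : ∀ g : ℝ → ℝ, Continuous g → MemLp g 2 (volume.restrict (Ioc 0 1)) := fun g hg => by
      obtain ⟨C, hC⟩ := isCompact_Icc.exists_bound_of_continuousOn (hg.continuousOn (s := Icc 0 1))
      exact MemLp.of_bound hg.aestronglyMeasurable C ((ae_restrict_iff' measurableSet_Ioc).2
        (.of_forall fun s hs => hC s (Ioc_subset_Icc_self hs)))
    have h2 : ‖f x - f (x - y)‖ ^ 2 ≤ ∫ s in (0 : ℝ)..1, ‖fderiv ℝ f (x - s • y) (-y)‖ ^ 2 := by
      rw [norm_sub_rev, ← ftc, intervalIntegral.integral_of_le zero_le_one,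
        intervalIntegral.integral_of_le zero_le_one]
      have h := integral_mul_le_sqrt (m _ csy.norm) (m (fun _ => 1) continuous_const)
      simp only [abs_norm, abs_one, mul_one, one_pow] at h
      have h' := (norm_integral_le_integral_norm _).trans h
      have := pow_le_pow_left₀ (norm_nonneg _) h' 2
      refine this.trans (le_of_eq ?_)
      rw [mul_pow, Real.sq_sqrt (integral_nonneg fun s => by positivity)]
      simp
    refine h2.trans ?_
    have csi : ∀ i, Continuous fun s : ℝ => ‖pd i f (x - s • y)‖ ^ 2 := fun i => by
      have := cp i; fun_prop
    rw [← intervalIntegral.integral_finsetSum (fun i _ => (csi i).intervalIntegrable _ _),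
      ← intervalIntegral.integral_const_mul]
    refine intervalIntegral.integral_mono_on zero_le_one ((csy.norm.pow 2).intervalIntegrable _ _)
      ((continuous_const.mul (continuous_finsetSum _ fun i _ => csi i)).intervalIntegrable _ _)
      fun s _ => ?_
    have h3 := (fderiv ℝ f (x - s • y)).le_opNorm (-y)
    rw [norm_neg] at h3
    have h4 := norm_fderiv_le f (x - s • y)
    rw [Fin.sum_univ_two] at h4 ⊢
    have h5 := h3.trans (mul_le_mul_of_nonneg_right h4 (norm_nonneg y))
    have h6 := pow_le_pow_left₀ (norm_nonneg _) h5 2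
    refine h6.trans ?_
    rw [mul_pow]
    have : (‖pd 0 f (x - s • y)‖ + ‖pd 1 f (x - s • y)‖) ^ 2 ≤
        2 * (‖pd 0 f (x - s • y)‖ ^ 2 + ‖pd 1 f (x - s • y)‖ ^ 2) := by
      nlinarith [sq_nonneg (‖pd 0 f (x - s • y)‖ - ‖pd 1 f (x - s • y)‖)]
    nlinarith [sq_nonneg ‖y‖]
  -- Tonelli
  have jc : ∀ i, Continuous fun z : Plane × ℝ => ‖pd i f (z.1 - z.2 • y)‖ ^ 2 := fun i => by
    have := cp i; fun_prop
  have pint : ∀ i, Integrable (fun z : Plane × ℝ => ‖pd i f (z.1 - z.2 • y)‖ ^ 2)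
      (volume.prod (volume.restrict (Ioc 0 1))) := by
    intro i
    rw [integrable_prod_iff' (jc i).aestronglyMeasurable]
    refine ⟨.of_forall fun s => (hint i).comp_sub_right (s • y), ?_⟩
    have : ∀ s : ℝ, ∫ x, ‖‖pd i f (x - s • y)‖ ^ 2‖ = ∫ x, ‖pd i f x‖ ^ 2 := fun s => by
      simp only [norm_pow, norm_norm]
      exact integral_sub_right_eq_self (fun x => ‖pd i f x‖ ^ 2) (s • y)
    simp only [this]
    exact integrable_const _
  have ti : ∀ i, Integrable fun x => ∫ s in (0 : ℝ)..1, ‖pd i f (x - s • y)‖ ^ 2 := fun i => by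
    simp only [intervalIntegral.integral_of_le zero_le_one]
    exact (pint i).integral_prod_left
  have ton : ∀ i, ∫ x, ∫ s in (0 : ℝ)..1, ‖pd i f (x - s • y)‖ ^ 2 = ∫ x, ‖pd i f x‖ ^ 2 := by
    intro i
    simp only [intervalIntegral.integral_of_le zero_le_one]
    rw [integral_integral_swap (pint i)]
    have : ∀ s : ℝ, ∫ x, ‖pd i f (x - s • y)‖ ^ 2 = ∫ x, ‖pd i f x‖ ^ 2 := fun s =>
      integral_sub_right_eq_self (fun x => ‖pd i f x‖ ^ 2) (s • y)
    simp only [this]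
    simp
  calc ∫ x, ‖f x - f (x - y)‖ ^ 2
      ≤ ∫ x, 2 * ‖y‖ ^ 2 * ∑ i, ∫ s in (0 : ℝ)..1, ‖pd i f (x - s • y)‖ ^ 2 :=
        integral_mono_of_nonneg (.of_forall fun x => by positivity)
          ((integrable_finsetSum _ fun i _ => ti i).const_mul _) (.of_forall pt)
    _ = _ := by
        rw [integral_const_mul, integral_finsetSum _ fun i _ => ti i]
        simp only [ton, gradSq]

lemma diff_contDiff {n : WithTop ℕ∞} (hf : ContDiff ℝ n f) (y : Plane) :
    ContDiff ℝ n (fun x => f x - f (x - y)) := hf.sub (hf.comp (contDiff_id.sub contDiff_const))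

lemma diff_compact (hc : HasCompactSupport f) (y : Plane) :
    HasCompactSupport (fun x => f x - f (x - y)) :=
  hc.sub (hc.comp_homeomorph (Homeomorph.subRight y))

lemma pd_diff (i : Fin 2) (hf : Differentiable ℝ f) (y : Plane) :
    pd i (fun x => f x - f (x - y)) = fun x => pd i f x - pd i f (x - y) := by
  ext1 x
  have h : HasFDerivAt (fun x => f x - f (x - y)) _ x :=
    (hf x).hasFDerivAt.sub ((hf (x - y)).hasFDerivAt.comp x ((hasFDerivAt_id x).sub_const y))
  unfold pd
  rw [h.fderiv]; simp

lemma integral_diff_sq_le (hf : Continuous f) (hc : HasCompactSupport f) (y : Plane) :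
    ∫ x, ‖f x - f (x - y)‖ ^ 2 ≤ 4 * ∫ x, ‖f x‖ ^ 2 := by
  have h := integrable_normSq hf hc
  have h' : Integrable fun x => ‖f (x - y)‖ ^ 2 := h.comp_sub_right y
  calc ∫ x, ‖f x - f (x - y)‖ ^ 2 ≤ ∫ x, (2 * ‖f x‖ ^ 2 + 2 * ‖f (x - y)‖ ^ 2) := by
        refine integral_mono_of_nonneg (.of_forall fun x => by positivity)
          ((h.const_mul 2).add (h'.const_mul 2)) (.of_forall fun x => ?_)
        have := pow_le_pow_left₀ (norm_nonneg _) (norm_sub_le (f x) (f (x - y))) 2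
        refine this.trans ?_
        nlinarith [sq_nonneg (‖f x‖ - ‖f (x - y)‖)]
    _ = _ := by
        rw [integral_add (h.const_mul 2) (h'.const_mul 2), integral_const_mul, integral_const_mul,
          integral_sub_right_eq_self (fun x => ‖f x‖ ^ 2) y]
        ring

/-- The logarithmic bound of the supremum norm by the `H¹` norm. -/
lemma log_sup : ∃ C : ℝ, 0 ≤ C ∧ ∀ f : Plane → Space, ContDiff ℝ ∞ f → HasCompactSupport f →
    ∀ ε : ℝ, 0 < ε → ε ≤ 1 → ∀ x, ‖f x‖ ^ 2 ≤ C * (1 + Real.log (1 / ε)) * (l2Sq f + gradSq f) +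
      C * ε * (gradSq f + hessSq f) := by
  have k0 := circleLen_pos
  refine ⟨12 / circleLen + 16 * Real.pi, by have := Real.pi_pos; positivity,
    fun f hf hc ε hε h1 x => ?_⟩
  have hf1 : ContDiff ℝ 1 f := hf.of_le (by simp)
  have key := log_pointwise hε h1 hf1 hc x
  obtain ⟨hm, hM⟩ := rho_moment hε
  have log0 : 0 ≤ Real.log (1 / ε) := Real.log_nonneg (by rw [le_div_iff₀ hε]; linarith)
  have ng := gradSq_nonneg f
  have nh := hessSq_nonneg f
  have nl := l2Sq_nonneg f
  have pdn : ∀ i, 0 ≤ ∫ x, ‖pd i f x‖ ^ 2 := fun i => integral_nonneg fun x => by positivity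
  have pdnn : ∀ i j, 0 ≤ ∫ x, ‖pd i (pd j f) x‖ ^ 2 := fun i j =>
    integral_nonneg fun x => by positivity
  have g1 : ∀ i, ∫ x, ‖pd i f x‖ ^ 2 ≤ gradSq f := fun i =>
    Finset.single_le_sum (fun i _ => pdn i) (Finset.mem_univ i)
  have h2 : ∀ j, gradSq (pd j f) ≤ hessSq f := fun j => by
    unfold gradSq hessSq
    rw [Finset.sum_comm]
    exact Finset.single_le_sum (f := fun j => ∑ i, ∫ x, ‖pd i (pd j f) x‖ ^ 2)
      (fun j _ => Finset.sum_nonneg fun i _ => pdnn i j) (Finset.mem_univ j)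
  have h3 : ∀ i j, ∫ x, ‖pd i (pd j f) x‖ ^ 2 ≤ hessSq f := fun i j =>
    (Finset.single_le_sum (f := fun i => ∫ x, ‖pd i (pd j f) x‖ ^ 2)
      (fun i _ => pdnn i j) (Finset.mem_univ i)).trans (h2 j)
  -- Hölder continuity
  have hol : ∀ y, ‖f x - f (x - y)‖ ^ 2 ≤ 16 * ‖y‖ * (gradSq f + hessSq f) := by
    intro y
    -- In each product one factor is a translation difference of a function with one more derivative
    -- available, which gains |y|, and the other is bounded trivially. So the square of the
    -- difference is linear in |y| and is integrated against the first moment of the kernel.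
    have a := agmon (diff_contDiff hf y) (diff_compact hc y) x
    have d1 := fun i => pd_diff i (hf.differentiable (by simp)) y
    have d2 : pd 0 (pd 1 (fun x => f x - f (x - y))) =
        fun x => pd 0 (pd 1 f) x - pd 0 (pd 1 f) (x - y) := by
      rw [d1, pd_diff 0 ((pd_contDiff hf).differentiable (by simp))]
    rw [d2, d1, d1] at a
    have s1 : √(∫ x, ‖pd 0 f x - pd 0 f (x - y)‖ ^ 2) ≤ √(2 * ‖y‖ ^ 2 * hessSq f) :=
      Real.sqrt_le_sqrt ((translation_sq ((pd_contDiff hf).of_le (by simp))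
        (pd_hasCompactSupport hc) y).trans (mul_le_mul_of_nonneg_left (h2 0) (by positivity)))
    have s2 : √(∫ x, ‖pd 1 f x - pd 1 f (x - y)‖ ^ 2) ≤ √(4 * gradSq f) :=
      Real.sqrt_le_sqrt ((integral_diff_sq_le (pd_continuous hf1) (pd_hasCompactSupport hc) y).trans
        (mul_le_mul_of_nonneg_left (g1 1) (by norm_num)))
    have s3 : √(l2Sq fun x => f x - f (x - y)) ≤ √(2 * ‖y‖ ^ 2 * gradSq f) :=
      Real.sqrt_le_sqrt (translation_sq hf1 hc y)
    have s4 : √(∫ x, ‖pd 0 (pd 1 f) x - pd 0 (pd 1 f) (x - y)‖ ^ 2) ≤ √(4 * hessSq f) :=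
      Real.sqrt_le_sqrt ((integral_diff_sq_le (pd_contDiff (pd_contDiff hf)).continuous
        (pd_hasCompactSupport (pd_hasCompactSupport hc)) y).trans
        (mul_le_mul_of_nonneg_left (h3 0 1) (by norm_num)))
    have e1 : √(2 * ‖y‖ ^ 2 * hessSq f) * √(4 * gradSq f) ≤ 4 * ‖y‖ * (gradSq f + hessSq f) := by
      rw [← Real.sqrt_mul (by positivity)]
      refine Real.sqrt_le_iff.2 ⟨by positivity, ?_⟩
      nlinarith [mul_nonneg (sq_nonneg ‖y‖) (sq_nonneg (gradSq f - hessSq f)),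
        mul_nonneg (sq_nonneg ‖y‖) (mul_nonneg ng nh),
        mul_nonneg (sq_nonneg ‖y‖) (sq_nonneg (gradSq f)),
        mul_nonneg (sq_nonneg ‖y‖) (sq_nonneg (hessSq f))]
    have e2 : √(2 * ‖y‖ ^ 2 * gradSq f) * √(4 * hessSq f) ≤ 4 * ‖y‖ * (gradSq f + hessSq f) := by
      refine le_trans (le_of_eq ?_) e1
      rw [← Real.sqrt_mul (by positivity), ← Real.sqrt_mul (by positivity)]
      congr 1; ring
    have t1 := mul_le_mul s1 s2 (by positivity) (by positivity)
    have t2 := mul_le_mul s3 s4 (by positivity) (by positivity)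
    linarith
  have int : ∫ y, rho ε y * ‖f x - f (x - y)‖ ^ 2 ≤
      16 * (gradSq f + hessSq f) * (circleLen * (ε * (Real.pi / 2))) := by
    rw [← hM, ← integral_const_mul]
    refine integral_mono_of_nonneg (.of_forall fun y => mul_nonneg (rho_nonneg _ _) (by positivity))
      (hm.const_mul _) (.of_forall fun y => ?_)
    have := mul_le_mul_of_nonneg_left (hol y) (rho_nonneg ε y)
    refine this.trans (le_of_eq ?_); ring
  have fin : ‖f x‖ ^ 2 ≤ 12 / circleLen * ((1 + Real.log (1 / ε)) * (l2Sq f + gradSq f)) +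
      16 * Real.pi * (ε * (gradSq f + hessSq f)) := by
    have h : circleLen ^ 2 * ‖f x‖ ^ 2 ≤ circleLen ^ 2 * (12 / circleLen *
      ((1 + Real.log (1 / ε)) * (l2Sq f + gradSq f)) + 16 * Real.pi * (ε * (gradSq f + hessSq f))) := by
      refine key.trans ?_
      have := mul_le_mul_of_nonneg_left int (show 0 ≤ 2 * circleLen by positivity)
      refine (add_le_add_right this _).trans (le_of_eq ?_)
      field_simp
    exact le_of_mul_le_mul_left h (by positivity)
  refine fin.trans ?_
  have p1 : 0 ≤ (1 + Real.log (1 / ε)) * (l2Sq f + gradSq f) := by positivity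
  have p2 : 0 ≤ ε * (gradSq f + hessSq f) := by positivity
  have p3 : 0 ≤ 12 / circleLen := by positivity
  have p4 := Real.pi_pos
  nlinarith [mul_nonneg p3 p2, mul_nonneg p4.le p1]

lemma normSq_compact {g : Plane → Space} (hc : HasCompactSupport g) :
    HasCompactSupport (fun x => ‖g x‖ ^ 2) := hc.comp_left (g := fun y => ‖y‖ ^ 2) (by simp)

/-- Ladyzhenskaya's inequality for f - f(·-y): the L² factor gains |y|² and the gradient factor is
bounded trivially, so no second derivative of f is needed. -/
lemma translation_fourth {CL : ℝ} (hCL : 0 ≤ CL) (lady : ∀ f : Plane → Space, ContDiff ℝ 1 f →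
    HasCompactSupport f → ∫ x, ‖f x‖ ^ 4 ≤ CL * l2Sq f * gradSq f) (hf1 : ContDiff ℝ 1 f)
    (hc : HasCompactSupport f) (y : Plane) :
    ∫ x, ‖f x - f (x - y)‖ ^ 4 ≤ (√(8 * CL) * ‖y‖ * gradSq f) ^ 2 := by
  have ng := gradSq_nonneg f
  have h := lady _ (diff_contDiff hf1 y) (diff_compact hc y)
  have a1 : l2Sq (fun x => f x - f (x - y)) ≤ 2 * ‖y‖ ^ 2 * gradSq f := translation_sq hf1 hc y
  have a2 : gradSq (fun x => f x - f (x - y)) ≤ 4 * gradSq f := by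
    unfold gradSq
    rw [Finset.mul_sum]
    refine Finset.sum_le_sum fun i _ => ?_
    rw [pd_diff i (hf1.differentiable (by simp)) y]
    exact integral_diff_sq_le (pd_continuous hf1) (pd_hasCompactSupport hc) y
  refine h.trans ?_
  rw [mul_pow, mul_pow, Real.sq_sqrt (by positivity)]
  calc _ ≤ CL * (2 * ‖y‖ ^ 2 * gradSq f) * (4 * gradSq f) := by
        have := gradSq_nonneg fun x => f x - f (x - y)
        gcongr
    _ = _ := by ring

lemma translation_product {CL : ℝ} (hCL : 0 ≤ CL) (lady : ∀ f : Plane → Space, ContDiff ℝ 1 f →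
    HasCompactSupport f → ∫ x, ‖f x‖ ^ 4 ≤ CL * l2Sq f * gradSq f) (hf1 : ContDiff ℝ 1 f)
    (hc : HasCompactSupport f) {g : Plane → Space} (g2 : MemLp g 2 volume) (g4 : MemLp g 4 volume)
    (y : Plane) : ∫ x, ‖f x - f (x - y)‖ ^ 2 * ‖g x‖ ^ 2 ≤
      √(8 * CL) * ‖y‖ * gradSq f * √(∫ x, ‖g x‖ ^ 4) := by
  have ng := gradSq_nonneg f
  have gi4 : Integrable fun x => ‖g x‖ ^ 4 := g4.integrable_norm_pow (by norm_num)
  have c1 : Continuous fun x => ‖f x - f (x - y)‖ ^ 2 :=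
    (diff_contDiff hf1 y).continuous.norm.pow 2
  have m1 : MemLp (fun x => ‖f x - f (x - y)‖ ^ 2) 2 volume :=
    c1.memLp_of_hasCompactSupport (normSq_compact (diff_compact hc y))
  have m2 : MemLp (fun x => ‖g x‖ ^ 2) 2 volume := by
    refine (memLp_two_iff_integrable_sq (f := fun x => ‖g x‖ ^ 2) (g2.1.norm.pow 2)).2 ?_
    simpa only [← pow_mul] using gi4
  have h := integral_mul_le_sqrt m1 m2
  simp only [abs_pow, abs_norm, ← pow_mul] at h
  refine h.trans (mul_le_mul_of_nonneg_right ?_ (by positivity))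
  exact Real.sqrt_le_iff.2 ⟨by positivity, translation_fourth hCL lady hf1 hc y⟩

/-- The logarithmic product inequality. -/
lemma log_product : ∃ C : ℝ, 0 ≤ C ∧ ∀ f : Plane → Space, ContDiff ℝ ∞ f → HasCompactSupport f →
    ∀ g : Plane → Space, MemLp g 2 volume → MemLp g 4 volume → ∀ ε : ℝ, 0 < ε → ε ≤ 1 →
    ∫ x, ‖f x‖ ^ 2 * ‖g x‖ ^ 2 ≤
      C * (1 + Real.log (1 / ε)) * (l2Sq f + gradSq f) * (∫ x, ‖g x‖ ^ 2) +
      C * ε * gradSq f * √(∫ x, ‖g x‖ ^ 4) := by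
  obtain ⟨CL, hCL, lady⟩ := ladyzhenskaya
  have k0 := circleLen_pos
  refine ⟨12 / circleLen + √(8 * CL) * Real.pi, by have := Real.pi_pos; positivity,
    fun f hf hc g g2 g4 ε hε h1 => ?_⟩
  have hf1 : ContDiff ℝ 1 f := hf.of_le (by simp)
  obtain ⟨hm, hM⟩ := rho_moment hε
  have log0 : 0 ≤ Real.log (1 / ε) := Real.log_nonneg (by rw [le_div_iff₀ hε]; linarith)
  have ng := gradSq_nonneg f
  have nl := l2Sq_nonneg f
  have cr : Continuous (rho ε) := by
    unfold rho
    exact continuous_const.div (by fun_prop) fun y => by positivity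
  have cf := hf.continuous
  have gi2 : Integrable fun x => ‖g x‖ ^ 2 := g2.integrable_norm_pow (by norm_num)
  have gi4 : Integrable fun x => ‖g x‖ ^ 4 := g4.integrable_norm_pow (by norm_num)
  obtain ⟨Cb, hCb⟩ := hc.exists_bound_of_continuous hf.continuous
  have bd : ∀ x y, ‖f x - f (x - y)‖ ≤ Cb + Cb := fun x y =>
    (norm_sub_le _ _).trans (add_le_add (hCb _) (hCb _))
  let H : Plane × Plane → ℝ := fun z => rho ε z.2 * (‖f z.1 - f (z.1 - z.2)‖ ^ 2 * ‖g z.1‖ ^ 2)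
  have slice : ∀ y, ∫ x, ‖f x - f (x - y)‖ ^ 2 * ‖g x‖ ^ 2 ≤
      √(8 * CL) * ‖y‖ * gradSq f * √(∫ x, ‖g x‖ ^ 4) :=
    translation_product hCL lady hf1 hc g2 g4
  have si : ∀ y, Integrable fun x => ‖f x - f (x - y)‖ ^ 2 * ‖g x‖ ^ 2 := fun y => by
    have c1 : Continuous fun x => ‖f x - f (x - y)‖ ^ 2 :=
      (diff_contDiff hf1 y).continuous.norm.pow 2
    exact Integrable.bdd_mul gi2 c1.aestronglyMeasurable (.of_forall fun x => by
      rw [norm_pow, norm_norm]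
      exact pow_le_pow_left₀ (norm_nonneg _) (bd x y) 2)
  have Hm : AEStronglyMeasurable H (volume.prod volume) := by
    have c1 : Continuous fun z : Plane × Plane => rho ε z.2 := cr.comp continuous_snd
    have c2 : Continuous fun z : Plane × Plane => ‖f z.1 - f (z.1 - z.2)‖ ^ 2 := by fun_prop
    exact c1.aestronglyMeasurable.mul (c2.aestronglyMeasurable.mul (gi2.1.comp_fst))
  have Hs : ∀ y, ∫ x, ‖H (x, y)‖ = rho ε y * ∫ x, ‖f x - f (x - y)‖ ^ 2 * ‖g x‖ ^ 2 := fun y => by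
    rw [← integral_const_mul]
    congr 1; ext1 x
    rw [Real.norm_of_nonneg]
    exact mul_nonneg (rho_nonneg _ _) (by positivity)
  have Hi : Integrable H (volume.prod volume) := by
    rw [integrable_prod_iff' Hm]
    refine ⟨.of_forall fun y => (si y).const_mul (rho ε y), ?_⟩
    refine (hm.mul_const (√(8 * CL) * gradSq f * √(∫ x, ‖g x‖ ^ 4))).mono'
      Hm.norm.prod_swap.integral_prod_right' (.of_forall fun y => ?_)
    rw [Real.norm_of_nonneg (integral_nonneg fun x => norm_nonneg _), Hs]
    refine (mul_le_mul_of_nonneg_left (slice y) (rho_nonneg _ _)).trans (le_of_eq ?_)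
    ring
  -- In the application f is a gradient, without a pointwise Hölder bound. Integrating in x first,
  -- at fixed y, uses only the fourth-power bound on translation differences; the remaining integral
  -- in y is the first moment of the kernel.
  have swap : ∫ x, (∫ y, rho ε y * ‖f x - f (x - y)‖ ^ 2) * ‖g x‖ ^ 2 ≤
      √(8 * CL) * gradSq f * √(∫ x, ‖g x‖ ^ 4) * (circleLen * (ε * (Real.pi / 2))) := by
    have e : ∀ x, (∫ y, rho ε y * ‖f x - f (x - y)‖ ^ 2) * ‖g x‖ ^ 2 = ∫ y, H (x, y) := fun x => by
      rw [← integral_mul_const]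
      congr 1; ext1 y; simp only [H]; ring
    simp only [e]
    rw [integral_integral_swap (f := fun x y => H (x, y)) Hi, ← hM, ← integral_const_mul]
    refine integral_mono_of_nonneg (.of_forall fun y => integral_nonneg fun x =>
      mul_nonneg (rho_nonneg _ _) (by positivity)) (hm.const_mul _) (.of_forall fun y => ?_)
    simp only [H]
    rw [integral_const_mul]
    refine (mul_le_mul_of_nonneg_left (slice y) (rho_nonneg _ _)).trans (le_of_eq ?_)
    ring
  have si2 : Integrable fun x => (∫ y, rho ε y * ‖f x - f (x - y)‖ ^ 2) * ‖g x‖ ^ 2 := by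
    refine Hi.integral_prod_left.congr (.of_forall fun x => ?_)
    simp only [H]
    rw [← integral_mul_const]
    congr 1; ext1 y; ring
  have fg : Integrable fun x => ‖f x‖ ^ 2 * ‖g x‖ ^ 2 := by
    have c1 : Continuous fun x => ‖f x‖ ^ 2 := cf.norm.pow 2
    exact Integrable.bdd_mul gi2 c1.aestronglyMeasurable (.of_forall fun x => by
      rw [norm_pow, norm_norm]
      exact pow_le_pow_left₀ (norm_nonneg _) (hCb x) 2)
  set L := Real.log (1 / ε)
  set G4 := √(∫ x, ‖g x‖ ^ 4)
  have main : circleLen ^ 2 * ∫ x, ‖f x‖ ^ 2 * ‖g x‖ ^ 2 ≤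
      12 * circleLen * (1 + L) * (l2Sq f + gradSq f) * (∫ x, ‖g x‖ ^ 2) + 2 * circleLen *
      (√(8 * CL) * gradSq f * G4 * (circleLen * (ε * (Real.pi / 2)))) := by
    refine le_trans ?_ (add_le_add_right (mul_le_mul_of_nonneg_left swap (by positivity)) _)
    rw [← integral_const_mul, ← integral_const_mul, ← integral_const_mul,
      ← integral_add (gi2.const_mul _) (si2.const_mul _)]
    refine integral_mono (fg.const_mul _) ((gi2.const_mul _).add (si2.const_mul _)) fun x => ?_
    have := mul_le_mul_of_nonneg_right (log_pointwise hε h1 hf1 hc x) (sq_nonneg ‖g x‖)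
    refine le_trans (le_of_eq ?_) (this.trans (le_of_eq ?_)) <;> ring
  have G0 : 0 ≤ ∫ x, ‖g x‖ ^ 2 := integral_nonneg fun x => by positivity
  have fin : ∫ x, ‖f x‖ ^ 2 * ‖g x‖ ^ 2 ≤ 12 / circleLen * ((1 + L) * (l2Sq f + gradSq f) *
      (∫ x, ‖g x‖ ^ 2)) + √(8 * CL) * Real.pi * (ε * gradSq f * G4) := by
    refine le_of_mul_le_mul_left (main.trans (le_of_eq ?_)) (show 0 < circleLen ^ 2 by positivity)
    field_simp
  refine fin.trans ?_
  have p1 : 0 ≤ (1 + L) * (l2Sq f + gradSq f) * (∫ x, ‖g x‖ ^ 2) := by positivity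
  have p2 : 0 ≤ ε * gradSq f * G4 := by positivity
  have p3 : 0 ≤ 12 / circleLen := by positivity
  have p4 : 0 ≤ √(8 * CL) * Real.pi := by have := Real.pi_pos; positivity
  nlinarith [mul_nonneg p3 p2, mul_nonneg p4 p1]

end Pointwise
end LLHelicity

namespace LLHelicity
set_option linter.unusedSectionVars false

/-! ### Weak partial derivatives -/

section Weak

variable {i j : Fin 2} {f f' g g' : Plane → Space}

lemma weakPartial_spec (h : ∃ g, HasWeakPartial i f g) : HasWeakPartial i f (weakPartial i f) := by
  rw [weakPartial, dif_pos h]; exact h.choose_spec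

lemma HasWeakPartial.unique (h : HasWeakPartial i f g) (h' : HasWeakPartial i f g') :
    g =ᵐ[volume] g' :=
  ae_eq_of_integral_contDiff_smul_eq h.2.1 h'.2.1 fun φ hφ hc =>
    neg_injective ((h.2.2 φ hφ hc).symm.trans (h'.2.2 φ hφ hc))

lemma HasWeakPartial.congr (h : HasWeakPartial i f g) (e : f =ᵐ[volume] f')
    (e' : g =ᵐ[volume] g') : HasWeakPartial i f' g' := by
  refine ⟨h.1.congr e, h.2.1.congr e', fun φ hφ hc => ?_⟩
  rw [← integral_congr_ae (f := fun x => fderiv ℝ φ x (EuclideanSpace.single i 1) • f x)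
    (by filter_upwards [e] with x hx; rw [hx]), h.2.2 φ hφ hc]
  congr 1
  exact integral_congr_ae (by filter_upwards [e'] with x hx; simp only [hx])

lemma HasWeakPartial.weakPartial_eq (h : HasWeakPartial i f g) : weakPartial i f =ᵐ[volume] g :=
  (weakPartial_spec ⟨g, h⟩).unique h

lemma weakPartial_congr (e : f =ᵐ[volume] f') : weakPartial i f =ᵐ[volume] weakPartial i f' := by
  by_cases h : ∃ g, HasWeakPartial i f g
  · exact (weakPartial_spec h).unique ((weakPartial_spec ⟨_, (weakPartial_spec h).congr e
      (ae_eq_refl _)⟩).congr e.symm (ae_eq_refl _))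
  -- Weak differentiability depends only on the class modulo null sets, so if it fails for one
  -- function it fails for the other and both sides take the default value 0.
  · have h' : ¬ ∃ g, HasWeakPartial i f' g := fun ⟨g, hg⟩ => h ⟨g, hg.congr e.symm (ae_eq_refl _)⟩
    rw [weakPartial, dif_neg h, weakPartial, dif_neg h']

lemma HasWeakPartial.sub_const (h : HasWeakPartial i f g) (c : Space) :
    HasWeakPartial i (fun x => f x - c) g := by
  refine ⟨h.1.sub (locallyIntegrable_const c), h.2.1, fun φ hφ hc => ?_⟩
  rw [← h.2.2 φ hφ hc]
  have c1 : Continuous fun x => fderiv ℝ φ x (EuclideanSpace.single i 1) :=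
    pd_continuous (hφ.of_le (by simp))
  have s1 : HasCompactSupport fun x => fderiv ℝ φ x (EuclideanSpace.single i 1) :=
    pd_hasCompactSupport hc
  have i1 : Integrable fun x => fderiv ℝ φ x (EuclideanSpace.single i 1) • f x :=
    h.1.integrable_smul_left_of_hasCompactSupport c1 s1
  have i2 : Integrable fun x => fderiv ℝ φ x (EuclideanSpace.single i 1) • c :=
    (c1.integrable_of_hasCompactSupport s1).smul_const c
  simp only [smul_sub]
  rw [integral_sub i1 i2, integral_smul_const]
  have := integral_pd_eq_zero i (hφ.of_le (by simp)) hc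
  unfold pd at this
  rw [this]; simp

lemma weakPartial_sub_const (c : Space) :
    weakPartial i (fun x => f x - c) =ᵐ[volume] weakPartial i f := by
  by_cases h : ∃ g, HasWeakPartial i f g
  · exact ((weakPartial_spec h).sub_const c).weakPartial_eq
  · have h' : ¬ ∃ g, HasWeakPartial i (fun x => f x - c) g := fun ⟨g, hg⟩ => h ⟨g, by
      simpa using hg.sub_const (-c)⟩
    rw [weakPartial, dif_neg h', weakPartial, dif_neg h]

end Weak

/-! ### Mollification -/

section Mollify

/-- The convolution of `f` with the kernel `ρ`. -/
noncomputable def moll (ρ : Plane → ℝ) (f : Plane → Space) (x : Plane) : Space :=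
  ∫ t, ρ (x - t) • f t

variable {ρ : Plane → ℝ} {f g : Plane → Space} {i : Fin 2}

lemma moll_eq_convolution : moll ρ f =
    MeasureTheory.convolution f ρ (ContinuousLinearMap.lsmul ℝ ℝ).flip volume := by
  ext1 x; rfl

lemma moll_eq (x : Plane) : moll ρ f x = ∫ y, ρ y • f (x - y) := by
  rw [moll, ← integral_sub_left_eq_self _ volume x]
  simp

lemma moll_contDiff (hρ : ContDiff ℝ ∞ ρ) (hc : HasCompactSupport ρ)
    (hf : LocallyIntegrable f volume) : ContDiff ℝ ∞ (moll ρ f) := by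
  rw [moll_eq_convolution]
  exact hc.contDiff_convolution_right _ hf hρ

lemma pd_moll (hρ : ContDiff ℝ ∞ ρ) (hc : HasCompactSupport ρ) (hf : HasWeakPartial i f g) :
    pd i (moll ρ f) = moll ρ g := by
  ext1 x
  have h := hc.hasFDerivAt_convolution_right (μ := volume) (ContinuousLinearMap.lsmul ℝ ℝ).flip hf.1
    (hρ.of_le (by simp)) x
  have hd : pd i (moll ρ f) x = ∫ t, pd i ρ (x - t) • f t := by
    unfold pd
    rw [moll_eq_convolution, h.fderiv, convolution_precompR_apply _ hf.1 (hc.fderiv ℝ)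
      (hρ.continuous_fderiv (by simp))]
    rfl
  have hw := hf.2.2 (fun t => ρ (x - t)) (hρ.comp (contDiff_const.sub contDiff_id))
    (reflect_compact hc x)
  have e : ∀ t, fderiv ℝ (fun t => ρ (x - t)) t (EuclideanSpace.single i 1) = - pd i ρ (x - t) := by
    intro t
    have h : HasFDerivAt (fun y => ρ (x - y)) _ t :=
      (hρ.differentiable (by simp) (x - t)).hasFDerivAt.comp t ((hasFDerivAt_id t).const_sub x)
    rw [h.fderiv]; simp [pd]
  simp only [e, neg_smul, integral_neg] at hw
  rw [hd, neg_injective hw]; rfl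

lemma moll_congr {f' : Plane → Space} (h : f =ᵐ[volume] f') : moll ρ f = moll ρ f' := by
  ext1 x
  exact integral_congr_ae (by filter_upwards [h] with t ht; rw [ht])

/-- The kernel is a probability density, so the square of the average of f(x-y) - f(x) is at most
the average of the square: L¹ norms are dominated by L² norms on a probability space. -/
lemma enorm_moll_sub_le (hρ : Continuous ρ) (hc : HasCompactSupport ρ) (h0 : ∀ y, 0 ≤ ρ y)
    (h1 : ∫ y, ρ y = 1) (hf : LocallyIntegrable f volume) (hm : StronglyMeasurable f) (x : Plane) :
    ‖moll ρ f x - f x‖ₑ ^ 2 ≤ ∫⁻ y, ENNReal.ofReal (ρ y) * ‖f (x - y) - f x‖ₑ ^ 2 := by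
  have hρi : Integrable ρ := hρ.integrable_of_hasCompactSupport hc
  have i0 : Integrable fun t => ρ (x - t) • f t :=
    hf.integrable_smul_left_of_hasCompactSupport (hρ.comp (by fun_prop)) (reflect_compact hc x)
  have i1 : Integrable fun y => ρ y • f (x - y) := by
    have := i0.comp_sub_left x
    simpa using this
  have e : moll ρ f x - f x = ∫ y, ρ y • (f (x - y) - f x) := by
    simp only [smul_sub]
    rw [integral_sub i1 (hρi.smul_const _), integral_smul_const, h1, one_smul, moll_eq]
  have l1 : ∫⁻ y, ENNReal.ofReal (ρ y) = 1 := by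
    rw [← ofReal_integral_eq_lintegral_ofReal hρi (.of_forall h0), h1, ENNReal.ofReal_one]
  have km : Measurable fun y => ENNReal.ofReal (ρ y) := hρ.measurable.ennreal_ofReal
  let ν := (volume : Measure Plane).withDensity fun y => ENNReal.ofReal (ρ y)
  have hν : IsProbabilityMeasure ν := ⟨by
    rw [withDensity_apply _ MeasurableSet.univ, Measure.restrict_univ, l1]⟩
  have hm' : StronglyMeasurable fun y => f (x - y) - f x :=
    (hm.comp_measurable (by fun_prop)).sub stronglyMeasurable_const
  have a1 : ‖moll ρ f x - f x‖ₑ ≤ eLpNorm (fun y => f (x - y) - f x) 1 ν := by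
    rw [e, eLpNorm_one_eq_lintegral_enorm,
      lintegral_withDensity_eq_lintegral_mul _ km hm'.enorm]
    refine (enorm_integral_le_lintegral_enorm _).trans (le_of_eq ?_)
    refine lintegral_congr fun y => ?_
    rw [Pi.mul_apply, enorm_smul, Real.enorm_of_nonneg (h0 y)]
  have a2 := a1.trans (eLpNorm_le_eLpNorm_of_exponent_le (show (1 : ℝ≥0∞) ≤ 2 by norm_num)
    hm'.aestronglyMeasurable)
  have a3 : eLpNorm (fun y => f (x - y) - f x) 2 ν ^ 2 =
      ∫⁻ y, ENNReal.ofReal (ρ y) * ‖f (x - y) - f x‖ₑ ^ 2 := by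
    have := eLpNorm_nnreal_pow_eq_lintegral (μ := ν) (f := fun y => f (x - y) - f x) (p := 2)
      (by norm_num)
    have h2 : ((2 : NNReal) : ℝ) = 2 := rfl
    simp only [h2, ENNReal.rpow_two] at this
    refine this.trans ?_
    rw [lintegral_withDensity_eq_lintegral_mul _ km (hm'.enorm.pow_const 2)]
    rfl
  rw [← a3]
  exact pow_le_pow_left' a2 2

/-- Integrate the pointwise Jensen bound in x and exchange the integrals: only translations by y in
the support of the kernel contribute. -/
lemma eLpNorm_moll_sub_le (hρ : Continuous ρ) (hc : HasCompactSupport ρ) (h0 : ∀ y, 0 ≤ ρ y)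
    (h1 : ∫ y, ρ y = 1) (hf : MemLp f 2 volume) {η : ℝ≥0∞}
    (hη : ∀ y, ρ y ≠ 0 → eLpNorm (fun x => f (x - y) - f x) 2 volume ≤ η) :
    eLpNorm (fun x => moll ρ f x - f x) 2 volume ≤ η := by
  -- Tonelli needs joint measurability of (x,y) ↦ f(x-y), which is immediate for a strongly
  -- measurable representative; neither the mollification nor the translation norms see the change.
  wlog hm : StronglyMeasurable f generalizing f
  · have e := hf.1.ae_eq_mk
    have := this (f := hf.1.mk f) ((memLp_congr_ae e).1 hf) (fun y hy => ?_) hf.1.stronglyMeasurable_mk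
    · rw [← moll_congr e] at this
      refine le_trans (le_of_eq (eLpNorm_congr_ae ?_)) this
      filter_upwards [e] with x hx
      rw [hx]
    · refine le_trans (le_of_eq (eLpNorm_congr_ae ?_)) (hη y hy)
      filter_upwards [e, (measurePreserving_sub_right volume y).quasiMeasurePreserving.ae_eq_comp e]
        with x hx hy
      simp only [Function.comp_apply] at hy
      rw [hx, hy]
  have hρi : Integrable ρ := hρ.integrable_of_hasCompactSupport hc
  have l1 : ∫⁻ y, ENNReal.ofReal (ρ y) = 1 := by
    rw [← ofReal_integral_eq_lintegral_ofReal hρi (.of_forall h0), h1, ENNReal.ofReal_one]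
  have sq : ∀ g : Plane → Space, eLpNorm g 2 volume ^ 2 = ∫⁻ x, ‖g x‖ₑ ^ 2 := fun g => by
    have := eLpNorm_nnreal_pow_eq_lintegral (μ := (volume : Measure Plane)) (f := g) (p := 2)
      (by norm_num)
    have h2 : ((2 : NNReal) : ℝ) = 2 := rfl
    simp only [h2, ENNReal.rpow_two] at this
    exact this
  have jm : Measurable fun z : Plane × Plane =>
      ENNReal.ofReal (ρ z.2) * ‖f (z.1 - z.2) - f z.1‖ₑ ^ 2 := by
    have m1 : StronglyMeasurable fun z : Plane × Plane => f (z.1 - z.2) - f z.1 :=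
      (hm.comp_measurable (by fun_prop)).sub (hm.comp_measurable measurable_fst)
    exact ((hρ.measurable.ennreal_ofReal).comp measurable_snd).mul (m1.enorm.pow_const 2)
  have key : eLpNorm (fun x => moll ρ f x - f x) 2 volume ^ 2 ≤ η ^ 2 := by
    rw [sq]
    calc ∫⁻ x, ‖moll ρ f x - f x‖ₑ ^ 2
        ≤ ∫⁻ x, ∫⁻ y, ENNReal.ofReal (ρ y) * ‖f (x - y) - f x‖ₑ ^ 2 :=
          lintegral_mono fun x =>
            enorm_moll_sub_le hρ hc h0 h1 (hf.locallyIntegrable (by norm_num)) hm x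
      _ = ∫⁻ y, ∫⁻ x, ENNReal.ofReal (ρ y) * ‖f (x - y) - f x‖ₑ ^ 2 :=
          lintegral_lintegral_swap jm.aemeasurable
      _ ≤ ∫⁻ y, ENNReal.ofReal (ρ y) * η ^ 2 := by
          refine lintegral_mono fun y => ?_
          rw [lintegral_const_mul' _ _ ENNReal.ofReal_ne_top]
          by_cases hy : ρ y = 0
          · simp [hy]
          · rw [← sq]
            exact mul_le_mul_right (pow_le_pow_left' (hη y hy) 2) _
      _ = η ^ 2 := by
          rw [lintegral_mul_const _ hρ.measurable.ennreal_ofReal, l1, one_mul]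
  exact (ENNReal.pow_le_pow_left_iff two_ne_zero).1 key

/-- A standard mollifier at scale `1 / (n + 1)`. -/
noncomputable def stdMoll (n : ℕ) : Plane → ℝ :=
  (⟨1 / (2 * ((n : ℝ) + 1)), 1 / ((n : ℝ) + 1), by positivity, by
    rw [div_lt_div_iff₀ (by positivity) (by positivity)]
    have : (0 : ℝ) < n + 1 := by positivity
    linarith⟩ : ContDiffBump (0 : Plane)).normed volume

lemma stdMoll_contDiff (n : ℕ) : ContDiff ℝ ∞ (stdMoll n) := ContDiffBump.contDiff_normed _
lemma stdMoll_compact (n : ℕ) : HasCompactSupport (stdMoll n) :=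
  ContDiffBump.hasCompactSupport_normed _
lemma stdMoll_nonneg (n : ℕ) (y : Plane) : 0 ≤ stdMoll n y := ContDiffBump.nonneg_normed _ _
lemma stdMoll_integral (n : ℕ) : ∫ y, stdMoll n y = 1 := ContDiffBump.integral_normed _
lemma stdMoll_support (n : ℕ) (y : Plane) (hy : stdMoll n y ≠ 0) : ‖y‖ ≤ 1 / ((n : ℝ) + 1) := by
  have : y ∈ Function.support (stdMoll n) := hy
  rw [stdMoll, ContDiffBump.support_normed_eq] at this
  rw [mem_ball_zero_iff] at this
  exact this.le

/-- Continuity of translations in L²: approximate f by a test function g and use the difference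
quotient bound for g. -/
lemma tendsto_translation (hf : MemLp f 2 volume) {η : ℝ} (hη : 0 < η) :
    ∃ δ > 0, ∀ y : Plane, ‖y‖ ≤ δ →
      eLpNorm (fun x => f (x - y) - f x) 2 volume ≤ ENNReal.ofReal η := by
  obtain ⟨g, hgc, hg, hfg⟩ := MemLp.exist_eLpNorm_sub_le (by simp) (by norm_num) hf
    (show 0 < η / 3 by positivity)
  have hg1 : ContDiff ℝ 1 g := hg.of_le (by simp)
  have gL : MemLp g 2 volume := hg.continuous.memLp_of_hasCompactSupport hgc
  -- A third of the error is spent on g itself, with translation constant √(2 gradSq g); the added 1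
  -- keeps the denominator positive when g has zero gradient. The other two thirds are the two
  -- copies of f - g.
  refine ⟨η / 3 / (√(2 * gradSq g) + 1), by positivity, fun y hy => ?_⟩
  have e : (fun x => f (x - y) - f x) = (fun x => (f - g) (x - y)) +
      (-(f - g) + fun x => -(g x - g (x - y))) := by
    ext1 x; simp only [Pi.add_apply, Pi.neg_apply, Pi.sub_apply]; abel
  have mp := measurePreserving_sub_right (volume : Measure Plane) y
  have m1 : AEStronglyMeasurable (fun x => (f - g) (x - y)) volume :=
    (hf.sub gL).1.comp_measurePreserving mp
  have m3 : AEStronglyMeasurable (fun x => -(g x - g (x - y))) volume :=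
    (diff_contDiff hg1 y).continuous.neg.aestronglyMeasurable
  have b1 : eLpNorm (fun x => (f - g) (x - y)) 2 volume ≤ ENNReal.ofReal (η / 3) :=
    (eLpNorm_comp_measurePreserving (hf.sub gL).1 mp).le.trans hfg
  have b3 : eLpNorm (fun x => -(g x - g (x - y))) 2 volume ≤ ENNReal.ofReal (η / 3) := by
    have hL : MemLp (fun x => g x - g (x - y)) 2 volume :=
      (diff_contDiff hg1 y).continuous.memLp_of_hasCompactSupport (diff_compact hgc y)
    have := eLpNorm_neg (f := fun x => g x - g (x - y)) (p := 2) (μ := (volume : Measure Plane))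
    refine this.le.trans ?_
    rw [eLpNorm_two_eq hL]
    refine ENNReal.ofReal_le_ofReal ((Real.sqrt_le_sqrt (translation_sq hg1 hgc y)).trans ?_)
    have ng := gradSq_nonneg g
    rw [mul_right_comm, Real.sqrt_mul (by positivity), Real.sqrt_sq (norm_nonneg _)]
    have hp : 0 < √(2 * gradSq g) + 1 := by positivity
    rw [le_div_iff₀ hp] at hy
    nlinarith [norm_nonneg y]
  rw [e]
  refine (eLpNorm_add_le m1 ((hf.sub gL).1.neg.add m3) (by norm_num)).trans ?_
  have b2 : eLpNorm (-(f - g)) 2 volume ≤ ENNReal.ofReal (η / 3) := by rwa [eLpNorm_neg]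
  refine (add_le_add b1 ((eLpNorm_add_le (hf.sub gL).1.neg m3 (by norm_num)).trans
    (add_le_add b2 b3))).trans (le_of_eq ?_)
  rw [← ENNReal.ofReal_add (by positivity) (by positivity),
    ← ENNReal.ofReal_add (by positivity) (by positivity)]
  congr 1; ring

lemma tl_moll (hf : MemLp f 2 volume) : TL 2 atTop (fun n => moll (stdMoll n) f) f := by
  have lim : Tendsto (fun n => eLpNorm (fun x => moll (stdMoll n) f x - f x) 2 volume) atTop
      (𝓝 0) := by
    rw [ENNReal.tendsto_nhds_zero]
    intro ε hε
    obtain ⟨η, h0, hη⟩ : ∃ η : ℝ, 0 < η ∧ ENNReal.ofReal η ≤ ε := by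
      by_cases h : ε = ⊤
      · exact ⟨1, one_pos, by simp [h]⟩
      · exact ⟨ε.toReal, ENNReal.toReal_pos hε.ne' h, by rw [ENNReal.ofReal_toReal h]⟩
    obtain ⟨δ, hδ, H⟩ := tendsto_translation hf h0
    filter_upwards [tendsto_one_div_add_atTop_nhds_zero_nat.eventually_le_const hδ] with n hn
    exact (eLpNorm_moll_sub_le (stdMoll_contDiff n).continuous (stdMoll_compact n)
      (stdMoll_nonneg n) (stdMoll_integral n) hf
      fun y hy => H y ((stdMoll_support n y hy).trans hn)).trans hη
  refine ⟨?_, hf, lim⟩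
  filter_upwards [lim.eventually_lt_const ENNReal.zero_lt_top] with n hn
  have hm : AEStronglyMeasurable (moll (stdMoll n) f) volume :=
    (moll_contDiff (stdMoll_contDiff n) (stdMoll_compact n)
      (hf.locallyIntegrable (by norm_num))).continuous.aestronglyMeasurable
  have h : MemLp (fun x => moll (stdMoll n) f x - f x) 2 volume := ⟨hm.sub hf.1, hn⟩
  have e : (fun x => moll (stdMoll n) f x - f x) + f = moll (stdMoll n) f := by ext1 x; simp
  exact e ▸ h.add hf

end Mollify
end LLHelicity

namespace LLHelicity
set_option linter.unusedSectionVars false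

/-! ### Density of test functions in `H²` -/

section Density

lemma TL.integral_normSq {ι : Type*} {l : Filter ι} {A : ι → Plane → Space} {f : Plane → Space}
    (h : TL 2 l A f) : Tendsto (fun n => ∫ x, ‖A n x‖ ^ 2) l (𝓝 (∫ x, ‖f x‖ ^ 2)) := by
  have := (h.bilin (r := 1) le_rfl innerB h).integral
  simpa only [innerB_apply, real_inner_self_eq_norm_sq] using this

lemma TL.normSq {ι : Type*} {l : Filter ι} {A : ι → Plane → Space} {f : Plane → Space}
    (h : TL 4 l A f) : TL 2 l (fun n x => ‖A n x‖ ^ 2) (fun x => ‖f x‖ ^ 2) := by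
  have := TL.bilin (p := lp 1) (q := lp 1) (r := lp (1 + 1)) (one_le_lp (by norm_num)) innerB
    (lp_one ▸ h) (lp_one ▸ h)
  rw [show lp (1 + 1) = 2 from lp_two] at this
  simpa only [innerB_apply, real_inner_self_eq_norm_sq] using this

lemma TL.integral_norm_pow_four {ι : Type*} {l : Filter ι} {A : ι → Plane → Space}
    {f : Plane → Space} (h : TL 4 l A f) :
    Tendsto (fun n => ∫ x, ‖A n x‖ ^ 4) l (𝓝 (∫ x, ‖f x‖ ^ 4)) := by
  have := (h.normSq.bilin (r := 1) le_rfl (ContinuousLinearMap.mul ℝ ℝ) h.normSq).integral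
  simpa only [ContinuousLinearMap.mul_apply', ← pow_add] using this

/-- Split χh - f into χ(h - f), controlled since 0 ≤ χ ≤ 1, and χf - f, which tends to zero by
dominated convergence. -/
lemma TL.cutoff {h : ℕ → Plane → Space} {f : Plane → Space} (H : TL 2 atTop h f)
    {χ : ℕ → Plane → ℝ} (hχ : ∀ n, Continuous (χ n)) (h01 : ∀ n x, 0 ≤ χ n x ∧ χ n x ≤ 1)
    (h1 : ∀ (n : ℕ) x, ‖x‖ ≤ (n : ℝ) + 1 → χ n x = 1) :
    TL 2 atTop (fun n x => χ n x • h n x) f := by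
  have mf : ∀ n, ∀ {g : Plane → Space}, MemLp g 2 volume → MemLp (fun x => χ n x • g x) 2 volume :=
    fun n g hg => hg.of_le ((hχ n).aestronglyMeasurable.smul hg.1) <| ae_of_all _ fun x => by
      rw [norm_smul, Real.norm_of_nonneg (h01 n x).1]
      exact mul_le_of_le_one_left (norm_nonneg _) (h01 n x).2
  refine ⟨H.memF.mono fun n hn => mf n hn, H.mem, ?_⟩
  have t1 : Tendsto (fun n => eLpNorm (fun x => χ n x • f x - f x) 2 volume) atTop (𝓝 0) := by
    have e : ∀ n, eLpNorm (fun x => χ n x • f x - f x) 2 volume =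
        ENNReal.ofReal √(∫ x, ‖χ n x • f x - f x‖ ^ 2) := fun n => eLpNorm_two_eq ((mf n H.mem).sub H.mem)
    simp only [e]
    have t : Tendsto (fun n => ∫ x, ‖χ n x • f x - f x‖ ^ 2) atTop (𝓝 (∫ x : Plane, (0 : ℝ))) := by
      refine tendsto_integral_of_dominated_convergence (fun x => ‖f x‖ ^ 2)
        (fun n => (((mf n H.mem).sub H.mem).1.norm.pow 2)) H.mem.norm.integrable_sq
        (fun n => ae_of_all _ fun x => ?_) (ae_of_all _ fun x => ?_)
      · have : χ n x • f x - f x = (χ n x - 1) • f x := by rw [sub_smul, one_smul]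
        rw [this, norm_smul, Real.norm_of_nonneg (by positivity), mul_pow, Real.norm_eq_abs, sq_abs]
        have := h01 n x
        exact mul_le_of_le_one_left (by positivity) (by nlinarith)
      · obtain ⟨N, hN⟩ := exists_nat_ge ‖x‖
        refine tendsto_const_nhds.congr' ?_
        filter_upwards [eventually_ge_atTop N] with n hn
        have : (N : ℝ) ≤ n := by exact_mod_cast hn
        rw [h1 n x (by linarith)]; simp
    have := (ENNReal.continuous_ofReal.tendsto _).comp ((Real.continuous_sqrt.tendsto _).comp t)
    simpa [Function.comp_def] using this
  have t2 := H.lim.add t1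
  rw [add_zero] at t2
  refine tendsto_of_tendsto_of_tendsto_of_le_of_le' tendsto_const_nhds t2
    (Eventually.of_forall fun _ => zero_le) ?_
  filter_upwards [H.memF] with n hn
  have e : (fun x => χ n x • h n x - f x) = (fun x => χ n x • (h n x - f x)) +
      fun x => χ n x • f x - f x := by
    ext1 x; simp only [Pi.add_apply, smul_sub]; abel
  rw [e]
  refine (eLpNorm_add_le (mf n (hn.sub H.mem)).1 ((mf n H.mem).sub H.mem).1 (by norm_num)).trans
    (add_le_add_left (eLpNorm_mono fun x => ?_) _)
  rw [norm_smul, Real.norm_of_nonneg (h01 n x).1]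
  exact mul_le_of_le_one_left (norm_nonneg _) (h01 n x).2

/-- For the terms of the product rule in which a derivative falls on the cut-off function. -/
lemma TL.small {h : ℕ → Plane → Space} {f : Plane → Space} (H : TL 2 atTop h f)
    {c : ℕ → Plane → ℝ} (hc : ∀ n, Continuous (c n)) {C : ℝ}
    (hC : ∀ (n : ℕ) x, |c n x| ≤ C / ((n : ℝ) + 1)) :
    TL 2 atTop (fun n x => c n x • h n x) (fun _ => (0 : Space)) := by
  have C0 : 0 ≤ C := by
    have := (abs_nonneg _).trans (hC 0 0); simpa using this
  have bd : ∀ n, eLpNorm (fun x => c n x • h n x) 2 volume ≤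
      ENNReal.ofReal (C / ((n : ℝ) + 1)) * eLpNorm (h n) 2 volume := fun n => by
    have : 0 ≤ C / ((n : ℝ) + 1) := by positivity
    have := eLpNorm_le_mul_eLpNorm_of_ae_le_mul (f := fun x => c n x • h n x) (g := h n)
      (μ := (volume : Measure Plane)) (c := C / ((n : ℝ) + 1)) (ae_of_all _ fun x => by
        rw [norm_smul]; exact mul_le_mul_of_nonneg_right (hC n x) (norm_nonneg _)) 2
    exact this
  refine ⟨H.memF.mono fun n hn => ⟨(hc n).aestronglyMeasurable.smul hn.1,
    (bd n).trans_lt (ENNReal.mul_lt_top ENNReal.ofReal_lt_top hn.2)⟩, by simp, ?_⟩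
  have t1 : Tendsto (fun n : ℕ => ENNReal.ofReal (C / ((n : ℝ) + 1))) atTop (𝓝 0) := by
    have : Tendsto (fun n : ℕ => C * (1 / ((n : ℝ) + 1))) atTop (𝓝 (C * 0)) :=
      tendsto_one_div_add_atTop_nhds_zero_nat.const_mul C
    rw [mul_zero] at this
    simpa [Function.comp_def, div_eq_mul_inv] using (ENNReal.continuous_ofReal.tendsto 0).comp this
  have t2 := ENNReal.Tendsto.mul t1 (Or.inr H.mem.2.ne) (H.tendsto_eLpNorm (by norm_num))
    (Or.inr ENNReal.zero_ne_top)
  rw [zero_mul] at t2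
  refine tendsto_of_tendsto_of_tendsto_of_le_of_le tendsto_const_nhds t2
    (fun _ => zero_le) fun n => ?_
  simpa using bd n

/-- Convergence in `L^p` of a sequence which is Cauchy in `L^q` is convergence in `L^q`. -/
lemma TL.upgrade {p q : ℝ≥0∞} (hp : p ≠ 0) {A : ℕ → Plane → Space} {f : Plane → Space}
    (h : TL p atTop A f) (hA : ∀ n, MemLp (A n) q volume)
    (hc : Tendsto (fun n : ℕ × ℕ => eLpNorm (fun x => A n.1 x - A n.2 x) q volume)
      (atTop ×ˢ atTop) (𝓝 0)) : TL q atTop A f := by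
  obtain ⟨ns, hns, hae⟩ := (tendstoInMeasure_of_tendsto_eLpNorm hp (fun n => (hA n).1) h.mem.1
    h.lim).exists_seq_tendsto_ae
  have key : ∀ ε : ℝ≥0∞, 0 < ε → ∀ᶠ n in atTop, eLpNorm (fun x => A n x - f x) q volume ≤ ε := by
    intro ε hε
    have := (ENNReal.tendsto_nhds_zero.1 hc ε hε)
    rw [prod_atTop_atTop_eq, eventually_atTop] at this
    obtain ⟨⟨N, N'⟩, hN⟩ := this
    filter_upwards [eventually_ge_atTop N] with n hn
    -- Fatou's lemma along a subsequence converging almost everywhere: the distance of A n to the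
    -- limit is at most the lower limit of its distances to later members of the sequence.
    refine (Lp.eLpNorm_lim_le_liminf_eLpNorm (f := fun k x => A n x - A (ns k) x)
      (fun k => ((hA n).sub (hA _)).1) _ ?_).trans ?_
    · filter_upwards [hae] with x hx
      exact tendsto_const_nhds.sub hx
    · refine liminf_le_of_le (by isBoundedDefault) fun b hb => ?_
      obtain ⟨k, h1, h2⟩ := (hb.and (hns.tendsto_atTop.eventually_ge_atTop N')).exists
      exact h1.trans (hN (n, ns k) ⟨hn, h2⟩)
  have lim : Tendsto (fun n => eLpNorm (fun x => A n x - f x) q volume) atTop (𝓝 0) :=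
    ENNReal.tendsto_nhds_zero.2 key
  refine ⟨Eventually.of_forall hA, ?_, lim⟩
  obtain ⟨n, hn⟩ := (lim.eventually_lt_const ENNReal.zero_lt_top).exists
  have m : MemLp (fun x => A n x - f x) q volume := ⟨(hA n).1.sub h.mem.1, hn⟩
  have := (hA n).sub m
  have e : A n - (fun x => A n x - f x) = f := by ext1 x; simp
  exact e ▸ this

lemma abs_integral_inner_le {f g : Plane → Space} (hf : MemLp f 2 volume)
    (hg : MemLp g 2 volume) :
    |∫ x, inner ℝ (f x) (g x)| ≤ √(∫ x, ‖f x‖ ^ 2) * √(∫ x, ‖g x‖ ^ 2) := by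
  have e := integral_mul_le_sqrt hf.norm hg.norm
  simp only [abs_norm] at e
  refine le_trans (abs_integral_le_integral_abs.trans (integral_mono_of_nonneg
    (ae_of_all _ fun x => abs_nonneg _) (hf.norm.integrable_mul hg.norm)
    (ae_of_all _ fun x => abs_real_inner_le_norm _ _))) e

/-- A sequence of test functions converging to `f` in `H²`, with derivatives `D` and `H`. -/
structure H2Approx (f : Plane → Space) (D : Fin 2 → Plane → Space)
    (H : Fin 2 → Fin 2 → Plane → Space) (φ : ℕ → Plane → Space) : Prop where
  smooth : ∀ n, ContDiff ℝ ∞ (φ n)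
  compact : ∀ n, HasCompactSupport (φ n)
  tl : TL 2 atTop φ f
  tl_pd : ∀ i, TL 2 atTop (fun n => pd i (φ n)) (D i)
  tl_pd_pd : ∀ i j, TL 2 atTop (fun n => pd i (pd j (φ n))) (H i j)

variable {f : Plane → Space} {D : Fin 2 → Plane → Space}
  {H : Fin 2 → Fin 2 → Plane → Space} {φ : ℕ → Plane → Space}

lemma pd_smul (i : Fin 2) {c : Plane → ℝ} {h : Plane → Space} (hc : Differentiable ℝ c)
    (hh : Differentiable ℝ h) (x : Plane) :
    pd i (fun x => c x • h x) x = pd i c x • h x + c x • pd i h x := by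
  have := pd_bilin i (ContinuousLinearMap.lsmul ℝ ℝ : ℝ →L[ℝ] Space →L[ℝ] Space) hc hh x
  simpa [add_comm] using this

/-- Mollify, then cut off. Mollification commutes with weak derivatives, so all derivatives up to
order two converge in L²; the terms in which the cut-off is differentiated vanish in the limit. -/
lemma exists_h2Approx_of_weak {f : Plane → Space} {D : Fin 2 → Plane → Space}
    {H : Fin 2 → Fin 2 → Plane → Space} (h0 : MemLp f 2 volume) (h1 : ∀ i, MemLp (D i) 2 volume)
    (h2 : ∀ i j, MemLp (H i j) 2 volume) (w1 : ∀ i, HasWeakPartial i f (D i))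
    (w2 : ∀ i j, HasWeakPartial i (D j) (H i j)) : ∃ φ, H2Approx f D H φ := by
  obtain ⟨χ, C, cs, cc, c01, c1, cd, cdd⟩ := exists_cutoff
  set m : ℕ → Plane → Space := fun n => moll (stdMoll n) f with hm
  have ms : ∀ n, ContDiff ℝ ∞ (m n) := fun n => moll_contDiff (stdMoll_contDiff n)
    (stdMoll_compact n) (h0.locallyIntegrable (by norm_num))
  have md : ∀ n i, pd i (m n) = moll (stdMoll n) (D i) := fun n i =>
    pd_moll (stdMoll_contDiff n) (stdMoll_compact n) (w1 i)
  have mdd : ∀ n i j, pd i (pd j (m n)) = moll (stdMoll n) (H i j) := fun n i j => by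
    rw [md, pd_moll (stdMoll_contDiff n) (stdMoll_compact n) (w2 i j)]
  have T0 : TL 2 atTop m f := tl_moll h0
  have T1 : ∀ i, TL 2 atTop (fun n => pd i (m n)) (D i) := fun i => by
    simp only [md]; exact tl_moll (h1 i)
  have T2 : ∀ i j, TL 2 atTop (fun n => pd i (pd j (m n))) (H i j) := fun i j => by
    simp only [mdd]; exact tl_moll (h2 i j)
  have df : ∀ {F : Type} [NormedAddCommGroup F] [NormedSpace ℝ F] {g : Plane → F}, ContDiff ℝ ∞ g →
      Differentiable ℝ g := fun h => h.differentiable (by simp)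
  have e1 : ∀ n i, pd i (fun x => χ n x • m n x) =
      fun x => pd i (χ n) x • m n x + χ n x • pd i (m n) x := fun n i =>
    funext fun x => pd_smul i (df (cs n)) (df (ms n)) x
  have e2 : ∀ n i j, pd i (pd j (fun x => χ n x • m n x)) =
      fun x => (pd i (pd j (χ n)) x • m n x + pd j (χ n) x • pd i (m n) x) +
        (pd i (χ n) x • pd j (m n) x + χ n x • pd i (pd j (m n)) x) := fun n i j => by
    rw [e1]
    ext1 x
    have d1 := df (pd_contDiff (i := j) (cs n))
    have d2 := df (pd_contDiff (i := j) (ms n))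
    rw [pd_add i (f := fun x => pd j (χ n) x • m n x) (g := fun x => χ n x • pd j (m n) x)
      (d1.smul (df (ms n))) ((df (cs n)).smul d2), pd_smul i d1 (df (ms n)), pd_smul i (df (cs n)) d2]
  have k1 : ∀ i n, Continuous (pd i (χ n)) := fun i n => (pd_contDiff (cs n)).continuous
  have k2 : ∀ i j n, Continuous (pd i (pd j (χ n))) := fun i j n =>
    (pd_contDiff (pd_contDiff (cs n))).continuous
  refine ⟨fun n x => χ n x • m n x, fun n => (cs n).smul (ms n),
    fun n => (cc n).smul_right, T0.cutoff (fun n => (cs n).continuous) c01 c1,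
    fun i => ?_, fun i j => ?_⟩
  · simp only [e1]
    have := (T0.small (k1 i) (cd i)).add (by norm_num) ((T1 i).cutoff (fun n => (cs n).continuous) c01 c1)
    simpa using this
  · simp only [e2]
    have := ((T0.small (k2 i j) (cdd i j)).add (by norm_num) ((T1 i).small (k1 j) (cd j))).add
      (by norm_num) (((T1 j).small (k1 i) (cd i)).add (by norm_num)
        ((T2 i j).cutoff (fun n => (cs n).continuous) c01 c1))
    simpa using this

lemma pd_comm (i j : Fin 2) {f : Plane → Space} (hf : ContDiff ℝ ∞ f) :
    pd i (pd j f) = pd j (pd i f) := by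
  ext1 x
  have hd : DifferentiableAt ℝ (fderiv ℝ f) x :=
    (contDiff_infty_iff_fderiv.1 hf).2.differentiable (by simp) x
  have key : ∀ k l : Fin 2, pd k (pd l f) x =
      fderiv ℝ (fderiv ℝ f) x (EuclideanSpace.single k 1) (EuclideanSpace.single l 1) :=
    fun k l => by
      unfold pd
      rw [fderiv_clm_apply hd (differentiableAt_const _)]
      simp
  rw [key, key]
  exact (hf.contDiffAt.isSymmSndFDerivAt
    (by simpa using (mod_cast le_top : ((2 : ℕ∞) : WithTop ℕ∞) ≤ ((⊤ : ℕ∞) : WithTop ℕ∞)))).eq _ _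

namespace H2Approx

variable (h : H2Approx f D H φ)
include h

lemma tl_zero : TL 2 (atTop ×ˢ atTop) (fun n : ℕ × ℕ => fun x => φ n.1 x - φ n.2 x)
    (fun _ => (0 : Space)) := by
  simpa using (h.tl.comp tendsto_fst).sub (by norm_num) (h.tl.comp tendsto_snd)

lemma pd_sub (i : Fin 2) (n : ℕ × ℕ) :
    pd i (fun x => φ n.1 x - φ n.2 x) = fun x => pd i (φ n.1) x - pd i (φ n.2) x := by
  ext1 x
  simp only [pd]
  rw [fderiv_fun_sub ((h.smooth _).differentiable (by simp) x)
    ((h.smooth _).differentiable (by simp) x), sub_apply]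

lemma pd_pd_sub (i j : Fin 2) (n : ℕ × ℕ) :
    pd i (fun x => pd j (φ n.1) x - pd j (φ n.2) x) =
      fun x => pd i (pd j (φ n.1)) x - pd i (pd j (φ n.2)) x := by
  ext1 x
  simp only [pd.eq_def i]
  rw [fderiv_fun_sub ((pd_contDiff (h.smooth _)).differentiable (by simp) x)
    ((pd_contDiff (h.smooth _)).differentiable (by simp) x), sub_apply]

lemma tl_pd_zero (i : Fin 2) : TL 2 (atTop ×ˢ atTop)
    (fun n : ℕ × ℕ => fun x => pd i (φ n.1) x - pd i (φ n.2) x) (fun _ => (0 : Space)) := by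
  simpa using ((h.tl_pd i).comp tendsto_fst).sub (by norm_num) ((h.tl_pd i).comp tendsto_snd)

lemma tl_pd_pd_zero (i j : Fin 2) : TL 2 (atTop ×ˢ atTop)
    (fun n : ℕ × ℕ => fun x => pd i (pd j (φ n.1)) x - pd i (pd j (φ n.2)) x)
    (fun _ => (0 : Space)) := by
  simpa using ((h.tl_pd_pd i j).comp tendsto_fst).sub (by norm_num)
    ((h.tl_pd_pd i j).comp tendsto_snd)

/-- Ladyzhenskaya's inequality for differences of members of the sequence: their first derivatives
tend to zero in L² and so do their second ones, hence the gradients are Cauchy in L⁴. -/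
lemma tl_pd_four (i : Fin 2) : TL 4 atTop (fun n => pd i (φ n)) (D i) := by
  have s : ∀ n, ContDiff ℝ ∞ (pd i (φ n)) := fun n => pd_contDiff (h.smooth n)
  have c : ∀ n, HasCompactSupport (pd i (φ n)) := fun n => pd_hasCompactSupport (h.compact n)
  refine (h.tl_pd i).upgrade two_ne_zero (fun n =>
    (s n).continuous.memLp_of_hasCompactSupport (c n)) ?_
  obtain ⟨C, hC, L⟩ := ladyzhenskaya
  have t1 := (h.tl_pd_zero i).integral_normSq
  have t2 := tendsto_finsetSum Finset.univ fun k (_ : k ∈ Finset.univ) =>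
    (h.tl_pd_pd_zero k i).integral_normSq
  have t3 := (t1.const_mul C).mul t2
  have t4 := ((ENNReal.continuous_ofReal.tendsto _).comp ((Real.continuousAt_rpow_const _ (1 / 4)
    (Or.inr (by norm_num))).tendsto.comp t3))
  simp only [norm_zero, ne_eq, OfNat.ofNat_ne_zero, not_false_eq_true, zero_pow, integral_zero,
    mul_zero, Finset.sum_const_zero] at t4
  rw [Real.zero_rpow (by norm_num), ENNReal.ofReal_zero] at t4
  refine tendsto_of_tendsto_of_tendsto_of_le_of_le tendsto_const_nhds t4 (fun _ => zero_le)
    fun n => ?_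
  have sn : ContDiff ℝ ∞ (fun x => pd i (φ n.1) x - pd i (φ n.2) x) := (s _).sub (s _)
  have cn : HasCompactSupport (fun x => pd i (φ n.1) x - pd i (φ n.2) x) :=
    (c n.1).sub (c n.2)
  have m4 : MemLp (fun x => pd i (φ n.1) x - pd i (φ n.2) x) 4 volume :=
    sn.continuous.memLp_of_hasCompactSupport cn
  have := L _ (sn.of_le (by simp)) cn
  simp only [gradSq, l2Sq, h.pd_pd_sub] at this
  rw [m4.eLpNorm_eq_integral_rpow_norm (by simp) (by simp)]
  refine ENNReal.ofReal_le_ofReal ?_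
  have e4 : (4 : ℝ≥0∞).toReal = 4 := by simp
  simp only [e4, ← one_div]
  refine Real.rpow_le_rpow (by positivity) ?_ (by norm_num)
  refine le_trans (le_of_eq ?_) this
  refine integral_congr_ae (ae_of_all _ fun x => ?_)
  exact_mod_cast rfl

/-- The sup bound `agmon` for differences of members of the sequence, all of whose derivatives up to
order two tend to zero in L². -/
lemma tl_top : TL ⊤ atTop φ f := by
  refine h.tl.upgrade two_ne_zero (fun n =>
    (h.smooth n).continuous.memLp_of_hasCompactSupport (h.compact n)) ?_
  have t0 := h.tl_zero.integral_normSq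
  have t1 := fun i => (h.tl_pd_zero i).integral_normSq
  have t2 := (h.tl_pd_pd_zero 0 1).integral_normSq
  have sq := fun {l : Filter (ℕ × ℕ)} {f : ℕ × ℕ → ℝ} {a : ℝ} (h : Tendsto f l (𝓝 a)) =>
    (Real.continuous_sqrt.tendsto _).comp h
  have t := sq ((((sq (t1 0)).mul (sq (t1 1))).add ((sq t0).mul (sq t2))).const_mul 2)
  have t4 := (ENNReal.continuous_ofReal.tendsto _).comp t
  simp only [norm_zero, ne_eq, OfNat.ofNat_ne_zero, not_false_eq_true, zero_pow, integral_zero,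
    mul_zero, Real.sqrt_zero, add_zero, ENNReal.ofReal_zero] at t4
  refine tendsto_of_tendsto_of_tendsto_of_le_of_le tendsto_const_nhds t4 (fun _ => zero_le)
    fun n => ?_
  have ag := agmon (f := fun x => φ n.1 x - φ n.2 x) ((h.smooth n.1).sub (h.smooth n.2))
    ((h.compact n.1).sub (h.compact n.2))
  simp only [l2Sq, h.pd_sub, h.pd_pd_sub] at ag
  rw [eLpNorm_exponent_top]
  refine eLpNormEssSup_le_of_ae_bound (ae_of_all _ fun x => ?_)
  exact Real.le_sqrt_of_sq_le (ag x)

lemma contDiff_one (n : ℕ) : ContDiff ℝ 1 (φ n) := (h.smooth n).of_le (by simp)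

lemma W_zero (i : Fin 2) : W i 0 f (D i) := by
  refine ⟨φ, h.contDiff_one, lp_zero ▸ h.tl_top, ?_⟩
  rw [show lp (0 + 1) = 4 from lp_one]
  exact h.tl_pd_four i

lemma W_one (i j : Fin 2) : W i 1 (D j) (H i j) := by
  refine ⟨fun n => pd j (φ n), fun n => (pd_contDiff (h.smooth n)).of_le (by simp), ?_, ?_⟩
  · rw [lp_one]; exact h.tl_pd_four j
  · rw [show lp (1 + 1) = 2 from lp_two]
    exact h.tl_pd_pd i j

lemma symm (i j : Fin 2) : H i j =ᵐ[volume] H j i := by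
  have e : ∀ n, pd i (pd j (φ n)) = pd j (pd i (φ n)) := fun n => pd_comm i j (h.smooth n)
  have t1 := h.tl_pd_pd i j
  have t2 := h.tl_pd_pd j i
  rw [show (fun n => pd i (pd j (φ n))) = fun n => pd j (pd i (φ n)) from funext e] at t1
  have := (t1.sub (by norm_num) t2).lim
  simp only [sub_self, zero_sub] at this
  have z := tendsto_nhds_unique tendsto_const_nhds this
  rw [eLpNorm_eq_zero_iff (f := fun x => -(H i j x - H j i x)) (t1.mem.sub t2.mem).1.neg (by norm_num)] at z
  filter_upwards [z] with x hx
  exact sub_eq_zero.1 (neg_eq_zero.1 hx)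

/-- Integrate |D|² by parts once. It lets L² convergence of maps together with an H² bound give L²
convergence of their gradients. -/
lemma interpolation (i : Fin 2) :
    ∫ x, ‖D i x‖ ^ 2 ≤ √(∫ x, ‖f x‖ ^ 2) * √(∫ x, ‖H i i x‖ ^ 2) := by
  have m2 : ∀ {g : Plane → Space}, MemLp g 2 volume → MemLp g (lp 2) volume := fun h => by rwa [lp_two]
  have := W.ibp (i := i) innerB (h.W_zero i) (h.W_one i i) (m2 h.tl.mem)
    (m2 (h.tl_pd i).mem) (m2 (h.tl_pd i).mem) (m2 (h.tl_pd_pd i i).mem)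
  simp only [innerB_apply, real_inner_self_eq_norm_sq] at this
  rw [this]
  exact (neg_le_abs _).trans (abs_integral_inner_le h.tl.mem (h.tl_pd_pd i i).mem)

end H2Approx

/-- Ladyzhenskaya's inequality for a gradient. -/
lemma ladyzhenskaya_h2 : ∃ C : ℝ, 0 ≤ C ∧ ∀ (f : Plane → Space) (D : Fin 2 → Plane → Space)
    (H : Fin 2 → Fin 2 → Plane → Space) (φ : ℕ → Plane → Space), H2Approx f D H φ → ∀ i,
    ∫ x, ‖D i x‖ ^ 4 ≤ C * (∫ x, ‖D i x‖ ^ 2) * ∑ k, ∫ x, ‖H k i x‖ ^ 2 := by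
  obtain ⟨C, hC, L⟩ := ladyzhenskaya
  refine ⟨C, hC, fun f D H φ h i => ?_⟩
  refine le_of_tendsto_of_tendsto' (h.tl_pd_four i).integral_norm_pow_four
    (((h.tl_pd i).integral_normSq.const_mul C).mul
      (tendsto_finsetSum Finset.univ fun k _ => (h.tl_pd_pd k i).integral_normSq)) fun n => ?_
  exact L _ ((pd_contDiff (h.smooth n)).of_le (by simp)) (pd_hasCompactSupport (h.compact n))

/-- The logarithmic Sobolev embedding of Brezis and Gallouet. -/
lemma log_sup_h2 : ∃ C : ℝ, 0 ≤ C ∧ ∀ (f : Plane → Space) (D : Fin 2 → Plane → Space)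
    (H : Fin 2 → Fin 2 → Plane → Space) (φ : ℕ → Plane → Space), H2Approx f D H φ →
    ∀ ε : ℝ, 0 < ε → ε ≤ 1 → ∀ᵐ x, ‖f x‖ ^ 2 ≤
      C * (1 + Real.log (1 / ε)) * ((∫ x, ‖f x‖ ^ 2) + ∑ i, ∫ x, ‖D i x‖ ^ 2) +
      C * ε * ((∑ i, ∫ x, ‖D i x‖ ^ 2) + ∑ i, ∑ j, ∫ x, ‖H i j x‖ ^ 2) := by
  obtain ⟨C, hC, L⟩ := log_sup
  refine ⟨C, hC, fun f D H φ h ε hε h1 => ?_⟩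
  obtain ⟨ns, hns, hae⟩ := (tendstoInMeasure_of_tendsto_eLpNorm two_ne_zero
    (fun n => (h.smooth n).continuous.aestronglyMeasurable) h.tl.mem.1
    h.tl.lim).exists_seq_tendsto_ae
  have t1 := tendsto_finsetSum Finset.univ fun i (_ : i ∈ Finset.univ) =>
    (h.tl_pd i).integral_normSq
  have t2 := tendsto_finsetSum Finset.univ fun i (_ : i ∈ Finset.univ) =>
    tendsto_finsetSum Finset.univ fun j (_ : j ∈ Finset.univ) => (h.tl_pd_pd i j).integral_normSq
  have t := (((h.tl.integral_normSq.add t1).const_mul (C * (1 + Real.log (1 / ε)))).add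
    ((t1.add t2).const_mul (C * ε))).comp hns.tendsto_atTop
  filter_upwards [hae] with x hx
  exact le_of_tendsto_of_tendsto' (hx.norm.pow 2) t fun n => L _ (h.smooth _) (h.compact _) ε hε h1 x

/-- The logarithmic product inequality for a gradient. -/
lemma log_product_h2 : ∃ C : ℝ, 0 ≤ C ∧ ∀ (f : Plane → Space) (D : Fin 2 → Plane → Space)
    (H : Fin 2 → Fin 2 → Plane → Space) (φ : ℕ → Plane → Space), H2Approx f D H φ → ∀ i,
    ∀ g : Plane → Space, MemLp g 2 volume → MemLp g 4 volume → ∀ ε : ℝ, 0 < ε → ε ≤ 1 →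
    ∫ x, ‖D i x‖ ^ 2 * ‖g x‖ ^ 2 ≤
      C * (1 + Real.log (1 / ε)) * ((∫ x, ‖D i x‖ ^ 2) + ∑ k, ∫ x, ‖H k i x‖ ^ 2) *
        (∫ x, ‖g x‖ ^ 2) +
      C * ε * (∑ k, ∫ x, ‖H k i x‖ ^ 2) * √(∫ x, ‖g x‖ ^ 4) := by
  obtain ⟨C, hC, L⟩ := log_product
  refine ⟨C, hC, fun f D H φ h i g g2 g4 ε hε h1 => ?_⟩
  have t1 := tendsto_finsetSum Finset.univ fun k (_ : k ∈ Finset.univ) =>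
    (h.tl_pd_pd k i).integral_normSq
  have tg : TL 4 (atTop : Filter ℕ) (fun _ => g) g := TL.const g4
  have t0 := ((h.tl_pd_four i).normSq.bilin (r := 1) le_rfl (ContinuousLinearMap.mul ℝ ℝ)
    tg.normSq).integral
  simp only [ContinuousLinearMap.mul_apply'] at t0
  refine le_of_tendsto_of_tendsto' t0
    (((((h.tl_pd i).integral_normSq.add t1).const_mul (C * (1 + Real.log (1 / ε)))).mul_const _).add
    ((t1.const_mul (C * ε)).mul_const _)) fun n => ?_
  exact L _ (pd_contDiff (h.smooth n)) (pd_hasCompactSupport (h.compact n)) g g2 g4 ε hε h1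

end Density
end LLHelicity

namespace LLHelicity
set_option linter.unusedSectionVars false

/-! ### Vector algebra -/

section Vector

lemma inner_eq (x y : Space) : inner ℝ x y = x 0 * y 0 + x 1 * y 1 + x 2 * y 2 := by
  simp [PiLp.inner_apply, Fin.sum_univ_three, mul_comm]

lemma normSq_eq (x : Space) : ‖x‖ ^ 2 = x 0 ^ 2 + x 1 ^ 2 + x 2 ^ 2 := by
  rw [← real_inner_self_eq_norm_sq, inner_eq]; ring

@[simp] lemma cross_zero' (x y : Space) : cross x y 0 = x 1 * y 2 - x 2 * y 1 := by
  simp [cross, crossProduct]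
@[simp] lemma cross_one' (x y : Space) : cross x y 1 = x 2 * y 0 - x 0 * y 2 := by
  simp [cross, crossProduct]
@[simp] lemma cross_two' (x y : Space) : cross x y 2 = x 0 * y 1 - x 1 * y 0 := by
  simp [cross, crossProduct]

lemma norm_cross_le (x y : Space) : ‖cross x y‖ ≤ ‖x‖ * ‖y‖ := by
  refine (sq_le_sq₀ (norm_nonneg _) (by positivity)).1 ?_
  rw [mul_pow, normSq_eq, normSq_eq, normSq_eq, cross_zero', cross_one', cross_two']
  nlinarith [sq_nonneg (x 0 * y 0 + x 1 * y 1 + x 2 * y 2)]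

/-- The vector product as a bounded bilinear map. -/
noncomputable def crossB : Space →L[ℝ] Space →L[ℝ] Space :=
  LinearMap.mkContinuous₂ (LinearMap.mk₂ ℝ cross
    (fun x y z => by ext k; fin_cases k <;> simp <;> ring)
    (fun c x y => by ext k; fin_cases k <;> simp <;> ring)
    (fun x y z => by ext k; fin_cases k <;> simp <;> ring)
    (fun c x y => by ext k; fin_cases k <;> simp <;> ring)) 1
    (fun x y => by simpa using norm_cross_le x y)

lemma crossB_apply (x y : Space) : crossB x y = cross x y := rfl

/-- The triple product `(x × y) · z`. -/
noncomputable def triple (x y z : Space) : ℝ := inner ℝ (cross x y) z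

lemma triple_eq (x y z : Space) : triple x y z = (x 1 * y 2 - x 2 * y 1) * z 0 +
    (x 2 * y 0 - x 0 * y 2) * z 1 + (x 0 * y 1 - x 1 * y 0) * z 2 := by
  rw [triple, inner_eq, cross_zero', cross_one', cross_two']

lemma abs_triple_le (x y z : Space) : |triple x y z| ≤ ‖x‖ * ‖y‖ * ‖z‖ :=
  (abs_real_inner_le_norm _ _).trans (mul_le_mul_of_nonneg_right (norm_cross_le x y) (norm_nonneg _))

/-- Cramer's rule. -/
lemma cramer (w x y z : Space) : ‖w‖ ^ 2 * triple x y z =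
    inner ℝ x w * triple w y z + inner ℝ y w * triple x w z + inner ℝ z w * triple x y w := by
  simp only [triple_eq, inner_eq, normSq_eq]; ring

lemma cross_neg_right (x y : Space) : cross x (-y) = - cross x y := by
  ext k; fin_cases k <;> simp <;> ring

lemma cross_self_add (x y z : Space) : cross x (y + z) = cross x y + cross x z := by
  ext k; fin_cases k <;> simp <;> ring

end Vector

/-! ### Weak convergence in `L²` -/

section WeakConvergence

lemma integrable_inner {f g : Plane → Space} (hf : MemLp f 2 volume) (hg : MemLp g 2 volume) :
    Integrable (fun x => inner ℝ (f x) (g x)) volume :=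
  memLp_one_iff_integrable.1
    (TL.bilin (l := (⊤ : Filter ℕ)) le_rfl innerB (TL.const hf) (TL.const hg)).mem

/-- Weak convergence in `L²`. -/
def WL {ι : Type*} (l : Filter ι) (g : ι → Plane → Space) (g₀ : Plane → Space) : Prop :=
  ∀ A : Plane → Space, MemLp A 2 volume →
    Tendsto (fun n => ∫ x, inner ℝ (A x) (g n x)) l (𝓝 (∫ x, inner ℝ (A x) (g₀ x)))

variable {ι : Type*} {l : Filter ι}

lemma TL.wl {g : ι → Plane → Space} {g₀ : Plane → Space} (h : TL 2 l g g₀) : WL l g g₀ :=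
  fun _ hA => ((TL.const hA).bilin (r := 1) le_rfl innerB h).integral

/-- Weak convergence for the fixed factor A₀, and Cauchy-Schwarz with the uniform bound on g for the
error A - A₀. -/
lemma WL.pair {g A : ι → Plane → Space} {g₀ A₀ : Plane → Space} (h : WL l g g₀) (hA : TL 2 l A A₀)
    (M : ℝ) (hg : ∀ᶠ n in l, MemLp (g n) 2 volume ∧ ∫ x, ‖g n x‖ ^ 2 ≤ M) :
    Tendsto (fun n => ∫ x, inner ℝ (A n x) (g n x)) l (𝓝 (∫ x, inner ℝ (A₀ x) (g₀ x))) := by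
  have t1 := h A₀ hA.mem
  have t2 : Tendsto (fun n => ∫ x, inner ℝ (A n x - A₀ x) (g n x)) l (𝓝 0) := by
    have d : TL 2 l (fun n x => A n x - A₀ x) (fun _ => (0 : Space)) := by
      simpa using hA.sub (by norm_num) (TL.const hA.mem)
    have t := ((Real.continuous_sqrt.tendsto _).comp d.integral_normSq).mul_const √M
    simp only [norm_zero, ne_eq, OfNat.ofNat_ne_zero, not_false_eq_true, zero_pow, integral_zero,
      Real.sqrt_zero, zero_mul] at t
    refine squeeze_zero_norm' ?_ t
    filter_upwards [hg, d.memF] with n hn hd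
    exact (abs_integral_inner_le hd hn.1).trans
      (mul_le_mul_of_nonneg_left (Real.sqrt_le_sqrt hn.2) (Real.sqrt_nonneg _))
  have t3 := t2.add t1
  rw [zero_add] at t3
  refine t3.congr' ?_
  filter_upwards [hg, hA.memF] with n hn hd
  rw [← integral_add (integrable_inner (f := fun x => A n x - A₀ x) (hd.sub hA.mem) hn.1) (integrable_inner hA.mem hn.1)]
  simp only [inner_sub_left, sub_add_cancel]

/-- Banach-Alaoglu in the dual of the Hilbert space L². Along an ultrafilter the whole family
converges, so no subsequences have to be extracted, and several families can be handled at the same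
time. -/
lemma exists_weakLim (𝒰 : Ultrafilter ι) (g : ι → Plane → Space) {M : ℝ} (hM : 0 ≤ M)
    (hg : ∀ᶠ n in (𝒰 : Filter ι), MemLp (g n) 2 volume ∧ ∫ x, ‖g n x‖ ^ 2 ≤ M ^ 2) :
    ∃ g₀, MemLp g₀ 2 volume ∧ ∫ x, ‖g₀ x‖ ^ 2 ≤ M ^ 2 ∧ WL 𝒰 g g₀ := by
  classical
  let E := Lp Space 2 (volume : Measure Plane)
  let G : ι → E := fun n => if h : MemLp (g n) 2 volume then h.toLp else 0
  have nsq : ∀ f : E, ‖f‖ ^ 2 = ∫ x, ‖f x‖ ^ 2 := fun f => by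
    rw [← real_inner_self_eq_norm_sq, L2.inner_def]
    simp only [real_inner_self_eq_norm_sq]
  have hG : ∀ᶠ n in (𝒰 : Filter ι), G n =ᵐ[volume] g n ∧ ‖G n‖ ≤ M := by
    filter_upwards [hg] with n hn
    have e : G n = hn.1.toLp := dif_pos hn.1
    have e' : G n =ᵐ[volume] g n := e ▸ hn.1.coeFn_toLp
    refine ⟨e', (sq_le_sq₀ (norm_nonneg _) hM).1 ?_⟩
    rw [nsq, integral_congr_ae (g := fun x => ‖g n x‖ ^ 2)]
    · exact hn.2
    · filter_upwards [e'] with x hx; rw [hx]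
  let Φ : ι → WeakDual ℝ E := fun n => StrongDual.toWeakDual (InnerProductSpace.toDual ℝ E (G n))
  have hK := WeakDual.isCompact_closedBall (𝕜 := ℝ) (E := E) 0 M
  have hmem : ∀ᶠ n in (𝒰 : Filter ι), Φ n ∈
      WeakDual.toStrongDual ⁻¹' Metric.closedBall (0 : StrongDual ℝ E) M := by
    filter_upwards [hG] with n hn
    simp only [mem_preimage, mem_closedBall_zero_iff]
    exact ((InnerProductSpace.toDual ℝ E).norm_map (G n)).trans_le hn.2
  obtain ⟨Λ, hΛ, hlim⟩ := hK.ultrafilter_le_nhds (𝒰.map Φ) (by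
    rw [le_principal_iff]; exact hmem)
  set g₀ : E := (InnerProductSpace.toDual ℝ E).symm (WeakDual.toStrongDual Λ) with hg₀
  have hn : ‖g₀‖ ≤ M := by
    rw [hg₀, LinearIsometryEquiv.norm_map]
    exact mem_closedBall_zero_iff.1 hΛ
  refine ⟨g₀, Lp.memLp g₀, ?_, fun A hA => ?_⟩
  · rw [← nsq]; exact pow_le_pow_left₀ (norm_nonneg _) hn 2
  · have t : Tendsto (fun n => Φ n hA.toLp) 𝒰 (𝓝 (Λ hA.toLp)) :=
      ((WeakDual.eval_continuous (𝕜 := ℝ) (hA.toLp : E)).tendsto Λ).comp hlim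
    have ip : ∀ f : E, ∀ f' : Plane → Space, f =ᵐ[volume] f' →
        inner ℝ f (hA.toLp : E) = ∫ x, inner ℝ (A x) (f' x) := fun f f' e => by
      rw [L2.inner_def]
      refine integral_congr_ae ?_
      filter_upwards [e, hA.coeFn_toLp] with x h1 h2
      rw [h1, h2, real_inner_comm]
    have e0 : Λ hA.toLp = ∫ x, inner ℝ (A x) (g₀ x) := by
      rw [← ip g₀ g₀ (ae_eq_refl _), hg₀]
      exact (InnerProductSpace.toDual_symm_apply (𝕜 := ℝ) (y := WeakDual.toStrongDual Λ)).symm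
    rw [e0] at t
    refine t.congr' ?_
    filter_upwards [hG] with n hn
    rw [← ip (G n) (g n) hn.1]
    rfl

lemma HasWeakPartial.of_wl [l.NeBot] {i : Fin 2} {f g : ι → Plane → Space} {f₀ g₀ : Plane → Space}
    (hf : WL l f f₀) (hg : WL l g g₀) (h : ∀ᶠ n in l, HasWeakPartial i (f n) (g n))
    (hf₀ : MemLp f₀ 2 volume) (hg₀ : MemLp g₀ 2 volume) : HasWeakPartial i f₀ g₀ := by
  have lf := hf₀.locallyIntegrable (by norm_num)
  have lg := hg₀.locallyIntegrable (by norm_num)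
  refine ⟨lf, lg, fun φ hφ hc => ?_⟩
  have c1 : Continuous fun x => fderiv ℝ φ x (EuclideanSpace.single i 1) :=
    pd_continuous (hφ.of_le (by simp))
  have s1 : HasCompactSupport fun x => fderiv ℝ φ x (EuclideanSpace.single i 1) :=
    pd_hasCompactSupport hc
  have key : ∀ {c : Plane → ℝ}, Continuous c → HasCompactSupport c → ∀ (h : Plane → Space),
      LocallyIntegrable h volume → ∀ e : Space,
      inner ℝ e (∫ x, c x • h x) = ∫ x, inner ℝ (c x • e) (h x) := by
    intro c hc hs h hh e
    rw [← integral_inner (hh.integrable_smul_left_of_hasCompactSupport hc hs)]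
    simp only [real_inner_smul_left, real_inner_smul_right]
  have tm : ∀ {c : Plane → ℝ}, Continuous c → HasCompactSupport c → ∀ e : Space,
      MemLp (fun x => c x • e) 2 volume := fun hc hs e =>
    (hc.smul continuous_const).memLp_of_hasCompactSupport hs.smul_right
  refine ext_inner_left ℝ fun e => ?_
  rw [inner_neg_right, key c1 s1 f₀ lf, key hφ.continuous hc g₀ lg]
  refine tendsto_nhds_unique (hf _ (tm c1 s1 e)) ((hg _ (tm hφ.continuous hc e)).neg.congr' ?_)
  filter_upwards [h] with n hn
  rw [← key c1 s1 _ hn.1, ← key hφ.continuous hc _ hn.2.1, hn.2.2 φ hφ hc, inner_neg_right]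

end WeakConvergence
end LLHelicity

namespace LLHelicity
set_option linter.unusedSectionVars false

/-! ### Maps in `k + H²` -/

section H2Map

lemma exists_test_approx {f : Plane → Space} (hf : MemLp f 2 volume) :
    ∃ φ : ℕ → Plane → Space, (∀ n, ContDiff ℝ ∞ (φ n)) ∧ (∀ n, HasCompactSupport (φ n)) ∧
      TL 2 atTop φ f := by
  obtain ⟨χ, C, cs, cc, c01, c1, -, -⟩ := exists_cutoff
  exact ⟨fun n x => χ n x • moll (stdMoll n) f x, fun n => (cs n).smul
    (moll_contDiff (stdMoll_contDiff n) (stdMoll_compact n) (hf.locallyIntegrable (by norm_num))),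
    fun n => (cc n).smul_right, (tl_moll hf).cutoff (fun n => (cs n).continuous) c01 c1⟩

/-- `f` lies in `k + H²`, and the `L²` norms of `f - k` and of its derivatives of order at most two
are bounded by `M`. -/
structure H2Map (M : ℝ) (f : Plane → Space) : Prop where
  weak_one : ∀ i, HasWeakPartial i (fun x => f x - kVec) (weakPartial i f)
  weak_two : ∀ i j, HasWeakPartial i (weakPartial j f) (weakPartial i (weakPartial j f))
  mem : MemLp (fun x => f x - kVec) 2 volume
  mem_one : ∀ i, MemLp (weakPartial i f) 2 volume
  mem_two : ∀ i j, MemLp (weakPartial i (weakPartial j f)) 2 volume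
  bound : ∫ x, ‖f x - kVec‖ ^ 2 ≤ M ^ 2
  bound_one : ∀ i, ∫ x, ‖weakPartial i f x‖ ^ 2 ≤ M ^ 2
  bound_two : ∀ i j, ∫ x, ‖weakPartial i (weakPartial j f) x‖ ^ 2 ≤ M ^ 2

variable {M : ℝ} {f : Plane → Space}

lemma integral_normSq_le_of_eLpNorm {g : Plane → Space} (hM : 0 ≤ M) (hg : MemLp g 2 volume)
    (h : eLpNorm g 2 volume ≤ ENNReal.ofReal M) : ∫ x, ‖g x‖ ^ 2 ≤ M ^ 2 := by
  rw [eLpNorm_two_eq hg, ENNReal.ofReal_le_ofReal_iff hM, Real.sqrt_le_left hM] at h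
  exact h

lemma H2Map.of_h2Norm (hM : 0 ≤ M)
    (h : h2Norm (fun x => f x - kVec) ≤ ENNReal.ofReal M) : H2Map M f := by
  have mem : MemH2 (fun x => f x - kVec) := by
    by_contra h'
    rw [h2Norm, if_neg h'] at h
    exact absurd h (by simp)
  rw [h2Norm, if_pos mem] at h
  have hs := ENNReal.rpow_le_rpow h (show (0 : ℝ) ≤ 2 by norm_num)
  rw [← ENNReal.rpow_mul, show (1 / 2 : ℝ) * 2 = 1 by norm_num, ENNReal.rpow_one,
    ENNReal.rpow_two] at hs
  have le_of : ∀ a : ℝ≥0∞, a ^ 2 ≤ ENNReal.ofReal M ^ 2 → a ≤ ENNReal.ofReal M := fun a ha =>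
    (ENNReal.pow_le_pow_left_iff two_ne_zero).1 ha
  have b0 := le_of _ ((le_add_right le_self_add).trans hs)
  have b1 : ∀ i, eLpNorm (weakPartial i (fun x => f x - kVec)) 2 volume ≤ ENNReal.ofReal M :=
    fun i => le_of _ ((le_add_right (le_add_left (Finset.single_le_sum
      (f := fun i => eLpNorm (weakPartial i (fun x => f x - kVec)) 2 volume ^ 2)
      (fun _ _ => zero_le) (Finset.mem_univ i)))).trans hs)
  have b2 : ∀ i j, eLpNorm (weakPartial i (weakPartial j (fun x => f x - kVec))) 2 volume ≤
      ENNReal.ofReal M := fun i j => le_of _ ((le_add_left ((Finset.single_le_sum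
      (f := fun j => eLpNorm (weakPartial i (weakPartial j (fun x => f x - kVec))) 2 volume ^ 2)
      (fun _ _ => zero_le) (Finset.mem_univ j)).trans (Finset.single_le_sum
      (f := fun i => ∑ j, eLpNorm (weakPartial i (weakPartial j (fun x => f x - kVec))) 2 volume ^ 2)
      (fun _ _ => zero_le) (Finset.mem_univ i)))).trans hs)
  have e1 : ∀ i, weakPartial i (fun x => f x - kVec) =ᵐ[volume] weakPartial i f :=
    fun i => weakPartial_sub_const kVec
  have e2 : ∀ i j, weakPartial i (weakPartial j (fun x => f x - kVec)) =ᵐ[volume]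
      weakPartial i (weakPartial j f) := fun i j => weakPartial_congr (e1 j)
  have m1 : ∀ i, MemLp (weakPartial i f) 2 volume := fun i => (memLp_congr_ae (e1 i)).1 (mem.2.1 i).2
  have m2 : ∀ i j, MemLp (weakPartial i (weakPartial j f)) 2 volume := fun i j =>
    (memLp_congr_ae (e2 i j)).1 (mem.2.2 i j).2
  exact ⟨fun i => (weakPartial_spec (mem.2.1 i).1).congr (ae_eq_refl _) (e1 i),
    fun i j => (weakPartial_spec (mem.2.2 i j).1).congr (e1 j) (e2 i j), mem.1, m1, m2,
    integral_normSq_le_of_eLpNorm hM mem.1 b0,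
    fun i => integral_normSq_le_of_eLpNorm hM (m1 i) ((eLpNorm_congr_ae (e1 i)).symm.trans_le (b1 i)),
    fun i j => integral_normSq_le_of_eLpNorm hM (m2 i j)
      ((eLpNorm_congr_ae (e2 i j)).symm.trans_le (b2 i j))⟩

lemma H2Map.exists_approx (h : H2Map M f) : ∃ φ, H2Approx (fun x => f x - kVec)
    (fun i => weakPartial i f) (fun i j => weakPartial i (weakPartial j f)) φ :=
  exists_h2Approx_of_weak h.mem h.mem_one h.mem_two h.weak_one h.weak_two

/-- An H² ball is closed under convergence in L²: the derivatives have weak limits, which are the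
weak derivatives of the limit map. It serves twice, to extend the H² bound from almost every time to
every time and to show that second derivatives are weakly continuous in time. -/
lemma H2Map.of_ultrafilter {ι : Type*} (𝒰 : Ultrafilter ι) {g : ι → Plane → Space} (hM : 0 ≤ M)
    (hg : ∀ᶠ n in (𝒰 : Filter ι), H2Map M (g n)) (hf : MemLp (fun x => f x - kVec) 2 volume)
    (hlim : Tendsto (fun n => eLpNorm (fun x => g n x - f x) 2 volume) 𝒰 (𝓝 0)) :
    H2Map M f ∧ ∀ i j, WL 𝒰 (fun n => weakPartial i (weakPartial j (g n)))
      (weakPartial i (weakPartial j f)) := by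
  have T : TL 2 (𝒰 : Filter ι) (fun n x => g n x - kVec) (fun x => f x - kVec) :=
    ⟨hg.mono fun n hn => hn.mem, hf, by simpa using hlim⟩
  choose d md bd wd using fun i => exists_weakLim 𝒰 (fun n => weakPartial i (g n)) hM
    (hg.mono fun n hn => ⟨hn.mem_one i, hn.bound_one i⟩)
  choose d2 md2 bd2 wd2 using fun i j => exists_weakLim 𝒰
    (fun n => weakPartial i (weakPartial j (g n))) hM
    (hg.mono fun n hn => ⟨hn.mem_two i j, hn.bound_two i j⟩)
  have h1 : ∀ i, HasWeakPartial i (fun x => f x - kVec) (d i) := fun i =>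
    HasWeakPartial.of_wl T.wl (wd i) (hg.mono fun n hn => hn.weak_one i) hf (md i)
  have h2 : ∀ i j, HasWeakPartial i (d j) (d2 i j) := fun i j =>
    HasWeakPartial.of_wl (wd j) (wd2 i j) (hg.mono fun n hn => hn.weak_two i j) (md j) (md2 i j)
  have e1 : ∀ i, weakPartial i f =ᵐ[volume] d i := fun i =>
    (weakPartial_sub_const kVec).symm.trans (h1 i).weakPartial_eq
  have e2 : ∀ i j, weakPartial i (weakPartial j f) =ᵐ[volume] d2 i j := fun i j =>
    (weakPartial_congr (e1 j)).trans (h2 i j).weakPartial_eq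
  have ie : ∀ {a a' : Plane → Space}, a =ᵐ[volume] a' → ∫ x, ‖a x‖ ^ 2 = ∫ x, ‖a' x‖ ^ 2 :=
    fun e => integral_congr_ae (by filter_upwards [e] with x hx; rw [hx])
  refine ⟨⟨fun i => (h1 i).congr (ae_eq_refl _) (e1 i).symm,
    fun i j => (h2 i j).congr (e1 j).symm (e2 i j).symm, hf,
    fun i => (memLp_congr_ae (e1 i)).2 (md i), fun i j => (memLp_congr_ae (e2 i j)).2 (md2 i j), ?_,
    fun i => (ie (e1 i)).trans_le (bd i), fun i j => (ie (e2 i j)).trans_le (bd2 i j)⟩, ?_⟩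
  · exact le_of_tendsto T.integral_normSq (hg.mono fun n hn => hn.bound)
  · intro i j A hA
    have := wd2 i j A hA
    rwa [show ∫ x, inner ℝ (A x) (d2 i j x) = ∫ x, inner ℝ (A x) (weakPartial i (weakPartial j f) x)
      from integral_congr_ae (by filter_upwards [e2 i j] with x hx; rw [hx])] at this

/-- The right-hand side `- f × Δf - b (f · ∇) f` of the equation, for maps into the sphere. -/
noncomputable def field (b : ℝ) (f : Plane → Space) (x : Plane) : Space :=
  - cross (f x) (∑ i, weakPartial i (weakPartial i f) x) -
    b • ∑ k : Fin 2, f x k.castSucc • weakPartial k f x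

/-- A map in `k + H²` with values in the sphere. -/
structure SphereMap (M : ℝ) (f : Plane → Space) : Prop extends H2Map M f where
  sphere : ∀ᵐ x, ‖f x‖ = 1

namespace SphereMap

variable (h : SphereMap M f)
include h

lemma W_zero (i : Fin 2) : W i 0 f (weakPartial i f) := by
  obtain ⟨φ, hφ⟩ := h.exists_approx
  have := (hφ.W_zero i).add (W.const (i := i) kVec)
  refine this.congr (ae_of_all _ fun x => by simp) (ae_of_all _ fun x => by simp)

lemma aestronglyMeasurable : AEStronglyMeasurable f volume := by
  have := h.mem.1.add (aestronglyMeasurable_const (b := kVec))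
  refine this.congr (ae_of_all _ fun x => by simp)

lemma mem_top : MemLp f ⊤ volume :=
  memLp_top_of_bound h.aestronglyMeasurable 1 (h.sphere.mono fun _ hx => hx.le)

/-- Differentiate |f|² = 1 and use uniqueness of weak derivatives. -/
lemma inner_weakPartial (i : Fin 2) : ∀ᵐ x, inner ℝ (f x) (weakPartial i f x) = (0 : ℝ) := by
  have w := (h.W_zero i).bilin innerB (h.W_zero i)
  have c : W i 0 (fun x => innerB (f x) (f x)) (fun _ => (0 : ℝ)) :=
    (W.const (i := i) (1 : ℝ)).congr (by
      filter_upwards [h.sphere] with x hx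
      rw [innerB_apply, real_inner_self_eq_norm_sq, hx]; norm_num) (ae_eq_refl _)
  filter_upwards [w.unique c] with x hx
  simp only [innerB_apply] at hx
  rw [real_inner_comm] at hx
  linarith

/-- The identity f × (∇ × f) = ½∇|f|² - (f·∇)f, in which the gradient vanishes on the sphere. The
helicity term thereby becomes a transport term of first order. -/
lemma llRHS_eq (b : ℝ) : llRHS b f =ᵐ[volume] field b f := by
  filter_upwards [h.inner_weakPartial 0, h.inner_weakPartial 1] with x h0 h1
  rw [inner_eq] at h0 h1
  rw [llRHS, field, weakLaplacian, cross_self_add, cross_neg_right, sub_eq_add_neg]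
  congr 1
  ext k
  fin_cases k <;> simp [curl, Fin.sum_univ_two]
  · linear_combination b * h0
  · linear_combination b * h1
  · ring

end SphereMap
end H2Map
end LLHelicity

namespace LLHelicity
set_option linter.unusedSectionVars false

/-! ### Continuity in time -/

section Time

lemma eLpNorm_four_eq {f : Plane → Space} (hf : MemLp f 4 volume) :
    eLpNorm f 4 volume = ENNReal.ofReal ((∫ x, ‖f x‖ ^ 4) ^ (1 / 4 : ℝ)) := by
  rw [hf.eLpNorm_eq_integral_rpow_norm (by simp) (by simp)]
  have e4 : (4 : ℝ≥0∞).toReal = ((4 : ℕ) : ℝ) := by simp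
  simp only [e4, Real.rpow_natCast, ← one_div]
  norm_num

variable {ι : Type*} {l : Filter ι} {M : ℝ}

lemma H2Approx.sub {f g : Plane → Space} {D D' : Fin 2 → Plane → Space}
    {H H' : Fin 2 → Fin 2 → Plane → Space} {φ ψ : ℕ → Plane → Space} (h : H2Approx f D H φ)
    (h' : H2Approx g D' H' ψ) : H2Approx (fun x => f x - g x) (fun i x => D i x - D' i x)
      (fun i j x => H i j x - H' i j x) (fun n x => φ n x - ψ n x) := by
  have e : ∀ i n, pd i (fun x => φ n x - ψ n x) = fun x => pd i (φ n) x - pd i (ψ n) x :=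
    fun i n => by
      ext1 x
      simp only [pd]
      rw [fderiv_fun_sub ((h.smooth _).differentiable (by simp) x)
        ((h'.smooth _).differentiable (by simp) x), sub_apply]
  have e2 : ∀ i j n, pd i (pd j (fun x => φ n x - ψ n x)) =
      fun x => pd i (pd j (φ n)) x - pd i (pd j (ψ n)) x := fun i j n => by
    rw [e]
    ext1 x
    simp only [pd.eq_def i]
    rw [fderiv_fun_sub ((pd_contDiff (h.smooth _)).differentiable (by simp) x)
      ((pd_contDiff (h'.smooth _)).differentiable (by simp) x), sub_apply]
  refine ⟨fun n => (h.smooth n).sub (h'.smooth n), fun n => (h.compact n).sub (h'.compact n),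
    h.tl.sub (by norm_num) h'.tl, fun i => ?_, fun i j => ?_⟩
  · simp only [e]; exact (h.tl_pd i).sub (by norm_num) (h'.tl_pd i)
  · simp only [e2]; exact (h.tl_pd_pd i j).sub (by norm_num) (h'.tl_pd_pd i j)

lemma integral_normSq_sub_le {f g : Plane → Space} (hf : MemLp f 2 volume) (hg : MemLp g 2 volume)
    (bf : ∫ x, ‖f x‖ ^ 2 ≤ M ^ 2) (bg : ∫ x, ‖g x‖ ^ 2 ≤ M ^ 2) :
    ∫ x, ‖f x - g x‖ ^ 2 ≤ 4 * M ^ 2 := by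
  have : ∫ x, ‖f x - g x‖ ^ 2 ≤ ∫ x, (2 * ‖f x‖ ^ 2 + 2 * ‖g x‖ ^ 2) := by
    refine integral_mono (hf.sub hg).norm.integrable_sq
      ((hf.norm.integrable_sq.const_mul 2).add (hg.norm.integrable_sq.const_mul 2)) fun x => ?_
    have := norm_sub_le (f x) (g x)
    show ‖f x - g x‖ ^ 2 ≤ 2 * ‖f x‖ ^ 2 + 2 * ‖g x‖ ^ 2
    nlinarith [norm_nonneg (f x - g x), sq_nonneg (‖f x‖ - ‖g x‖)]
  refine this.trans ?_
  rw [integral_add (hf.norm.integrable_sq.const_mul 2) (hg.norm.integrable_sq.const_mul 2),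
    integral_const_mul, integral_const_mul]
  linarith

/-- Convergence in `L²` of maps bounded in `H²` gives convergence of the gradients. -/
lemma tl_weakPartial {g : ι → Plane → Space} {f : Plane → Space} (hg : ∀ᶠ n in l, H2Map M (g n))
    (hf : H2Map M f) (hlim : Tendsto (fun n => eLpNorm (fun x => g n x - f x) 2 volume) l (𝓝 0))
    (i : Fin 2) : TL 2 l (fun n => weakPartial i (g n)) (weakPartial i f) ∧
      TL 4 l (fun n => weakPartial i (g n)) (weakPartial i f) := by
  obtain ⟨ψ, hψ⟩ := hf.exists_approx
  obtain ⟨C, hC, lad⟩ := ladyzhenskaya_h2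
  have T : TL 2 l (fun n x => (g n x - kVec) - (f x - kVec)) (fun _ => (0 : Space)) := by
    refine ⟨hg.mono fun n hn => hn.mem.sub hf.mem, by simp, by simpa using hlim⟩
  have t0 := T.integral_normSq
  simp only [norm_zero, ne_eq, OfNat.ofNat_ne_zero, not_false_eq_true, zero_pow, integral_zero]
    at t0
  -- Interpolation for the difference: the maps converge in L² while the Hessians need only be
  -- bounded.
  have b1 : ∀ᶠ n in l, ∫ x, ‖weakPartial i (g n) x - weakPartial i f x‖ ^ 2 ≤
      √(∫ x, ‖(g n x - kVec) - (f x - kVec)‖ ^ 2) * √(4 * M ^ 2) := by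
    filter_upwards [hg] with n hn
    obtain ⟨φ, hφ⟩ := hn.exists_approx
    exact ((hφ.sub hψ).interpolation i).trans (mul_le_mul_of_nonneg_left (Real.sqrt_le_sqrt
      (integral_normSq_sub_le (hn.mem_two i i) (hf.mem_two i i) (hn.bound_two i i)
        (hf.bound_two i i))) (Real.sqrt_nonneg _))
  have t1 : Tendsto (fun n => ∫ x, ‖weakPartial i (g n) x - weakPartial i f x‖ ^ 2) l (𝓝 0) := by
    have t := ((Real.continuous_sqrt.tendsto _).comp t0).mul_const √(4 * M ^ 2)
    rw [Real.sqrt_zero, zero_mul] at t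
    exact squeeze_zero' (Eventually.of_forall fun n => by positivity) b1 t
  have m4 : ∀ {f : Plane → Space}, H2Map M f → MemLp (weakPartial i f) 4 volume := fun h => by
    obtain ⟨φ, hφ⟩ := h.exists_approx
    exact (hφ.tl_pd_four i).mem
  have b2 : ∀ᶠ n in l, ∫ x, ‖weakPartial i (g n) x - weakPartial i f x‖ ^ 4 ≤
      C * (∫ x, ‖weakPartial i (g n) x - weakPartial i f x‖ ^ 2) * (8 * M ^ 2) := by
    filter_upwards [hg] with n hn
    obtain ⟨φ, hφ⟩ := hn.exists_approx
    refine (lad _ _ _ _ (hφ.sub hψ) i).trans (mul_le_mul_of_nonneg_left ?_ (by positivity))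
    have := fun k => integral_normSq_sub_le (hn.mem_two k i) (hf.mem_two k i) (hn.bound_two k i)
      (hf.bound_two k i)
    rw [Fin.sum_univ_two]
    linarith [this 0, this 1]
  have t2 : Tendsto (fun n => ∫ x, ‖weakPartial i (g n) x - weakPartial i f x‖ ^ 4) l (𝓝 0) := by
    have t := (t1.const_mul C).mul_const (8 * M ^ 2)
    rw [mul_zero, zero_mul] at t
    exact squeeze_zero' (Eventually.of_forall fun n => by positivity) b2 t
  constructor
  · refine ⟨hg.mono fun n hn => hn.mem_one i, hf.mem_one i, ?_⟩
    have t := (ENNReal.continuous_ofReal.tendsto _).comp ((Real.continuous_sqrt.tendsto _).comp t1)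
    rw [Real.sqrt_zero, ENNReal.ofReal_zero] at t
    refine t.congr' ?_
    filter_upwards [hg] with n hn
    exact (eLpNorm_two_eq ((hn.mem_one i).sub (hf.mem_one i))).symm
  · refine ⟨hg.mono fun n hn => m4 hn, m4 hf, ?_⟩
    have t := (ENNReal.continuous_ofReal.tendsto _).comp
      ((Real.continuousAt_rpow_const _ (1 / 4) (Or.inr (by norm_num))).tendsto.comp t2)
    rw [Real.zero_rpow (by norm_num), ENNReal.ofReal_zero] at t
    refine t.congr' ?_
    filter_upwards [hg] with n hn
    exact (eLpNorm_four_eq ((m4 hn).sub (m4 hf))).symm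

/-- A curve in `k + H²` with values in the sphere, bounded in `H²` and continuous in
`L² ∩ L^∞`. -/
structure Flow (M : ℝ) (I : Set ℝ) (u : ℝ → Plane → Space) : Prop where
  map : ∀ t ∈ I, SphereMap M (u t)
  tendsto_two : ∀ t ∈ I, Tendsto (fun s => eLpNorm (fun x => u s x - u t x) 2 volume) (𝓝[I] t) (𝓝 0)
  tendsto_top : ∀ t ∈ I, Tendsto (fun s => eLpNorm (fun x => u s x - u t x) ⊤ volume) (𝓝[I] t) (𝓝 0)

namespace Flow

variable {I J : Set ℝ} {u : ℝ → Plane → Space} {t b : ℝ}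

lemma mono (h : Flow M I u) (hJ : J ⊆ I) : Flow M J u :=
  ⟨fun t ht => h.map t (hJ ht), fun t ht => (h.tendsto_two t (hJ ht)).mono_left (nhdsWithin_mono _ hJ),
    fun t ht => (h.tendsto_top t (hJ ht)).mono_left (nhdsWithin_mono _ hJ)⟩

variable (h : Flow M I u) (ht : t ∈ I)
include h ht

lemma ev_map : ∀ᶠ s in 𝓝[I] t, SphereMap M (u s) := by
  filter_upwards [self_mem_nhdsWithin] with s hs using h.map s hs

lemma tl_top : TL ⊤ (𝓝[I] t) u (u t) :=
  ⟨(h.ev_map ht).mono fun _ hs => hs.mem_top, (h.map t ht).mem_top, h.tendsto_top t ht⟩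

lemma tl : TL 2 (𝓝[I] t) (fun s x => u s x - kVec) (fun x => u t x - kVec) :=
  ⟨(h.ev_map ht).mono fun _ hs => hs.mem, (h.map t ht).mem, by simpa using h.tendsto_two t ht⟩

lemma tl_one (i : Fin 2) : TL 2 (𝓝[I] t) (fun s => weakPartial i (u s)) (weakPartial i (u t)) :=
  (tl_weakPartial ((h.ev_map ht).mono fun _ hs => hs.toH2Map) (h.map t ht).toH2Map
    (h.tendsto_two t ht) i).1

lemma tl_one_four (i : Fin 2) :
    TL 4 (𝓝[I] t) (fun s => weakPartial i (u s)) (weakPartial i (u t)) :=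
  (tl_weakPartial ((h.ev_map ht).mono fun _ hs => hs.toH2Map) (h.map t ht).toH2Map
    (h.tendsto_two t ht) i).2

/-- Convergence along a filter is convergence along all finer ultrafilters, and on each of these the
weak limit is identified. -/
lemma wl_two (hM : 0 ≤ M) (i j : Fin 2) : WL (𝓝[I] t) (fun s => weakPartial i (weakPartial j (u s)))
    (weakPartial i (weakPartial j (u t))) := by
  intro A hA
  rw [tendsto_iff_ultrafilter]
  intro 𝒰 h𝒰
  exact (H2Map.of_ultrafilter 𝒰 hM (((h.ev_map ht).mono fun _ hs => hs.toH2Map).filter_mono h𝒰)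
    (h.map t ht).mem ((h.tendsto_two t ht).mono_left h𝒰)).2 i j A hA

end Flow

lemma inner_field (b : ℝ) (f : Plane → Space) (a : Space) (x : Plane) :
    inner ℝ a (field b f x) = - ∑ i, inner ℝ (cross a (f x)) (weakPartial i (weakPartial i f) x) -
      b * ∑ k : Fin 2, f x k.castSucc * inner ℝ a (weakPartial k f x) := by
  rw [field, inner_sub_right, inner_neg_right, inner_smul_right]
  congr 2
  · simp only [inner_eq, Fin.sum_univ_two, cross_zero', cross_one', cross_two', PiLp.add_apply]
    ring
  · rw [inner_sum]
    simp only [inner_smul_right]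

/-- The `k`-th coordinate as a bounded linear map. -/
noncomputable def coordL (k : Fin 3) : Space →L[ℝ] ℝ := EuclideanSpace.proj k

lemma coordL_apply (k : Fin 3) (x : Space) : coordL k x = x k := rfl

/-- Scalar multiplication as a bounded bilinear map. -/
noncomputable def smulB : ℝ →L[ℝ] Space →L[ℝ] Space := ContinuousLinearMap.lsmul ℝ ℝ

lemma smulB_apply (c : ℝ) (x : Space) : smulB c x = c • x := rfl

lemma memLp_smulB {c : Plane → ℝ} {g : Plane → Space} (hc : MemLp c ⊤ volume)
    (hg : MemLp g 2 volume) : MemLp (fun x => smulB (c x) (g x)) 2 volume :=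
  smulB.memLp_of_bilin 2 hc hg

lemma memLp_crossB {f g : Plane → Space} (hf : MemLp f ⊤ volume) (hg : MemLp g 2 volume) :
    MemLp (fun x => crossB (f x) (g x)) 2 volume :=
  crossB.memLp_of_bilin 2 hf hg

lemma memLp_crossB' {f g : Plane → Space} (hf : MemLp f 2 volume) (hg : MemLp g ⊤ volume) :
    MemLp (fun x => crossB (f x) (g x)) 2 volume :=
  crossB.memLp_of_bilin 2 hf hg

lemma memLp_sum_two {E : Type*} [NormedAddCommGroup E] {p : ℝ≥0∞} {g : Fin 2 → Plane → E}
    (h : ∀ i, MemLp (g i) p volume) : MemLp (fun x => ∑ i, g i x) p volume :=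
  memLp_finsetSum _ fun i _ => h i

lemma SphereMap.memLp_field {f : Plane → Space} (h : SphereMap M f) (b : ℝ) :
    MemLp (field b f) 2 volume := by
  have m1 : MemLp (fun x => crossB (f x) (∑ i, weakPartial i (weakPartial i f) x)) 2 volume :=
    memLp_crossB h.mem_top (memLp_sum_two fun i => h.mem_two i i)
  have m2 : ∀ k : Fin 2, MemLp (fun x => smulB
      (coordL k.castSucc (f x)) (weakPartial k f x)) 2 volume := fun k =>
    memLp_smulB ((coordL _).comp_memLp' h.mem_top) (h.mem_one k)
  exact m1.neg.sub ((memLp_sum_two m2).const_smul b)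

lemma norm_field_le {f : Plane → Space} {x : Plane} (h : ‖f x‖ = 1) (b : ℝ) :
    ‖field b f x‖ ≤ ∑ i, ‖weakPartial i (weakPartial i f) x‖ + |b| * ∑ k, ‖weakPartial k f x‖ := by
  have h1 : ‖cross (f x) (∑ i, weakPartial i (weakPartial i f) x)‖ ≤
      ∑ i, ‖weakPartial i (weakPartial i f) x‖ :=
    (norm_cross_le _ _).trans (by rw [h, one_mul]; exact norm_sum_le _ _)
  have h2 : ‖∑ k : Fin 2, f x k.castSucc • weakPartial k f x‖ ≤ ∑ k, ‖weakPartial k f x‖ := by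
    refine norm_sum_le_of_le _ fun k _ => ?_
    rw [norm_smul]
    exact mul_le_of_le_one_left (norm_nonneg _) (h ▸ PiLp.norm_apply_le _ _)
  rw [field]
  refine (norm_sub_le _ _).trans ?_
  rw [norm_neg, norm_smul, Real.norm_eq_abs]
  exact add_le_add h1 (mul_le_mul_of_nonneg_left h2 (abs_nonneg _))

lemma SphereMap.integral_field_le {f : Plane → Space} (h : SphereMap M f) (b : ℝ) :
    ∫ x, ‖field b f x‖ ^ 2 ≤ 8 * (1 + b ^ 2) * M ^ 2 := by
  have i2 := fun i => (h.mem_two i i).norm.integrable_sq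
  have i1 := fun i => (h.mem_one i).norm.integrable_sq
  have : ∫ x, ‖field b f x‖ ^ 2 ≤ ∫ x, ((4 * ∑ i, ‖weakPartial i (weakPartial i f) x‖ ^ 2) +
      4 * b ^ 2 * ∑ k, ‖weakPartial k f x‖ ^ 2) := by
    refine integral_mono_ae (h.memLp_field b).norm.integrable_sq
      (((integrable_finsetSum _ fun i _ => i2 i).const_mul 4).add
        ((integrable_finsetSum _ fun i _ => i1 i).const_mul (4 * b ^ 2))) ?_
    filter_upwards [h.sphere] with x hx
    have := norm_field_le hx b
    simp only [Fin.sum_univ_two] at this ⊢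
    have h0 := norm_nonneg (field b f x)
    have e := sq_abs b
    set p := ‖weakPartial 0 (weakPartial 0 f) x‖
    set q := ‖weakPartial 1 (weakPartial 1 f) x‖
    set r := ‖weakPartial 0 f x‖
    set s := ‖weakPartial 1 f x‖
    refine (pow_le_pow_left₀ h0 this 2).trans ?_
    rw [← e]
    nlinarith [sq_nonneg (p - q), sq_nonneg (p - |b| * r), sq_nonneg (p - |b| * s),
      sq_nonneg (q - |b| * r), sq_nonneg (q - |b| * s), sq_nonneg (|b| * r - |b| * s)]
  refine this.trans ?_
  rw [integral_add ((integrable_finsetSum _ fun i _ => i2 i).const_mul 4)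
    ((integrable_finsetSum _ fun i _ => i1 i).const_mul (4 * b ^ 2)), integral_const_mul,
    integral_const_mul, integral_finsetSum _ fun i _ => i2 i, integral_finsetSum _ fun i _ => i1 i]
  simp only [Fin.sum_univ_two]
  nlinarith [h.bound_two 0 0, h.bound_two 1 1, mul_le_mul_of_nonneg_left (h.bound_one 0) (sq_nonneg b),
    mul_le_mul_of_nonneg_left (h.bound_one 1) (sq_nonneg b)]

namespace Flow

variable {I : Set ℝ} {u : ℝ → Plane → Space} {t : ℝ} (h : Flow M I u)
include h

lemma wl_field (hM : 0 ≤ M) (b : ℝ) (ht : t ∈ I) :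
    WL (𝓝[I] t) (fun s => field b (u s)) (field b (u t)) := by
  intro A hA
  -- The map is moved across the vector product onto A, so that the weakly convergent second
  -- derivatives are paired with a factor converging strongly in L².
  have e : ∀ s ∈ I, ∫ x, inner ℝ (A x) (field b (u s) x) =
      - (∑ i, ∫ x, inner ℝ (crossB (A x) (u s x)) (weakPartial i (weakPartial i (u s)) x)) -
      b * ∑ k : Fin 2, ∫ x, inner ℝ (A x) (smulB
        (coordL k.castSucc (u s x)) (weakPartial k (u s) x)) := by
    intro s hs
    have hm := h.map s hs
    have m0 : MemLp (fun x => crossB (A x) (u s x)) 2 volume :=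
      memLp_crossB' hA hm.mem_top
    have m2 : ∀ k : Fin 2, MemLp (fun x => smulB
        (coordL k.castSucc (u s x)) (weakPartial k (u s) x)) 2 volume := fun k =>
      memLp_smulB ((coordL _).comp_memLp' hm.mem_top) (hm.mem_one k)
    rw [← integral_finsetSum _ fun i _ => integrable_inner m0 (hm.mem_two i i),
      ← integral_finsetSum _ fun i _ => integrable_inner hA (m2 i), ← integral_const_mul,
      ← integral_neg, ← integral_sub]
    · refine integral_congr_ae (ae_of_all _ fun x => ?_)
      simp only [inner_field, smulB_apply, coordL_apply,
        crossB_apply, inner_smul_right]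
    · exact (integrable_finsetSum _ fun i _ => integrable_inner m0 (hm.mem_two i i)).neg
    · exact (integrable_finsetSum _ fun i _ => integrable_inner hA (m2 i)).const_mul b
  rw [e t ht]
  refine Tendsto.congr' (by filter_upwards [self_mem_nhdsWithin] with s hs using (e s hs).symm) ?_
  have T := h.tl_top ht
  have c := TL.bilin (r := 2) (by norm_num) crossB (TL.const (l := 𝓝[I] t) hA) T
  refine ((tendsto_finsetSum _ fun i _ => ?_).neg).sub
    ((tendsto_finsetSum _ fun k _ => ?_).const_mul b)
  · exact (h.wl_two ht hM i i).pair c (M ^ 2) ((h.ev_map ht).mono fun s hs =>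
      ⟨hs.mem_two i i, hs.bound_two i i⟩)
  · exact ((TL.const (l := 𝓝[I] t) hA).bilin (r := 1) le_rfl innerB
      (TL.bilin (r := 2) (by norm_num) smulB
        (T.clm (coordL k.castSucc)) (h.tl_one ht k))).integral

lemma continuousOn_inner_field (hM : 0 ≤ M) (b : ℝ) {A : Plane → Space} (hA : MemLp A 2 volume) :
    ContinuousOn (fun t => ∫ x, inner ℝ (A x) (field b (u t) x)) I :=
  fun _ ht => h.wl_field hM b ht A hA

lemma abs_inner_field_le (b : ℝ) {A : Plane → Space} (hA : MemLp A 2 volume) (ht : t ∈ I) :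
    |∫ x, inner ℝ (A x) (field b (u t) x)| ≤ √(∫ x, ‖A x‖ ^ 2) * √(8 * (1 + b ^ 2) * M ^ 2) :=
  (abs_integral_inner_le hA ((h.map t ht).memLp_field b)).trans
    (mul_le_mul_of_nonneg_left (Real.sqrt_le_sqrt ((h.map t ht).integral_field_le b))
      (Real.sqrt_nonneg _))

lemma memLp_sub {s : ℝ} (hs : s ∈ I) (ht : t ∈ I) : MemLp (fun x => u t x - u s x) 2 volume := by
  have := (h.map t ht).mem.sub (h.map s hs).mem
  refine (memLp_congr_ae (ae_of_all _ fun x => ?_)).1 this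
  simp

end Flow

/-- A flow solving the equation, tested with functions in `L²`. -/
structure Evolution (b M : ℝ) (I : Set ℝ) (u : ℝ → Plane → Space) : Prop extends Flow M I u where
  increment : ∀ A : Plane → Space, MemLp A 2 volume → ∀ s ∈ I, ∀ t ∈ I,
    ∫ x, inner ℝ (A x) (u t x - u s x) = ∫ r in s..t, ∫ x, inner ℝ (A x) (field b (u r) x)

lemma Evolution.mono {b : ℝ} {I J : Set ℝ} {u : ℝ → Plane → Space} (h : Evolution b M I u)
    (hJ : J ⊆ I) : Evolution b M J u :=
  ⟨h.toFlow.mono hJ, fun A hA s hs t ht => h.increment A hA s (hJ hs) t (hJ ht)⟩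

lemma continuousOn_of_inner {V : ℝ → Space} {I : Set ℝ}
    (h : ∀ e : Space, ContinuousOn (fun r => inner ℝ e (V r)) I) : ContinuousOn V I := by
  have e : V = fun r => ∑ k, inner ℝ (EuclideanSpace.basisFun (Fin 3) ℝ k) (V r) •
      EuclideanSpace.basisFun (Fin 3) ℝ k := by
    ext1 r; exact (OrthonormalBasis.sum_repr' _ _).symm
  rw [e]
  exact continuousOn_finsetSum _ fun k _ => (h _).smul continuousOn_const

/-- The H² bound is given at almost every time only. Such times are dense, the maps are continuous
in L² in time, and H² balls are closed in L², so the bound holds at every time with the same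
constant. -/
lemma IsSolution.flow {b T : ℝ} {u : ℝ → Plane → Space} (hT : 0 < T) (hu : IsSolution b T u)
    (hM : 0 ≤ M) (h : linftyH2 T u ≤ ENNReal.ofReal M) : Flow M (Icc 0 T) u := by
  have ae : ∀ᵐ t ∂(volume.restrict (Icc 0 T)), H2Map M (u t) := by
    filter_upwards [ae_le_essSup (f := fun t => h2Norm (fun x => u t x - kVec))
      (μ := volume.restrict (Icc 0 T))] with t ht
    exact H2Map.of_h2Norm hM (ht.trans h)
  refine ⟨fun t ht => ⟨?_, hu.sphere t ht⟩, hu.continuous_L2, hu.continuous_Linfty⟩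
  let S : Set ℝ := {s | s ∈ Icc 0 T ∧ H2Map M (u s)}
  have hS : (𝓝[S] t).NeBot := by
    rw [← mem_closure_iff_nhdsWithin_neBot]
    rw [ae_restrict_iff' measurableSet_Icc] at ae
    have d : Dense {s : ℝ | s ∈ Icc 0 T → H2Map M (u s)} := Measure.dense_of_ae ae
    have : Ioo 0 T ∩ {s : ℝ | s ∈ Icc 0 T → H2Map M (u s)} ⊆ S := fun s hs =>
      ⟨Ioo_subset_Icc_self hs.1, hs.2 (Ioo_subset_Icc_self hs.1)⟩
    refine closure_minimal ((d.open_subset_closure_inter isOpen_Ioo).trans (closure_mono this))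
      isClosed_closure ?_
    rw [closure_Ioo hT.ne]
    exact ht
  refine (H2Map.of_ultrafilter (Ultrafilter.of (𝓝[S] t)) hM ?_ (hu.memL2 t ht)
    ((hu.continuous_L2 t ht).mono_left ?_)).1
  · exact Filter.mem_of_superset ((Ultrafilter.of_le _) self_mem_nhdsWithin) fun s hs => hs.2
  · exact (Ultrafilter.of_le _).trans (nhdsWithin_mono _ fun s hs => hs.1)

/-- The equation is tested with scalar test functions times fixed vectors, hence with vector-valued
test functions, hence, by density and the uniform L² bound on the right-hand side, with all of L².
This allows the energy factors, which are merely square-integrable, as test functions. -/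
lemma IsSolution.evolution {b T : ℝ} {u : ℝ → Plane → Space} (hT : 0 < T) (hu : IsSolution b T u)
    (hM : 0 ≤ M) (h : linftyH2 T u ≤ ENNReal.ofReal M) : Evolution b M (Icc 0 T) u := by
  have hf := hu.flow hT hM h
  have h0 : (0 : ℝ) ∈ Icc 0 T := ⟨le_rfl, hT.le⟩
  have ii : ∀ A : Plane → Space, MemLp A 2 volume → ∀ s ∈ Icc 0 T, ∀ t ∈ Icc 0 T, IntervalIntegrable
      (fun r => ∫ x, inner ℝ (A x) (field b (u r) x)) volume s t := fun A hA s hs t ht =>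
    ((hf.continuousOn_inner_field hM b hA).mono (uIcc_subset_Icc hs ht)).intervalIntegrable
  -- test functions
  have h1 : ∀ φ : Plane → ℝ, ContDiff ℝ ∞ φ → HasCompactSupport φ → ∀ e : Space, ∀ t ∈ Icc 0 T,
      ∫ x, inner ℝ (φ x • e) (u t x - u 0 x) =
        ∫ r in (0 : ℝ)..t, ∫ x, inner ℝ (φ x • e) (field b (u r) x) := by
    intro φ hφ hc e t ht
    have sw : ∀ g : Plane → Space, LocallyIntegrable g volume →
        inner ℝ e (∫ x, φ x • g x) = ∫ x, inner ℝ (φ x • e) (g x) := by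
      intro g hg
      rw [← integral_inner (hg.integrable_smul_left_of_hasCompactSupport hφ.continuous hc)]
      simp only [real_inner_smul_left, real_inner_smul_right]
    have mf : ∀ r ∈ Icc 0 T, LocallyIntegrable (field b (u r)) volume := fun r hr =>
      ((hf.map r hr).memLp_field b).locallyIntegrable (by norm_num)
    have ei : ∀ r ∈ Icc 0 T, ∫ x, φ x • llRHS b (u r) x = ∫ x, φ x • field b (u r) x := fun r hr =>
      integral_congr_ae (by filter_upwards [(hf.map r hr).llRHS_eq b] with x hx; rw [hx])
    have sub : uIcc 0 t ⊆ Icc 0 T := uIcc_subset_Icc h0 ht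
    have ci : ContinuousOn (fun r => ∫ x, φ x • field b (u r) x) (Icc 0 T) := by
      refine continuousOn_of_inner fun e' => ?_
      have := hf.continuousOn_inner_field hM b (A := fun x => φ x • e')
        ((hφ.continuous.smul continuous_const).memLp_of_hasCompactSupport hc.smul_right)
      refine this.congr fun r hr => ?_
      have hl := mf r hr
      rw [← integral_inner (hl.integrable_smul_left_of_hasCompactSupport hφ.continuous hc)]
      simp only [real_inner_smul_left, real_inner_smul_right]
    rw [← sw (fun x => u t x - u 0 x) ((hf.memLp_sub h0 ht).locallyIntegrable (by norm_num)),
      hu.equation φ hφ hc t ht,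
      intervalIntegral.integral_congr (g := fun r => ∫ x, φ x • field b (u r) x)
        (fun r hr => ei r (sub hr))]
    have := (innerSL ℝ e).intervalIntegral_comp_comm (μ := volume) (ci.mono sub).intervalIntegrable
    rw [innerSL_apply_apply] at this
    rw [← this]
    exact intervalIntegral.integral_congr fun r hr => by
      rw [innerSL_apply_apply]; exact sw _ (mf r (sub hr))
  have h2 : ∀ t ∈ Icc 0 T, ∀ A : Plane → Space, MemLp A 2 volume →
      ∫ x, inner ℝ (A x) (u t x - u 0 x) =
        ∫ r in (0 : ℝ)..t, ∫ x, inner ℝ (A x) (field b (u r) x) := by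
    intro t ht
    have sub : uIcc 0 t ⊆ Icc 0 T := uIcc_subset_Icc h0 ht
    have md := hf.memLp_sub h0 ht
    have add : ∀ {A B : Plane → Space}, MemLp A 2 volume → MemLp B 2 volume →
        ∫ x, inner ℝ (A x) (u t x - u 0 x) =
          ∫ r in (0 : ℝ)..t, ∫ x, inner ℝ (A x) (field b (u r) x) →
        ∫ x, inner ℝ (B x) (u t x - u 0 x) =
          ∫ r in (0 : ℝ)..t, ∫ x, inner ℝ (B x) (field b (u r) x) →
        ∫ x, inner ℝ (A x + B x) (u t x - u 0 x) =
          ∫ r in (0 : ℝ)..t, ∫ x, inner ℝ (A x + B x) (field b (u r) x) := by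
      intro A B hA hB eA eB
      simp only [inner_add_left]
      rw [integral_add (integrable_inner hA md) (integrable_inner hB md), eA, eB,
        ← intervalIntegral.integral_add (ii A hA 0 h0 t ht) (ii B hB 0 h0 t ht)]
      refine intervalIntegral.integral_congr fun r hr => ?_
      have mr := (hf.map r (sub hr)).memLp_field b
      exact (integral_add (integrable_inner hA mr) (integrable_inner hB mr)).symm
    intro A hA
    obtain ⟨φ, φs, φc, tφ⟩ := exists_test_approx hA
    have hφ : ∀ n, ∫ x, inner ℝ (φ n x) (u t x - u 0 x) =
        ∫ r in (0 : ℝ)..t, ∫ x, inner ℝ (φ n x) (field b (u r) x) := by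
      intro n
      have e : ∀ x, φ n x = (φ n x 0 • EuclideanSpace.single 0 (1 : ℝ) +
          φ n x 1 • EuclideanSpace.single 1 (1 : ℝ)) + φ n x 2 • EuclideanSpace.single 2 (1 : ℝ) :=
        fun x => by ext k; fin_cases k <;> simp
      have cs : ∀ k, ContDiff ℝ ∞ (fun x => φ n x k) := fun k => (coordL k).contDiff.comp (φs n)
      have cc : ∀ k, HasCompactSupport (fun x => φ n x k) := fun k =>
        (φc n).comp_left (g := coordL k) (map_zero _)
      have m : ∀ k (e : Space), MemLp (fun x => φ n x k • e) 2 volume := fun k e =>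
        ((cs k).continuous.smul continuous_const).memLp_of_hasCompactSupport (cc k).smul_right
      have := add ((m 0 (EuclideanSpace.single 0 1)).add (m 1 (EuclideanSpace.single 1 1)))
        (m 2 (EuclideanSpace.single 2 1)) (add (m 0 _) (m 1 _) (h1 _ (cs 0) (cc 0) _ t ht)
          (h1 _ (cs 1) (cc 1) _ t ht)) (h1 _ (cs 2) (cc 2) _ t ht)
      simp only [Pi.add_apply, ← e] at this
      exact this
    have t1 := (tφ.bilin (r := 1) le_rfl innerB (TL.const md)).integral
    have t2 : Tendsto (fun n => ∫ r in (0 : ℝ)..t, ∫ x, inner ℝ (φ n x) (field b (u r) x)) atTop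
        (𝓝 (∫ r in (0 : ℝ)..t, ∫ x, inner ℝ (A x) (field b (u r) x))) := by
      have d : TL 2 atTop (fun n x => φ n x - A x) (fun _ => (0 : Space)) := by
        simpa using tφ.sub (by norm_num) (TL.const hA)
      have t' := (((Real.continuous_sqrt.tendsto _).comp d.integral_normSq).mul_const
        √(8 * (1 + b ^ 2) * M ^ 2)).mul_const |t - 0|
      simp only [norm_zero, ne_eq, OfNat.ofNat_ne_zero, not_false_eq_true, zero_pow, integral_zero,
        Real.sqrt_zero, zero_mul] at t'
      rw [tendsto_iff_norm_sub_tendsto_zero]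
      refine squeeze_zero' (Eventually.of_forall fun n => norm_nonneg _) ?_ t'
      filter_upwards [tφ.memF] with n hn
      rw [← intervalIntegral.integral_sub (ii _ hn 0 h0 t ht) (ii _ hA 0 h0 t ht)]
      refine intervalIntegral.norm_integral_le_of_norm_le_const fun r hr => ?_
      have hr' := sub (uIoc_subset_uIcc hr)
      have mr := (hf.map r hr').memLp_field b
      rw [← integral_sub (integrable_inner hn mr) (integrable_inner hA mr)]
      simp only [← inner_sub_left]
      exact hf.abs_inner_field_le b (hn.sub hA) hr'
    exact tendsto_nhds_unique t1 (t2.congr fun n => (hφ n).symm)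
  refine ⟨hf, fun A hA s hs t ht => ?_⟩
  have e : ∀ x, u t x - u s x = (u t x - u 0 x) - (u s x - u 0 x) := fun x => by abel
  simp only [e, inner_sub_right (A _) (_ - _)]
  rw [integral_sub (integrable_inner hA (hf.memLp_sub h0 ht))
    (integrable_inner hA (hf.memLp_sub h0 hs)), h2 t ht A hA, h2 s hs A hA]
  exact intervalIntegral.integral_interval_sub_left (ii A hA 0 h0 t ht) (ii A hA 0 h0 s hs)

end Time
end LLHelicity

namespace LLHelicity
set_option linter.unusedSectionVars false

/-! ### Pointwise estimates -/

section Pointwise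

lemma triple_swap (x y z : Space) : triple x y z = - triple x z y := by
  simp only [triple_eq]; ring

lemma abs_mul_le {a b A B : ℝ} (ha : |a| ≤ A) (hb : |b| ≤ B) : |a * b| ≤ A * B := by
  rw [abs_mul]; exact mul_le_mul ha hb (abs_nonneg _) ((abs_nonneg _).trans ha)

lemma abs_inner_le' {a b : Space} {A B : ℝ} (ha : ‖a‖ ≤ A) (hb : ‖b‖ ≤ B) :
    |inner ℝ a b| ≤ A * B :=
  (abs_real_inner_le_norm _ _).trans (mul_le_mul ha hb (norm_nonneg _) ((norm_nonneg _).trans ha))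

lemma abs_triple_le' {a b c : Space} {A B C : ℝ} (ha : ‖a‖ ≤ A) (hb : ‖b‖ ≤ B) (hc : ‖c‖ ≤ C) :
    |triple a b c| ≤ A * B * C :=
  (abs_triple_le _ _ _).trans (mul_le_mul (mul_le_mul ha hb (norm_nonneg _)
    ((norm_nonneg _).trans ha)) hc (norm_nonneg _)
      (mul_nonneg ((norm_nonneg _).trans ha) ((norm_nonneg _).trans hb)))

/-- The weight controlling all error terms. -/
def weight (r s p h : ℝ) : ℝ := r * (1 + h + p ^ 2) + s * (1 + p)

section Weight
variable {r s p h : ℝ} (hr : 0 ≤ r) (hs : 0 ≤ s) (hp : 0 ≤ p) (hh : 0 ≤ h) (hsp : s ≤ p)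
include hr hs hp hh

lemma weight_nonneg : 0 ≤ weight r s p h := by unfold weight; positivity
lemma le_weight_r : r ≤ weight r s p h := by
  have : weight r s p h = r + (r * h + r * p ^ 2 + s * (1 + p)) := by unfold weight; ring
  rw [this]; exact le_add_of_nonneg_right (by positivity)
lemma le_weight_s : s ≤ weight r s p h := by
  have : weight r s p h = s + (r * (1 + h + p ^ 2) + s * p) := by unfold weight; ring
  rw [this]; exact le_add_of_nonneg_right (by positivity)
lemma le_weight_rh : r * h ≤ weight r s p h := by
  have : weight r s p h = r * h + (r + r * p ^ 2 + s * (1 + p)) := by unfold weight; ring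
  rw [this]; exact le_add_of_nonneg_right (by positivity)
lemma le_weight_rpp : r * p ^ 2 ≤ weight r s p h := by
  have : weight r s p h = r * p ^ 2 + (r + r * h + s * (1 + p)) := by unfold weight; ring
  rw [this]; exact le_add_of_nonneg_right (by positivity)
lemma le_weight_sp : s * p ≤ weight r s p h := by
  have : weight r s p h = s * p + (r * (1 + h + p ^ 2) + s) := by unfold weight; ring
  rw [this]; exact le_add_of_nonneg_right (by positivity)
lemma le_weight_rp : r * p ≤ weight r s p h := by
  have h1 : r * p ≤ r * (1 + p ^ 2) := mul_le_mul_of_nonneg_left (by nlinarith [sq_nonneg (p - 1)]) hr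
  have : weight r s p h = r * (1 + p ^ 2) + (r * h + s * (1 + p)) := by unfold weight; ring
  rw [this]; exact h1.trans (le_add_of_nonneg_right (by positivity))
lemma le_weight_rH : r * (1 + h + p ^ 2) ≤ weight r s p h :=
  le_add_of_nonneg_right (by positivity)

end Weight

variable {w q wm qm wk qk wmm qmm wkk qkk wmk qmk : Space} {r s p h : ℝ}

/-- The three groups on the left are the leading part of the energy derivative, the null form and
the flux. Cramer's rule with respect to w is applied to [w_m, q_kk, q_m], [w_k, q_mk, q_m] and [q,
w_kk, q_mm]. The component q_m·w = -X produces the terms that cancel the X-part and part of the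
flux; w_kk·w has the part -|w_k|², which is not small and is removed by the rest of the flux. -/
lemma core_identity (X : ℝ) (X' : ℝ) (hX : inner ℝ qm w = -X) (hqw : inner ℝ q w = (0 : ℝ))
    (hn : ‖w‖ ^ 2 + ‖q‖ ^ 2 / 4 = 1)
    (h5 : inner ℝ wkk w = -‖wk‖ ^ 2 - (inner ℝ qkk q + ‖qk‖ ^ 2) / 4) :
    (triple w qkk qmm + triple q wkk qmm + X * (triple w qkk wm + triple q wkk wm)) -
      (triple w qkk qmm + triple wm qkk qm - triple wk qmk qm) -
      (2 * inner ℝ wk wmk * triple w q qm + ‖wk‖ ^ 2 * (triple wm q qm + triple w q qmm) -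
        X' * triple wk qk w - X * (triple wmk qk w + triple wk qmk w + triple wk qk wm)) =
    (- ((‖q‖ ^ 2 / 4) * triple wm qkk qm) - inner ℝ wm w * triple w qkk qm -
        inner ℝ qkk w * triple wm w qm) +
      ((‖q‖ ^ 2 / 4) * triple wk qmk qm + inner ℝ wk w * triple w qmk qm +
        inner ℝ qmk w * triple wk w qm) +
      ((‖q‖ ^ 2 / 4) * triple q wkk qmm + (inner ℝ qkk q + ‖qk‖ ^ 2) / 4 * triple w q qmm +
        inner ℝ qmm w * triple q wkk w) +
      (X * triple q wkk wm - 2 * inner ℝ wk wmk * triple w q qm - ‖wk‖ ^ 2 * triple wm q qm +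
        X' * triple wk qk w + X * triple wmk qk w + X * triple wk qk wm) := by
  have c1 := cramer w wm qkk qm
  have c2 := cramer w wk qmk qm
  have c3 := cramer w q wkk qmm
  have s1 : triple wm qkk w = - triple w qkk wm := by simp only [triple_eq]; ring
  have s2 : triple q w qmm = - triple w q qmm := by simp only [triple_eq]; ring
  rw [hX, s1] at c1
  rw [hX] at c2
  rw [hqw, h5, s2] at c3
  have hn' : ‖w‖ ^ 2 = 1 - ‖q‖ ^ 2 / 4 := by linarith
  rw [hn'] at c1 c2 c3
  linear_combination -c1 + c2 + c3

/-- The hypotheses on inner products with w are the differentiated constraints, which trade a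
component along w for products containing q or ∇q. After the cancellations each remaining term has
two such small factors and fits under a product of two summands of `weight`; the constant is
generous. -/
lemma core_bound (X X' : ℝ) (hX : inner ℝ qm w = -X) (hqw : inner ℝ q w = (0 : ℝ))
    (hn : ‖w‖ ^ 2 + ‖q‖ ^ 2 / 4 = 1) (hXe : X = inner ℝ wm q)
    (hX' : X' = inner ℝ wmm q + inner ℝ wm qm)
    (h1 : inner ℝ wm w = - inner ℝ qm q / 4) (h2 : inner ℝ wk w = - inner ℝ qk q / 4)
    (h3 : inner ℝ qkk w = - (inner ℝ wkk q + 2 * inner ℝ wk qk))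
    (h4 : inner ℝ qmk w = - (inner ℝ wmk q + inner ℝ wk qm + inner ℝ wm qk))
    (h4' : inner ℝ qmm w = - (inner ℝ wmm q + 2 * inner ℝ wm qm))
    (h5 : inner ℝ wkk w = -‖wk‖ ^ 2 - (inner ℝ qkk q + ‖qk‖ ^ 2) / 4)
    (br : ‖q‖ = r) (bqm : ‖qm‖ ≤ s) (bqk : ‖qk‖ ≤ s) (bwm : ‖wm‖ ≤ p) (bwk : ‖wk‖ ≤ p)
    (bwmm : ‖wmm‖ ≤ h) (bqmm : ‖qmm‖ ≤ h) (bwkk : ‖wkk‖ ≤ h) (bqkk : ‖qkk‖ ≤ h) (bwmk : ‖wmk‖ ≤ h)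
    (bqmk : ‖qmk‖ ≤ h) (hsp : s ≤ p) :
    |(triple w qkk qmm + triple q wkk qmm + X * (triple w qkk wm + triple q wkk wm)) -
      (triple w qkk qmm + triple wm qkk qm - triple wk qmk qm) -
      (2 * inner ℝ wk wmk * triple w q qm + ‖wk‖ ^ 2 * (triple wm q qm + triple w q qmm) -
        X' * triple wk qk w - X * (triple wmk qk w + triple wk qmk w + triple wk qk wm))| ≤
      100 * weight r s p h ^ 2 := by
  rw [core_identity X X' hX hqw hn h5]
  have hr0 : 0 ≤ r := br ▸ norm_nonneg _
  have hs0 : 0 ≤ s := (norm_nonneg _).trans bqm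
  have hp0 : 0 ≤ p := (norm_nonneg _).trans bwm
  have hh0 : 0 ≤ h := (norm_nonneg _).trans bwmm
  have hw1 : ‖w‖ ≤ 1 := by nlinarith [sq_nonneg ‖q‖, norm_nonneg w]
  have hr2 : r ≤ 2 := by rw [br] at hn; nlinarith [sq_nonneg ‖w‖]
  have bq : ‖q‖ ≤ r := br.le
  have bX : |X| ≤ p * r := hXe ▸ abs_inner_le' bwm bq
  have bX' : |X'| ≤ h * r + p * s := by
    rw [hX']; exact (abs_add_le _ _).trans (add_le_add (abs_inner_le' bwmm bq) (abs_inner_le' bwm bqm))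
  have bwmw : |inner ℝ wm w| ≤ s * r / 4 := by
    rw [h1, abs_div, abs_neg, abs_of_pos (by norm_num : (0:ℝ) < 4)]
    exact div_le_div_of_nonneg_right (abs_inner_le' bqm bq) (by norm_num)
  have bwkw : |inner ℝ wk w| ≤ s * r / 4 := by
    rw [h2, abs_div, abs_neg, abs_of_pos (by norm_num : (0:ℝ) < 4)]
    exact div_le_div_of_nonneg_right (abs_inner_le' bqk bq) (by norm_num)
  have two : |(2 : ℝ)| ≤ 2 := by norm_num
  have bqkkw : |inner ℝ qkk w| ≤ h * r + 2 * (p * s) := by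
    rw [h3, abs_neg]
    exact (abs_add_le _ _).trans (add_le_add (abs_inner_le' bwkk bq) (abs_mul_le two (abs_inner_le' bwk bqk)))
  have bqmmw : |inner ℝ qmm w| ≤ h * r + 2 * (p * s) := by
    rw [h4', abs_neg]
    exact (abs_add_le _ _).trans (add_le_add (abs_inner_le' bwmm bq) (abs_mul_le two (abs_inner_le' bwm bqm)))
  have bqmkw : |inner ℝ qmk w| ≤ h * r + p * s + p * s := by
    rw [h4, abs_neg]
    exact (abs_add_le _ _).trans (add_le_add ((abs_add_le _ _).trans
      (add_le_add (abs_inner_le' bwmk bq) (abs_inner_le' bwk bqm))) (abs_inner_le' bwm bqk))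
  have bn : |‖q‖ ^ 2 / 4| ≤ r ^ 2 / 4 := by rw [br, abs_of_nonneg (by positivity)]
  have bc : |(inner ℝ qkk q + ‖qk‖ ^ 2) / 4| ≤ (h * r + s * s) / 4 := by
    rw [abs_div, abs_of_pos (by norm_num : (0:ℝ) < 4)]
    refine div_le_div_of_nonneg_right ((abs_add_le _ _).trans (add_le_add (abs_inner_le' bqkk bq) ?_))
      (by norm_num)
    rw [sq]; exact abs_mul_le (by simpa using bqk) (by simpa using bqk)
  have bk : |‖wk‖ ^ 2| ≤ p * p := by
    rw [sq]; exact abs_mul_le (by simpa using bwk) (by simpa using bwk)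
  have a1 := abs_le.1 (abs_mul_le bn (abs_triple_le' bwm bqkk bqm))
  have a2 := abs_le.1 (abs_mul_le bwmw (abs_triple_le' hw1 bqkk bqm))
  have a3 := abs_le.1 (abs_mul_le bqkkw (abs_triple_le' bwm hw1 bqm))
  have a4 := abs_le.1 (abs_mul_le bn (abs_triple_le' bwk bqmk bqm))
  have a5 := abs_le.1 (abs_mul_le bwkw (abs_triple_le' hw1 bqmk bqm))
  have a6 := abs_le.1 (abs_mul_le bqmkw (abs_triple_le' bwk hw1 bqm))
  have a7 := abs_le.1 (abs_mul_le bn (abs_triple_le' bq bwkk bqmm))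
  have a8 := abs_le.1 (abs_mul_le bc (abs_triple_le' hw1 bq bqmm))
  have a9 := abs_le.1 (abs_mul_le bqmmw (abs_triple_le' bq bwkk hw1))
  have a10 := abs_le.1 (abs_mul_le bX (abs_triple_le' bq bwkk bwm))
  have a11 := abs_le.1 (abs_mul_le (abs_mul_le two (abs_inner_le' bwk bwmk))
    (abs_triple_le' hw1 bq bqm))
  have a12 := abs_le.1 (abs_mul_le bk (abs_triple_le' bwm bq bqm))
  have a13 := abs_le.1 (abs_mul_le bX' (abs_triple_le' bwk bqk hw1))
  have a14 := abs_le.1 (abs_mul_le bX (abs_triple_le' bwmk bqk hw1))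
  have a15 := abs_le.1 (abs_mul_le bX (abs_triple_le' bwk bqk bwm))
  have K0 := weight_nonneg hr0 hs0 hp0 hh0
  have k1 := le_weight_rh hr0 hs0 hp0 hh0
  have k2 := le_weight_sp hr0 hs0 hp0 hh0
  have k3 := le_weight_rp hr0 hs0 hp0 hh0
  have k4 := le_weight_rpp hr0 hs0 hp0 hh0
  set K := weight r s p h with hK
  have n1 : 0 ≤ r * h := by positivity
  have n2 : 0 ≤ s * p := by positivity
  have n3 : 0 ≤ r * p := by positivity
  have n4 : 0 ≤ r * p ^ 2 := by positivity
  have m11 : r * h * (r * h) ≤ K * K := mul_le_mul k1 k1 n1 K0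
  have m12 : r * h * (s * p) ≤ K * K := mul_le_mul k1 k2 n2 K0
  have m22 : s * p * (s * p) ≤ K * K := mul_le_mul k2 k2 n2 K0
  have m14 : r * h * (r * p ^ 2) ≤ K * K := mul_le_mul k1 k4 n4 K0
  have m24 : s * p * (r * p ^ 2) ≤ K * K := mul_le_mul k2 k4 n4 K0
  have m12r : r * (r * h * (s * p)) ≤ 2 * (K * K) := mul_le_mul hr2 m12 (by positivity) (by norm_num)
  have m11r : r * (r * h * (r * h)) ≤ 2 * (K * K) := mul_le_mul hr2 m11 (by positivity) (by norm_num)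
  have m12s : r * h * (s * s) ≤ K * K :=
    (mul_le_mul_of_nonneg_left (mul_le_mul_of_nonneg_left hsp hs0) n1).trans m12
  rw [abs_le]
  rw [sq K]
  constructor <;> linarith

/-- These are the terms of the first variation that need no cancellation: each coefficient together
with its paired vector contains q or ∇q at least twice, so only the size of the right-hand sides N
enters. The variables z and n₀ stand for ζ and the constant in that size. -/
lemma lower_bound (X Y X' Y' z Z n₀ : ℝ) {Nq Nw : Space}
    (hXe : X = inner ℝ wm q) (hYe : Y = inner ℝ q qm)
    (hX' : X' = inner ℝ wmm q + inner ℝ wm qm) (hY' : Y' = inner ℝ qm qm + inner ℝ q qmm)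
    (hz0 : 0 ≤ z) (hzZ : z ≤ Z) (hz : z * (4 - ‖q‖ ^ 2) = 2) (hr2 : ‖q‖ ≤ 2)
    (br : ‖q‖ = r) (bqm : ‖qm‖ ≤ s) (bwm : ‖wm‖ ≤ p) (bwmm : ‖wmm‖ ≤ h) (bqmm : ‖qmm‖ ≤ h)
    (hsp : s ≤ p) (hn : 0 ≤ n₀) (hNq : ‖Nq‖ ≤ n₀ * (1 + h + p ^ 2))
    (hNw : ‖Nw‖ ≤ n₀ * (1 + h + p ^ 2)) :
    |-(z ^ 2 * X ^ 2 * inner ℝ q Nq) - (2 * z - 1) * X * inner ℝ wm Nq -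
        (z ^ 2 * Y ^ 2 + 2 * z * Y') / 4 * inner ℝ q Nq +
        2 * (z ^ 2 * Y * X * inner ℝ q Nw + z * X' * inner ℝ q Nw + z * X * inner ℝ qm Nw)| ≤
      20 * (Z + Z ^ 2) * n₀ * weight r s p h ^ 2 := by
  have hr0 : 0 ≤ r := br ▸ norm_nonneg _
  have hs0 : 0 ≤ s := (norm_nonneg _).trans bqm
  have hp0 : 0 ≤ p := (norm_nonneg _).trans bwm
  have hh0 : 0 ≤ h := (norm_nonneg _).trans bwmm
  have hZ0 : 0 ≤ Z := hz0.trans hzZ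
  have bq : ‖q‖ ≤ r := br.le
  rw [br] at hr2 hz
  set n := n₀ * (1 + h + p ^ 2) with hn_def
  have hn0 : 0 ≤ n := by positivity
  have bX : |X| ≤ p * r := hXe ▸ abs_inner_le' bwm bq
  have bY : |Y| ≤ r * s := hYe ▸ abs_inner_le' bq bqm
  have bX' : |X'| ≤ h * r + p * s := by
    rw [hX']; exact (abs_add_le _ _).trans (add_le_add (abs_inner_le' bwmm bq) (abs_inner_le' bwm bqm))
  have bY' : |Y'| ≤ s * s + r * h := by
    rw [hY']; exact (abs_add_le _ _).trans (add_le_add (abs_inner_le' bqm bqm) (abs_inner_le' bq bqmm))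
  have bz : |z| ≤ Z := by rwa [abs_of_nonneg hz0]
  have bz2 : |z ^ 2| ≤ Z ^ 2 := by
    rw [abs_of_nonneg (by positivity)]; exact pow_le_pow_left₀ hz0 hzZ 2
  -- The relation z(4 - |q|²) = 2 says 2z - 1 = z|q|²/2: ζ differs from its value at coinciding
  -- points by a term quadratic in q.
  have b2 : |2 * z - 1| ≤ Z * r ^ 2 / 2 := by
    have : 2 * z - 1 = z * r ^ 2 / 2 := by linarith
    rw [this, abs_of_nonneg (by positivity)]
    have := mul_le_mul_of_nonneg_right hzZ (sq_nonneg r)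
    linarith
  have bX2 : |X ^ 2| ≤ (p * r) * (p * r) := by rw [sq]; exact abs_mul_le bX bX
  have bY2 : |Y ^ 2| ≤ (r * s) * (r * s) := by rw [sq]; exact abs_mul_le bY bY
  have a1 := abs_mul_le (abs_mul_le bz2 bX2) (abs_inner_le' bq hNq)
  have a2 := abs_mul_le (abs_mul_le b2 bX) (abs_inner_le' bwm hNq)
  have a3 := abs_mul_le (abs_mul_le bz2 bY2) (abs_inner_le' bq hNq)
  have a4 := abs_mul_le (abs_mul_le bz bY') (abs_inner_le' bq hNq)
  have a5 := abs_mul_le (abs_mul_le (abs_mul_le bz2 bY) bX) (abs_inner_le' bq hNw)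
  have a6 := abs_mul_le (abs_mul_le bz bX') (abs_inner_le' bq hNw)
  have a7 := abs_mul_le (abs_mul_le bz bX) (abs_inner_le' bqm hNw)
  have K0 := weight_nonneg hr0 hs0 hp0 hh0
  have k0 := le_weight_rH hr0 hs0 hp0 hh0
  have k1 := le_weight_rh hr0 hs0 hp0 hh0
  have k2 := le_weight_sp hr0 hs0 hp0 hh0
  have k4 := le_weight_rpp hr0 hs0 hp0 hh0
  set K := weight r s p h with hK
  have k5 : s * s ≤ K := (mul_le_mul_of_nonneg_left hsp hs0).trans k2
  have kn : r * n ≤ n₀ * K := by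
    rw [hn_def, mul_left_comm]; exact mul_le_mul_of_nonneg_left k0 hn
  have hrn : 0 ≤ r * n := by positivity
  have e1 : r * p ^ 2 * (r * n) ≤ K * (n₀ * K) := mul_le_mul k4 kn hrn K0
  have e2 : s * s * (r * n) ≤ K * (n₀ * K) := mul_le_mul k5 kn hrn K0
  have e3 : r * h * (r * n) ≤ K * (n₀ * K) := mul_le_mul k1 kn hrn K0
  have e4 : s * p * (r * n) ≤ K * (n₀ * K) := mul_le_mul k2 kn hrn K0
  have r4 : r * r ≤ 4 := by linarith only [mul_self_le_mul_self hr0 hr2]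
  have f1 : Z ^ 2 * (r * (r * p ^ 2 * (r * n))) ≤ Z ^ 2 * (2 * (K * (n₀ * K))) :=
    mul_le_mul_of_nonneg_left (mul_le_mul hr2 e1 (by positivity) (by norm_num)) (by positivity)
  have f2 : Z * (r * (r * p ^ 2 * (r * n))) ≤ Z * (2 * (K * (n₀ * K))) :=
    mul_le_mul_of_nonneg_left (mul_le_mul hr2 e1 (by positivity) (by norm_num)) hZ0
  have f3 : Z ^ 2 * (r * r * (s * s * (r * n))) ≤ Z ^ 2 * (4 * (K * (n₀ * K))) :=
    mul_le_mul_of_nonneg_left (mul_le_mul r4 e2 (by positivity) (by norm_num)) (by positivity)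
  have f4 := mul_le_mul_of_nonneg_left e2 hZ0
  have f5 := mul_le_mul_of_nonneg_left e3 hZ0
  have f6 := mul_le_mul_of_nonneg_left e4 hZ0
  have f7 : Z ^ 2 * (r * r * (s * p * (r * n))) ≤ Z ^ 2 * (4 * (K * (n₀ * K))) :=
    mul_le_mul_of_nonneg_left (mul_le_mul r4 e4 (by positivity) (by norm_num)) (by positivity)
  have g1 : 0 ≤ Z * (K * (n₀ * K)) := by positivity
  have g2 : 0 ≤ Z ^ 2 * (K * (n₀ * K)) := by positivity
  have b1 : |z ^ 2 * X ^ 2 * inner ℝ q Nq| ≤ 2 * (Z ^ 2 * (K * (n₀ * K))) :=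
    a1.trans (by linarith only [f1])
  have b2 : |(2 * z - 1) * X * inner ℝ wm Nq| ≤ Z * (K * (n₀ * K)) :=
    a2.trans (by linarith only [f2])
  have b3 : |z ^ 2 * Y ^ 2 * inner ℝ q Nq| ≤ 4 * (Z ^ 2 * (K * (n₀ * K))) :=
    a3.trans (by linarith only [f3])
  have b4 : |z * Y' * inner ℝ q Nq| ≤ 2 * (Z * (K * (n₀ * K))) :=
    a4.trans (by linarith only [f4, f5])
  have b5 : |z ^ 2 * Y * X * inner ℝ q Nw| ≤ 4 * (Z ^ 2 * (K * (n₀ * K))) :=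
    a5.trans (by linarith only [f7])
  have b6 : |z * X' * inner ℝ q Nw| ≤ 2 * (Z * (K * (n₀ * K))) :=
    a6.trans (by linarith only [f5, f6])
  have b7 : |z * X * inner ℝ qm Nw| ≤ Z * (K * (n₀ * K)) :=
    a7.trans (by linarith only [f6])
  rw [show 20 * (Z + Z ^ 2) * n₀ * K ^ 2 = 20 * (Z * (K * (n₀ * K))) +
    20 * (Z ^ 2 * (K * (n₀ * K))) by ring, show (z ^ 2 * Y ^ 2 + 2 * z * Y') / 4 * inner ℝ q Nq =
    (z ^ 2 * Y ^ 2 * inner ℝ q Nq) / 4 + (z * Y' * inner ℝ q Nq) / 2 by ring]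
  clear_value K
  generalize z ^ 2 * X ^ 2 * inner ℝ q Nq = t1 at *
  generalize (2 * z - 1) * X * inner ℝ wm Nq = t2 at *
  generalize z ^ 2 * Y ^ 2 * inner ℝ q Nq = t3 at *
  generalize z * Y' * inner ℝ q Nq = t4 at *
  generalize z ^ 2 * Y * X * inner ℝ q Nw = t5 at *
  generalize z * X' * inner ℝ q Nw = t6 at *
  generalize z * X * inner ℝ qm Nw = t7 at *
  generalize Z * (K * (n₀ * K)) = g at *
  generalize Z ^ 2 * (K * (n₀ * K)) = g' at *
  rw [abs_le] at b1 b2 b3 b4 b5 b6 b7 ⊢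
  constructor <;> linarith only [b1.1, b1.2, b2.1, b2.2, b3.1, b3.2, b4.1, b4.2, b5.1, b5.2, b6.1,
    b6.2, b7.1, b7.2, g1, g2]

end Pointwise
end LLHelicity

namespace LLHelicity
set_option linter.unusedSectionVars false

/-! ### Pairs of maps, in terms of their mean and their difference -/

section MemLpBilin
variable {E F G : Type*} [NormedAddCommGroup E] [NormedSpace ℝ E] [NormedAddCommGroup F]
  [NormedSpace ℝ F] [NormedAddCommGroup G] [NormedSpace ℝ G] (b : E →L[ℝ] F →L[ℝ] G)
  {f : Plane → E} {g : Plane → F}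

lemma memLp_bilin_four (hf : MemLp f 4 volume) (hg : MemLp g 4 volume) :
    MemLp (fun x => b (f x) (g x)) 2 volume := by
  rw [← lp_one] at hf hg
  have := b.memLp_of_bilin (lp (1 + 1)) hf hg
  rwa [show lp (1 + 1) = 2 from lp_two] at this

lemma memLp_bilin_top_left (hf : MemLp f ⊤ volume) (hg : MemLp g 2 volume) :
    MemLp (fun x => b (f x) (g x)) 2 volume := b.memLp_of_bilin 2 hf hg

lemma memLp_bilin_top_right (hf : MemLp f 2 volume) (hg : MemLp g ⊤ volume) :
    MemLp (fun x => b (f x) (g x)) 2 volume := b.memLp_of_bilin 2 hf hg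

lemma memLp_bilin_two (hf : MemLp f 2 volume) (hg : MemLp g 2 volume) :
    MemLp (fun x => b (f x) (g x)) 1 volume := b.memLp_of_bilin 1 hf hg

end MemLpBilin

/-- The mean `w` and the difference `q` of two maps into the sphere which are nowhere antipodal,
with derivatives of order at most two. -/
structure Pair (c₀ : ℝ) (w q : Plane → Space) (dw dq : Fin 2 → Plane → Space)
    (ddw ddq : Fin 2 → Fin 2 → Plane → Space) : Prop where
  approx_mean : ∃ φ, H2Approx (fun x => w x - kVec) dw ddw φ
  approx_diff : ∃ φ, H2Approx q dq ddq φ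
  orth : ∀ᵐ x, inner ℝ (w x) (q x) = (0 : ℝ)
  sphere : ∀ᵐ x, ‖w x‖ ^ 2 + ‖q x‖ ^ 2 / 4 = 1
  gap : ∀ᵐ x, ‖q x‖ ^ 2 ≤ 4 - c₀

/-- The weight of the error terms. -/
noncomputable def errWeight (q : Plane → Space) (dw dq : Fin 2 → Plane → Space)
    (ddw ddq : Fin 2 → Fin 2 → Plane → Space) (x : Plane) : ℝ :=
  weight ‖q x‖ (∑ i, ‖dq i x‖) (∑ i, (‖dw i x‖ + ‖dq i x‖))
    (∑ i, ∑ j, (‖ddw i j x‖ + ‖ddq i j x‖))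

namespace Pair

variable {c₀ : ℝ} {w q : Plane → Space} {dw dq : Fin 2 → Plane → Space}
    {ddw ddq : Fin 2 → Fin 2 → Plane → Space} (h : Pair c₀ w q dw dq ddw ddq)
include h

lemma W_w (i : Fin 2) : W i 0 w (dw i) := by
  obtain ⟨φ, hφ⟩ := h.approx_mean
  have := (hφ.W_zero i).add (W.const (i := i) kVec)
  exact this.congr (ae_of_all _ fun x => by simp) (ae_of_all _ fun x => by simp)

lemma W_q (i : Fin 2) : W i 0 q (dq i) := by
  obtain ⟨φ, hφ⟩ := h.approx_diff
  exact hφ.W_zero i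

lemma W_dw (i j : Fin 2) : W i 1 (dw j) (ddw i j) := by
  obtain ⟨φ, hφ⟩ := h.approx_mean
  exact hφ.W_one i j

lemma W_dq (i j : Fin 2) : W i 1 (dq j) (ddq i j) := by
  obtain ⟨φ, hφ⟩ := h.approx_diff
  exact hφ.W_one i j

lemma w_top : MemLp w ⊤ volume := lp_zero ▸ (h.W_w 0).mem
lemma q_top : MemLp q ⊤ volume := lp_zero ▸ (h.W_q 0).mem
lemma q_two : MemLp q 2 volume := by
  obtain ⟨φ, hφ⟩ := h.approx_diff
  exact hφ.tl.mem
lemma dw_four (i : Fin 2) : MemLp (dw i) 4 volume := lp_one ▸ (h.W_dw 0 i).mem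
lemma dq_four (i : Fin 2) : MemLp (dq i) 4 volume := lp_one ▸ (h.W_dq 0 i).mem
lemma dw_two (i : Fin 2) : MemLp (dw i) 2 volume := by
  obtain ⟨φ, hφ⟩ := h.approx_mean
  exact (hφ.tl_pd i).mem
lemma dq_two (i : Fin 2) : MemLp (dq i) 2 volume := by
  obtain ⟨φ, hφ⟩ := h.approx_diff
  exact (hφ.tl_pd i).mem
lemma ddw_two (i j : Fin 2) : MemLp (ddw i j) 2 volume := by
  obtain ⟨φ, hφ⟩ := h.approx_mean
  exact (hφ.tl_pd_pd i j).mem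
lemma ddq_two (i j : Fin 2) : MemLp (ddq i j) 2 volume := by
  obtain ⟨φ, hφ⟩ := h.approx_diff
  exact (hφ.tl_pd_pd i j).mem
lemma ddq_symm (i j : Fin 2) : ddq i j =ᵐ[volume] ddq j i := by
  obtain ⟨φ, hφ⟩ := h.approx_diff
  exact hφ.symm i j

/-- The first of four differentiated constraints, obtained from uniqueness of weak derivatives.
Together w·q = 0 and |w|² + |q|²/4 = 1 say that both original maps take values in the sphere; their
derivatives give the components along w needed in Cramer's rule. -/
lemma orth_one (i : Fin 2) :
    ∀ᵐ x, inner ℝ (dw i x) (q x) + inner ℝ (w x) (dq i x) = (0 : ℝ) := by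
  have a := (h.W_w i).bilin innerB (h.W_q i)
  have b : W i 0 (fun x => innerB (w x) (q x)) (fun _ => (0 : ℝ)) :=
    (W.const (i := i) (0 : ℝ)).congr (by
      filter_upwards [h.orth] with x hx; exact hx.symm) (ae_eq_refl _)
  exact a.unique b

lemma sphere_one (i : Fin 2) :
    ∀ᵐ x, inner ℝ (w x) (dw i x) + inner ℝ (q x) (dq i x) / 4 = (0 : ℝ) := by
  have a1 := (h.W_w i).bilin innerB (h.W_w i)
  have a2 := (h.W_q i).bilin innerB (h.W_q i)
  have a := a1.add (W.smul (1 / 4 : ℝ) a2)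
  have b : W i 0 (fun x => innerB (w x) (w x) + (1 / 4 : ℝ) • innerB (q x) (q x))
      (fun _ => (0 : ℝ)) :=
    (W.const (i := i) (1 : ℝ)).congr (by
      filter_upwards [h.sphere] with x hx
      simp only [innerB_apply, real_inner_self_eq_norm_sq, smul_eq_mul]
      linarith) (ae_eq_refl _)
  filter_upwards [a.unique b] with x hx
  simp only [innerB_apply, smul_eq_mul] at hx
  rw [real_inner_comm (dw i x) (w x), real_inner_comm (dq i x) (q x)] at hx
  linarith [real_inner_comm (dw i x) (w x), real_inner_comm (dq i x) (q x)]

lemma orth_two (i j : Fin 2) : ∀ᵐ x, inner ℝ (ddw i j x) (q x) + inner ℝ (dw j x) (dq i x) +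
    inner ℝ (dw i x) (dq j x) + inner ℝ (w x) (ddq i j x) = (0 : ℝ) := by
  have a1 := (h.W_dw i j).bilin innerB (h.W_q i)
  have a2 := (h.W_w i).bilin innerB (h.W_dq i j)
  rw [Nat.add_zero] at a1
  rw [Nat.zero_add] at a2
  have a := a1.add a2
  have b : W i 0 (fun x => innerB (dw j x) (q x) + innerB (w x) (dq j x)) (fun _ => (0 : ℝ)) :=
    (W.const (i := i) (0 : ℝ)).congr (by
      filter_upwards [h.orth_one j] with x hx; exact hx.symm) (ae_eq_refl _)
  filter_upwards [a.unique b] with x hx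
  simp only [innerB_apply] at hx
  linarith

lemma sphere_two (i j : Fin 2) : ∀ᵐ x, inner ℝ (w x) (ddw i j x) + inner ℝ (dw i x) (dw j x) +
    (inner ℝ (q x) (ddq i j x) + inner ℝ (dq i x) (dq j x)) / 4 = (0 : ℝ) := by
  have a1 := (h.W_w i).bilin innerB (h.W_dw i j)
  have a2 := (h.W_q i).bilin innerB (h.W_dq i j)
  have a := a1.add (W.smul (1 / 4 : ℝ) a2)
  have b : W i 0 (fun x => innerB (w x) (dw j x) + (1 / 4 : ℝ) • innerB (q x) (dq j x))
      (fun _ => (0 : ℝ)) :=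
    (W.const (i := i) (0 : ℝ)).congr (by
      filter_upwards [h.sphere_one j] with x hx
      simp only [innerB_apply, smul_eq_mul]
      linarith) (ae_eq_refl _)
  filter_upwards [a.unique b] with x hx
  simp only [innerB_apply, smul_eq_mul] at hx
  linarith

/-- The null form: three derivatives cancel in `∂_m [w, q_kk, q_m] - ∂_k [w, q_mk, q_m]`. -/
lemma integral_nullForm (m k : Fin 2) :
    ∫ x, (triple (w x) (ddq k k x) (ddq m m x) + triple (dw m x) (ddq k k x) (dq m x) -
      triple (dw k x) (ddq m k x) (dq m x)) = 0 := by
  obtain ⟨φ, hφ⟩ := h.approx_mean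
  obtain ⟨ψ, hψ⟩ := h.approx_diff
  have T0 : TL (lp 0) atTop (fun n x => φ n x + kVec) w := by
    have c : TL (lp 0) atTop (fun (_ : ℕ) (_ : Plane) => kVec) (fun _ => kVec) :=
      TL.const (by rw [lp_zero]; exact memLp_top_const _)
    have c' : TL (lp 0) atTop φ (fun x => w x - kVec) := by rw [lp_zero]; exact hφ.tl_top
    simpa using c'.add (one_le_lp (by norm_num)) c
  have T1 : ∀ i, TL (lp 1) atTop (fun n => pd i (φ n)) (dw i) := fun i => by
    rw [lp_one]; exact hφ.tl_pd_four i
  have S1 : ∀ i, TL (lp 1) atTop (fun n => pd i (ψ n)) (dq i) := fun i => by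
    rw [lp_one]; exact hψ.tl_pd_four i
  have S2 : ∀ i j, TL (lp 2) atTop (fun n => pd i (pd j (ψ n))) (ddq i j) := fun i j => by
    rw [lp_two]; exact hψ.tl_pd_pd i j
  have a1 := T0.bilin (r := lp (0 + 2)) (one_le_lp (by norm_num)) crossB (S2 k k)
  have a2 := (T1 m).bilin (r := lp (1 + 2)) (one_le_lp (by norm_num)) crossB (S2 k k)
  have a3 := (T1 k).bilin (r := lp (1 + 2)) (one_le_lp (by norm_num)) crossB (S2 m k)
  have t1 := a1.bilin (r := lp (0 + 2 + 2)) (one_le_lp (by norm_num)) innerB (S2 m m)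
  have t2 := a2.bilin (r := lp (1 + 2 + 1)) (one_le_lp (by norm_num)) innerB (S1 m)
  have t3 := a3.bilin (r := lp (1 + 2 + 1)) (one_le_lp (by norm_num)) innerB (S1 m)
  rw [show lp (0 + 2 + 2) = 1 from lp_four] at t1
  rw [show lp (1 + 2 + 1) = 1 from lp_four] at t2 t3
  refine tendsto_nhds_unique ((t1.add le_rfl t2).sub le_rfl t3).integral
    (tendsto_const_nhds.congr fun n => ?_)
  set A : Plane → Space := fun x => φ n x + kVec with hA
  have As : ContDiff ℝ ∞ A := (hφ.smooth n).add contDiff_const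
  have Bs := hψ.smooth n
  have B1 : ∀ i, ContDiff ℝ ∞ (pd i (ψ n)) := fun i => pd_contDiff Bs
  have B2 : ∀ i j, ContDiff ℝ ∞ (pd i (pd j (ψ n))) := fun i j => pd_contDiff (B1 j)
  have Bc : ∀ i, HasCompactSupport (pd i (ψ n)) := fun i => pd_hasCompactSupport (hψ.compact n)
  have Bc2 : ∀ i j, HasCompactSupport (pd i (pd j (ψ n))) := fun i j => pd_hasCompactSupport (Bc j)
  have dA : ∀ i, pd i A = pd i (φ n) := fun i => by
    ext1 x; simp only [pd, hA, fderiv_add_const]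
  have df : ∀ {g : Plane → Space}, ContDiff ℝ ∞ g → Differentiable ℝ g :=
    fun h => h.differentiable (by simp)
  -- derivative of a triple product
  have key : ∀ i, ∀ g g' : Plane → Space, ContDiff ℝ ∞ g → ContDiff ℝ ∞ g' →
      HasCompactSupport g' → (∀ x, pd i (fun x => triple (A x) (g x) (g' x)) x =
        triple (pd i (φ n) x) (g x) (g' x) + triple (A x) (pd i g x) (g' x) +
          triple (A x) (g x) (pd i g' x)) ∧
      Continuous (pd i (fun x => triple (A x) (g x) (g' x))) ∧
      HasCompactSupport (pd i (fun x => triple (A x) (g x) (g' x))) ∧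
      ∫ x, pd i (fun x => triple (A x) (g x) (g' x)) x = 0 := by
    intro i g g' hg hg' hc
    have sm1 : ContDiff ℝ ∞ (fun x => crossB (A x) (g x)) := (crossB.contDiff.comp As).clm_apply hg
    have sm : ContDiff ℝ ∞ (fun x => triple (A x) (g x) (g' x)) :=
      (innerB.contDiff.comp sm1).clm_apply hg'
    have cs : HasCompactSupport (fun x => triple (A x) (g x) (g' x)) := by
      refine hc.mono fun x hx => ?_
      contrapose! hx
      simp only [Function.mem_support, not_not] at hx ⊢
      simp [triple, hx]
    refine ⟨fun x => ?_, (pd_contDiff sm).continuous, pd_hasCompactSupport cs,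
      integral_pd_eq_zero i (sm.of_le (by simp)) cs⟩
    have e1 := pd_bilin i innerB (df sm1) (df hg') x
    have e2 := pd_bilin i crossB (df As) (df hg) x
    rw [e2, dA] at e1
    refine e1.trans ?_
    simp only [innerB_apply, crossB_apply, inner_add_left, triple]
  obtain ⟨p1, c1, s1, z1⟩ := key m (pd k (pd k (ψ n))) (pd m (ψ n)) (B2 k k) (B1 m) (Bc m)
  obtain ⟨p2, c2, s2, z2⟩ := key k (pd m (pd k (ψ n))) (pd m (ψ n)) (B2 m k) (B1 m) (Bc m)
  -- Third derivatives are present only for the smooth approximations. They cancel because partial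
  -- derivatives commute, and the remaining term [A, ψ_mk, ψ_mk] vanishes, so the identity passes to
  -- the limit with second derivatives alone.
  have e : ∀ x, pd m (fun x => triple (A x) (pd k (pd k (ψ n)) x) (pd m (ψ n) x)) x -
      pd k (fun x => triple (A x) (pd m (pd k (ψ n)) x) (pd m (ψ n) x)) x =
      innerB (crossB (φ n x + kVec) (pd k (pd k (ψ n)) x)) (pd m (pd m (ψ n)) x) +
        innerB (crossB (pd m (φ n) x) (pd k (pd k (ψ n)) x)) (pd m (ψ n) x) -
        innerB (crossB (pd k (φ n) x) (pd m (pd k (ψ n)) x)) (pd m (ψ n) x) := fun x => by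
    rw [p1, p2, pd_comm m k (B1 k), pd_comm k m Bs]
    have z : ∀ a b : Space, triple a b b = 0 := fun a b => by simp only [triple_eq]; ring
    simp only [innerB_apply, crossB_apply, z, ← triple.eq_1]
    ring
  simp only [← e]
  rw [integral_sub (c1.integrable_of_hasCompactSupport s1) (c2.integrable_of_hasCompactSupport s2),
    z1, z2, sub_zero]

end Pair
end LLHelicity

namespace LLHelicity
set_option linter.unusedSectionVars false

/-! ### The spatial inequality -/

namespace Pair

variable {c₀ : ℝ} {w q : Plane → Space} {dw dq : Fin 2 → Plane → Space}
    {ddw ddq : Fin 2 → Fin 2 → Plane → Space} (h : Pair c₀ w q dw dq ddw ddq)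
include h

lemma integrable_nullForm (m k : Fin 2) : Integrable (fun x =>
    triple (w x) (ddq k k x) (ddq m m x) + triple (dw m x) (ddq k k x) (dq m x) -
      triple (dw k x) (ddq m k x) (dq m x)) := by
  have a0 : ∀ i, MemLp (fun x => innerB (crossB (w x) (ddq k k x)) (ddq i i x)) 1 volume := fun i =>
    memLp_bilin_two innerB (memLp_bilin_top_left crossB h.w_top (h.ddq_two k k)) (h.ddq_two i i)
  have a1 : ∀ i j l, MemLp (fun x => innerB (crossB (dw i x) (dq m x)) (ddq j l x)) 1 volume :=
    fun i j l => memLp_bilin_two innerB (memLp_bilin_four crossB (h.dw_four i) (h.dq_four m))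
      (h.ddq_two j l)
  refine (memLp_one_iff_integrable.1 (((a0 m).sub (a1 m k k)).add (a1 k m k))).congr
    (ae_of_all _ fun x => ?_)
  simp only [Pi.add_apply, Pi.sub_apply, innerB_apply, crossB_apply]
  rw [← triple.eq_1, ← triple.eq_1, ← triple.eq_1, triple_swap (dw m x) (dq m x),
    triple_swap (dw k x) (dq m x)]
  ring

/-- The integrand is ∂_m of |w_k|² [w, q, q_m] - (w_m·q) [w_k, q_k, w], up to the vanishing [w, q_m,
q_m]. The functions under the derivative are of total order 3, so the derivative is of order 4 and
integrable. -/
lemma integral_flux (m k : Fin 2) :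
    Integrable (fun x => 2 * inner ℝ (dw k x) (ddw m k x) * triple (w x) (q x) (dq m x) +
      ‖dw k x‖ ^ 2 * (triple (dw m x) (q x) (dq m x) + triple (w x) (q x) (ddq m m x)) -
      (inner ℝ (ddw m m x) (q x) + inner ℝ (dw m x) (dq m x)) * triple (dw k x) (dq k x) (w x) -
      inner ℝ (dw m x) (q x) * (triple (ddw m k x) (dq k x) (w x) +
        triple (dw k x) (ddq m k x) (w x) + triple (dw k x) (dq k x) (dw m x))) ∧
    ∫ x, (2 * inner ℝ (dw k x) (ddw m k x) * triple (w x) (q x) (dq m x) +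
      ‖dw k x‖ ^ 2 * (triple (dw m x) (q x) (dq m x) + triple (w x) (q x) (ddq m m x)) -
      (inner ℝ (ddw m m x) (q x) + inner ℝ (dw m x) (dq m x)) * triple (dw k x) (dq k x) (w x) -
      inner ℝ (dw m x) (q x) * (triple (ddw m k x) (dq k x) (w x) +
        triple (dw k x) (ddq m k x) (w x) + triple (dw k x) (dq k x) (dw m x))) = 0 := by
  set mulB : ℝ →L[ℝ] ℝ →L[ℝ] ℝ := ContinuousLinearMap.mul ℝ ℝ with hm
  have m1 : MemLp (fun x => innerB (dw k x) (dw k x)) 2 volume :=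
    memLp_bilin_four innerB (h.dw_four k) (h.dw_four k)
  have m2 : MemLp (fun x => innerB (crossB (w x) (q x)) (dq m x)) 2 volume :=
    memLp_bilin_top_left innerB (crossB.memLp_of_bilin ⊤ h.w_top h.q_top) (h.dq_two m)
  have m3 : MemLp (fun x => innerB (dw m x) (q x)) 2 volume :=
    memLp_bilin_top_right innerB (h.dw_two m) h.q_top
  have m4 : MemLp (fun x => innerB (crossB (dw k x) (dq k x)) (w x)) 2 volume :=
    memLp_bilin_top_right innerB (memLp_bilin_four crossB (h.dw_four k) (h.dq_four k)) h.w_top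
  have w1 := (h.W_dw m k).bilin innerB (h.W_dw m k)
  have w2a := (h.W_w m).bilin crossB (h.W_q m)
  have w2 := w2a.bilin innerB (h.W_dq m m)
  have w3 := (h.W_dw m m).bilin innerB (h.W_q m)
  have w4a := (h.W_dw m k).bilin crossB (h.W_dq m k)
  have w4 := w4a.bilin innerB (h.W_w m)
  have w5 := w1.bilin mulB w2
  have w6 := w3.bilin mulB w4
  have n5 := memLp_bilin_two mulB m1 m2
  have n6 := memLp_bilin_two mulB m3 m4
  have d5 := w5.mem'
  have d6 := w6.mem'
  rw [show lp (1 + 1 + (0 + 0 + 1) + 1) = 1 from lp_four] at d5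
  rw [show lp (1 + 0 + (1 + 1 + 0) + 1) = 1 from lp_four] at d6
  have z5 := w5.integral_eq_zero n5 d5
  have z6 := w6.integral_eq_zero n6 d6
  have i5 := memLp_one_iff_integrable.1 d5
  have i6 := memLp_one_iff_integrable.1 d6
  have z : ∀ a b : Space, triple a b b = 0 := fun a b => by simp only [triple_eq]; ring
  have e : ∀ x, (mulB (innerB (ddw m k x) (dw k x) +
        innerB (dw k x) (ddw m k x)) (innerB (crossB (w x) (q x)) (dq m x)) +
        mulB (innerB (dw k x) (dw k x)) (innerB (crossB (dw m x) (q x) + crossB (w x) (dq m x))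
        (dq m x) + innerB (crossB (w x) (q x)) (ddq m m x))) -
      (mulB (innerB (ddw m m x) (q x) + innerB (dw m x) (dq m x))
        (innerB (crossB (dw k x) (dq k x)) (w x)) + mulB (innerB (dw m x) (q x))
        (innerB (crossB (ddw m k x) (dq k x) + crossB (dw k x) (ddq m k x)) (w x) +
          innerB (crossB (dw k x) (dq k x)) (dw m x))) =
      (2 * inner ℝ (dw k x) (ddw m k x) * triple (w x) (q x) (dq m x) +
      ‖dw k x‖ ^ 2 * (triple (dw m x) (q x) (dq m x) + triple (w x) (q x) (ddq m m x)) -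
      (inner ℝ (ddw m m x) (q x) + inner ℝ (dw m x) (dq m x)) * triple (dw k x) (dq k x) (w x) -
      inner ℝ (dw m x) (q x) * (triple (ddw m k x) (dq k x) (w x) +
        triple (dw k x) (ddq m k x) (w x) + triple (dw k x) (dq k x) (dw m x))) := fun x => by
    have := z (w x) (dq m x)
    rw [← real_inner_self_eq_norm_sq]
    simp only [hm, ContinuousLinearMap.mul_apply', innerB_apply, crossB_apply, inner_add_left,
      ← triple.eq_1, this, real_inner_comm (ddw m k x) (dw k x)]
    ring
  refine ⟨(i5.sub i6).congr (ae_of_all _ e), ?_⟩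
  refine (integral_congr_ae (ae_of_all _ fun x => (e x).symm)).trans ((integral_sub i5 i6).trans ?_)
  rw [z5, z6, sub_zero]

end Pair
end LLHelicity

/-! ### Size of the error weight, and the contribution of the helicity term -/

namespace LLHelicity
set_option linter.unusedSectionVars false

section ErrWeight
variable (q : Plane → Space) (dw dq : Fin 2 → Plane → Space) (ddw ddq : Fin 2 → Fin 2 → Plane → Space)
  (x : Plane)

lemma norm_dq_le (i : Fin 2) : ‖dq i x‖ ≤ ∑ i, ‖dq i x‖ :=
  Finset.single_le_sum (f := fun i => ‖dq i x‖) (fun _ _ => norm_nonneg _) (Finset.mem_univ i)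

lemma sum_dq_le : ∑ i, ‖dq i x‖ ≤ ∑ i, (‖dw i x‖ + ‖dq i x‖) :=
  Finset.sum_le_sum fun _ _ => le_add_of_nonneg_left (norm_nonneg _)

lemma norm_dw_le (i : Fin 2) : ‖dw i x‖ ≤ ∑ i, (‖dw i x‖ + ‖dq i x‖) :=
  (le_add_of_nonneg_right (norm_nonneg _)).trans (Finset.single_le_sum
    (f := fun i => ‖dw i x‖ + ‖dq i x‖) (fun _ _ => by positivity) (Finset.mem_univ i))

lemma norm_add_le_hess (i j : Fin 2) :
    ‖ddw i j x‖ + ‖ddq i j x‖ ≤ ∑ i, ∑ j, (‖ddw i j x‖ + ‖ddq i j x‖) :=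
  (Finset.single_le_sum (f := fun j => ‖ddw i j x‖ + ‖ddq i j x‖)
    (fun _ _ => by positivity) (Finset.mem_univ j)).trans (Finset.single_le_sum
    (f := fun i => ∑ j, (‖ddw i j x‖ + ‖ddq i j x‖)) (fun _ _ => by positivity) (Finset.mem_univ i))

lemma norm_ddw_le (i j : Fin 2) : ‖ddw i j x‖ ≤ ∑ i, ∑ j, (‖ddw i j x‖ + ‖ddq i j x‖) :=
  (le_add_of_nonneg_right (norm_nonneg _)).trans (norm_add_le_hess ddw ddq x i j)

lemma norm_ddq_le (i j : Fin 2) : ‖ddq i j x‖ ≤ ∑ i, ∑ j, (‖ddw i j x‖ + ‖ddq i j x‖) :=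
  (le_add_of_nonneg_left (norm_nonneg _)).trans (norm_add_le_hess ddw ddq x i j)

end ErrWeight

lemma transport_bound {r s p h a b c d : ℝ} (hr0 : 0 ≤ r) (hs0 : 0 ≤ s) (hp0 : 0 ≤ p) (hh0 : 0 ≤ h)
    (b1 : |a| ≤ p * s * s) (b2 : |b| ≤ s * (p * s)) (b3 : |c| ≤ s * (s * p))
    (b4 : |d| ≤ s * (r * h)) : |1 / 2 * a - (b + (c + d))| ≤ 4 * weight r s p h ^ 2 := by
  have K0 := weight_nonneg hr0 hs0 hp0 hh0
  have k1 := le_weight_rh hr0 hs0 hp0 hh0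
  have k2 := le_weight_sp hr0 hs0 hp0 hh0
  have k3 := le_weight_s hr0 hs0 hp0 hh0
  have m1 := mul_le_mul k3 k2 (mul_nonneg hs0 hp0) K0
  have m2 := mul_le_mul k3 k1 (mul_nonneg hr0 hh0) K0
  simp only [abs_le] at b1 b2 b3 b4 ⊢
  constructor <;> linarith only [b1.1, b1.2, b2.1, b2.2, b3.1, b3.2, b4.1, b4.2, m1, m2]

namespace Pair

variable {c₀ : ℝ} {w q : Plane → Space} {dw dq : Fin 2 → Plane → Space}
    {ddw ddq : Fin 2 → Fin 2 → Plane → Space} (h : Pair c₀ w q dw dq ddw ddq)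
include h

lemma memLp_errWeight : MemLp (errWeight q dw dq ddw ddq) 2 volume := by
  have mr : MemLp (fun x => ‖q x‖) ⊤ volume := h.q_top.norm
  have mr2 : MemLp (fun x => ‖q x‖) 2 volume := h.q_two.norm
  have ms2 : MemLp (fun x => ∑ i, ‖dq i x‖) 2 volume := memLp_sum_two fun i => (h.dq_two i).norm
  have ms4 : MemLp (fun x => ∑ i, ‖dq i x‖) 4 volume := memLp_sum_two fun i => (h.dq_four i).norm
  have mp4 : MemLp (fun x => ∑ i, (‖dw i x‖ + ‖dq i x‖)) 4 volume :=
    memLp_sum_two fun i => (h.dw_four i).norm.add (h.dq_four i).norm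
  have mh2 : MemLp (fun x => ∑ i, ∑ j, (‖ddw i j x‖ + ‖ddq i j x‖)) 2 volume :=
    memLp_sum_two fun i => memLp_sum_two fun j => (h.ddw_two i j).norm.add (h.ddq_two i j).norm
  have a1 := memLp_bilin_top_left (ContinuousLinearMap.mul ℝ ℝ) mr mh2
  have a2 := memLp_bilin_top_left (ContinuousLinearMap.mul ℝ ℝ) mr
    (memLp_bilin_four (ContinuousLinearMap.mul ℝ ℝ) mp4 mp4)
  have a3 := memLp_bilin_four (ContinuousLinearMap.mul ℝ ℝ) ms4 mp4
  refine (memLp_congr_ae (ae_of_all _ fun x => ?_)).1 ((((mr2.add a1).add a2).add ms2).add a3)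
  simp only [Pi.add_apply, ContinuousLinearMap.mul_apply', errWeight, weight]
  ring

lemma integrable_errWeight : Integrable (fun x => errWeight q dw dq ddw ddq x ^ 2) :=
  h.memLp_errWeight.integrable_sq

/-- Move one derivative ∂_m off q_mm. The only term that still has a second derivative of q is w_k
(q_m·q_mk), which is half of w_k ∂_k|q_m|² and is integrated by parts once more; transport costs no
derivative. -/
lemma integral_transport (m k : Fin 2) :
    Integrable (fun x => inner ℝ (ddq m m x)
      (w x k.castSucc • dq k x + q x k.castSucc • dw k x)) ∧
    |∫ x, inner ℝ (ddq m m x) (w x k.castSucc • dq k x + q x k.castSucc • dw k x)| ≤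
      4 * ∫ x, errWeight q dw dq ddw ddq x ^ 2 := by
  have cw : MemLp (fun x => coordL k.castSucc (w x)) ⊤ volume := (coordL _).comp_memLp' h.w_top
  have cq : MemLp (fun x => coordL k.castSucc (q x)) ⊤ volume := (coordL _).comp_memLp' h.q_top
  have cdw : ∀ i, MemLp (fun x => coordL k.castSucc (dw i x)) 4 volume := fun i =>
    (coordL _).comp_memLp' (h.dw_four i)
  have cdq : ∀ i, MemLp (fun x => coordL k.castSucc (dq i x)) 4 volume := fun i =>
    (coordL _).comp_memLp' (h.dq_four i)
  have Wcw := fun i => (h.W_w i).clm (coordL k.castSucc)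
  have Wcq := fun i => (h.W_q i).clm (coordL k.castSucc)
  have t1 := (Wcw m).bilin smulB (h.W_dq m k)
  have t2 := (Wcq m).bilin smulB (h.W_dw m k)
  have t3 := (Wcw k).bilin smulB (h.W_dq k m)
  have n1 := memLp_bilin_top_left smulB cw (h.dq_two k)
  have n2 := memLp_bilin_top_left smulB cq (h.dw_two k)
  have n3 := memLp_bilin_top_left smulB cw (h.dq_two m)
  have p1 := memLp_bilin_four smulB (cdw m) (h.dq_four k)
  have p2 := memLp_bilin_top_left smulB cw (h.ddq_two m k)
  have p3 := memLp_bilin_four smulB (cdq m) (h.dw_four k)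
  have p4 := memLp_bilin_top_left smulB cq (h.ddw_two m k)
  have p5 := memLp_bilin_four smulB (cdw k) (h.dq_four m)
  have p6 := memLp_bilin_top_left smulB cw (h.ddq_two k m)
  have l2 : ∀ {g : Plane → Space}, MemLp g 2 volume → MemLp g (lp 2) volume := fun h => by
    rwa [lp_two]
  have I1 := W.ibp innerB (h.W_dq m m) (t1.add t2) (l2 (h.dq_two m)) (l2 (h.ddq_two m m))
    (l2 (n1.add n2)) (l2 ((p1.add p2).add (p3.add p4)))
  have I2 := W.ibp innerB t3 (h.W_dq k m) (l2 n3) (l2 (p5.add p6)) (l2 (h.dq_two m))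
    (l2 (h.ddq_two k m))
  have i1 := integrable_inner (h.ddq_two m m) (n1.add n2)
  have j1 := integrable_inner (h.dq_two m) p1
  have j2 := integrable_inner (h.dq_two m) p2
  have j3 := integrable_inner (h.dq_two m) p3
  have j4 := integrable_inner (h.dq_two m) p4
  have j5 := integrable_inner p5 (h.dq_two m)
  have j6 := integrable_inner p6 (h.dq_two m)
  refine ⟨i1, ?_⟩
  have I2' : (∫ x, inner ℝ (smulB (coordL k.castSucc (dw k x)) (dq m x)) (dq m x)) +
      2 * ∫ x, inner ℝ (smulB (coordL k.castSucc (w x)) (ddq k m x)) (dq m x) = 0 := by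
    have e1 := integral_add j5 j6
    simp only [← inner_add_left] at e1
    have e2 : ∫ x, innerB (smulB (coordL k.castSucc (w x)) (dq m x)) (ddq k m x) =
        ∫ x, inner ℝ (smulB (coordL k.castSucc (w x)) (ddq k m x)) (dq m x) := by
      refine integral_congr_ae (ae_of_all _ fun x => ?_)
      simp only [innerB_apply, smulB_apply, real_inner_smul_left]
      rw [real_inner_comm]
    rw [e2] at I2
    linarith [e1.symm.trans I2]
  have I3 : ∫ x, inner ℝ (dq m x) (smulB (coordL k.castSucc (w x)) (ddq m k x)) =
      ∫ x, inner ℝ (smulB (coordL k.castSucc (w x)) (ddq k m x)) (dq m x) := by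
    refine integral_congr_ae ?_
    filter_upwards [h.ddq_symm m k] with x hx
    rw [hx, real_inner_comm]
  have key : ∫ x, inner ℝ (ddq m m x) (w x k.castSucc • dq k x + q x k.castSucc • dw k x) =
      ∫ x, ((1 / 2) * inner ℝ (smulB (coordL k.castSucc (dw k x)) (dq m x)) (dq m x) -
        (inner ℝ (dq m x) (smulB (coordL k.castSucc (dw m x)) (dq k x)) +
        (inner ℝ (dq m x) (smulB (coordL k.castSucc (dq m x)) (dw k x)) +
          inner ℝ (dq m x) (smulB (coordL k.castSucc (q x)) (ddw m k x))))) := by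
    refine I1.trans ?_
    have e : ∫ x, innerB (dq m x) ((smulB (coordL k.castSucc (dw m x)) (dq k x) +
        smulB (coordL k.castSucc (w x)) (ddq m k x)) + (smulB (coordL k.castSucc (dq m x)) (dw k x) +
          smulB (coordL k.castSucc (q x)) (ddw m k x))) =
        ∫ x, ((inner ℝ (dq m x) (smulB (coordL k.castSucc (dw m x)) (dq k x)) +
          inner ℝ (dq m x) (smulB (coordL k.castSucc (w x)) (ddq m k x))) +
          (inner ℝ (dq m x) (smulB (coordL k.castSucc (dq m x)) (dw k x)) +
          inner ℝ (dq m x) (smulB (coordL k.castSucc (q x)) (ddw m k x)))) := by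
      simp only [innerB_apply, inner_add_right]
    have s1 := integral_sub (j5.const_mul (1 / 2)) (j1.add (j3.add j4))
    have s2 := integral_add j1 (j3.add j4)
    have s3 := integral_add (j1.add j2) (j3.add j4)
    have s4 := integral_add j1 j2
    simp only [Pi.add_apply] at s1 s2 s3 s4
    rw [e, s3, s4, I3, s1, s2, integral_const_mul]
    linarith
  rw [key]
  refine abs_integral_le_integral_abs.trans ?_
  rw [← integral_const_mul]
  refine integral_mono_of_nonneg (ae_of_all _ fun x => abs_nonneg _)
    (h.integrable_errWeight.const_mul 4) (ae_of_all _ fun x => ?_)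
  have c1 : ∀ a : Space, |coordL k.castSucc a| ≤ ‖a‖ := fun a => by
    exact PiLp.norm_apply_le a k.castSucc
  have sm : ∀ {a b : Space} {A B : ℝ}, ‖a‖ ≤ A → ‖b‖ ≤ B →
      ‖smulB (coordL k.castSucc a) b‖ ≤ A * B := fun {a b A B} ha hb => by
    rw [smulB_apply, norm_smul]
    exact mul_le_mul ((c1 a).trans ha) hb (norm_nonneg _) ((norm_nonneg _).trans ha)
  have qs := norm_dq_le dq x
  have wp := norm_dw_le dw dq x
  have wh := norm_ddw_le ddw ddq x
  exact transport_bound (norm_nonneg _) ((norm_nonneg _).trans (qs m))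
    ((norm_nonneg _).trans (wp m)) ((norm_nonneg _).trans (wh m m))
    (abs_inner_le' (sm (wp k) (qs m)) (qs m)) (abs_inner_le' (qs m) (sm (wp m) (qs k)))
    (abs_inner_le' (qs m) (sm (qs m) (wp k))) (abs_inner_le' (qs m) (sm (le_refl ‖q x‖) (wh m k)))

end Pair
end LLHelicity

/-! ### Pointwise splitting of the energy derivative -/

namespace LLHelicity
set_option linter.unusedSectionVars false

/-- The factor `1 / (1 + u · v)` in terms of `q = u - v`. -/
noncomputable def zeta (q : Space) : ℝ := 2 / (4 - ‖q‖ ^ 2)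

lemma zeta_spec {q : Space} {c₀ : ℝ} (hc : 0 < c₀) (hq : ‖q‖ ^ 2 ≤ 4 - c₀) :
    0 ≤ zeta q ∧ zeta q ≤ 2 / c₀ ∧ zeta q * (4 - ‖q‖ ^ 2) = 2 := by
  have : c₀ ≤ 4 - ‖q‖ ^ 2 := by linarith
  have h4 : 0 < 4 - ‖q‖ ^ 2 := by linarith
  refine ⟨by unfold zeta; positivity, ?_, by unfold zeta; field_simp⟩
  exact div_le_div_of_nonneg_left (by norm_num) hc this

/-- The derivative of the energy in the direction of the difference. -/
noncomputable def dualDiff (q wm qm qmm : Space) : Space :=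
  -qmm - (zeta q ^ 2 * inner ℝ wm q ^ 2) • q - (2 * zeta q * inner ℝ wm q) • wm -
    ((zeta q ^ 2 * inner ℝ q qm ^ 2 + 2 * zeta q * (inner ℝ qm qm + inner ℝ q qmm)) / 4) • q

/-- The derivative of the energy in the direction of the mean. -/
noncomputable def dualMean (q wm qm wmm : Space) : Space :=
  (2 * (zeta q ^ 2 * inner ℝ q qm * inner ℝ wm q +
    zeta q * (inner ℝ wmm q + inner ℝ wm qm))) • q + (2 * zeta q * inner ℝ wm q) • qm

lemma inner_cross (a b c : Space) : inner ℝ a (cross b c) = triple b c a := by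
  rw [triple, real_inner_comm]

namespace Pair

variable {c₀ : ℝ} {w q : Plane → Space} {dw dq : Fin 2 → Plane → Space}
    {ddw ddq : Fin 2 → Fin 2 → Plane → Space}

/-- The difference of the right-hand sides of two solutions. -/
def IsDiffField (β : ℝ) (w q : Plane → Space) (dw dq : Fin 2 → Plane → Space)
    (ddw ddq : Fin 2 → Fin 2 → Plane → Space) (N : Plane → Space) : Prop :=
  ∀ᵐ x, N x = - ∑ k, (cross (w x) (ddq k k x) + cross (q x) (ddw k k x)) -
    β • ∑ k : Fin 2, (w x k.castSucc • dq k x + q x k.castSucc • dw k x)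

/-- Functions of the size of the right-hand side. -/
def IsFieldBound (n₀ : ℝ) (dw dq : Fin 2 → Plane → Space)
    (ddw ddq : Fin 2 → Fin 2 → Plane → Space) (N : Plane → Space) : Prop :=
  ∀ᵐ x, ‖N x‖ ≤ n₀ * (1 + (∑ i, ∑ j, (‖ddw i j x‖ + ‖ddq i j x‖)) +
    (∑ i, (‖dw i x‖ + ‖dq i x‖)) ^ 2)

/-- What is subtracted has zero integral or is estimated by `integral_transport`. In the constant,
200 is the core estimate for the two values of k, the term with n₀ is `lower_bound`, and 4|β| is the
helicity term paired with the correction (w_m·q) w_m. -/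
lemma density_bound (hc : 0 < c₀) (h : Pair c₀ w q dw dq ddw ddq) {β n₀ : ℝ} (hn : 0 ≤ n₀)
    {Nq Nw : Plane → Space} (hNq : IsDiffField β w q dw dq ddw ddq Nq)
    (bNq : IsFieldBound n₀ dw dq ddw ddq Nq) (bNw : IsFieldBound n₀ dw dq ddw ddq Nw) (m : Fin 2) :
    ∀ᵐ x, |inner ℝ (dualDiff (q x) (dw m x) (dq m x) (ddq m m x)) (Nq x) +
      inner ℝ (dualMean (q x) (dw m x) (dq m x) (ddw m m x)) (Nw x) -
      (∑ k, (triple (w x) (ddq k k x) (ddq m m x) + triple (dw m x) (ddq k k x) (dq m x) -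
        triple (dw k x) (ddq m k x) (dq m x))) -
      (∑ k, (2 * inner ℝ (dw k x) (ddw m k x) * triple (w x) (q x) (dq m x) +
      ‖dw k x‖ ^ 2 * (triple (dw m x) (q x) (dq m x) + triple (w x) (q x) (ddq m m x)) -
      (inner ℝ (ddw m m x) (q x) + inner ℝ (dw m x) (dq m x)) * triple (dw k x) (dq k x) (w x) -
      inner ℝ (dw m x) (q x) * (triple (ddw m k x) (dq k x) (w x) +
        triple (dw k x) (ddq m k x) (w x) + triple (dw k x) (dq k x) (dw m x)))) -
      β * ∑ k : Fin 2, inner ℝ (ddq m m x) (w x k.castSucc • dq k x + q x k.castSucc • dw k x)| ≤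
    (200 + 20 * (2 / c₀ + (2 / c₀) ^ 2) * n₀ + 4 * |β|) * errWeight q dw dq ddw ddq x ^ 2 := by
  filter_upwards [hNq, bNq, bNw, h.orth, h.sphere, h.gap, h.orth_one m, h.sphere_one m,
    h.sphere_one 0, h.sphere_one 1, h.orth_two m m, ae_all_iff.2 fun k => h.orth_two k k,
    ae_all_iff.2 fun k => h.orth_two m k, ae_all_iff.2 fun k => h.sphere_two k k,
    ae_all_iff.2 fun k => h.sphere_one k]
    with x eN bq bw ho hs hg ho1 hs1 _ _ ho2 hokk homk hskk hsk
  obtain ⟨z0, zZ, hz⟩ := zeta_spec hc hg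
  set r := ‖q x‖ with hr
  have qs := norm_dq_le dq x
  have hsp := sum_dq_le dw dq x
  have wp := norm_dw_le dw dq x
  have wh := norm_ddw_le ddw ddq x
  have qh := norm_ddq_le ddw ddq x
  have hK : errWeight q dw dq ddw ddq x = weight r (∑ i, ‖dq i x‖) (∑ i, (‖dw i x‖ + ‖dq i x‖))
    (∑ i, ∑ j, (‖ddw i j x‖ + ‖ddq i j x‖)) := rfl
  rw [hK]
  generalize ∑ i, ‖dq i x‖ = s at *
  generalize ∑ i, (‖dw i x‖ + ‖dq i x‖) = p at *
  generalize ∑ i, ∑ j, (‖ddw i j x‖ + ‖ddq i j x‖) = H at *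
  have hr0 : 0 ≤ r := norm_nonneg _
  have hs0 : 0 ≤ s := (norm_nonneg _).trans (qs m)
  have hp0 : 0 ≤ p := (norm_nonneg _).trans (wp m)
  have hh0 : 0 ≤ H := (norm_nonneg _).trans (wh m m)
  have hr2 : r ≤ 2 := by nlinarith [sq_nonneg ‖w x‖]
  have hw1 : ‖w x‖ ≤ 1 := by nlinarith [sq_nonneg r, norm_nonneg (w x)]
  have core : ∀ k, _ := fun k => core_bound (w := w x) (q := q x) (wm := dw m x) (qm := dq m x)
    (wk := dw k x) (qk := dq k x) (wmm := ddw m m x) (qmm := ddq m m x) (wkk := ddw k k x)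
    (qkk := ddq k k x) (wmk := ddw m k x) (qmk := ddq m k x) (r := r) (s := s) (p := p) (h := H)
    (inner ℝ (dw m x) (q x)) (inner ℝ (ddw m m x) (q x) + inner ℝ (dw m x) (dq m x))
    (by rw [real_inner_comm]; linarith) (by rw [real_inner_comm]; exact ho) hs rfl rfl
    (by rw [real_inner_comm, real_inner_comm (q x)]; linarith)
    (by rw [real_inner_comm, real_inner_comm (q x)]; linarith [hsk k])
    (by rw [real_inner_comm]; linarith [hokk k])
    (by rw [real_inner_comm]; linarith [homk k])
    (by rw [real_inner_comm]; linarith)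
    (by
      rw [real_inner_comm, real_inner_comm (q x), ← real_inner_self_eq_norm_sq (dw k x),
        ← real_inner_self_eq_norm_sq (dq k x)]
      linarith [hskk k])
    rfl (qs m) (qs k) (wp m) (wp k) (wh m m) (qh m m) (wh k k) (qh k k) (wh m k) (qh m k) hsp
  have low := lower_bound (q := q x) (wm := dw m x) (qm := dq m x) (wmm := ddw m m x)
    (qmm := ddq m m x) (r := r) (s := s) (p := p) (h := H) (inner ℝ (dw m x) (q x))
    (inner ℝ (q x) (dq m x)) (inner ℝ (ddw m m x) (q x) + inner ℝ (dw m x) (dq m x))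
    (inner ℝ (dq m x) (dq m x) + inner ℝ (q x) (ddq m m x)) (zeta (q x)) (2 / c₀) n₀ rfl rfl rfl rfl
    z0 zZ hz hr2 rfl (qs m) (wp m) (wh m m) (qh m m) hsp hn bq bw
  -- The helicity part of (w_m·q)(w_m·N) needs no integration by parts: |q||∇w|² multiplies a
  -- first-order difference.
  have tr : ∀ k : Fin 2, |inner ℝ (dw m x) (q x) *
      inner ℝ (dw m x) (w x k.castSucc • dq k x + q x k.castSucc • dw k x)| ≤
      2 * weight r s p H ^ 2 := by
    intro k
    have c1 : ∀ a : Space, |a k.castSucc| ≤ ‖a‖ := fun a => PiLp.norm_apply_le a k.castSucc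
    have nt : ‖w x k.castSucc • dq k x + q x k.castSucc • dw k x‖ ≤ 1 * s + r * p := by
      refine (norm_add_le _ _).trans (add_le_add ?_ ?_)
      · rw [norm_smul]; exact mul_le_mul ((c1 _).trans hw1) (qs k) (norm_nonneg _) zero_le_one
      · rw [norm_smul]; exact mul_le_mul (c1 _) (wp k) (norm_nonneg _) hr0
    refine (abs_mul_le (abs_inner_le' (wp m) (le_refl r)) (abs_inner_le' (wp m) nt)).trans ?_
    have K0 := weight_nonneg hr0 hs0 hp0 hh0
    have m1 := mul_le_mul (le_weight_rpp hr0 hs0 hp0 hh0) (le_weight_s hr0 hs0 hp0 hh0) hs0 K0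
    have m2 := mul_le_mul (le_weight_rpp hr0 hs0 hp0 hh0) (le_weight_rp hr0 hs0 hp0 hh0)
      (mul_nonneg hr0 hp0) K0
    linarith only [m1, m2]
  have hqm : inner ℝ (ddq m m x) (Nq x) = -(∑ k, (triple (w x) (ddq k k x) (ddq m m x) +
      triple (q x) (ddw k k x) (ddq m m x))) -
      β * ∑ k : Fin 2, inner ℝ (ddq m m x) (w x k.castSucc • dq k x + q x k.castSucc • dw k x) := by
    rw [eN]
    simp only [inner_sub_right, inner_neg_right, real_inner_smul_right, inner_sum, inner_add_right,
      inner_cross]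
  have hwm : inner ℝ (dw m x) (Nq x) = -(∑ k, (triple (w x) (ddq k k x) (dw m x) +
      triple (q x) (ddw k k x) (dw m x))) -
      β * ∑ k : Fin 2, inner ℝ (dw m x) (w x k.castSucc • dq k x + q x k.castSucc • dw k x) := by
    rw [eN]
    simp only [inner_sub_right, inner_neg_right, real_inner_smul_right, inner_sum, inner_add_right,
      inner_cross]
  -- The coefficient 2ζ of the term with w_m is written as 1 + (2ζ - 1). The unit part takes part in
  -- the exact cancellation; the other is quadratic in q and goes to the lower-order terms.
  have main : inner ℝ (dualDiff (q x) (dw m x) (dq m x) (ddq m m x)) (Nq x) +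
      inner ℝ (dualMean (q x) (dw m x) (dq m x) (ddw m m x)) (Nw x) =
      -inner ℝ (ddq m m x) (Nq x) - inner ℝ (dw m x) (q x) * inner ℝ (dw m x) (Nq x) +
      (-(zeta (q x) ^ 2 * inner ℝ (dw m x) (q x) ^ 2 * inner ℝ (q x) (Nq x)) -
        (2 * zeta (q x) - 1) * inner ℝ (dw m x) (q x) * inner ℝ (dw m x) (Nq x) -
        (zeta (q x) ^ 2 * inner ℝ (q x) (dq m x) ^ 2 + 2 * zeta (q x) *
          (inner ℝ (dq m x) (dq m x) + inner ℝ (q x) (ddq m m x))) / 4 * inner ℝ (q x) (Nq x) +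
        2 * (zeta (q x) ^ 2 * inner ℝ (q x) (dq m x) * inner ℝ (dw m x) (q x) *
          inner ℝ (q x) (Nw x) + zeta (q x) * (inner ℝ (ddw m m x) (q x) +
          inner ℝ (dw m x) (dq m x)) * inner ℝ (q x) (Nw x) +
          zeta (q x) * inner ℝ (dw m x) (q x) * inner ℝ (dq m x) (Nw x))) := by
    simp only [dualDiff, dualMean, inner_sub_left, inner_neg_left, inner_add_left,
      real_inner_smul_left]
    ring
  rw [main]
  rw [hqm]
  -- Only the occurrence with coefficient 1 is expanded; in the one with 2ζ - 1 the right-hand side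
  -- N is estimated by its size.
  nth_rewrite 1 [hwm]
  have c0 := core 0
  have c1 := core 1
  have t0 := tr 0
  have t1 := tr 1
  simp only [Fin.sum_univ_two]
  have bt : |β * (inner ℝ (dw m x) (q x) * inner ℝ (dw m x)
      (w x (0 : Fin 2).castSucc • dq 0 x + q x (0 : Fin 2).castSucc • dw 0 x) +
      inner ℝ (dw m x) (q x) * inner ℝ (dw m x)
      (w x (1 : Fin 2).castSucc • dq 1 x + q x (1 : Fin 2).castSucc • dw 1 x))| ≤
      |β| * (2 * weight r s p H ^ 2 + 2 * weight r s p H ^ 2) := by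
    rw [abs_mul]
    exact mul_le_mul_of_nonneg_left ((abs_add_le _ _).trans (add_le_add t0 t1)) (abs_nonneg _)
  refine le_trans (le_trans (le_of_eq (congrArg _ ?_)) ((abs_add_le _ _).trans (add_le_add
    ((abs_add_le _ _).trans (add_le_add ((abs_add_le _ _).trans (add_le_add c0 c1)) low)) bt)))
    (le_of_eq ?_)
  · ring
  · ring

end Pair
end LLHelicity

/-! ### Integrated spatial inequalities -/

namespace LLHelicity
set_option linter.unusedSectionVars false

namespace Pair

variable {c₀ : ℝ} {w q : Plane → Space} {dw dq : Fin 2 → Plane → Space}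
    {ddw ddq : Fin 2 → Fin 2 → Plane → Space}

/-- The spatial inequality for the energy of the transported gradients. -/
lemma integral_density_le (hc : 0 < c₀) (h : Pair c₀ w q dw dq ddw ddq) {β n₀ : ℝ} (hn : 0 ≤ n₀)
    {Nq Nw : Plane → Space} (hNq : IsDiffField β w q dw dq ddw ddq Nq)
    (bNq : IsFieldBound n₀ dw dq ddw ddq Nq) (bNw : IsFieldBound n₀ dw dq ddw ddq Nw) (m : Fin 2)
    (hi : Integrable (fun x => inner ℝ (dualDiff (q x) (dw m x) (dq m x) (ddq m m x)) (Nq x) +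
      inner ℝ (dualMean (q x) (dw m x) (dq m x) (ddw m m x)) (Nw x))) :
    ∫ x, (inner ℝ (dualDiff (q x) (dw m x) (dq m x) (ddq m m x)) (Nq x) +
      inner ℝ (dualMean (q x) (dw m x) (dq m x) (ddw m m x)) (Nw x)) ≤
    (200 + 20 * (2 / c₀ + (2 / c₀) ^ 2) * n₀ + 12 * |β|) *
      ∫ x, errWeight q dw dq ddw ddq x ^ 2 := by
  have i1 := integrable_finsetSum Finset.univ fun k (_ : k ∈ Finset.univ) => h.integrable_nullForm m k
  have i2 := integrable_finsetSum Finset.univ fun k (_ : k ∈ Finset.univ) => (h.integral_flux m k).1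
  have i3 := (integrable_finsetSum Finset.univ fun k (_ : k ∈ Finset.univ) =>
    (h.integral_transport m k).1).const_mul β
  have z1 : ∫ x, (∑ k, (triple (w x) (ddq k k x) (ddq m m x) +
      triple (dw m x) (ddq k k x) (dq m x) - triple (dw k x) (ddq m k x) (dq m x))) = 0 := by
    rw [integral_finsetSum _ fun k _ => h.integrable_nullForm m k]
    exact Finset.sum_eq_zero fun k _ => h.integral_nullForm m k
  have z2 := integral_finsetSum Finset.univ fun k (_ : k ∈ Finset.univ) => (h.integral_flux m k).1
  rw [Finset.sum_eq_zero fun k _ => (h.integral_flux m k).2] at z2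
  have z3 := integral_finsetSum Finset.univ fun k (_ : k ∈ Finset.univ) =>
    (h.integral_transport m k).1
  have b0 := (h.integral_transport m 0).2
  have b1 := (h.integral_transport m 1).2
  have hD := h.density_bound hc hn hNq bNq bNw m
  set κ := ∫ x, errWeight q dw dq ddw ddq x ^ 2 with hκ
  have hr := integral_mono_of_nonneg (ae_of_all _ fun x => abs_nonneg _)
    (h.integrable_errWeight.const_mul
      (200 + 20 * (2 / c₀ + (2 / c₀) ^ 2) * n₀ + 4 * |β|)) hD
  rw [integral_const_mul] at hr
  have e3 := integral_sub ((hi.sub i1).sub i2) i3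
  have e2 := integral_sub (hi.sub i1) i2
  have e1 := integral_sub hi i1
  simp only [Pi.sub_apply] at e1 e2 e3
  have hle := (le_abs_self _).trans (abs_integral_le_integral_abs.trans hr)
  rw [e3, e2, e1, z1, z2, integral_const_mul, z3, Fin.sum_univ_two] at hle
  have bβ : β * ((∫ x, inner ℝ (ddq m m x) (w x (0 : Fin 2).castSucc • dq 0 x +
      q x (0 : Fin 2).castSucc • dw 0 x)) + ∫ x, inner ℝ (ddq m m x)
      (w x (1 : Fin 2).castSucc • dq 1 x + q x (1 : Fin 2).castSucc • dw 1 x)) ≤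
      |β| * (4 * κ + 4 * κ) := by
    refine (le_abs_self _).trans ?_
    rw [abs_mul]
    exact mul_le_mul_of_nonneg_left ((abs_add_le _ _).trans (add_le_add b0 b1)) (abs_nonneg _)
  linarith

/-- In q·N the product [q, w_kk, q] vanishes. The term with q_kk is left aside as the sum, to be
integrated by parts, so only helicity terms are estimated here. -/
lemma inner_q_bound (h : Pair c₀ w q dw dq ddw ddq) {β : ℝ}
    {Nq : Plane → Space} (hNq : IsDiffField β w q dw dq ddw ddq Nq) :
    ∀ᵐ x, |inner ℝ (q x) (Nq x) + ∑ k, inner ℝ (ddq k k x) (crossB (q x) (w x))| ≤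
      4 * |β| * errWeight q dw dq ddw ddq x ^ 2 := by
  filter_upwards [hNq, h.sphere] with x eN hs
  have qs := norm_dq_le dq x
  have wp := norm_dw_le dw dq x
  have wh := norm_ddw_le ddw ddq x
  have hK : errWeight q dw dq ddw ddq x = weight ‖q x‖ (∑ i, ‖dq i x‖)
    (∑ i, (‖dw i x‖ + ‖dq i x‖)) (∑ i, ∑ j, (‖ddw i j x‖ + ‖ddq i j x‖)) := rfl
  rw [hK]
  generalize ∑ i, ‖dq i x‖ = s at *
  generalize ∑ i, (‖dw i x‖ + ‖dq i x‖) = p at *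
  generalize ∑ i, ∑ j, (‖ddw i j x‖ + ‖ddq i j x‖) = H at *
  have hr0 : 0 ≤ ‖q x‖ := norm_nonneg _
  have hs0 : 0 ≤ s := (norm_nonneg _).trans (qs 0)
  have hp0 : 0 ≤ p := (norm_nonneg _).trans (wp 0)
  have hh0 : 0 ≤ H := (norm_nonneg _).trans (wh 0 0)
  have hw1 : ‖w x‖ ≤ 1 := by nlinarith [sq_nonneg ‖q x‖, norm_nonneg (w x)]
  have K0 := weight_nonneg hr0 hs0 hp0 hh0
  have m1 := mul_le_mul (le_weight_r hr0 hs0 hp0 hh0) (le_weight_s hr0 hs0 hp0 hh0) hs0 K0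
  have m2 := mul_le_mul (le_weight_r hr0 hs0 hp0 hh0) (le_weight_rp hr0 hs0 hp0 hh0)
    (mul_nonneg hr0 hp0) K0
  have tr : ∀ k : Fin 2, |inner ℝ (q x) (w x k.castSucc • dq k x + q x k.castSucc • dw k x)| ≤
      2 * weight ‖q x‖ s p H ^ 2 := by
    intro k
    have c1 : ∀ a : Space, |a k.castSucc| ≤ ‖a‖ := fun a => PiLp.norm_apply_le a k.castSucc
    have nt : ‖w x k.castSucc • dq k x + q x k.castSucc • dw k x‖ ≤ 1 * s + ‖q x‖ * p := by
      refine (norm_add_le _ _).trans (add_le_add ?_ ?_)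
      · rw [norm_smul]; exact mul_le_mul ((c1 _).trans hw1) (qs k) (norm_nonneg _) zero_le_one
      · rw [norm_smul]; exact mul_le_mul (c1 _) (wp k) (norm_nonneg _) hr0
    refine (abs_inner_le' le_rfl nt).trans ?_
    linarith only [m1, m2]
  have z : ∀ a b : Space, triple a b a = 0 := fun a b => by simp only [triple_eq]; ring
  have e : inner ℝ (q x) (Nq x) + ∑ k, inner ℝ (ddq k k x) (crossB (q x) (w x)) =
      -(β * ∑ k : Fin 2, inner ℝ (q x) (w x k.castSucc • dq k x + q x k.castSucc • dw k x)) := by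
    rw [eN]
    simp only [inner_sub_right, inner_neg_right, real_inner_smul_right, inner_sum, inner_add_right,
      inner_cross, z, crossB_apply, add_zero]
    have : ∀ k, triple (q x) (w x) (ddq k k x) = triple (w x) (ddq k k x) (q x) := fun k => by
      simp only [triple_eq]; ring
    simp only [this]
    ring
  rw [e, abs_neg, abs_mul, Fin.sum_univ_two]
  refine (mul_le_mul_of_nonneg_left ((abs_add_le _ _).trans (add_le_add (tr 0) (tr 1)))
    (abs_nonneg _)).trans (le_of_eq ?_)
  ring

/-- The spatial inequality for the difference. -/
lemma integral_inner_q_le (h : Pair c₀ w q dw dq ddw ddq) {β : ℝ}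
    {Nq : Plane → Space} (hN : MemLp Nq 2 volume) (hNq : IsDiffField β w q dw dq ddw ddq Nq) :
    ∫ x, inner ℝ (q x) (Nq x) ≤ (4 * |β| + 2) * ∫ x, errWeight q dw dq ddw ddq x ^ 2 := by
  have l2 : ∀ {g : Plane → Space}, MemLp g 2 volume → MemLp g (lp 2) volume := fun h => by
    rwa [lp_two]
  have n1 := memLp_bilin_top_right crossB h.q_two h.w_top
  have n2 := fun k => memLp_bilin_top_right crossB (h.dq_two k) h.w_top
  have n3 := fun k => memLp_bilin_top_left crossB h.q_top (h.dw_two k)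
  have i1 := fun k => integrable_inner (h.ddq_two k k) n1
  have I : ∀ k, |∫ x, inner ℝ (ddq k k x) (crossB (q x) (w x))| ≤
      ∫ x, errWeight q dw dq ddw ddq x ^ 2 := fun k => by
    -- After this integration by parts [q_k, w, q_k] vanishes and [q, w_k, q_k] remains, with two
    -- small factors.
    have e := W.ibp innerB (h.W_dq k k) ((h.W_q k).bilin crossB (h.W_w k)) (l2 (h.dq_two k))
      (l2 (h.ddq_two k k)) (l2 n1) (l2 ((n2 k).add (n3 k)))
    simp only [innerB_apply] at e
    rw [e, abs_neg]
    refine abs_integral_le_integral_abs.trans (integral_mono_of_nonneg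
      (ae_of_all _ fun x => abs_nonneg _) h.integrable_errWeight ?_)
    filter_upwards with x
    have qs := norm_dq_le dq x
    have wp := norm_dw_le dw dq x
    have wh := norm_ddw_le ddw ddq x
    have hK : errWeight q dw dq ddw ddq x = weight ‖q x‖ (∑ i, ‖dq i x‖)
      (∑ i, (‖dw i x‖ + ‖dq i x‖)) (∑ i, ∑ j, (‖ddw i j x‖ + ‖ddq i j x‖)) := rfl
    rw [hK]
    generalize ∑ i, ‖dq i x‖ = s at *
    generalize ∑ i, (‖dw i x‖ + ‖dq i x‖) = p at *
    generalize ∑ i, ∑ j, (‖ddw i j x‖ + ‖ddq i j x‖) = H at *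
    have hr0 : 0 ≤ ‖q x‖ := norm_nonneg _
    have hs0 : 0 ≤ s := (norm_nonneg _).trans (qs 0)
    have hp0 : 0 ≤ p := (norm_nonneg _).trans (wp 0)
    have hh0 : 0 ≤ H := (norm_nonneg _).trans (wh 0 0)
    have z : ∀ a b : Space, triple a b a = 0 := fun a b => by simp only [triple_eq]; ring
    simp only [inner_add_right, inner_cross, z, crossB_apply, zero_add]
    refine (abs_triple_le' le_rfl (wp k) (qs k)).trans ?_
    have m1 := mul_le_mul (le_weight_r hr0 hs0 hp0 hh0) (le_weight_sp hr0 hs0 hp0 hh0)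
      (mul_nonneg hs0 hp0) (weight_nonneg hr0 hs0 hp0 hh0)
    linarith only [m1]
  have is := integrable_finsetSum Finset.univ fun k (_ : k ∈ Finset.univ) => i1 k
  have hr := integral_mono_of_nonneg (ae_of_all _ fun x => abs_nonneg _)
    (h.integrable_errWeight.const_mul (4 * |β|)) (h.inner_q_bound hNq)
  rw [integral_const_mul] at hr
  have hle := (le_abs_self _).trans (abs_integral_le_integral_abs.trans hr)
  have e := integral_add (integrable_inner h.q_two hN) is
  have e' := integral_finsetSum Finset.univ fun k (_ : k ∈ Finset.univ) => i1 k
  rw [Fin.sum_univ_two] at e'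
  rw [e, e'] at hle
  have I0 := (abs_le.1 (I 0)).1
  have I1 := (abs_le.1 (I 1)).1
  linarith

end Pair
end LLHelicity

namespace LLHelicity
set_option linter.unusedSectionVars false

/-! ### Products and quotients -/

section Products

variable {ι : Type*} {l : Filter ι} {i j : ℕ}

lemma TL.mul_fun {c d : ι → Plane → ℝ} {c₀ d₀ : Plane → ℝ} (hc : TL (lp i) l c c₀)
    (hd : TL (lp j) l d d₀) (h : i + j ≤ 4 := by norm_num) :
    TL (lp (i + j)) l (fun n x => c n x * d n x) (fun x => c₀ x * d₀ x) :=
  hc.bilin (one_le_lp h) (ContinuousLinearMap.mul ℝ ℝ) hd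

lemma TL.smul_fun {c : ι → Plane → ℝ} {c₀ : Plane → ℝ} {f : ι → Plane → Space}
    {f₀ : Plane → Space} (hc : TL (lp i) l c c₀) (hf : TL (lp j) l f f₀)
    (h : i + j ≤ 4 := by norm_num) :
    TL (lp (i + j)) l (fun n x => c n x • f n x) (fun x => c₀ x • f₀ x) := by
  simpa only [smulB_apply] using hc.bilin (one_le_lp h) smulB hf

lemma TL.inner_fun {f g : ι → Plane → Space} {f₀ g₀ : Plane → Space} (hf : TL (lp i) l f f₀)
    (hg : TL (lp j) l g g₀) (h : i + j ≤ 4 := by norm_num) :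
    TL (lp (i + j)) l (fun n x => (inner ℝ (f n x) (g n x) : ℝ)) (fun x => inner ℝ (f₀ x) (g₀ x)) := by
  simpa only [innerB_apply] using hf.bilin (one_le_lp h) innerB hg

lemma W.mul_fun {m : Fin 2} {c d c' d' : Plane → ℝ} (hc : W m i c c') (hd : W m j d d')
    (h : i + j ≤ 3 := by norm_num) :
    W m (i + j) (fun x => c x * d x) (fun x => c' x * d x + c x * d' x) :=
  hc.bilin (ContinuousLinearMap.mul ℝ ℝ) hd h

lemma W.smul_fun {m : Fin 2} {c c' : Plane → ℝ} {f f' : Plane → Space} (hc : W m i c c')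
    (hf : W m j f f') (h : i + j ≤ 3 := by norm_num) :
    W m (i + j) (fun x => c x • f x) (fun x => c' x • f x + c x • f' x) := by
  simpa only [smulB_apply] using hc.bilin smulB hf h

lemma W.inner_fun {m : Fin 2} {f g f' g' : Plane → Space} (hf : W m i f f')
    (hg : W m j g g') (h : i + j ≤ 3 := by norm_num) :
    W m (i + j) (fun x => (inner ℝ (f x) (g x) : ℝ))
      (fun x => inner ℝ (f' x) (g x) + inner ℝ (f x) (g' x)) := by
  simpa only [innerB_apply] using hf.bilin innerB hg h

lemma memLp_top_inv {d : Plane → ℝ} {c : ℝ} (hc : 0 < c) (hd : MemLp d ⊤ volume)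
    (h : ∀ᵐ x, c ≤ d x) : MemLp (fun x => (d x)⁻¹) ⊤ volume := by
  refine memLp_top_of_bound hd.1.aemeasurable.inv.aestronglyMeasurable c⁻¹ ?_
  filter_upwards [h] with x hx
  rw [Real.norm_eq_abs, abs_of_nonneg (inv_nonneg.2 (hc.le.trans hx))]
  exact inv_anti₀ hc hx

lemma TL.inv_fun {d : ι → Plane → ℝ} {d₀ : Plane → ℝ} {c : ℝ} (hc : 0 < c) (hd : TL ⊤ l d d₀)
    (h : ∀ᶠ n in l, ∀ᵐ x, c ≤ d n x) (h₀ : ∀ᵐ x, c ≤ d₀ x) :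
    TL ⊤ l (fun n x => (d n x)⁻¹) (fun x => (d₀ x)⁻¹) := by
  refine ⟨?_, memLp_top_inv hc hd.mem h₀, ?_⟩
  · filter_upwards [hd.memF, h] with n h1 h2 using memLp_top_inv hc h1 h2
  have t := ENNReal.Tendsto.const_mul (a := ENNReal.ofReal ((c⁻¹) ^ 2)) hd.lim (Or.inr (by simp))
  rw [mul_zero] at t
  refine tendsto_of_tendsto_of_tendsto_of_le_of_le' tendsto_const_nhds t
    (Eventually.of_forall fun _ => zero_le) ?_
  filter_upwards [h] with n hn
  refine eLpNorm_le_mul_eLpNorm_of_ae_le_mul ?_ ⊤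
  filter_upwards [hn, h₀] with x h1 h2
  have p1 : 0 < d n x := hc.trans_le h1
  have p2 : 0 < d₀ x := hc.trans_le h2
  rw [inv_sub_inv p1.ne' p2.ne', norm_div, norm_sub_rev, Real.norm_eq_abs (_ * _),
    abs_of_pos (mul_pos p1 p2), div_eq_mul_inv, mul_comm]
  refine mul_le_mul_of_nonneg_right ?_ (norm_nonneg _)
  rw [inv_pow]
  exact inv_anti₀ (by positivity) (by nlinarith)

/-- The approximations converge uniformly, so from some index N on they are at least c/2 almost
everywhere, and by continuity everywhere. Shifting the sequence by N makes all reciprocals C¹, with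
derivatives given by the chain rule. -/
lemma W.inv_fun {m : Fin 2} {d d' : Plane → ℝ} {c : ℝ} (hc : 0 < c) (hd : W m 0 d d')
    (h : ∀ᵐ x, c ≤ d x) : W m 0 (fun x => (d x)⁻¹) (fun x => -((d x)⁻¹ * (d x)⁻¹ * d' x)) := by
  obtain ⟨A, hA, h0, h1⟩ := hd
  rw [lp_zero] at h0
  have ev : ∀ᶠ n in atTop, ∀ x, c / 2 ≤ A n x := by
    filter_upwards [h0.lim.eventually_lt_const (u := ENNReal.ofReal (c / 2)) (by simpa),
      h0.memF] with n hn hm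
    have ae : ∀ᵐ x, c / 2 ≤ A n x := by
      filter_upwards [h, ae_le_eLpNormEssSup (f := fun x => A n x - d x) (μ := volume)] with x h2 h3
      rw [eLpNorm_exponent_top] at hn
      have := h3.trans_lt hn
      rw [← ofReal_norm, ENNReal.ofReal_lt_ofReal_iff (by positivity), Real.norm_eq_abs] at this
      linarith [neg_abs_le (A n x - d x)]
    have cl : IsClosed {x | c / 2 ≤ A n x} := isClosed_le continuous_const (hA n).continuous
    have : {x | c / 2 ≤ A n x} = univ := cl.closure_eq.symm.trans (Measure.dense_of_ae ae).closure_eq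
    exact fun x => this.ge (mem_univ x)
  obtain ⟨N, hN⟩ := eventually_atTop.1 ev
  have sh : Tendsto (fun n => n + N) atTop atTop := tendsto_add_atTop_nat N
  have hpos : ∀ n x, A (n + N) x ≠ 0 := fun n x =>
    (lt_of_lt_of_le (by positivity) (hN (n + N) (Nat.le_add_left _ _) x)).ne'
  have t0 := TL.inv_fun (c := c / 2) (by positivity) (h0.comp sh)
    (Eventually.of_forall fun n => ae_of_all _ (hN _ (Nat.le_add_left _ _)))
    (by filter_upwards [h] with x hx; linarith)
  rw [← lp_zero] at t0
  refine ⟨fun n x => (A (n + N) x)⁻¹, fun n => (hA _).inv (hpos n), t0, ?_⟩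
  refine ((t0.mul_fun t0).mul_fun (h1.comp sh)).neg.congr_left
    (Eventually.of_forall fun n => ae_of_all _ fun x => ?_)
  have hd := ((hA (n + N)).differentiable (by simp) x).hasFDerivAt
  have := ((hasDerivAt_inv (hpos n x)).comp_hasFDerivAt x hd).fderiv
  simp only [pd]
  rw [show fderiv ℝ (fun x => (A (n + N) x)⁻¹) x = _ from this]
  simp only [smul_apply, smul_eq_mul]
  ring

end Products

/-! ### The factor `ζ` -/

lemma zeta_eq (q : Space) : zeta q = (2 + (-(1 / 2) : ℝ) • (inner ℝ q q : ℝ))⁻¹ := by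
  rw [zeta, real_inner_self_eq_norm_sq, smul_eq_mul,
    show 2 + -(1 / 2) * ‖q‖ ^ 2 = (4 - ‖q‖ ^ 2) / 2 by ring, inv_div]

lemma le_zeta_den {c₀ : ℝ} {q : Space} (hq : ‖q‖ ^ 2 ≤ 4 - c₀) :
    c₀ / 2 ≤ 2 + (-(1 / 2) : ℝ) • (inner ℝ q q : ℝ) := by
  rw [real_inner_self_eq_norm_sq, smul_eq_mul]
  linarith

/-- An exact secant formula: the increment of ζ is linear in the increment of q with an explicit
factor, which is what exact increments of the energy require. -/
lemma zeta_sub {p q : Space} {c₀ : ℝ} (hc : 0 < c₀) (hp : ‖p‖ ^ 2 ≤ 4 - c₀)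
    (hq : ‖q‖ ^ 2 ≤ 4 - c₀) :
    zeta p - zeta q = 1 / 2 * (zeta q * zeta p) * inner ℝ (p + q) (p - q) := by
  have h1 := (zeta_spec hc hp).2.2
  have h2 := (zeta_spec hc hq).2.2
  have e : (inner ℝ (p + q) (p - q) : ℝ) = ‖p‖ ^ 2 - ‖q‖ ^ 2 := by
    simp only [inner_add_left, inner_sub_right, real_inner_self_eq_norm_sq, real_inner_comm p q]
    ring
  rw [e]
  linear_combination (1 / 2 * zeta q) * h1 - (1 / 2 * zeta p) * h2

lemma TL.zeta_fun {ι : Type*} {l : Filter ι} {q : ι → Plane → Space} {q₀ : Plane → Space} {c₀ : ℝ}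
    (hc : 0 < c₀) (hq : TL (lp 0) l q q₀) (h : ∀ᶠ n in l, ∀ᵐ x, ‖q n x‖ ^ 2 ≤ 4 - c₀)
    (h₀ : ∀ᵐ x, ‖q₀ x‖ ^ 2 ≤ 4 - c₀) :
    TL (lp 0) l (fun n x => zeta (q n x)) (fun x => zeta (q₀ x)) := by
  have c2 : TL (lp 0) l (fun (_ : ι) (_ : Plane) => (2 : ℝ)) (fun _ => 2) :=
    TL.const (by rw [lp_zero]; exact memLp_top_const _)
  have d := c2.add (one_le_lp (by norm_num)) ((hq.inner_fun hq).smul (-(1 / 2)))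
  rw [lp_zero] at d ⊢
  simp only [zeta_eq]
  refine TL.inv_fun (half_pos hc) d (h.mono fun n hn => hn.mono fun x hx => le_zeta_den hx)
    (h₀.mono fun x hx => le_zeta_den hx)

lemma W.zeta_fun {m : Fin 2} {q q' : Plane → Space} {c₀ : ℝ} (hc : 0 < c₀) (hq : W m 0 q q')
    (h₀ : ∀ᵐ x, ‖q x‖ ^ 2 ≤ 4 - c₀) :
    W m 0 (fun x => zeta (q x)) (fun x => zeta (q x) * zeta (q x) * inner ℝ (q x) (q' x)) := by
  have d := (W.const (i := m) (2 : ℝ)).add ((hq.inner_fun hq).smul (-(1 / 2)))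
  have := d.inv_fun (half_pos hc) (h₀.mono fun x hx => le_zeta_den hx)
  simp only [← zeta_eq] at this
  refine this.congr (ae_eq_refl _) (ae_of_all _ fun x => ?_)
  simp only [smul_eq_mul, real_inner_comm (q x) (q' x)]
  ring

/-! ### Bounded weakly convergent families -/

/-- Weak convergence in `L²` of a bounded family. -/
structure WB {ι : Type*} (l : Filter ι) (g : ι → Plane → Space) (g₀ : Plane → Space) : Prop where
  wl : WL l g g₀
  mem : MemLp g₀ 2 volume
  bound : ∃ K : ℝ≥0∞, K ≠ ⊤ ∧ ∀ᶠ n in l, MemLp (g n) 2 volume ∧ eLpNorm (g n) 2 volume ≤ K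

section WB

variable {ι : Type*} {l : Filter ι} {g g' : ι → Plane → Space} {g₀ g₀' : Plane → Space}

lemma eLpNorm_two_le {f : Plane → Space} (hf : MemLp f 2 volume) {K : ℝ≥0∞} (hK : K ≠ ⊤)
    (h : eLpNorm f 2 volume ≤ K) : ∫ x, ‖f x‖ ^ 2 ≤ K.toReal ^ 2 := by
  rw [eLpNorm_two_eq hf, ENNReal.ofReal_le_iff_le_toReal hK] at h
  exact (Real.sqrt_le_left (ENNReal.toReal_nonneg)).1 h

lemma TL.wb (h : TL 2 l g g₀) : WB l g g₀ := by
  refine ⟨h.wl, h.mem, eLpNorm g₀ 2 volume + 1, ENNReal.add_ne_top.2 ⟨h.mem.2.ne, by simp⟩, ?_⟩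
  have := (h.tendsto_eLpNorm (by norm_num)).eventually_lt_const
    (ENNReal.lt_add_right h.mem.2.ne one_ne_zero)
  filter_upwards [h.memF, this] with n h1 h2 using ⟨h1, h2.le⟩

namespace WB

lemma comp {κ : Type*} {l' : Filter κ} {k : κ → ι} (h : WB l g g₀) (hk : Tendsto k l' l) :
    WB l' (fun n => g (k n)) g₀ := by
  obtain ⟨K, hK, hb⟩ := h.bound
  exact ⟨fun A hA => (h.wl A hA).comp hk, h.mem, K, hK, hk.eventually hb⟩

lemma add (h : WB l g g₀) (h' : WB l g' g₀') :
    WB l (fun n x => g n x + g' n x) (fun x => g₀ x + g₀' x) := by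
  obtain ⟨K, hK, hb⟩ := h.bound
  obtain ⟨K', hK', hb'⟩ := h'.bound
  refine ⟨fun A hA => ?_, h.mem.add h'.mem, K + K', ENNReal.add_ne_top.2 ⟨hK, hK'⟩, ?_⟩
  · simp only [inner_add_right]
    rw [integral_add (integrable_inner hA h.mem) (integrable_inner hA h'.mem)]
    refine ((h.wl A hA).add (h'.wl A hA)).congr' ?_
    filter_upwards [hb, hb'] with n h1 h2
    exact (integral_add (integrable_inner hA h1.1) (integrable_inner hA h2.1)).symm
  · filter_upwards [hb, hb'] with n h1 h2
    exact ⟨h1.1.add h2.1, (eLpNorm_add_le h1.1.1 h2.1.1 (by norm_num)).trans (add_le_add h1.2 h2.2)⟩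

lemma smul (c : ℝ) (h : WB l g g₀) : WB l (fun n x => c • g n x) (fun x => c • g₀ x) := by
  obtain ⟨K, hK, hb⟩ := h.bound
  refine ⟨fun A hA => ?_, h.mem.const_smul c, ‖c‖ₑ * K, ENNReal.mul_ne_top (by simp) hK, ?_⟩
  · simp only [inner_smul_right, integral_const_mul]
    exact (h.wl A hA).const_mul c
  · filter_upwards [hb] with n h1
    refine ⟨h1.1.const_smul c, ?_⟩
    exact (eLpNorm_const_smul_le (c := c) (f := g n)).trans (mul_le_mul_right h1.2 _)

lemma sub (h : WB l g g₀) (h' : WB l g' g₀') :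
    WB l (fun n x => g n x - g' n x) (fun x => g₀ x - g₀' x) := by
  simpa [sub_eq_add_neg] using h.add (h'.smul (-1))

/-- In a pairing with A both uniformly convergent factors are moved onto A, leaving the weakly
convergent g alone. All second derivatives in the energy factors occur linearly, either bare or in
this rank-one form. -/
lemma rankOne {p q : ι → Plane → Space} {p₀ q₀ : Plane → Space} (h : WB l g g₀)
    (hp : TL (lp 0) l p p₀) (hq : TL (lp 0) l q q₀) :
    WB l (fun n x => (inner ℝ (g n x) (q n x) : ℝ) • p n x)
      (fun x => (inner ℝ (g₀ x) (q₀ x) : ℝ) • p₀ x) := by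
  obtain ⟨K, hK, hb⟩ := h.bound
  have m : ∀ {g p q : Plane → Space}, MemLp g 2 volume → MemLp p ⊤ volume → MemLp q ⊤ volume →
      MemLp (fun x => (inner ℝ (g x) (q x) : ℝ) • p x) 2 volume ∧
        eLpNorm (fun x => (inner ℝ (g x) (q x) : ℝ) • p x) 2 volume ≤
          eLpNorm g 2 volume * eLpNorm q ⊤ volume * eLpNorm p ⊤ volume := by
    intro g p q hg hp hq
    have m1 : MemLp (fun x => (inner ℝ (g x) (q x) : ℝ)) 2 volume := innerB.memLp_of_bilin 2 hg hq
    refine ⟨smulB.memLp_of_bilin 2 m1 hp, ?_⟩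
    have b1 := eLpNorm_le_eLpNorm_mul_eLpNorm_of_nnnorm (p := 2) (q := ⊤) (r := 2) m1.1 hp.1 (fun c v => c • v) 1
      (ae_of_all _ fun x => by simp [nnnorm_smul])
    have b2 := eLpNorm_le_eLpNorm_mul_eLpNorm_of_nnnorm (p := 2) (q := ⊤) (r := 2) hg.1 hq.1
      (fun v w => (inner ℝ v w : ℝ)) 1
      (ae_of_all _ fun x => by simpa using nnnorm_inner_le_nnnorm (𝕜 := ℝ) (g x) (q x))
    simp only [ENNReal.coe_one, one_mul] at b1 b2
    exact b1.trans (mul_le_mul_left b2 _)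
  rw [lp_zero] at hp hq
  refine ⟨fun A hA => ?_, (m h.mem hp.mem hq.mem).1,
    K * (eLpNorm q₀ ⊤ volume + 1) * (eLpNorm p₀ ⊤ volume + 1), ?_, ?_⟩
  · have e : ∀ a g p q : Space, (inner ℝ a ((inner ℝ g q : ℝ) • p) : ℝ) =
        inner ℝ ((inner ℝ a p : ℝ) • q) g := fun a g p q => by
      rw [real_inner_smul_right, real_inner_smul_left, real_inner_comm g q]; ring
    simp only [e]
    have hA' : TL (lp 2) l (fun _ => A) A := TL.const (by rw [lp_two]; exact hA)
    rw [← lp_zero] at hp hq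
    have T := (hA'.inner_fun hp).smul_fun hq
    rw [show lp (2 + 0 + 0) = 2 from lp_two] at T
    exact h.wl.pair T (K.toReal ^ 2) (hb.mono fun n hn => ⟨hn.1, eLpNorm_two_le hn.1 hK hn.2⟩)
  · exact ENNReal.mul_ne_top (ENNReal.mul_ne_top hK (ENNReal.add_ne_top.2 ⟨hq.mem.2.ne, by simp⟩))
      (ENNReal.add_ne_top.2 ⟨hp.mem.2.ne, by simp⟩)
  · have b : ∀ {f : ι → Plane → Space} {f₀}, TL ⊤ l f f₀ →
        ∀ᶠ n in l, eLpNorm (f n) ⊤ volume ≤ eLpNorm f₀ ⊤ volume + 1 := fun h => by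
      have := (h.tendsto_eLpNorm (by norm_num)).eventually_lt_const
        (ENNReal.lt_add_right h.mem.2.ne one_ne_zero)
      exact this.mono fun _ h => h.le
    filter_upwards [hb, hp.memF, hq.memF, b hp, b hq] with n h1 h2 h3 h4 h5
    obtain ⟨m1, m2⟩ := m h1.1 h2 h3
    exact ⟨m1, m2.trans (mul_le_mul' (mul_le_mul' h1.2 h5) h4)⟩

end WB
end WB
end LLHelicity

namespace LLHelicity
set_option linter.unusedSectionVars false

/-! ### Increments of the energy of the transported gradients -/

/-- The mean and the difference of two maps with their derivatives of order at most two. -/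
structure Jet where
  w : Plane → Space
  q : Plane → Space
  dw : Fin 2 → Plane → Space
  dq : Fin 2 → Plane → Space
  ddw : Fin 2 → Fin 2 → Plane → Space
  ddq : Fin 2 → Fin 2 → Plane → Space

/-- The jet of a pair of maps that are nowhere antipodal. -/
abbrev Jet.IsPair (c₀ : ℝ) (J : Jet) : Prop := Pair c₀ J.w J.q J.dw J.dq J.ddw J.ddq

/-- The density of half the energy of a transported gradient. -/
noncomputable def density (q wm qm : Space) : ℝ :=
  1 / 2 * inner ℝ qm qm - zeta q * (inner ℝ wm q * inner ℝ wm q) +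
    1 / 4 * (zeta q * (inner ℝ q qm * inner ℝ q qm))

noncomputable def Jet.energy (m : Fin 2) (J : Jet) : ℝ :=
  ∫ x, density (J.q x) (J.dw m x) (J.dq m x)

/-- The factor of the increment of the difference in the increment of the energy. -/
noncomputable def incDiff (q q' wm wm' qm qm' qmm qmm' : Space) : Space :=
  ((-(1 / 2) : ℝ) • (qmm' + qmm) +
    ((-(1 / 2) : ℝ) • ((zeta q * zeta q') * (inner ℝ wm' q' * inner ℝ wm' q')) • (q' + q) -
      (zeta q * (inner ℝ wm' q' + inner ℝ wm q)) • wm +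
    (1 / 4 : ℝ) • ((1 / 2 : ℝ) •
        ((zeta q * zeta q') * (inner ℝ q' qm' * inner ℝ q' qm')) • (q' + q) +
      (zeta q * (inner ℝ q' qm' + inner ℝ q qm)) • qm' -
      (zeta q * zeta q * (inner ℝ q qm * (inner ℝ q' qm' + inner ℝ q qm))) • q -
      (zeta q * (inner ℝ qm' qm' + inner ℝ qm qm)) • q -
      (zeta q * (inner ℝ q' qm' + inner ℝ q qm)) • qm))) -
  (1 / 4 : ℝ) • ((inner ℝ qmm' q' : ℝ) • zeta q • q + (inner ℝ qmm q : ℝ) • zeta q • q)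

/-- The factor of the increment of the mean in the increment of the energy. -/
noncomputable def incMean (q q' wm wm' qm qm' wmm wmm' : Space) : Space :=
  ((zeta q * zeta q * (inner ℝ q qm * (inner ℝ wm' q' + inner ℝ wm q))) • q' +
    (zeta q * (inner ℝ wm' qm' + inner ℝ wm qm)) • q' +
    (zeta q * (inner ℝ wm' q' + inner ℝ wm q)) • qm') +
  ((inner ℝ wmm' q' : ℝ) • zeta q • q' + (inner ℝ wmm q : ℝ) • zeta q • q')

/-- On the diagonal the two-point factor is the first variation of the energy, so the limit of the
increments is the expression treated by the spatial inequality. -/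
lemma incDiff_self (q wm qm qmm : Space) :
    incDiff q q wm wm qm qm qmm qmm = dualDiff q wm qm qmm := by
  rw [incDiff, dualDiff, real_inner_comm q qmm]
  module

lemma incMean_self (q wm qm wmm : Space) :
    incMean q q wm wm qm qm wmm wmm = dualMean q wm qm wmm := by
  rw [incMean, dualMean]
  module

/-- Convergence of jets: strong up to order one, weak and bounded for the second order. -/
structure JetLim {ι : Type*} (l : Filter ι) (Y : ι → Jet) (J : Jet) : Prop where
  w : TL (lp 0) l (fun n => (Y n).w) J.w
  q : TL (lp 0) l (fun n => (Y n).q) J.q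
  dw : ∀ i, TL (lp 1) l (fun n => (Y n).dw i) (J.dw i)
  dq : ∀ i, TL (lp 1) l (fun n => (Y n).dq i) (J.dq i)
  ddw : ∀ i j, WB l (fun n => (Y n).ddw i j) (J.ddw i j)
  ddq : ∀ i j, WB l (fun n => (Y n).ddq i j) (J.ddq i j)

lemma JetLim.comp {ι κ : Type*} {l : Filter ι} {l' : Filter κ} {k : κ → ι} {Y : ι → Jet} {J : Jet}
    (h : JetLim l Y J) (hk : Tendsto k l' l) : JetLim l' (fun n => Y (k n)) J :=
  ⟨h.w.comp hk, h.q.comp hk, fun i => (h.dw i).comp hk, fun i => (h.dq i).comp hk,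
    fun i j => (h.ddw i j).comp hk, fun i j => (h.ddq i j).comp hk⟩

lemma Jet.IsPair.jetLim_const {ι : Type*} {l : Filter ι} {J : Jet} {c₀ : ℝ} (h : J.IsPair c₀) :
    JetLim l (fun _ => J) J :=
  ⟨TL.const (by rw [lp_zero]; exact h.w_top), TL.const (by rw [lp_zero]; exact h.q_top),
    fun i => TL.const (by rw [lp_one]; exact h.dw_four i),
    fun i => TL.const (by rw [lp_one]; exact h.dq_four i),
    fun i j => (TL.const (h.ddw_two i j)).wb, fun i j => (TL.const (h.ddq_two i j)).wb⟩

section Limits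

attribute [local irreducible] lp

variable {ι : Type*} {l : Filter ι} {Y Y' : ι → Jet} {J J' : Jet} {c₀ : ℝ}

/-- Apart from the terms linear in the second derivatives, every summand is a product of strongly
convergent factors of total order 2, hence converges strongly in L². The second-derivative terms are
bare or of rank one. -/
lemma incDiff_wb (hc : 0 < c₀) (h : JetLim l Y J) (h' : JetLim l Y' J')
    (g : ∀ᶠ n in l, ∀ᵐ x, ‖(Y n).q x‖ ^ 2 ≤ 4 - c₀) (g₀ : ∀ᵐ x, ‖J.q x‖ ^ 2 ≤ 4 - c₀)
    (g' : ∀ᶠ n in l, ∀ᵐ x, ‖(Y' n).q x‖ ^ 2 ≤ 4 - c₀) (g₀' : ∀ᵐ x, ‖J'.q x‖ ^ 2 ≤ 4 - c₀)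
    (m : Fin 2) :
    WB l (fun n x => incDiff ((Y n).q x) ((Y' n).q x) ((Y n).dw m x) ((Y' n).dw m x)
      ((Y n).dq m x) ((Y' n).dq m x) ((Y n).ddq m m x) ((Y' n).ddq m m x))
      (fun x => incDiff (J.q x) (J'.q x) (J.dw m x) (J'.dw m x) (J.dq m x) (J'.dq m x)
        (J.ddq m m x) (J'.ddq m m x)) := by
  have o : ∀ j ≤ 4, 1 ≤ lp j := fun j => one_le_lp
  simp only [incDiff]
  have z := h.q.zeta_fun hc g g₀
  have z' := h'.q.zeta_fun hc g' g₀'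
  have X : TL (lp 1) l _ _ := (h.dw m).inner_fun h.q
  have X' : TL (lp 1) l _ _ := (h'.dw m).inner_fun h'.q
  have Z : TL (lp 1) l _ _ := h.q.inner_fun (h.dq m)
  have Z' : TL (lp 1) l _ _ := h'.q.inner_fun (h'.dq m)
  have zz : TL (lp 0) l _ _ := z.mul_fun z'
  have sq := h'.q.add (o 0 (by norm_num)) h.q
  have a1 : TL (lp 2) l _ _ := (zz.mul_fun (X'.mul_fun X')).smul_fun sq
  have zX : TL (lp 1) l _ _ := z.mul_fun (X'.add (o 1 (by norm_num)) X)
  have a2 : TL (lp 2) l _ _ := zX.smul_fun (h.dw m)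
  have a3 : TL (lp 2) l _ _ := (zz.mul_fun (Z'.mul_fun Z')).smul_fun sq
  have ZZ := Z'.add (o 1 (by norm_num)) Z
  have zZ : TL (lp 1) l _ _ := z.mul_fun ZZ
  have a4 : TL (lp 2) l _ _ := zZ.smul_fun (h'.dq m)
  have a5 : TL (lp 2) l _ _ := ((z.mul_fun z).mul_fun (Z.mul_fun ZZ)).smul_fun h.q
  have a6 : TL (lp 2) l _ _ := (z.mul_fun (((h'.dq m).inner_fun (h'.dq m)).add
    (o 2 (by norm_num)) ((h.dq m).inner_fun (h.dq m)))).smul_fun h.q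
  have a7 : TL (lp 2) l _ _ := zZ.smul_fun (h.dq m)
  have o2 := o 2 (by norm_num)
  have R := ((a1.smul (-(1 / 2))).sub o2 a2).add o2 ((((((a3.smul (1 / 2)).add o2 a4).sub o2 a5).sub
    o2 a6).sub o2 a7).smul (1 / 4))
  rw [lp_two] at R
  have zq : TL (lp 0) l _ _ := z.smul_fun h.q
  exact ((((h'.ddq m m).add (h.ddq m m)).smul (-(1 / 2))).add R.wb).sub
    ((((h'.ddq m m).rankOne zq h'.q).add ((h.ddq m m).rankOne zq h.q)).smul (1 / 4))

lemma incMean_wb (hc : 0 < c₀) (h : JetLim l Y J) (h' : JetLim l Y' J')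
    (g : ∀ᶠ n in l, ∀ᵐ x, ‖(Y n).q x‖ ^ 2 ≤ 4 - c₀) (g₀ : ∀ᵐ x, ‖J.q x‖ ^ 2 ≤ 4 - c₀)
    (m : Fin 2) :
    WB l (fun n x => incMean ((Y n).q x) ((Y' n).q x) ((Y n).dw m x) ((Y' n).dw m x)
      ((Y n).dq m x) ((Y' n).dq m x) ((Y n).ddw m m x) ((Y' n).ddw m m x))
      (fun x => incMean (J.q x) (J'.q x) (J.dw m x) (J'.dw m x) (J.dq m x) (J'.dq m x)
        (J.ddw m m x) (J'.ddw m m x)) := by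
  have o : ∀ j ≤ 4, 1 ≤ lp j := fun j => one_le_lp
  simp only [incMean]
  have z := h.q.zeta_fun hc g g₀
  have X : TL (lp 1) l _ _ := (h.dw m).inner_fun h.q
  have X' : TL (lp 1) l _ _ := (h'.dw m).inner_fun h'.q
  have Z : TL (lp 1) l _ _ := h.q.inner_fun (h.dq m)
  have XX := X'.add (o 1 (by norm_num)) X
  have a1 : TL (lp 2) l _ _ := ((z.mul_fun z).mul_fun (Z.mul_fun XX)).smul_fun h'.q
  have a2 : TL (lp 2) l _ _ := (z.mul_fun (((h'.dw m).inner_fun (h'.dq m)).add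
    (o 2 (by norm_num)) ((h.dw m).inner_fun (h.dq m)))).smul_fun h'.q
  have zX : TL (lp 1) l _ _ := z.mul_fun XX
  have a3 : TL (lp 2) l _ _ := zX.smul_fun (h'.dq m)
  have o2 := o 2 (by norm_num)
  have R := (a1.add o2 a2).add o2 a3
  rw [lp_two] at R
  have zq : TL (lp 0) l _ _ := z.smul_fun h'.q
  exact R.wb.add (((h'.ddw m m).rankOne zq h'.q).add ((h.ddw m m).rankOne zq h.q))

end Limits

lemma W.integral_inner_eq_zero {i : Fin 2} {j k : ℕ} {f f' g g' : Plane → Space}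
    (hf : W i j f f') (hg : W i k g g') (f2 : MemLp f 2 volume) (f2' : MemLp f' 2 volume)
    (g2 : MemLp g 2 volume) (g2' : MemLp g' 2 volume) (h : j + k ≤ 3 := by norm_num) :
    Integrable (fun x => (inner ℝ (f' x) (g x) + inner ℝ (f x) (g' x) : ℝ)) ∧
      ∫ x, (inner ℝ (f' x) (g x) + inner ℝ (f x) (g' x) : ℝ) = 0 := by
  have i1 := integrable_inner f2' g2
  have i2 := integrable_inner f2 g2'
  refine ⟨i1.add i2, ?_⟩
  exact (hf.inner_fun hg h).integral_eq_zero
    (memLp_one_iff_integrable.2 (integrable_inner f2 g2))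
    (memLp_one_iff_integrable.2 (i1.add i2)) h

lemma memLp_mul_top {c d : Plane → ℝ} (hc : MemLp c ⊤ volume) (hd : MemLp d 2 volume) :
    MemLp (fun x => c x * d x) 2 volume :=
  (ContinuousLinearMap.mul ℝ ℝ).memLp_of_bilin 2 hc hd

lemma memLp_inner_left {f g : Plane → Space} (hf : MemLp f ⊤ volume) (hg : MemLp g 2 volume) :
    MemLp (fun x => (inner ℝ (f x) (g x) : ℝ)) 2 volume :=
  innerB.memLp_of_bilin 2 hf hg

lemma memLp_inner_right {f g : Plane → Space} (hf : MemLp f 2 volume) (hg : MemLp g ⊤ volume) :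
    MemLp (fun x => (inner ℝ (f x) (g x) : ℝ)) 2 volume :=
  innerB.memLp_of_bilin 2 hf hg

lemma integrable_mul_two {c d : Plane → ℝ} (hc : MemLp c 2 volume) (hd : MemLp d 2 volume) :
    Integrable (fun x => c x * d x) volume :=
  memLp_one_iff_integrable.1 ((ContinuousLinearMap.mul ℝ ℝ).memLp_of_bilin 1 hc hd)

namespace Jet.IsPair

variable {J J' : Jet} {c₀ : ℝ}

lemma memLp_zeta (hc : 0 < c₀) (h : J.IsPair c₀) : MemLp (fun x => zeta (J.q x)) ⊤ volume := by
  have := ((h.W_q 0).zeta_fun hc h.gap).mem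
  rwa [lp_zero] at this

lemma memLp_mean_sub (h : J.IsPair c₀) (h' : J'.IsPair c₀) :
    MemLp (fun x => J'.w x - J.w x) 2 volume := by
  obtain ⟨φ, hφ⟩ := h.approx_mean
  obtain ⟨φ', hφ'⟩ := h'.approx_mean
  refine (memLp_congr_ae (ae_of_all _ fun x => ?_)).1 (hφ'.tl.mem.sub hφ.tl.mem)
  simp

lemma integrable_density (hc : 0 < c₀) (h : J.IsPair c₀) (m : Fin 2) :
    Integrable (fun x => density (J.q x) (J.dw m x) (J.dq m x)) := by
  have X := memLp_inner_right (h.dw_two m) h.q_top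
  have Y := memLp_inner_left h.q_top (h.dq_two m)
  have z := h.memLp_zeta hc
  have i1 := (integrable_inner (h.dq_two m) (h.dq_two m)).const_mul (1 / 2)
  have i2 := integrable_mul_two (memLp_mul_top z X) X
  have i3 := (integrable_mul_two (memLp_mul_top z Y) Y).const_mul (1 / 4)
  refine ((i1.sub i2).add i3).congr (ae_of_all _ fun x => ?_)
  simp only [Pi.add_apply, Pi.sub_apply, density]
  ring

lemma memLp_incDiff (hc : 0 < c₀) (h : J.IsPair c₀) (h' : J'.IsPair c₀) (m : Fin 2) :
    MemLp (fun x => incDiff (J.q x) (J'.q x) (J.dw m x) (J'.dw m x) (J.dq m x) (J'.dq m x)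
        (J.ddq m m x) (J'.ddq m m x)) 2 volume :=
  (incDiff_wb (l := (⊤ : Filter ℕ)) hc h.jetLim_const h'.jetLim_const
    (Eventually.of_forall fun _ => h.gap) h.gap (Eventually.of_forall fun _ => h'.gap) h'.gap m).mem

lemma memLp_incMean (hc : 0 < c₀) (h : J.IsPair c₀) (h' : J'.IsPair c₀) (m : Fin 2) :
    MemLp (fun x => incMean (J.q x) (J'.q x) (J.dw m x) (J'.dw m x) (J.dq m x) (J'.dq m x)
        (J.ddw m m x) (J'.ddw m m x)) 2 volume :=
  (incMean_wb (l := (⊤ : Filter ℕ)) hc h.jetLim_const h'.jetLim_const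
    (Eventually.of_forall fun _ => h.gap) h.gap m).mem

/-- A purely algebraic identity. The last bracket collects, for three products, the derivative
obtained by the product rule; each will integrate to zero. The only non-polynomial ingredient is the
secant formula for ζ. -/
lemma density_sub (hc : 0 < c₀) {q q' : Space} (hq : ‖q‖ ^ 2 ≤ 4 - c₀) (hq' : ‖q'‖ ^ 2 ≤ 4 - c₀)
    (w w' wm wm' qm qm' wmm wmm' qmm qmm' : Space) :
    density q' wm' qm' - density q wm qm =
    inner ℝ (incDiff q q' wm wm' qm qm' qmm qmm') (q' - q) +
      inner ℝ (incMean q q' wm wm' qm qm' wmm wmm') (w' - w) +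
    (1 / 2 * (inner ℝ (qmm' + qmm) (q' - q) + inner ℝ (qm' + qm) (qm' - qm)) -
      (inner ℝ (((zeta q * zeta q * inner ℝ q qm) * (inner ℝ wm' q' + inner ℝ wm q) +
          zeta q * ((inner ℝ wmm' q' + inner ℝ wm' qm') + (inner ℝ wmm q + inner ℝ wm qm))) • q' +
        (zeta q * (inner ℝ wm' q' + inner ℝ wm q)) • qm') (w' - w) +
        inner ℝ ((zeta q * (inner ℝ wm' q' + inner ℝ wm q)) • q') (wm' - wm)) +
      1 / 4 * (inner ℝ (((zeta q * zeta q * inner ℝ q qm) * (inner ℝ q' qm' + inner ℝ q qm) +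
          zeta q * ((inner ℝ qm' qm' + inner ℝ q' qmm') + (inner ℝ qm qm + inner ℝ q qmm))) • q +
        (zeta q * (inner ℝ q' qm' + inner ℝ q qm)) • qm) (q' - q) +
        inner ℝ ((zeta q * (inner ℝ q' qm' + inner ℝ q qm)) • q) (qm' - qm))) := by
  have ez := zeta_sub hc hq' hq
  rw [density, density, incDiff, incMean, real_inner_comm q qmm, real_inner_comm q' qmm']
  simp only [inner_add_left, inner_sub_left, inner_smul_left, inner_sub_right,
    conj_trivial] at ez ⊢
  simp only [real_inner_comm q' q, real_inner_comm qm' qm, real_inner_comm q qm',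
    real_inner_comm q' qm', real_inner_comm q qm, real_inner_comm q' qm,
    real_inner_comm q' wm', real_inner_comm q wm, real_inner_comm q' wm] at ez ⊢
  linear_combination (-(inner ℝ q' wm' * inner ℝ q' wm') +
    1 / 4 * (inner ℝ q' qm' * inner ℝ q' qm')) * ez

attribute [local irreducible] lp in
-- The density contains increments of first derivatives, but the equation controls only increments
-- of q and w. Integrating by parts three divergences moves these derivatives to the other factors,
-- which therefore contain second derivatives and are in L².
lemma energy_sub (hc : 0 < c₀) (h : J.IsPair c₀) (h' : J'.IsPair c₀) (m : Fin 2) :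
    J'.energy m - J.energy m =
    (∫ x, inner ℝ (incDiff (J.q x) (J'.q x) (J.dw m x) (J'.dw m x) (J.dq m x) (J'.dq m x)
        (J.ddq m m x) (J'.ddq m m x)) (J'.q x - J.q x)) +
    ∫ x, inner ℝ (incMean (J.q x) (J'.q x) (J.dw m x) (J'.dw m x) (J.dq m x) (J'.dq m x)
        (J.ddw m m x) (J'.ddw m m x)) (J'.w x - J.w x) := by
  have dq2 : MemLp (fun x => J'.q x - J.q x) 2 volume := h'.q_two.sub h.q_two
  have dw2 := h.memLp_mean_sub h'
  have iD := integrable_inner (h.memLp_incDiff hc h' m) dq2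
  have iM := integrable_inner (h.memLp_incMean hc h' m) dw2
  have z := (h.W_q m).zeta_fun hc h.gap
  have X := (h.W_dw m m).inner_fun (h.W_q m)
  have X' := (h'.W_dw m m).inner_fun (h'.W_q m)
  have Y := (h.W_q m).inner_fun (h.W_dq m m)
  have Y' := (h'.W_q m).inner_fun (h'.W_dq m m)
  have sX : W m 1 _ _ := (z.mul_fun (X'.add X)).smul_fun (h'.W_q m)
  have sY : W m 1 _ _ := (z.mul_fun (Y'.add Y)).smul_fun (h.W_q m)
  have z2 := h.memLp_zeta hc
  have top : ∀ {c : Plane → ℝ} {f : Plane → Space}, MemLp c 2 volume → MemLp f ⊤ volume →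
      MemLp (fun x => c x • f x) 2 volume := fun hc hf => smulB.memLp_of_bilin 2 hc hf
  have mX := top (memLp_mul_top z2 ((memLp_inner_right (h'.dw_two m) h'.q_top).add
    (memLp_inner_right (h.dw_two m) h.q_top))) h'.q_top
  have mY := top (memLp_mul_top z2 ((memLp_inner_left h'.q_top (h'.dq_two m)).add
    (memLp_inner_left h.q_top (h.dq_two m)))) h.q_top
  have l2 : ∀ {g : Plane → Space}, MemLp g (lp 2) volume → MemLp g 2 volume := fun h => by
    rwa [lp_two] at h
  have F1 := ((h'.W_dq m m).add (h.W_dq m m)).integral_inner_eq_zero ((h'.W_q m).sub (h.W_q m))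
    ((h'.dq_two m).add (h.dq_two m)) ((h'.ddq_two m m).add (h.ddq_two m m)) dq2
    ((h'.dq_two m).sub (h.dq_two m))
  have F2 := sX.integral_inner_eq_zero ((h'.W_w m).sub (h.W_w m)) mX (l2 sX.mem') dw2
    ((h'.dw_two m).sub (h.dw_two m))
  have F3 := sY.integral_inner_eq_zero ((h'.W_q m).sub (h.W_q m)) mY (l2 sY.mem') dq2
    ((h'.dq_two m).sub (h.dq_two m))
  have e1 := integral_add (((F1.1.const_mul (1 / 2)).sub F2.1)) (F3.1.const_mul (1 / 4))
  have e2 := integral_sub (F1.1.const_mul (1 / 2)) F2.1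
  rw [integral_const_mul, F1.2, F2.2] at e2
  simp only [Pi.sub_apply] at e1
  rw [e2, integral_const_mul, F3.2] at e1
  have e3 := integral_add (iD.add iM) ((((F1.1.const_mul (1 / 2)).sub F2.1)).add
    (F3.1.const_mul (1 / 4)))
  simp only [Pi.add_apply, Pi.sub_apply] at e3
  rw [e1, integral_add iD iM] at e3
  rw [Jet.energy, Jet.energy, ← integral_sub (h'.integrable_density hc m)
    (h.integrable_density hc m), ← sub_zero (_ + _)]
  refine Eq.trans (integral_congr_ae ?_) (e3.trans (by ring))
  filter_upwards [h.gap, h'.gap] with x hx hx'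
  exact density_sub hc hx hx' _ _ _ _ _ _ _ _ _ _

end Jet.IsPair
end LLHelicity

namespace LLHelicity
set_option linter.unusedSectionVars false

/-! ### A fundamental theorem of calculus for two-point densities -/

section Riemann

variable {t₁ t₂ : ℝ}

/-- A bound near the diagonal of a compact square, from local bounds. -/
lemma exists_bound_near_diagonal {P : ℝ → ℝ → ℝ → Prop}
    (hP : ∀ s t K K', K ≤ K' → P s t K → P s t K')
    (h : ∀ s ∈ Icc t₁ t₂, ∃ K, ∀ᶠ p : ℝ × ℝ in 𝓝[Icc t₁ t₂] s ×ˢ 𝓝[Icc t₁ t₂] s, P p.1 p.2 K) :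
    ∃ K, ∃ δ > 0, ∀ s ∈ Icc t₁ t₂, ∀ t ∈ Icc t₁ t₂, |t - s| < δ → P s t K := by
  by_contra! hn
  -- Failure for K = n and δ = 1/(n+1) at every n gives pairs of times that accumulate at a point of
  -- the diagonal, where the local bound is contradicted.
  choose s hs t ht hst hb using fun n : ℕ => hn n (1 / ((n : ℝ) + 1)) (by positivity)
  obtain ⟨a, ha, φ, hφ, hlim⟩ := isCompact_Icc.tendsto_subseq hs
  have hlim' : Tendsto (t ∘ φ) atTop (𝓝 a) := by
    have : Tendsto (fun n => t (φ n) - s (φ n)) atTop (𝓝 0) :=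
      squeeze_zero_norm (fun n => (hst (φ n)).le)
        (tendsto_one_div_add_atTop_nhds_zero_nat.comp hφ.tendsto_atTop)
    simpa [Function.comp_def] using this.add hlim
  obtain ⟨K, hK⟩ := h a ha
  have t1 : Tendsto (fun n => (s (φ n), t (φ n))) atTop (𝓝[Icc t₁ t₂] a ×ˢ 𝓝[Icc t₁ t₂] a) :=
    (tendsto_nhdsWithin_iff.2 ⟨hlim, Eventually.of_forall fun n => hs _⟩).prodMk
      (tendsto_nhdsWithin_iff.2 ⟨hlim', Eventually.of_forall fun n => ht _⟩)
  obtain ⟨n, h1, h2⟩ := ((t1.eventually hK).and (eventually_ge_atTop ⌈K⌉₊)).exists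
  refine hb (φ n) (hP _ _ _ _ ?_ h1)
  exact (Nat.le_ceil K).trans (Nat.cast_le.2 (h2.trans hφ.le_apply))

/-- A fundamental theorem of calculus without differentiability of e: telescope over a uniform
partition, write each increment as an integral with the kernel frozen at the two nodes, and let the
mesh tend to zero by dominated convergence. -/
lemma sub_le_of_increments (ht : t₁ ≤ t₂) {e ℓ : ℝ → ℝ} {a : ℝ → ℝ → ℝ → ℝ} {B : ℝ} (hB : 0 ≤ B)
    (inc : ∀ s ∈ Icc t₁ t₂, ∀ t ∈ Icc t₁ t₂, e t - e s = ∫ r in s..t, a s t r)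
    (cont : ∀ s ∈ Icc t₁ t₂, ∀ t ∈ Icc t₁ t₂, ContinuousOn (a s t) (Icc t₁ t₂))
    (bdd : ∀ s ∈ Icc t₁ t₂, ∃ K, ∀ᶠ p : ℝ × ℝ in 𝓝[Icc t₁ t₂] s ×ˢ 𝓝[Icc t₁ t₂] s,
      ∀ r ∈ Icc t₁ t₂, |a p.1 p.2 r| ≤ K)
    (lim : ∀ s ∈ Icc t₁ t₂, Tendsto (fun p : ℝ × ℝ => a p.1 p.2 s)
      (𝓝[Icc t₁ t₂] s ×ˢ 𝓝[Icc t₁ t₂] s) (𝓝 (ℓ s)))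
    (hℓ : ∀ s ∈ Icc t₁ t₂, ℓ s ≤ B) : e t₂ - e t₁ ≤ B * (t₂ - t₁) := by
  rcases ht.eq_or_lt with rfl | ht
  · simp
  obtain ⟨K, δ, hδ, hK⟩ := exists_bound_near_diagonal (P := fun s t K => ∀ r ∈ Icc t₁ t₂,
    |a s t r| ≤ K) (fun s t K K' hKK h r hr => (h r hr).trans hKK) bdd
  set h : ℕ → ℝ := fun n => (t₂ - t₁) / ((n : ℝ) + 1) with hh
  have h0 : ∀ n, 0 < h n := fun n => div_pos (by linarith) (by positivity)
  have hlim : Tendsto h atTop (𝓝 0) := by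
    have := (tendsto_const_div_atTop_nhds_zero_nat (t₂ - t₁)).comp (tendsto_add_atTop_nat 1)
    simpa [hh, Function.comp_def] using this
  set τ : ℕ → ℕ → ℝ := fun n j => t₁ + j * h n with hτ
  have τ0 : ∀ n, τ n 0 = t₁ := fun n => by simp [hτ]
  have τ1 : ∀ n, τ n (n + 1) = t₂ := fun n => by
    simp only [hτ, hh]; push_cast; field_simp; ring
  have τs : ∀ n j, τ n (j + 1) = τ n j + h n := fun n j => by
    simp only [hτ]; push_cast; ring
  have τm : ∀ n, Monotone (τ n) := fun n => monotone_nat_of_le_succ fun j => by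
    rw [τs]; linarith [h0 n]
  have τI : ∀ n j, j ≤ n + 1 → τ n j ∈ Icc t₁ t₂ := fun n j hj =>
    ⟨(τ0 n).symm.le.trans (τm n (Nat.zero_le j)), (τm n hj).trans (τ1 n).le⟩
  set k : ℕ → ℝ → ℕ := fun n s => ⌊(s - t₁) / h n⌋₊ with hk
  have kτ : ∀ n j s, τ n j ≤ s → s < τ n (j + 1) → k n s = j := fun n j s h1 h2 => by
    have hs : 0 ≤ s - t₁ := by
      have := (τ0 n).symm.le.trans (τm n (Nat.zero_le j)); linarith
    rw [hk]
    refine (Nat.floor_eq_iff (div_nonneg hs (h0 n).le)).2 ⟨?_, ?_⟩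
    · rw [le_div_iff₀ (h0 n)]; simp only [hτ] at h1; linarith
    · rw [div_lt_iff₀ (h0 n)]; simp only [hτ] at h2; push_cast at h2; linarith
  have τk : ∀ n s, t₁ ≤ s → τ n (k n s) ≤ s ∧ s < τ n (k n s + 1) := fun n s hs => by
    have h1 := Nat.floor_le (div_nonneg (sub_nonneg.2 hs) (h0 n).le)
    have h2 := Nat.lt_floor_add_one ((s - t₁) / h n)
    rw [le_div_iff₀ (h0 n)] at h1
    rw [div_lt_iff₀ (h0 n)] at h2
    simp only [hτ, hk]; push_cast
    constructor <;> linarith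
  have kn : ∀ n s, t₁ ≤ s → s < t₂ → k n s + 1 ≤ n + 1 := fun n s h1 h2 => by
    by_contra! hc
    have := (τ1 n).symm.le.trans ((τm n (Nat.lt_succ_iff.1 hc)).trans (τk n s h1).1)
    linarith
  -- At time s the kernel is taken with the two nodes of the cell containing s, found by the floor
  -- function k. Its integral equals the total increment for every n.
  set f : ℕ → ℝ → ℝ := fun n s => a (τ n (k n s)) (τ n (k n s + 1)) s with hf
  have sub : ∀ n j, j < n + 1 → uIcc (τ n j) (τ n (j + 1)) ⊆ Icc t₁ t₂ := fun n j hj => by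
    rw [uIcc_of_le (τm n j.le_succ)]
    exact Icc_subset_Icc (τI n j hj.le).1 (τI n (j + 1) hj).2
  -- The floor assigns the right endpoint of a cell to the next cell, so equality holds only off
  -- that single point.
  have congr : ∀ n j, ∀ᵐ s, s ∈ uIoc (τ n j) (τ n (j + 1)) →
      a (τ n j) (τ n (j + 1)) s = f n s := fun n j => by
    filter_upwards [Measure.ae_ne volume (τ n (j + 1))] with s hs hs'
    rw [uIoc_of_le (τm n j.le_succ)] at hs'
    have := kτ n j s hs'.1.le (lt_of_le_of_ne hs'.2 hs)
    simp only [hf, this]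
  have ii : ∀ n j, j < n + 1 → IntervalIntegrable (f n) volume (τ n j) (τ n (j + 1)) :=
    fun n j hj => ((cont _ (τI n j hj.le) _ (τI n (j + 1) hj)).mono
      (sub n j hj)).intervalIntegrable.congr_ae
        ((ae_restrict_iff' measurableSet_uIoc).2 (congr n j))
  have tot : ∀ n, e t₂ - e t₁ = ∫ s in t₁..t₂, f n s := fun n => by
    rw [← τ0 n, ← τ1 n, ← intervalIntegral.sum_integral_adjacent_intervals (ii n),
      ← Finset.sum_range_sub (fun j => e (τ n j)) (n + 1)]
    refine Finset.sum_congr rfl fun j hj => ?_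
    have hj := Finset.mem_range.1 hj
    rw [inc _ (τI n j hj.le) _ (τI n (j + 1) hj)]
    exact intervalIntegral.integral_congr_ae (congr n j)
  have fi : ∀ n, IntervalIntegrable (f n) volume t₁ t₂ := fun n => by
    have := IntervalIntegrable.trans_iterate (ii n)
    rwa [τ0, τ1] at this
  have ev : ∀ᶠ n in atTop, h n < δ := hlim.eventually_lt_const hδ
  have bd : ∀ᶠ n in atTop, ∀ᵐ s, s ∈ uIoc t₁ t₂ → ‖f n s‖ ≤ K := by
    filter_upwards [ev] with n hn
    filter_upwards [Measure.ae_ne volume t₂] with s hs hs'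
    rw [uIoc_of_le ht.le] at hs'
    have hlt := lt_of_le_of_ne hs'.2 hs
    have := kn n s hs'.1.le hlt
    refine hK _ (τI n _ (by omega)) _ (τI n _ this) ?_ s ⟨hs'.1.le, hs'.2⟩
    rw [τs, add_sub_cancel_left, abs_of_pos (h0 n)]
    exact hn
  have pt : ∀ᵐ s, s ∈ uIoc t₁ t₂ → Tendsto (fun n => f n s) atTop (𝓝 (ℓ s)) := by
    filter_upwards [Measure.ae_ne volume t₂] with s hs hs'
    rw [uIoc_of_le ht.le] at hs'
    have hlt := lt_of_le_of_ne hs'.2 hs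
    have c1 : Tendsto (fun n => τ n (k n s)) atTop (𝓝 s) := by
      refine tendsto_of_tendsto_of_tendsto_of_le_of_le (g := fun n => s - h n)
        (by simpa using hlim.const_sub s) tendsto_const_nhds (fun n => ?_)
        fun n => (τk n s hs'.1.le).1
      have := (τk n s hs'.1.le).2
      rw [τs] at this
      simp only; linarith
    have c2 : Tendsto (fun n => τ n (k n s + 1)) atTop (𝓝 s) := by
      simp only [τs]; simpa using c1.add hlim
    have m := fun n => kn n s hs'.1.le hlt
    exact (lim s ⟨hs'.1.le, hs'.2⟩).comp ((tendsto_nhdsWithin_iff.2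
      ⟨c1, Eventually.of_forall fun n => τI n _ (by have := m n; omega)⟩).prodMk
        (tendsto_nhdsWithin_iff.2 ⟨c2, Eventually.of_forall fun n => τI n _ (m n)⟩))
  have conv := intervalIntegral.tendsto_integral_filter_of_dominated_convergence (fun _ => K)
    (Eventually.of_forall fun n => (fi n).def'.aestronglyMeasurable) bd intervalIntegrable_const pt
  simp only [← tot] at conv
  rw [tendsto_nhds_unique tendsto_const_nhds conv]
  -- No regularity of ℓ in time is assumed. If it were not integrable, its integral would be 0 by
  -- convention, and 0 ≤ B gives the claim.
  by_cases hi : IntervalIntegrable ℓ volume t₁ t₂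
  · have := intervalIntegral.integral_mono_on ht.le hi (intervalIntegrable_const (c := B)) hℓ
    simpa [mul_comm] using this
  · rw [intervalIntegral.integral_undef hi]
    exact mul_nonneg hB (by linarith)

end Riemann
end LLHelicity

namespace LLHelicity
set_option linter.unusedSectionVars false

/-! ### Pairs of solutions -/

lemma H2Approx.smul {f : Plane → Space} {D : Fin 2 → Plane → Space}
    {H : Fin 2 → Fin 2 → Plane → Space} {φ : ℕ → Plane → Space} (c : ℝ) (h : H2Approx f D H φ) :
    H2Approx (fun x => c • f x) (fun i x => c • D i x) (fun i j x => c • H i j x)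
      (fun n x => c • φ n x) := by
  have e : ∀ (i : Fin 2) {g : Plane → Space}, ContDiff ℝ ∞ g →
      pd i (fun x => c • g x) = fun x => c • pd i g x := fun i g hg => by
    ext1 x
    simp only [pd]
    rw [fderiv_fun_const_smul (hg.differentiable (by simp) x)]
    rfl
  refine ⟨fun n => (h.smooth n).const_smul c, fun n => (h.compact n).smul_left (f := fun _ => c),
    h.tl.smul c, fun i => ?_, fun i j => ?_⟩
  · simp only [e _ (h.smooth _)]; exact (h.tl_pd i).smul c
  · simp only [e _ (h.smooth _), e _ (pd_contDiff (h.smooth _))]; exact (h.tl_pd_pd i j).smul c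

/-- The jet of a pair of maps. -/
noncomputable def jet (u v : Plane → Space) : Jet where
  w x := (1 / 2 : ℝ) • (u x + v x)
  q x := u x - v x
  dw i x := (1 / 2 : ℝ) • (weakPartial i u x + weakPartial i v x)
  dq i x := weakPartial i u x - weakPartial i v x
  ddw i j x := (1 / 2 : ℝ) • (weakPartial i (weakPartial j u) x + weakPartial i (weakPartial j v) x)
  ddq i j x := weakPartial i (weakPartial j u) x - weakPartial i (weakPartial j v) x

section Jet

variable {M M' c₀ : ℝ} {u v : Plane → Space}

lemma jet_isPair (hu : SphereMap M u) (hv : SphereMap M' v)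
    (g : ∀ᵐ x, ‖u x - v x‖ ^ 2 ≤ 4 - c₀) : (jet u v).IsPair c₀ := by
  obtain ⟨φ, hφ⟩ := hu.exists_approx
  obtain ⟨ψ, hψ⟩ := hv.exists_approx
  refine ⟨⟨fun n x => (1 / 2 : ℝ) • φ n x - (-(1 / 2) : ℝ) • ψ n x, ?_⟩,
    ⟨fun n x => φ n x - ψ n x, ?_⟩, ?_, ?_, g⟩
  · convert (hφ.smul (1 / 2)).sub (hψ.smul (-(1 / 2))) using 1
    · ext1 x; simp only [jet]; module
    · ext1 i; ext1 x; simp only [jet]; module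
    · ext1 i; ext1 j; ext1 x; simp only [jet]; module
  · convert hφ.sub hψ using 1
    · ext1 x; simp only [jet]; abel
    · rfl
    · rfl
  · filter_upwards [hu.sphere, hv.sphere] with x h1 h2
    simp only [jet, inner_smul_left, inner_add_left, inner_sub_right, real_inner_self_eq_norm_sq, h1,
      h2, real_inner_comm (u x) (v x), conj_trivial]
    ring
  · filter_upwards [hu.sphere, hv.sphere] with x h1 h2
    have := parallelogram_law_with_norm ℝ (u x) (v x)
    simp only [jet, norm_smul, h1, h2] at this ⊢
    rw [Real.norm_of_nonneg (by norm_num)]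
    linarith

/-- Polarisation: for a bilinear expression the difference of its values at two maps is the
symmetrised expression in the mean and the difference, without a quadratic remainder. -/
lemma jet_isDiffField (b : ℝ) : Pair.IsDiffField b (jet u v).w (jet u v).q (jet u v).dw
    (jet u v).dq (jet u v).ddw (jet u v).ddq (fun x => field b u x - field b v x) := by
  refine ae_of_all _ fun x => ?_
  ext i
  fin_cases i <;>
  · simp only [field, jet, Fin.sum_univ_two, PiLp.add_apply, PiLp.sub_apply, PiLp.neg_apply,
      PiLp.smul_apply, smul_eq_mul, cross_zero', cross_one', cross_two', Fin.zero_eta, Fin.mk_one,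
      Fin.reduceFinMk]
    ring

lemma norm_le_mean_add (a c : Space) : ‖a‖ ≤ ‖(1 / 2 : ℝ) • (a + c)‖ + ‖a - c‖ ∧
    ‖c‖ ≤ ‖(1 / 2 : ℝ) • (a + c)‖ + ‖a - c‖ := by
  have e1 : a = (1 / 2 : ℝ) • (a + c) + (1 / 2 : ℝ) • (a - c) := by module
  have e2 : c = (1 / 2 : ℝ) • (a + c) - (1 / 2 : ℝ) • (a - c) := by module
  have h : ‖(1 / 2 : ℝ) • (a - c)‖ ≤ ‖a - c‖ := by
    rw [norm_smul, Real.norm_of_nonneg (by norm_num)]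
    linarith [norm_nonneg (a - c)]
  constructor
  · nth_rw 1 [e1]; exact (norm_add_le _ _).trans (by gcongr)
  · nth_rw 1 [e2]; exact (norm_sub_le _ _).trans (by gcongr)

lemma norm_field_le_jet (b : ℝ) {x : Plane} (h1 : ‖u x‖ = 1) (h2 : ‖v x‖ = 1) :
    ‖field b u x‖ ≤ (1 + |b|) * (1 + ∑ i, ∑ j, (‖(jet u v).ddw i j x‖ + ‖(jet u v).ddq i j x‖) +
      (∑ i, (‖(jet u v).dw i x‖ + ‖(jet u v).dq i x‖)) ^ 2) ∧
    ‖field b v x‖ ≤ (1 + |b|) * (1 + ∑ i, ∑ j, (‖(jet u v).ddw i j x‖ + ‖(jet u v).ddq i j x‖) +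
      (∑ i, (‖(jet u v).dw i x‖ + ‖(jet u v).dq i x‖)) ^ 2) := by
  have key : ∀ {p h P H : ℝ}, 0 ≤ p → 0 ≤ h → p ≤ P → h ≤ H →
      h + |b| * p ≤ (1 + |b|) * (1 + H + P ^ 2) := fun {p h P H} p0 h0 hp hh => by
    have := abs_nonneg b
    nlinarith [mul_le_mul_of_nonneg_left (show p ≤ 1 + H + P ^ 2 by nlinarith [sq_nonneg (P - 1)]) this,
      sq_nonneg P]
  have d1 := fun i => norm_le_mean_add (weakPartial i u x) (weakPartial i v x)
  have d2 := fun i j => norm_le_mean_add (weakPartial i (weakPartial j u) x)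
    (weakPartial i (weakPartial j v) x)
  have nn := fun i j => norm_nonneg ((1 / 2 : ℝ) • (weakPartial i (weakPartial j u) x +
    weakPartial i (weakPartial j v) x))
  have nn' := fun i j => norm_nonneg (weakPartial i (weakPartial j u) x -
    weakPartial i (weakPartial j v) x)
  constructor
  · refine (norm_field_le h1 b).trans (key (Finset.sum_nonneg fun _ _ => norm_nonneg _)
      (Finset.sum_nonneg fun _ _ => norm_nonneg _)
      (Finset.sum_le_sum fun i _ => (d1 i).1) ?_)
    simp only [jet, Fin.sum_univ_two]
    linarith [(d2 0 0).1, (d2 1 1).1, nn 0 1, nn 1 0, nn' 0 1, nn' 1 0]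
  · refine (norm_field_le h2 b).trans (key (Finset.sum_nonneg fun _ _ => norm_nonneg _)
      (Finset.sum_nonneg fun _ _ => norm_nonneg _)
      (Finset.sum_le_sum fun i _ => (d1 i).2) ?_)
    simp only [jet, Fin.sum_univ_two]
    linarith [(d2 0 0).2, (d2 1 1).2, nn 0 1, nn 1 0, nn' 0 1, nn' 1 0]

lemma jet_isFieldBound (b : ℝ) (hu : SphereMap M u) (hv : SphereMap M' v) :
    Pair.IsFieldBound (2 * (1 + |b|)) (jet u v).dw (jet u v).dq (jet u v).ddw (jet u v).ddq
      (fun x => field b u x - field b v x) ∧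
    Pair.IsFieldBound (2 * (1 + |b|)) (jet u v).dw (jet u v).dq (jet u v).ddw (jet u v).ddq
      (fun x => (1 / 2 : ℝ) • (field b u x + field b v x)) := by
  constructor
  · filter_upwards [hu.sphere, hv.sphere] with x h1 h2
    obtain ⟨b1, b2⟩ := norm_field_le_jet b h1 h2
    exact (norm_sub_le _ _).trans (by linarith)
  · filter_upwards [hu.sphere, hv.sphere] with x h1 h2
    obtain ⟨b1, b2⟩ := norm_field_le_jet b h1 h2
    rw [norm_smul, Real.norm_of_nonneg (by norm_num)]
    have := norm_add_le (field b u x) (field b v x)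
    linarith [norm_nonneg (field b u x)]

end Jet

section Flow

variable {M c₀ : ℝ} {I : Set ℝ} {u v : ℝ → Plane → Space} {t : ℝ}

lemma Flow.wb_two (h : Flow M I u) (hM : 0 ≤ M) (ht : t ∈ I) (i j : Fin 2) :
    WB (𝓝[I] t) (fun s => weakPartial i (weakPartial j (u s))) (weakPartial i (weakPartial j (u t))) := by
  refine ⟨h.wl_two ht hM i j, (h.map t ht).mem_two i j, ENNReal.ofReal M, by simp, ?_⟩
  filter_upwards [h.ev_map ht] with s hs
  refine ⟨hs.mem_two i j, ?_⟩
  rw [eLpNorm_two_eq (hs.mem_two i j)]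
  exact ENNReal.ofReal_le_ofReal (Real.sqrt_le_iff.2 ⟨hM, hs.bound_two i j⟩)

lemma Flow.jetLim (hu : Flow M I u) (hv : Flow M I v) (hM : 0 ≤ M) (ht : t ∈ I) :
    JetLim (𝓝[I] t) (fun s => jet (u s) (v s)) (jet (u t) (v t)) := by
  have u0 := hu.tl_top ht
  have v0 := hv.tl_top ht
  have u1 := hu.tl_one_four ht
  have v1 := hv.tl_one_four ht
  have u2 := hu.wb_two hM ht
  have v2 := hv.wb_two hM ht
  rw [← lp_zero] at u0 v0
  simp only [← lp_one] at u1 v1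
  have o0 := one_le_lp (j := 0) (by norm_num)
  have o1 := one_le_lp (j := 1) (by norm_num)
  exact ⟨(u0.add o0 v0).smul _, u0.sub o0 v0, fun i => ((u1 i).add o1 (v1 i)).smul _,
    fun i => (u1 i).sub o1 (v1 i), fun i j => ((u2 i j).add (v2 i j)).smul _,
    fun i j => (u2 i j).sub (v2 i j)⟩

end Flow

end LLHelicity

namespace LLHelicity
set_option linter.unusedSectionVars false

/-! ### Growth of the energies along a pair of solutions -/

section Growth

variable {b M t₁ t₂ c₀ B : ℝ} {u v : ℝ → Plane → Space}

lemma sqrt_integral_le {f : Plane → Space} (hf : MemLp f 2 volume) {K : ℝ≥0∞} (hK : K ≠ ⊤)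
    (h : eLpNorm f 2 volume ≤ K) : √(∫ x, ‖f x‖ ^ 2) ≤ K.toReal :=
  Real.sqrt_le_iff.2 ⟨ENNReal.toReal_nonneg, eLpNorm_two_le hf hK h⟩

/-- Testing the equations of u and v with the frozen factors A s t and Q s t turns the given
increments into time integrals, as `sub_le_of_increments` requires. -/
lemma Evolution.sub_le (ht : t₁ ≤ t₂) (hM : 0 ≤ M) (hB : 0 ≤ B) (hu : Evolution b M (Icc t₁ t₂) u)
    (hv : Evolution b M (Icc t₁ t₂) v) {e : ℝ → ℝ} {A Q : ℝ → ℝ → Plane → Space}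
    {A₀ Q₀ : ℝ → Plane → Space}
    (inc : ∀ s ∈ Icc t₁ t₂, ∀ t ∈ Icc t₁ t₂, e t - e s =
      (∫ x, inner ℝ (A s t x) ((jet (u t) (v t)).q x - (jet (u s) (v s)).q x)) +
        ∫ x, inner ℝ (Q s t x) ((jet (u t) (v t)).w x - (jet (u s) (v s)).w x))
    (mA : ∀ s ∈ Icc t₁ t₂, ∀ t ∈ Icc t₁ t₂, MemLp (A s t) 2 volume)
    (mQ : ∀ s ∈ Icc t₁ t₂, ∀ t ∈ Icc t₁ t₂, MemLp (Q s t) 2 volume)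
    (wA : ∀ s ∈ Icc t₁ t₂, WB (𝓝[Icc t₁ t₂] s ×ˢ 𝓝[Icc t₁ t₂] s)
      (fun p : ℝ × ℝ => A p.1 p.2) (A₀ s))
    (wQ : ∀ s ∈ Icc t₁ t₂, WB (𝓝[Icc t₁ t₂] s ×ˢ 𝓝[Icc t₁ t₂] s)
      (fun p : ℝ × ℝ => Q p.1 p.2) (Q₀ s))
    (hℓ : ∀ s ∈ Icc t₁ t₂, (∫ x, inner ℝ (A₀ s x) (field b (u s) x - field b (v s) x)) +
      (∫ x, inner ℝ (Q₀ s x) ((1 / 2 : ℝ) • (field b (u s) x + field b (v s) x))) ≤ B) :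
    e t₂ - e t₁ ≤ B * (t₂ - t₁) := by
  have split : ∀ {a q f g : Plane → Space}, MemLp a 2 volume → MemLp q 2 volume →
      MemLp f 2 volume → MemLp g 2 volume → (∫ x, inner ℝ (a x) (f x - g x)) +
      (∫ x, inner ℝ (q x) ((1 / 2 : ℝ) • (f x + g x))) =
      ((∫ x, inner ℝ (a x) (f x)) - ∫ x, inner ℝ (a x) (g x)) +
        1 / 2 * ((∫ x, inner ℝ (q x) (f x)) + ∫ x, inner ℝ (q x) (g x)) := by
    intro a q f g ha hq hf hg
    simp only [inner_sub_right, inner_smul_right, inner_add_right]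
    rw [integral_sub (integrable_inner ha hf) (integrable_inner ha hg), integral_const_mul,
      integral_add (integrable_inner hq hf) (integrable_inner hq hg)]
  set N : (Plane → Space) → (Plane → Space) → ℝ → ℝ := fun a q r =>
    ((∫ x, inner ℝ (a x) (field b (u r) x)) - ∫ x, inner ℝ (a x) (field b (v r) x)) +
      1 / 2 * ((∫ x, inner ℝ (q x) (field b (u r) x)) + ∫ x, inner ℝ (q x) (field b (v r) x)) with hN
  have cu := fun {a : Plane → Space} (ha : MemLp a 2 volume) => hu.continuousOn_inner_field hM b ha
  have cv := fun {a : Plane → Space} (ha : MemLp a 2 volume) => hv.continuousOn_inner_field hM b ha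
  refine sub_le_of_increments ht hB (a := fun s t r => N (A s t) (Q s t) r)
    (ℓ := fun s => N (A₀ s) (Q₀ s) s) (fun s hs t ht => ?_) (fun s hs t ht => ?_) (fun s hs => ?_)
    (fun s hs => ?_) fun s hs => ?_
  · have hI : uIcc s t ⊆ Icc t₁ t₂ := uIcc_subset_Icc hs ht
    have a1 := mA s hs t ht
    have q1 := mQ s hs t ht
    have iu := fun {a : Plane → Space} (ha : MemLp a 2 volume) =>
      ((cu ha).mono hI).intervalIntegrable (μ := volume)
    have iv := fun {a : Plane → Space} (ha : MemLp a 2 volume) =>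
      ((cv ha).mono hI).intervalIntegrable (μ := volume)
    have e1 : ∀ x, (jet (u t) (v t)).q x - (jet (u s) (v s)).q x =
        (u t x - u s x) - (v t x - v s x) := fun x => by simp only [jet]; abel
    have e2 : ∀ x, (jet (u t) (v t)).w x - (jet (u s) (v s)).w x =
        (1 / 2 : ℝ) • ((u t x - u s x) + (v t x - v s x)) := fun x => by simp only [jet]; module
    rw [inc s hs t ht]
    simp only [e1, e2]
    rw [split a1 q1 (hu.memLp_sub hs ht) (hv.memLp_sub hs ht), hu.increment _ a1 s hs t ht,
      hv.increment _ a1 s hs t ht, hu.increment _ q1 s hs t ht, hv.increment _ q1 s hs t ht,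
      ← intervalIntegral.integral_sub (iu a1) (iv a1), ← intervalIntegral.integral_add (iu q1) (iv q1),
      ← intervalIntegral.integral_const_mul,
      ← intervalIntegral.integral_add ((iu a1).sub (iv a1)) (((iu q1).add (iv q1)).const_mul _)]
  · have a1 := mA s hs t ht
    have q1 := mQ s hs t ht
    exact ((cu a1).sub (cv a1)).add (((cu q1).add (cv q1)).const_smul (1 / 2 : ℝ))
  · obtain ⟨K, hK, hb⟩ := (wA s hs).bound
    obtain ⟨K', hK', hb'⟩ := (wQ s hs).bound
    set κ := √(8 * (1 + b ^ 2) * M ^ 2)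
    refine ⟨(K.toReal * κ + K.toReal * κ) + 1 / 2 * (K'.toReal * κ + K'.toReal * κ), ?_⟩
    filter_upwards [hb, hb'] with p h1 h2 r hr
    have k1 := mul_le_mul_of_nonneg_right (sqrt_integral_le h1.1 hK h1.2) (Real.sqrt_nonneg
      (8 * (1 + b ^ 2) * M ^ 2))
    have k2 := mul_le_mul_of_nonneg_right (sqrt_integral_le h2.1 hK' h2.2) (Real.sqrt_nonneg
      (8 * (1 + b ^ 2) * M ^ 2))
    have b1 := (hu.abs_inner_field_le b h1.1 hr).trans k1
    have b2 := (hv.abs_inner_field_le b h1.1 hr).trans k1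
    have b3 := (hu.abs_inner_field_le b h2.1 hr).trans k2
    have b4 := (hv.abs_inner_field_le b h2.1 hr).trans k2
    rw [abs_le] at b1 b2 b3 b4 ⊢
    simp only [hN]
    constructor <;> linarith [b1.1, b1.2, b2.1, b2.2, b3.1, b3.2, b4.1, b4.2]
  · have fu := (hu.map s hs).memLp_field b
    have fv := (hv.map s hs).memLp_field b
    -- The right-hand side is taken at the limit time itself, hence is a fixed L² function, and weak
    -- convergence of the factors is enough.
    have pair : ∀ {g : ℝ × ℝ → Plane → Space} {g₀ f : Plane → Space},
        WB (𝓝[Icc t₁ t₂] s ×ˢ 𝓝[Icc t₁ t₂] s) g g₀ → MemLp f 2 volume →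
        Tendsto (fun p => ∫ x, inner ℝ (g p x) (f x)) (𝓝[Icc t₁ t₂] s ×ˢ 𝓝[Icc t₁ t₂] s)
          (𝓝 (∫ x, inner ℝ (g₀ x) (f x))) := fun hg hf => by
      have := hg.wl _ hf
      simpa only [real_inner_comm] using this
    exact ((pair (wA s hs) fu).sub (pair (wA s hs) fv)).add
      (((pair (wQ s hs) fu).add (pair (wQ s hs) fv)).const_mul (1 / 2))
  · exact (split (wA s hs).mem (wQ s hs).mem ((hu.map s hs).memLp_field b)
      ((hv.map s hs).memLp_field b)).symm.trans_le (hℓ s hs)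

variable (ht : t₁ ≤ t₂) (hM : 0 ≤ M) (hB : 0 ≤ B) (hu : Evolution b M (Icc t₁ t₂) u)
    (hv : Evolution b M (Icc t₁ t₂) v)
    (hg : ∀ t ∈ Icc t₁ t₂, ∀ᵐ x, ‖u t x - v t x‖ ^ 2 ≤ 4 - c₀)
include ht hM hB hu hv hg

/-- The weight of the error terms for the pair `u`, `v`. -/
noncomputable def errJet (J : Jet) : ℝ := ∫ x, errWeight J.q J.dw J.dq J.ddw J.ddq x ^ 2

lemma l2_sub_le (hκ : ∀ t ∈ Icc t₁ t₂, 2 * ((4 * |b| + 2) * errJet (jet (u t) (v t))) ≤ B) :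
    (∫ x, ‖u t₂ x - v t₂ x‖ ^ 2) - ∫ x, ‖u t₁ x - v t₁ x‖ ^ 2 ≤ B * (t₂ - t₁) := by
  have P := fun t ht => jet_isPair (hu.map t ht) (hv.map t ht) (hg t ht)
  have lim : ∀ s ∈ Icc t₁ t₂, TL 2 (𝓝[Icc t₁ t₂] s) (fun t => (jet (u t) (v t)).q)
      (jet (u s) (v s)).q := fun s hs => by
    have := (hu.tl hs).sub (by norm_num) (hv.tl hs)
    simpa [jet] using this
  refine Evolution.sub_le ht hM hB hu hv (e := fun t => ∫ x, ‖(jet (u t) (v t)).q x‖ ^ 2)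
    (A := fun s t x => (jet (u t) (v t)).q x + (jet (u s) (v s)).q x) (Q := fun _ _ _ => (0 : Space))
    (A₀ := fun s x => (2 : ℝ) • (jet (u s) (v s)).q x) (Q₀ := fun _ _ => (0 : Space)) ?_ ?_ ?_ ?_ ?_ ?_
  · intro s hs t ht
    rw [← integral_sub (P t ht).q_two.norm.integrable_sq (P s hs).q_two.norm.integrable_sq]
    simp only [inner_zero_left, integral_zero, add_zero]
    have key : ∀ a c : Space, ‖a‖ ^ 2 - ‖c‖ ^ 2 = inner ℝ (a + c) (a - c) := fun a c => by
      simp only [inner_add_left, inner_sub_right, real_inner_self_eq_norm_sq, real_inner_comm a c]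
      ring
    exact integral_congr_ae (ae_of_all _ fun x => key _ _)
  · exact fun s hs t ht => (P t ht).q_two.add (P s hs).q_two
  · exact fun s hs t ht => MemLp.zero'
  · intro s hs
    have := (((lim s hs).comp tendsto_snd).add (by norm_num)
      ((lim s hs).comp (k := Prod.fst) (tendsto_fst (g := 𝓝[Icc t₁ t₂] s)))).wb
    simpa only [two_smul] using this
  · exact fun s hs => (TL.const (f := fun _ => (0 : Space)) MemLp.zero').wb
  · intro s hs
    have := (P s hs).integral_inner_q_le (((hu.map s hs).memLp_field b).sub
      ((hv.map s hs).memLp_field b)) (jet_isDiffField b)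
    simp only [inner_zero_left, integral_zero, add_zero, inner_smul_left, conj_trivial,
      integral_const_mul]
    exact (mul_le_mul_of_nonneg_left this (by norm_num)).trans (hκ s hs)

lemma energy_sub_le (hc : 0 < c₀) (m : Fin 2) (hκ : ∀ t ∈ Icc t₁ t₂,
      (200 + 20 * (2 / c₀ + (2 / c₀) ^ 2) * (2 * (1 + |b|)) + 12 * |b|) *
        errJet (jet (u t) (v t)) ≤ B) :
    (jet (u t₂) (v t₂)).energy m - (jet (u t₁) (v t₁)).energy m ≤ B * (t₂ - t₁) := by
  have P := fun t ht => jet_isPair (hu.map t ht) (hv.map t ht) (hg t ht)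
  have lim := fun s (hs : s ∈ Icc t₁ t₂) => hu.jetLim hv.toFlow hM hs
  have ev : ∀ s ∈ Icc t₁ t₂, ∀ᶠ t in 𝓝[Icc t₁ t₂] s, ∀ᵐ x, ‖(jet (u t) (v t)).q x‖ ^ 2 ≤ 4 - c₀ :=
    fun s _ => by filter_upwards [self_mem_nhdsWithin] with t ht using hg t ht
  refine Evolution.sub_le ht hM hB hu hv (e := fun t => (jet (u t) (v t)).energy m)
    (fun s hs t ht => Jet.IsPair.energy_sub hc (P s hs) (P t ht) m)
    (fun s hs t ht => Jet.IsPair.memLp_incDiff hc (P s hs) (P t ht) m)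
    (fun s hs t ht => Jet.IsPair.memLp_incMean hc (P s hs) (P t ht) m)
    (fun s hs => incDiff_wb hc ((lim s hs).comp tendsto_fst) ((lim s hs).comp tendsto_snd)
      (tendsto_fst.eventually (ev s hs)) (hg s hs) (tendsto_snd.eventually (ev s hs)) (hg s hs) m)
    (fun s hs => incMean_wb hc ((lim s hs).comp tendsto_fst) ((lim s hs).comp tendsto_snd)
      (tendsto_fst.eventually (ev s hs)) (hg s hs) m) fun s hs => ?_
  have fu := (hu.map s hs).memLp_field b
  have fv := (hv.map s hs).memLp_field b
  have iD := integrable_inner (Jet.IsPair.memLp_incDiff hc (P s hs) (P s hs) m) (fu.sub fv)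
  have iM := integrable_inner (Jet.IsPair.memLp_incMean hc (P s hs) (P s hs) m)
    ((fu.add fv).const_smul (1 / 2 : ℝ))
  obtain ⟨bq, bw⟩ := jet_isFieldBound b (hu.map s hs) (hv.map s hs)
  simp only [incDiff_self, incMean_self, Pi.sub_apply, Pi.smul_apply, Pi.add_apply] at iD iM ⊢
  rw [← integral_add iD iM]
  exact ((P s hs).integral_density_le hc (by positivity) (jet_isDiffField b) bq bw m
    (iD.add iM)).trans (hκ s hs)

end Growth
end LLHelicity

namespace LLHelicity
set_option linter.unusedSectionVars false

/-! ### The error terms are controlled by the energies, up to a logarithm -/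

lemma ladyzhenskaya_h2_zero : ∃ C : ℝ, 0 ≤ C ∧ ∀ (f : Plane → Space) (D : Fin 2 → Plane → Space)
    (H : Fin 2 → Fin 2 → Plane → Space) (φ : ℕ → Plane → Space), H2Approx f D H φ →
    ∫ x, ‖f x‖ ^ 4 ≤ C * (∫ x, ‖f x‖ ^ 2) * ∑ k, ∫ x, ‖D k x‖ ^ 2 := by
  obtain ⟨C, hC, L⟩ := ladyzhenskaya
  refine ⟨C, hC, fun f D H φ h => ?_⟩
  have t0 := TL.bilin (r := 2) (by norm_num) innerB h.tl_top h.tl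
  simp only [innerB_apply, real_inner_self_eq_norm_sq] at t0
  have t := (t0.bilin (r := 1) le_rfl (ContinuousLinearMap.mul ℝ ℝ) t0).integral
  simp only [ContinuousLinearMap.mul_apply', ← pow_add] at t
  refine le_of_tendsto_of_tendsto' t ((h.tl.integral_normSq.const_mul C).mul
      (tendsto_finsetSum Finset.univ fun k _ => (h.tl_pd k).integral_normSq)) fun n => ?_
  exact L _ ((h.smooth n).of_le (by simp)) (h.compact n)

/-- Bounds for the `L²` norms of a jet. -/
structure Jet.Bounded (K : ℝ) (J : Jet) : Prop where
  q : ∫ x, ‖J.q x‖ ^ 2 ≤ K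
  dw : ∀ i, ∫ x, ‖J.dw i x‖ ^ 2 ≤ K
  dq : ∀ i, ∫ x, ‖J.dq i x‖ ^ 2 ≤ K
  ddw : ∀ i j, ∫ x, ‖J.ddw i j x‖ ^ 2 ≤ K
  ddq : ∀ i j, ∫ x, ‖J.ddq i j x‖ ^ 2 ≤ K

/-- The squared `L²` norm of the difference plus those of the transported gradients. -/
noncomputable def Jet.total (J : Jet) : ℝ := (∫ x, ‖J.q x‖ ^ 2) + ∑ m, 2 * J.energy m

lemma integrable_normSq_mul {f g : Plane → Space} (hf : MemLp f 4 volume) (hg : MemLp g 4 volume) :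
    Integrable (fun x => ‖f x‖ ^ 2 * ‖g x‖ ^ 2) ∧
      ∫ x, ‖f x‖ ^ 2 * ‖g x‖ ^ 2 ≤ √(∫ x, ‖f x‖ ^ 4) * √(∫ x, ‖g x‖ ^ 4) := by
  have sq : ∀ {f : Plane → Space}, MemLp f 4 volume → MemLp (fun x => ‖f x‖ ^ 2) 2 volume :=
    fun h => (TL.normSq (l := (⊤ : Filter ℕ)) (TL.const h)).mem
  refine ⟨integrable_mul_two (sq hf) (sq hg), ?_⟩
  have := integral_mul_le_sqrt (sq hf) (sq hg)
  simpa only [← pow_mul, abs_pow, abs_norm] using this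

lemma integrable_norm_pow_four {f : Plane → Space} (hf : MemLp f 4 volume) :
    Integrable (fun x => ‖f x‖ ^ 4) := by
  refine (integrable_normSq_mul hf hf).1.congr (ae_of_all _ fun x => ?_)
  simp only [← pow_add]

namespace Jet.IsPair

variable {J : Jet} {c₀ K : ℝ}

lemma q_four (h : J.IsPair c₀) : MemLp J.q 4 volume := by
  obtain ⟨φ, hφ⟩ := h.approx_diff
  have t := TL.bilin (r := 2) (by norm_num) innerB hφ.tl_top hφ.tl
  have m : MemLp (fun x => ‖J.q x‖ ^ 2) 2 volume := by
    simpa only [innerB_apply, real_inner_self_eq_norm_sq] using t.mem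
  have i : Integrable (fun x => ‖J.q x‖ ^ 4) :=
    (integrable_mul_two m m).congr (ae_of_all _ fun x => by simp only [← pow_add])
  rw [← integrable_norm_rpow_iff h.q_two.1 (by norm_num) (by norm_num)]
  refine i.congr (ae_of_all _ fun x => ?_)
  have e4 : (4 : ℝ≥0∞).toReal = ((4 : ℕ) : ℝ) := by simp
  simp only [e4, Real.rpow_natCast]

/-- The transported gradients control the gradient of the difference. -/
lemma exists_grad_le (hc : 0 < c₀) (hK : 0 ≤ K) : ∃ C : ℝ, 0 ≤ C ∧ ∀ J : Jet, J.IsPair c₀ →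
    J.Bounded K → (∀ m, 0 ≤ J.energy m) → ∑ m, ∫ x, ‖J.dq m x‖ ^ 2 ≤ C * J.total := by
  obtain ⟨C₁, hC₁, lad⟩ := ladyzhenskaya_h2
  obtain ⟨C₂, hC₂, lad0⟩ := ladyzhenskaya_h2_zero
  set A : ℝ := 4 / c₀ * √(C₁ * K * (2 * K)) with hA
  have hA0 : 0 ≤ A := by positivity
  refine ⟨2 + 4 * A ^ 2 * C₂, by positivity, fun J h hb hE => ?_⟩
  obtain ⟨φ, hφ⟩ := h.approx_mean
  obtain ⟨ψ, hψ⟩ := h.approx_diff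
  have w4 : ∀ m, ∫ x, ‖J.dw m x‖ ^ 4 ≤ C₁ * K * (2 * K) := fun m => by
    refine (lad _ _ _ _ hφ m).trans (mul_le_mul (mul_le_mul_of_nonneg_left (hb.dw m) hC₁) ?_
      (by positivity) (by positivity))
    rw [Fin.sum_univ_two]; linarith [hb.ddw 0 m, hb.ddw 1 m]
  have q4 := lad0 _ _ _ _ hψ
  set n : ℝ := ∫ x, ‖J.q x‖ ^ 2 with hn
  set g : ℝ := ∑ m, ∫ x, ‖J.dq m x‖ ^ 2 with hg
  have n0 : 0 ≤ n := integral_nonneg fun _ => sq_nonneg _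
  have g0 : 0 ≤ g := Finset.sum_nonneg fun _ _ => integral_nonneg fun _ => sq_nonneg _
  clear_value n g
  -- The only negative term of the density is -ζ(w_m·q)². It is controlled by the L⁴ norms of w_m,
  -- bounded by the H² bound, and of q, which Ladyzhenskaya's inequality bounds by n and g.
  have key : ∀ m, ∫ x, ‖J.dq m x‖ ^ 2 ≤ 2 * J.energy m + A * √(C₂ * n * g) := fun m => by
    obtain ⟨i1, b1⟩ := integrable_normSq_mul (h.dw_four m) h.q_four
    have b2 : ∫ x, ‖J.dw m x‖ ^ 2 * ‖J.q x‖ ^ 2 ≤ √(C₁ * K * (2 * K)) * √(C₂ * n * g) :=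
      b1.trans (mul_le_mul (Real.sqrt_le_sqrt (w4 m)) (Real.sqrt_le_sqrt q4) (Real.sqrt_nonneg _)
        (Real.sqrt_nonneg _))
    have id := h.integrable_density hc m
    have : ∫ x, ‖J.dq m x‖ ^ 2 ≤ ∫ x, (2 * density (J.q x) (J.dw m x) (J.dq m x) +
        4 / c₀ * (‖J.dw m x‖ ^ 2 * ‖J.q x‖ ^ 2)) := by
      refine integral_mono_ae (h.dq_two m).norm.integrable_sq
        ((id.const_mul 2).add (i1.const_mul (4 / c₀))) ?_
      filter_upwards [h.gap] with x hx
      obtain ⟨z0, z1, -⟩ := zeta_spec hc hx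
      have cs : inner ℝ (J.dw m x) (J.q x) ^ 2 ≤ ‖J.dw m x‖ ^ 2 * ‖J.q x‖ ^ 2 := by
        rw [← mul_pow, ← sq_abs]
        exact pow_le_pow_left₀ (abs_nonneg _) (abs_real_inner_le_norm _ _) 2
      have m1 := mul_le_mul z1 cs (sq_nonneg _) (z0.trans z1)
      have m2 := mul_nonneg z0 (sq_nonneg (inner ℝ (J.q x) (J.dq m x)))
      have e : 4 / c₀ * (‖J.dw m x‖ ^ 2 * ‖J.q x‖ ^ 2) =
        2 * (2 / c₀ * (‖J.dw m x‖ ^ 2 * ‖J.q x‖ ^ 2)) := by ring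
      simp only [density, real_inner_self_eq_norm_sq, e]
      nlinarith
    refine this.trans ?_
    rw [integral_add (id.const_mul 2) (i1.const_mul (4 / c₀)), integral_const_mul,
      integral_const_mul, hA, mul_assoc (4 / c₀)]
    exact add_le_add le_rfl (mul_le_mul_of_nonneg_left b2 (by positivity))
  have k0 := key 0
  have k1 := key 1
  have eg : g = (∫ x, ‖J.dq 0 x‖ ^ 2) + ∫ x, ‖J.dq 1 x‖ ^ 2 := by rw [hg, Fin.sum_univ_two]
  -- The arithmetic-geometric mean inequality with g/4: summed over both directions it costs half of
  -- g, which is absorbed on the left.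
  have am : A * √(C₂ * n * g) ≤ g / 4 + A ^ 2 * C₂ * n := by
    have s := Real.sq_sqrt (show 0 ≤ C₂ * n * g by positivity)
    rcases g0.eq_or_lt with hz | hp
    · rw [← hz]; simp; positivity
    · have : (2 * A * √(C₂ * n * g)) ^ 2 ≤ (g / 2 + 2 * A ^ 2 * C₂ * n) ^ 2 := by
        nlinarith [sq_nonneg (g / 2 - 2 * A ^ 2 * C₂ * n)]
      have := abs_le_of_sq_le_sq this (by positivity)
      linarith [(le_abs_self _).trans this]
  have e0 := hE 0
  have e1 := hE 1
  rw [Jet.total, Fin.sum_univ_two, ← hn]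
  have p1 : 0 ≤ A ^ 2 * C₂ * (2 * J.energy 0 + 2 * J.energy 1) := by positivity
  nlinarith

end Jet.IsPair

/-- An integrable function with a bound for its integral. -/
def IntBound (f : Plane → ℝ) (B : ℝ) : Prop := Integrable f ∧ ∫ x, f x ≤ B

namespace IntBound

variable {f g : Plane → ℝ} {B B' : ℝ}

lemma add (hf : IntBound f B) (hg : IntBound g B') : IntBound (fun x => f x + g x) (B + B') :=
  ⟨hf.1.add hg.1, (integral_add hf.1 hg.1).trans_le (add_le_add hf.2 hg.2)⟩

lemma const_mul {c : ℝ} (hc : 0 ≤ c) (hf : IntBound f B) : IntBound (fun x => c * f x) (c * B) :=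
  ⟨hf.1.const_mul c, (integral_const_mul c f).trans_le (mul_le_mul_of_nonneg_left hf.2 hc)⟩

lemma sum_two {f : Fin 2 → Plane → ℝ} (hf : ∀ i, IntBound (f i) B) :
    IntBound (fun x => ∑ i, f i x) (2 * B) := by
  simp only [Fin.sum_univ_two, two_mul]
  exact (hf 0).add (hf 1)

end IntBound

lemma sq_sum_two_le (f : Fin 2 → ℝ) : (∑ i, f i) ^ 2 ≤ 2 * ∑ i, f i ^ 2 := by
  simp only [Fin.sum_univ_two]
  nlinarith [sq_nonneg (f 0 - f 1)]

/-- The factor r multiplies the second derivatives, which are only in L², so its supremum S is used;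
s²p² is kept as a product of gradients for the logarithmic product inequality, since neither
gradient is bounded. -/
lemma weight_sq_le {r s p h S H P₂ P₄ s₂ : ℝ} (hS : r ^ 2 ≤ S) (hH : h ^ 2 ≤ H)
    (hP₂ : p ^ 2 ≤ P₂) (hP₄ : p ^ 4 ≤ P₄) (hs : s ^ 2 ≤ s₂) :
    weight r s p h ^ 2 ≤ 6 * r ^ 2 + 6 * S * (H + P₄) + 4 * s₂ + 4 * (s₂ * P₂) := by
  have b1 : weight r s p h ^ 2 ≤ 6 * r ^ 2 + 6 * (r ^ 2 * (h ^ 2 + p ^ 4)) + 4 * s ^ 2 +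
      4 * (s ^ 2 * p ^ 2) := by
    have e1 : (1 + h + p ^ 2) ^ 2 ≤ 3 * (1 + (h ^ 2 + p ^ 4)) := by
      nlinarith [sq_nonneg (1 - h), sq_nonneg (1 - p ^ 2), sq_nonneg (h - p ^ 2)]
    have e2 : (1 + p) ^ 2 ≤ 2 * (1 + p ^ 2) := by nlinarith [sq_nonneg (1 - p)]
    have e3 : weight r s p h ^ 2 ≤ 2 * (r ^ 2 * (1 + h + p ^ 2) ^ 2) + 2 * (s ^ 2 * (1 + p) ^ 2) := by
      rw [weight]
      nlinarith [sq_nonneg (r * (1 + h + p ^ 2) - s * (1 + p))]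
    have m1 := mul_le_mul_of_nonneg_left e1 (sq_nonneg r)
    have m2 := mul_le_mul_of_nonneg_left e2 (sq_nonneg s)
    linarith
  have m1 : r ^ 2 * (h ^ 2 + p ^ 4) ≤ S * (H + P₄) :=
    mul_le_mul hS (add_le_add hH hP₄) (by positivity) ((sq_nonneg r).trans hS)
  have m2 : s ^ 2 * p ^ 2 ≤ s₂ * P₂ := mul_le_mul hs hP₂ (by positivity) ((sq_nonneg s).trans hs)
  linarith

lemma sq_sum_add_le (a c : Fin 2 → ℝ) : (∑ i, (a i + c i)) ^ 2 ≤ 4 * ∑ i, (a i ^ 2 + c i ^ 2) := by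
  simp only [Fin.sum_univ_two]
  nlinarith [sq_nonneg (a 0 - a 1), sq_nonneg (a 0 - c 0), sq_nonneg (a 0 - c 1),
    sq_nonneg (a 1 - c 0), sq_nonneg (a 1 - c 1), sq_nonneg (c 0 - c 1)]

lemma pow_four_sum_add_le (a c : Fin 2 → ℝ) :
    (∑ i, (a i + c i)) ^ 4 ≤ 64 * ∑ i, (a i ^ 4 + c i ^ 4) := by
  have h1 := sq_sum_add_le a c
  have h2 := sq_sum_add_le (fun i => a i ^ 2) (fun i => c i ^ 2)
  simp only [← pow_mul] at h2
  have h3 := pow_le_pow_left₀ (sq_nonneg _) h1 2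
  rw [← pow_mul, mul_pow] at h3
  norm_num at h2 h3
  simp only [Fin.sum_univ_two]
  linarith

lemma sq_sum_sum_add_le (a c : Fin 2 → Fin 2 → ℝ) :
    (∑ i, ∑ j, (a i j + c i j)) ^ 2 ≤ 8 * ∑ i, ∑ j, (a i j ^ 2 + c i j ^ 2) := by
  refine (sq_sum_two_le _).trans ?_
  have := Finset.sum_le_sum fun i (_ : i ∈ Finset.univ) => sq_sum_add_le (a i) (c i)
  rw [← Finset.mul_sum] at this
  linarith

namespace Jet.IsPair

variable {J : Jet} {c₀ K : ℝ}

/-- The sup inequality handles |q| times second derivatives and fourth powers of gradients; the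
product inequality handles |∇q| times gradients. In both, the logarithm multiplies norms of the
difference, controlled by the total energy, and ε multiplies norms bounded by K alone. -/
lemma exists_errJet_le (hc : 0 < c₀) (hK : 0 ≤ K) : ∃ C : ℝ, 0 ≤ C ∧ ∀ J : Jet, J.IsPair c₀ →
    J.Bounded K → (∀ m, 0 ≤ J.energy m) → ∀ ε : ℝ, 0 < ε → ε ≤ 1 →
    errJet J ≤ C * ((1 + Real.log (1 / ε)) * J.total + ε) := by
  obtain ⟨A, hA, grad⟩ := exists_grad_le hc hK
  obtain ⟨C₁, hC₁, lad⟩ := ladyzhenskaya_h2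
  obtain ⟨C₂, hC₂, sup⟩ := log_sup_h2
  obtain ⟨C₃, hC₃, prod⟩ := log_product_h2
  set D : ℝ := C₁ * K * (2 * K) with hD
  have hD0 : 0 ≤ D := by positivity
  set R : ℝ := 8 * (2 * (2 * (K + K))) + 64 * (2 * (D + D)) with hR
  have hR0 : 0 ≤ R := by positivity
  -- Here α collects the coefficients of the logarithmic term and β those of ε; R bounds the
  -- integrals multiplied by the supremum of |q|².
  set α : ℝ := 6 + 6 * (C₂ * (1 + A)) * R + 8 * (2 * A) + 256 * (3 * C₃ * K * A) with hα
  set β : ℝ := 6 * (6 * C₂ * K) * R + 256 * (2 * C₃ * K * √D) with hβ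
  have hα0 : 0 ≤ α := by positivity
  have hβ0 : 0 ≤ β := by positivity
  refine ⟨α + β, by positivity, fun J h hb hE ε hε h1 => ?_⟩
  obtain ⟨φ, hφ⟩ := h.approx_mean
  obtain ⟨ψ, hψ⟩ := h.approx_diff
  have g1 := grad J h hb hE
  set x := J.total with hx
  set L := 1 + Real.log (1 / ε) with hL
  have L1 : 1 ≤ L := by
    have := Real.log_nonneg (show 1 ≤ 1 / ε by rw [le_div_iff₀ hε]; linarith)
    linarith
  have hn : ∫ x, ‖J.q x‖ ^ 2 ≤ x := by
    rw [hx, Jet.total, Fin.sum_univ_two]; linarith [hE 0, hE 1]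
  have n0 : 0 ≤ ∫ x, ‖J.q x‖ ^ 2 := integral_nonneg fun _ => sq_nonneg _
  have x0 : 0 ≤ x := n0.trans hn
  have dn : ∀ m, 0 ≤ ∫ x, ‖J.dq m x‖ ^ 2 := fun m => integral_nonneg fun _ => sq_nonneg _
  have g2 : ∀ m, ∫ x, ‖J.dq m x‖ ^ 2 ≤ A * x := fun m =>
    (Finset.single_le_sum (fun i _ => dn i) (Finset.mem_univ m)).trans g1
  have xL : x ≤ L * x := le_mul_of_one_le_left x0 L1
  have sum2 : ∀ {f : Fin 2 → ℝ}, (∀ i, f i ≤ K) → ∑ i, f i ≤ 2 * K := fun h => by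
    rw [Fin.sum_univ_two]; linarith [h 0, h 1]
  have w4 : ∀ m, ∫ x, ‖J.dw m x‖ ^ 4 ≤ D := fun m =>
    (lad _ _ _ _ hφ m).trans (mul_le_mul (mul_le_mul_of_nonneg_left (hb.dw m) hC₁)
      (sum2 fun k => hb.ddw k m) (Finset.sum_nonneg fun _ _ => integral_nonneg fun _ => sq_nonneg _)
      (by positivity))
  have q4 : ∀ m, ∫ x, ‖J.dq m x‖ ^ 4 ≤ D := fun m =>
    (lad _ _ _ _ hψ m).trans (mul_le_mul (mul_le_mul_of_nonneg_left (hb.dq m) hC₁)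
      (sum2 fun k => hb.ddq k m) (Finset.sum_nonneg fun _ _ => integral_nonneg fun _ => sq_nonneg _)
      (by positivity))
  set S : ℝ := C₂ * (1 + A) * (L * x) + 6 * C₂ * K * ε with hS
  have S0 : 0 ≤ S := by positivity
  have hsup : ∀ᵐ y, ‖J.q y‖ ^ 2 ≤ S := by
    filter_upwards [sup _ _ _ _ hψ ε hε h1] with y hy
    refine hy.trans ?_
    have s1 := mul_le_mul_of_nonneg_left (add_le_add hn g1) (show 0 ≤ C₂ * L by positivity)
    have s2 := mul_le_mul_of_nonneg_left (add_le_add (sum2 hb.dq) (Finset.sum_le_sum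
      fun i (_ : i ∈ Finset.univ) => sum2 fun j => hb.ddq i j)) (show 0 ≤ C₂ * ε by positivity)
    rw [Finset.sum_const, Finset.card_univ, Fintype.card_fin, nsmul_eq_mul, Nat.cast_ofNat] at s2
    rw [hS, ← hL]
    linarith
  have pr : ∀ {f : Plane → Space} {d : Fin 2 → Plane → Space} {H : Fin 2 → Fin 2 → Plane → Space}
      {θ : ℕ → Plane → Space}, H2Approx f d H θ → (∀ i, ∫ y, ‖d i y‖ ^ 2 ≤ K) →
      (∀ i j, ∫ y, ‖H i j y‖ ^ 2 ≤ K) → ∀ i m, IntBound (fun y => ‖d i y‖ ^ 2 * ‖J.dq m y‖ ^ 2)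
        (3 * C₃ * K * A * (L * x) + 2 * C₃ * K * √D * ε) := by
    intro f d H θ hθ b1 b2 i m
    refine ⟨(integrable_normSq_mul (hθ.tl_pd_four i).mem (h.dq_four m)).1, ?_⟩
    refine (prod _ _ _ _ hθ i (J.dq m) (h.dq_two m) (h.dq_four m) ε hε h1).trans ?_
    have s1 := mul_le_mul (mul_le_mul_of_nonneg_left (add_le_add (b1 i) (sum2 fun k => b2 k i))
      (show 0 ≤ C₃ * L by positivity)) (g2 m) (dn m) (by positivity)
    have s2 := mul_le_mul (mul_le_mul_of_nonneg_left (sum2 fun k => b2 k i)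
      (show 0 ≤ C₃ * ε by positivity)) (Real.sqrt_le_sqrt (q4 m)) (Real.sqrt_nonneg _) (by positivity)
    linarith
  have I1 : IntBound (fun y => ‖J.q y‖ ^ 2) x := ⟨h.q_two.norm.integrable_sq, hn⟩
  have I2 := IntBound.sum_two fun i => IntBound.sum_two fun j =>
    IntBound.add (f := fun y => ‖J.ddw i j y‖ ^ 2) (B := K)
      ⟨(h.ddw_two i j).norm.integrable_sq, hb.ddw i j⟩ (g := fun y => ‖J.ddq i j y‖ ^ 2) (B' := K)
      ⟨(h.ddq_two i j).norm.integrable_sq, hb.ddq i j⟩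
  have I3 := IntBound.sum_two fun i =>
    IntBound.add (f := fun y => ‖J.dw i y‖ ^ 4) (B := D)
      ⟨integrable_norm_pow_four (h.dw_four i), w4 i⟩ (g := fun y => ‖J.dq i y‖ ^ 4) (B' := D)
      ⟨integrable_norm_pow_four (h.dq_four i), q4 i⟩
  have I4 := IntBound.sum_two fun i => (⟨(h.dq_two i).norm.integrable_sq, g2 i⟩ :
    IntBound (fun y => ‖J.dq i y‖ ^ 2) (A * x))
  have I5 := IntBound.sum_two fun m => IntBound.sum_two fun i =>
    (pr hφ hb.dw hb.ddw i m).add (pr hψ hb.dq hb.ddq i m)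
  have I := (((I1.const_mul (c := 6) (by norm_num)).add (((I2.const_mul (c := 8) (by norm_num)).add
    (I3.const_mul (c := 64) (by norm_num))).const_mul (c := 6 * S) (by positivity))).add
    (I4.const_mul (c := 8) (by norm_num))).add (I5.const_mul (c := 32) (by norm_num))
  refine (integral_mono_ae h.integrable_errWeight I.1 ?_).trans (I.2.trans ?_)
  · filter_upwards [hsup] with y hy
    have := weight_sq_le hy
      (sq_sum_sum_add_le (fun i j => ‖J.ddw i j y‖) (fun i j => ‖J.ddq i j y‖))
      (sq_sum_add_le (fun i => ‖J.dw i y‖) (fun i => ‖J.dq i y‖))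
      (pow_four_sum_add_le (fun i => ‖J.dw i y‖) (fun i => ‖J.dq i y‖))
      (sq_sum_two_le (fun i => ‖J.dq i y‖))
    refine this.trans (le_of_eq ?_)
    simp only [Fin.sum_univ_two]
    ring
  · rw [← hR]
    have e : 6 * x + 6 * S * R + 8 * (2 * (A * x)) + 32 * (2 * (2 * (3 * C₃ * K * A * (L * x) +
        2 * C₃ * K * √D * ε + (3 * C₃ * K * A * (L * x) + 2 * C₃ * K * √D * ε)))) ≤
        α * (L * x) + β * ε := by
      rw [hα, hβ, hS]
      have := mul_le_mul_of_nonneg_left xL hA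
      linarith
    refine e.trans ?_
    have := mul_nonneg hβ0 (show 0 ≤ L * x by positivity)
    have := mul_nonneg hα0 hε.le
    linarith

end Jet.IsPair
end LLHelicity

namespace LLHelicity
set_option linter.unusedSectionVars false

/-! ### The differential inequality -/

section Growth

/-- Choose ε = x/X and use log(X/x) ≤ p (X/x)^(1/p); since X ≥ 1, its power 1/p is at most X, so the
dependence on p is only the factor p. For x = 0 let ε tend to zero. -/
lemma le_rpow_of_log_bound {e x X C p : ℝ} (hC : 0 ≤ C) (hx : 0 ≤ x) (hX : x ≤ X) (hX1 : 1 ≤ X)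
    (hp : 2 < p)
    (h : ∀ ε : ℝ, 0 < ε → ε ≤ 1 → e ≤ C * ((1 + Real.log (1 / ε)) * x + ε)) :
    e ≤ 3 * C * X * p * x ^ (1 - 1 / p) := by
  have p0 : 0 < p := by linarith
  have hp1 : 1 / p < 1 := by rw [div_lt_one p0]; linarith
  have hp' : 0 < 1 / p := by positivity
  rcases hx.eq_or_lt with rfl | hx
  · rw [Real.zero_rpow (by linarith), mul_zero]
    refine le_of_forall_pos_le_add fun δ hδ => ?_
    have := h (min 1 (δ / (C + 1))) (by positivity) (min_le_left _ _)
    refine this.trans ?_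
    rw [mul_zero, zero_add, zero_add]
    calc C * min 1 (δ / (C + 1)) ≤ (C + 1) * (δ / (C + 1)) :=
          mul_le_mul (by linarith) (min_le_right _ _) (by positivity) (by positivity)
      _ = δ := by field_simp
  set y := x ^ (1 - 1 / p) with hy
  have y0 : 0 ≤ y := by positivity
  have X0 : 0 < X := by linarith
  have e1 : x = x ^ (1 / p) * y := by
    rw [hy, ← Real.rpow_add hx, add_sub_cancel, Real.rpow_one]
  have XX : X ^ (1 / p) ≤ X := by
    calc X ^ (1 / p) ≤ X ^ (1 : ℝ) := Real.rpow_le_rpow_of_exponent_le hX1 hp1.le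
      _ = X := Real.rpow_one X
  have b1 : x ≤ X * y := by
    calc x = x ^ (1 / p) * y := e1
      _ ≤ X ^ (1 / p) * y := mul_le_mul_of_nonneg_right (Real.rpow_le_rpow hx.le hX hp'.le) y0
      _ ≤ X * y := mul_le_mul_of_nonneg_right XX y0
  have b2 : Real.log (1 / (x / X)) * x ≤ p * (X * y) := by
    rw [one_div_div]
    have l := Real.log_le_rpow_div (show 0 ≤ X / x by positivity) hp'
    rw [div_div_eq_mul_div, div_one, mul_comm] at l
    calc Real.log (X / x) * x ≤ (p * (X / x) ^ (1 / p)) * x := mul_le_mul_of_nonneg_right l hx.le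
      _ = p * (X ^ (1 / p) * y) := by
        rw [Real.div_rpow X0.le hx.le]
        have : x ^ (1 / p) ≠ 0 := by positivity
        nth_rw 2 [e1]
        field_simp
      _ ≤ p * (X * y) := by gcongr
  have b3 : x / X ≤ X * y := (div_le_self hx.le hX1).trans b1
  have := h (x / X) (by positivity) (by rw [div_le_one X0]; exact hX)
  refine this.trans ?_
  have Xy : 0 ≤ X * y := by positivity
  calc C * ((1 + Real.log (1 / (x / X))) * x + x / X)
      ≤ C * (X * y + p * (X * y) + X * y) := by
        refine mul_le_mul_of_nonneg_left ?_ hC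
        linarith
    _ ≤ C * (3 * p * (X * y)) := mul_le_mul_of_nonneg_left (by nlinarith) hC
    _ = 3 * C * X * p * y := by ring

variable {T p L X : ℝ} {e : Fin 3 → ℝ → ℝ}

/-- The running suprema sum to a nondecreasing G, and each grows only through the growth of its e j,
so G satisfies G' ≤ 3Lp G^(1-1/p) in integrated form. Then G^(1/p) has slope at most 3L: the factor
p is cancelled by the exponent 1/p, so the constant does not depend on p. -/
lemma sum_sSup_le (hT : 0 ≤ T) (hp : 2 < p) (hL : 0 ≤ L) (h0 : ∀ j, ∀ t ∈ Icc 0 T, 0 ≤ e j t)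
    (hX : ∀ t ∈ Icc 0 T, ∑ j, e j t ≤ X)
    (h : ∀ j, ∀ t₁ t₂ Y, 0 ≤ t₁ → t₁ ≤ t₂ → t₂ ≤ T → (∀ s ∈ Icc t₁ t₂, ∑ j, e j s ≤ Y) →
      e j t₂ - e j t₁ ≤ L * p * Y ^ (1 - 1 / p) * (t₂ - t₁)) :
    ∑ j, sSup (e j '' Icc 0 T) ≤ ((∑ j, e j 0) ^ (1 / p) + 3 * L * T) ^ p := by
  have p0 : 0 < p := by linarith
  have hp1 : 0 < 1 - 1 / p := by
    have : 1 / p < 1 := by rw [div_lt_one p0]; linarith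
    linarith
  have ejX : ∀ j, ∀ t ∈ Icc 0 T, e j t ≤ X := fun j t ht =>
    (Finset.single_le_sum (fun i _ => h0 i t ht) (Finset.mem_univ j)).trans (hX t ht)
  have bdd : ∀ j, ∀ t ≤ T, BddAbove (e j '' Icc 0 t) := fun j t ht =>
    ⟨X, by rintro _ ⟨s, hs, rfl⟩; exact ejX j s ⟨hs.1, hs.2.trans ht⟩⟩
  set m : Fin 3 → ℝ → ℝ := fun j t => sSup (e j '' Icc 0 t) with hm
  set G : ℝ → ℝ := fun t => ∑ j, m j t with hG
  have em : ∀ j t s, t ≤ T → 0 ≤ s → s ≤ t → e j s ≤ m j t := fun j t s ht h1 h2 =>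
    le_csSup (bdd j t ht) (mem_image_of_mem _ ⟨h1, h2⟩)
  have ne : ∀ j t, 0 ≤ t → (e j '' Icc 0 t).Nonempty := fun j t ht =>
    ⟨e j 0, mem_image_of_mem _ ⟨le_rfl, ht⟩⟩
  have m0 : ∀ j t, 0 ≤ t → t ≤ T → 0 ≤ m j t := fun j t h1 h2 =>
    (h0 j 0 ⟨le_rfl, hT⟩).trans (em j t 0 h2 le_rfl h1)
  have G0 : ∀ t, 0 ≤ t → t ≤ T → 0 ≤ G t := fun t h1 h2 => Finset.sum_nonneg fun j _ => m0 j t h1 h2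
  have mX : ∀ j t, 0 ≤ t → t ≤ T → m j t ≤ X := fun j t h1 h2 => csSup_le (ne j t h1) (by
    rintro _ ⟨s, hs, rfl⟩; exact ejX j s ⟨hs.1, hs.2.trans h2⟩)
  have GX : ∀ t, 0 ≤ t → t ≤ T → G t ≤ 3 * X := fun t h1 h2 => by
    simp only [hG, Fin.sum_univ_three]
    linarith [mX 0 t h1 h2, mX 1 t h1 h2, mX 2 t h1 h2]
  have X0 : 0 ≤ X := (h0 0 0 ⟨le_rfl, hT⟩).trans (ejX 0 0 ⟨le_rfl, hT⟩)
  have mono : ∀ t₁ t₂, 0 ≤ t₁ → t₁ ≤ t₂ → t₂ ≤ T → G t₁ ≤ G t₂ := fun t₁ t₂ h1 h2 h3 =>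
    Finset.sum_le_sum fun j _ => csSup_le_csSup (bdd j t₂ h3) (ne j t₁ h1)
      (image_mono (Icc_subset_Icc_right h2))
  have minc : ∀ j t₁ t₂, 0 ≤ t₁ → t₁ ≤ t₂ → t₂ ≤ T →
      m j t₂ ≤ m j t₁ + L * p * G t₂ ^ (1 - 1 / p) * (t₂ - t₁) := fun j t₁ t₂ h1 h2 h3 => by
    have k0 : 0 ≤ L * p * G t₂ ^ (1 - 1 / p) := by
      have := G0 t₂ (h1.trans h2) h3
      positivity
    refine csSup_le (ne j t₂ (h1.trans h2)) ?_
    rintro _ ⟨s, hs, rfl⟩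
    rcases le_total s t₁ with hst | hst
    · have := em j t₁ s (h2.trans h3) hs.1 hst
      have := mul_nonneg k0 (sub_nonneg.2 h2)
      linarith
    · have a1 := h j t₁ s (G t₂) h1 hst (hs.2.trans h3) fun r hr =>
        Finset.sum_le_sum fun i _ => em i t₂ r h3 (h1.trans hr.1) (hr.2.trans hs.2)
      have a2 := em j t₁ t₁ (h2.trans h3) h1 le_rfl
      have a3 := mul_le_mul_of_nonneg_left (sub_le_sub_right hs.2 t₁) k0
      linarith
  have inc : ∀ t₁ t₂, 0 ≤ t₁ → t₁ ≤ t₂ → t₂ ≤ T →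
      G t₂ ≤ G t₁ + 3 * L * p * G t₂ ^ (1 - 1 / p) * (t₂ - t₁) := fun t₁ t₂ h1 h2 h3 => by
    have a := fun j => minc j t₁ t₂ h1 h2 h3
    generalize G t₂ ^ (1 - 1 / p) = z at a ⊢
    simp only [hG, Fin.sum_univ_three]
    linarith [a 0, a 1, a 2]
  -- Adding δ to G makes the base positive, and adding δ to the slope makes the comparison function
  -- strictly faster; δ tends to zero at the end.
  have key : ∀ δ : ℝ, 0 < δ → G T + δ ≤ ((G 0 + δ) ^ (1 / p) + (3 * L + δ) * T) ^ p := by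
    intro δ hδ
    set F : ℝ → ℝ := fun t => G t + δ with hF
    have F0 : ∀ t, 0 ≤ t → t ≤ T → 0 < F t := fun t h1 h2 => by
      have := G0 t h1 h2; simp only [hF]; linarith
    have Finc : ∀ t₁ t₂, 0 ≤ t₁ → t₁ ≤ t₂ → t₂ ≤ T →
        F t₂ ≤ F t₁ + 3 * L * p * F t₂ ^ (1 - 1 / p) * (t₂ - t₁) := fun t₁ t₂ h1 h2 h3 => by
      have a := inc t₁ t₂ h1 h2 h3
      have a2 := Real.rpow_le_rpow (G0 t₂ (h1.trans h2) h3) (show G t₂ ≤ F t₂ by simp only [hF]; linarith)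
        hp1.le
      have a3 := mul_le_mul_of_nonneg_right (mul_le_mul_of_nonneg_left a2
        (show 0 ≤ 3 * L * p by positivity)) (sub_nonneg.2 h2)
      simp only [hF] at a3 ⊢
      linarith
    -- Monotonicity from one side and the increment bound, with G at most 3X, from the other make F
    -- Lipschitz.
    have cont : ContinuousOn F (Icc 0 T) := by
      have kk : 0 ≤ 3 * L * p * (3 * X + δ) ^ (1 - 1 / p) := by positivity
      refine (LipschitzOnWith.of_le_add_mul (Real.toNNReal (3 * L * p * (3 * X + δ) ^ (1 - 1 / p)))
        fun t₂ h2 t₁ h1 => ?_).continuousOn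
      rw [Real.coe_toNNReal _ kk, Real.dist_eq]
      rcases le_total t₁ t₂ with h12 | h12
      · have a := Finc t₁ t₂ h1.1 h12 h2.2
        have a2 := Real.rpow_le_rpow (F0 t₂ h2.1 h2.2).le (show F t₂ ≤ 3 * X + δ by
          have := GX t₂ h2.1 h2.2; simp only [hF]; linarith) hp1.le
        have a3 := mul_le_mul_of_nonneg_right (mul_le_mul_of_nonneg_left a2
          (show 0 ≤ 3 * L * p by positivity)) (sub_nonneg.2 h12)
        rw [abs_of_nonneg (sub_nonneg.2 h12)]
        linarith
      · have a := mono t₂ t₁ h2.1 h12 h1.2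
        have := mul_nonneg kk (abs_nonneg (t₂ - t₁))
        simp only [hF]
        linarith
    set y₀ := F 0 ^ (1 / p) with hy₀
    have y₀0 : 0 < y₀ := Real.rpow_pos_of_pos (F0 0 le_rfl hT) _
    set c := 3 * L + δ with hc
    have c0 : 0 < c := by positivity
    have ypos : ∀ t, 0 ≤ t → 0 < y₀ + c * t := fun t ht => by positivity
    have hd : ∀ t, 0 ≤ t → HasDerivAt (fun t => (y₀ + c * t) ^ p)
        (c * p * (y₀ + c * t) ^ (p - 1)) t := fun t ht => by
      have d1 : HasDerivAt (fun t : ℝ => y₀ + c * t) c t := by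
        simpa using ((hasDerivAt_id t).const_mul c).const_add y₀
      exact d1.rpow_const (Or.inl (ypos t ht).ne')
    have := image_le_of_liminf_slope_right_lt_deriv_boundary' (f := F)
      (f' := fun t => 3 * L * p * F t ^ (1 - 1 / p)) (B := fun t => (y₀ + c * t) ^ p)
      (B' := fun t => c * p * (y₀ + c * t) ^ (p - 1)) (a := 0) (b := T) cont ?_ ?_ ?_ ?_ ?_
      (right_mem_Icc.2 hT)
    · exact this
    · intro t ht r hr
      refine Eventually.frequently ?_
      have ct : Tendsto (fun z => 3 * L * p * F z ^ (1 - 1 / p)) (𝓝[>] t)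
          (𝓝 (3 * L * p * F t ^ (1 - 1 / p))) := by
        have c1 : Tendsto F (𝓝[>] t) (𝓝 (F t)) := (cont t ⟨ht.1, ht.2.le⟩).mono_left
          (by rw [← nhdsWithin_Ioc_eq_nhdsGT ht.2]
              exact nhdsWithin_mono _ fun z hz => ⟨ht.1.trans hz.1.le, hz.2⟩)
        exact (c1.rpow_const (Or.inr hp1.le)).const_mul _
      filter_upwards [ct.eventually_lt_const hr, Ioc_mem_nhdsGT ht.2] with z hz hz'
      have a := Finc t z ht.1 hz'.1.le hz'.2
      have hpos := sub_pos.2 hz'.1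
      rw [slope_def_field, div_lt_iff₀ hpos]
      nlinarith
    · simp only [mul_zero, add_zero, hy₀]
      rw [← Real.rpow_mul (F0 0 le_rfl hT).le, one_div_mul_cancel p0.ne', Real.rpow_one]
    · exact fun t ht => (hd t ht.1).continuousAt.continuousWithinAt
    · exact fun t ht => (hd t ht.1).hasDerivWithinAt
    · intro t ht he
      have yp := ypos t ht.1
      -- At a contact point the power of F is exactly the power in the derivative of (y₀ + ct)^p, so
      -- the slopes compare as 3Lp < cp.
      have e1 : F t ^ (1 - 1 / p) = (y₀ + c * t) ^ (p - 1) := by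
        rw [he, ← Real.rpow_mul yp.le]
        congr 1
        field_simp
      simp only [e1]
      have := Real.rpow_pos_of_pos yp (p - 1)
      have hcl : 3 * L * p < c * p := by nlinarith
      exact mul_lt_mul_of_pos_right hcl this
  have G00 : G 0 = ∑ j, e j 0 := by simp [hG, hm]
  rw [← G00]
  have t1 : Tendsto (fun δ : ℝ => G T + δ) (𝓝[>] 0) (𝓝 (G T + 0)) :=
    (tendsto_const_nhds.add tendsto_id).mono_left nhdsWithin_le_nhds
  have t2 : Tendsto (fun δ : ℝ => ((G 0 + δ) ^ (1 / p) + (3 * L + δ) * T) ^ p) (𝓝[>] 0)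
      (𝓝 (((G 0 + 0) ^ (1 / p) + (3 * L + 0) * T) ^ p)) := by
    refine Tendsto.mono_left ?_ nhdsWithin_le_nhds
    exact (((tendsto_const_nhds.add tendsto_id).rpow_const (Or.inr (by positivity))).add
      ((tendsto_const_nhds.add tendsto_id).mul_const T)).rpow_const (Or.inr p0.le)
  rw [add_zero] at t1
  simp only [add_zero] at t2
  exact le_of_tendsto_of_tendsto t1 t2 (by filter_upwards [self_mem_nhdsWithin] with δ hδ using key δ hδ)

end Growth
end LLHelicity

namespace LLHelicity
set_option linter.unusedSectionVars false

/-! ### Parallel transport along minimal geodesics -/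

section Transport

lemma eq_of_deriv_zero {E : Type*} [NormedAddCommGroup E] [NormedSpace ℝ E] {f f' : ℝ → E}
    (h : ∀ s ∈ Icc (0 : ℝ) 1, HasDerivWithinAt f (f' s) (Icc 0 1) s)
    (h0 : ∀ s ∈ Icc (0 : ℝ) 1, f' s = 0) : ∀ s ∈ Icc (0 : ℝ) 1, f s = f 0 := by
  refine constant_of_has_deriv_right_zero (fun s hs => (h s hs).continuousWithinAt) fun s hs => ?_
  have := h s ⟨hs.1, hs.2.le⟩
  rw [h0 s ⟨hs.1, hs.2.le⟩] at this
  refine this.mono_of_mem_nhdsWithin ?_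
  exact mem_of_superset (Icc_mem_nhdsGE hs.2) (Icc_subset_Icc_left hs.1)

variable {p q ξ η : Space} {γ γ' F : ℝ → Space}

/-- The value of a parallel field at the end of a minimal geodesic. -/
lemma IsTransport.eq (hp : ‖p‖ = 1) (hq : ‖q‖ = 1) (hc : -1 < (inner ℝ p q : ℝ))
    (hξ : (inner ℝ ξ p : ℝ) = 0) (h : IsTransport p q ξ η) :
    η = ξ - (inner ℝ ξ q / (1 + inner ℝ p q) : ℝ) • (p + q) := by
  obtain ⟨γ, γ', F, hγ, hF, hF0, hF1⟩ := h
  set α := InnerProductGeometry.angle p q with hα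
  have cosα : Real.cos α = inner ℝ p q := by
    rw [hα, InnerProductGeometry.cos_angle, hp, hq]; simp
  have m1 : (1 : ℝ) ∈ Icc (0 : ℝ) 1 := by simp
  have m0 : (0 : ℝ) ∈ Icc (0 : ℝ) 1 := by simp
  have vv : ∀ s ∈ Icc (0 : ℝ) 1, (inner ℝ (γ' s) (γ' s) : ℝ) = α ^ 2 := fun s hs => by
    rw [real_inner_self_eq_norm_sq, hγ.minimal s hs]
  have gg : ∀ s ∈ Icc (0 : ℝ) 1, (inner ℝ (γ s) (γ s) : ℝ) = 1 := fun s hs => by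
    rw [real_inner_self_eq_norm_sq, hγ.sphere s hs, one_pow]
  have ud : ∀ s ∈ Icc (0 : ℝ) 1, UniqueDiffWithinAt ℝ (Icc (0 : ℝ) 1) s :=
    uniqueDiffOn_Icc zero_lt_one
  have gv : ∀ s ∈ Icc (0 : ℝ) 1, (inner ℝ (γ s) (γ' s) : ℝ) = 0 := fun s hs => by
    have d1 := (hγ.velocity s hs).inner ℝ (hγ.velocity s hs)
    have d2 : HasDerivWithinAt (fun s => (inner ℝ (γ s) (γ s) : ℝ)) 0 (Icc 0 1) s :=
      (hasDerivWithinAt_const s _ (1 : ℝ)).congr (fun t ht => gg t ht) (gg s hs)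
    have := (ud s hs).eq_deriv _ d1 d2
    rw [real_inner_comm] at this
    linarith [real_inner_comm (γ s) (γ' s)]
  have geo : ∀ s ∈ Icc (0 : ℝ) 1, HasDerivWithinAt γ' (-(α ^ 2) • γ s) (Icc 0 1) s := fun s hs => by
    have := hγ.geodesic s hs; rwa [vv s hs] at this
  have Fg : ∀ s ∈ Icc (0 : ℝ) 1, (inner ℝ (F s) (γ s) : ℝ) = 0 := fun s hs => by
    have := eq_of_deriv_zero (fun s hs => (hF s hs).inner ℝ (hγ.velocity s hs)) (fun s hs => by
      rw [inner_smul_left, gg s hs]; simp) s hs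
    rw [this, hF0, hγ.source, hξ]
  have Fv : ∀ s ∈ Icc (0 : ℝ) 1, (inner ℝ (F s) (γ' s) : ℝ) = inner ℝ ξ (γ' 0) := fun s hs => by
    have := eq_of_deriv_zero (fun s hs => (hF s hs).inner ℝ (geo s hs)) (fun s hs => by
      rw [inner_smul_left, inner_smul_right, gv s hs, Fg s hs]; simp) s hs
    rw [this, hF0]
  set κ : ℝ := inner ℝ ξ (γ' 0) with hκ
  -- A parallel field keeps its products with γ and γ', and both F and γ' have derivatives
  -- proportional to γ, so α²F - κγ' is constant.
  have e1 := eq_of_deriv_zero (fun s hs => ((hF s hs).const_smul (α ^ 2)).sub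
    ((geo s hs).const_smul κ)) (fun s hs => by rw [Fv s hs]; module) 1 m1
  rcases (InnerProductGeometry.angle_nonneg p q).eq_or_lt with h0 | h0
  -- For coinciding endpoints the geodesic is constant and the transport is the identity; α² cannot
  -- be divided out.
  · have α0 : α = 0 := h0.symm
    have pq : p = q := by
      have : (inner ℝ p q : ℝ) = 1 := by rw [← cosα, α0, Real.cos_zero]
      exact (inner_eq_one_iff_of_norm_eq_one hp hq).1 this
    have v0 : ∀ s ∈ Icc (0 : ℝ) 1, γ' s = 0 := fun s hs => by
      rw [← norm_eq_zero, hγ.minimal s hs]; exact α0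
    have := eq_of_deriv_zero hF (fun s hs => by rw [v0 s hs]; simp) 1 m1
    rw [← hF1, this, hF0, ← pq, hξ]
    simp
  · have αpi : α < Real.pi := by
      refine lt_of_le_of_ne (InnerProductGeometry.angle_le_pi p q) fun h => ?_
      rw [h, Real.cos_pi] at cosα
      linarith
    have sp : 0 < Real.sin α := Real.sin_pos_of_pos_of_lt_pi h0 αpi
    have αne : α ≠ 0 := h0.ne'
    have dcos : ∀ s : ℝ, HasDerivWithinAt (fun s => Real.cos (α * s)) (-Real.sin (α * s) * α)
        (Icc 0 1) s := fun s => by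
      have := ((hasDerivAt_id s).const_mul α).cos.hasDerivWithinAt (s := Icc (0 : ℝ) 1)
      simpa using this
    have dsin : ∀ s : ℝ, HasDerivWithinAt (fun s => Real.sin (α * s)) (Real.cos (α * s) * α)
        (Icc 0 1) s := fun s => by
      have := ((hasDerivAt_id s).const_mul α).sin.hasDerivWithinAt (s := Icc (0 : ℝ) 1)
      simpa using this
    -- In the rotating frame the geodesic equation has two constants of motion; they determine the
    -- velocities at both ends from the endpoints, since sin α ≠ 0.
    have e2 := eq_of_deriv_zero (fun s hs => (((dcos s).smul (hγ.velocity s hs)).const_smul α).sub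
      ((dsin s).smul (geo s hs))) (fun s hs => by module) 1 m1
    have e3 := eq_of_deriv_zero (fun s hs => (((dsin s).smul (hγ.velocity s hs)).const_smul α).add
      ((dcos s).smul (geo s hs))) (fun s hs => by module) 1 m1
    simp only [Pi.sub_apply, Pi.add_apply, Pi.smul_apply, Pi.smul_apply', mul_one, mul_zero,
      Real.cos_zero, Real.sin_zero, hγ.source, hγ.target, one_smul, zero_smul, smul_zero, sub_zero,
      zero_add, hF0, hF1] at e1 e2 e3
    have v1 : γ' 1 = (α / Real.sin α) • (Real.cos α • q - p) := by
      have : Real.sin α • γ' 1 = α • (Real.cos α • q - p) := by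
        rw [smul_sub, ← e2]; abel
      rw [div_eq_inv_mul, mul_smul, ← this, smul_smul, inv_mul_cancel₀ sp.ne', one_smul]
    have sc := Real.sin_sq_add_cos_sq α
    have v0 : γ' 0 = (α / Real.sin α) • (q - Real.cos α • p) := by
      rw [← e3, v1]
      have : Real.sin α = (1 / Real.sin α) * (1 - Real.cos α ^ 2) := by
        field_simp; linarith
      nth_rw 1 [this]
      module
    have κe : κ = α / Real.sin α * inner ℝ ξ q := by
      rw [hκ, v0, inner_smul_right, inner_sub_right, inner_smul_right, hξ]; ring
    have hne : (1 + Real.cos α) ≠ 0 := by rw [cosα]; linarith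
    have e4 : α ^ 2 • η = α ^ 2 • (ξ - (inner ℝ ξ q / (1 + inner ℝ p q) : ℝ) • (p + q)) := by
      have : α ^ 2 • η = α ^ 2 • ξ + κ • (γ' 1 - γ' 0) := by
        rw [sub_eq_iff_eq_add.1 e1]; module
      have d : γ' 1 - γ' 0 = -((α / Real.sin α) * (1 - Real.cos α)) • (p + q) := by
        rw [v1, v0]; module
      have co : κ * ((α / Real.sin α) * (1 - Real.cos α)) =
          α ^ 2 * (inner ℝ ξ q / (1 + inner ℝ p q)) := by
        rw [κe, ← cosα]
        field_simp
        linear_combination (-(inner ℝ ξ q : ℝ)) * sc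
      rw [this, d, smul_smul, mul_neg, co]
      module
    exact smul_right_injective _ (pow_ne_zero 2 αne) e4

/-- The great circle through p and q and the field whose component along the direction of motion
rotates with it. -/
lemma exists_isTransport (hp : ‖p‖ = 1) (hq : ‖q‖ = 1) (hc : -1 < (inner ℝ p q : ℝ))
    (hξ : (inner ℝ ξ p : ℝ) = 0) : ∃ η, IsTransport p q ξ η := by
  set α := InnerProductGeometry.angle p q with hα
  have cosα : Real.cos α = inner ℝ p q := by
    rw [hα, InnerProductGeometry.cos_angle, hp, hq]; simp
  have pp : (inner ℝ p p : ℝ) = 1 := by rw [real_inner_self_eq_norm_sq, hp, one_pow]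
  have qq : (inner ℝ q q : ℝ) = 1 := by rw [real_inner_self_eq_norm_sq, hq, one_pow]
  have sc := Real.sin_sq_add_cos_sq α
  -- For p = q no direction is distinguished, and e = 0 serves: all later identities need |e|² = 1
  -- only after multiplication by α, or through sin(αs) = 0.
  obtain ⟨e, ep, eq, ee⟩ : ∃ e : Space, (inner ℝ p e : ℝ) = 0 ∧
      q = Real.cos α • p + Real.sin α • e ∧ (α = 0 ∨ (inner ℝ e e : ℝ) = 1) := by
    rcases (InnerProductGeometry.angle_nonneg p q).eq_or_lt with h0 | h0
    · refine ⟨0, by simp, ?_, Or.inl h0.symm⟩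
      have : (inner ℝ p q : ℝ) = 1 := by rw [← cosα, hα, ← h0, Real.cos_zero]
      rw [cosα, this, (inner_eq_one_iff_of_norm_eq_one hp hq).1 this]; simp
    · have αpi : α < Real.pi := by
        refine lt_of_le_of_ne (InnerProductGeometry.angle_le_pi p q) fun h => ?_
        rw [h, Real.cos_pi] at cosα
        linarith
      have sp : 0 < Real.sin α := Real.sin_pos_of_pos_of_lt_pi h0 αpi
      refine ⟨(1 / Real.sin α) • (q - Real.cos α • p), ?_, ?_, Or.inr ?_⟩
      · rw [inner_smul_right, inner_sub_right, inner_smul_right, pp, cosα]; ring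
      · rw [smul_smul, mul_one_div_cancel sp.ne']; module
      · simp only [inner_smul_left, inner_smul_right, inner_sub_left, inner_sub_right, pp, qq,
          real_inner_comm p q, conj_trivial, ← cosα]
        field_simp
        linarith
  have pe : (inner ℝ e p : ℝ) = 0 := by rw [real_inner_comm]; exact ep
  have αe : α * inner ℝ e e = α := by
    rcases ee with h | h
    · rw [h, zero_mul]
    · rw [h, mul_one]
  have dcos : ∀ s : ℝ, HasDerivAt (fun s => Real.cos (α * s)) (-Real.sin (α * s) * α) s := fun s => by
    simpa using ((hasDerivAt_id s).const_mul α).cos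
  have dsin : ∀ s : ℝ, HasDerivAt (fun s => Real.sin (α * s)) (Real.cos (α * s) * α) s := fun s => by
    simpa using ((hasDerivAt_id s).const_mul α).sin
  set g : ℝ → Space := fun s => Real.cos (α * s) • p + Real.sin (α * s) • e with hg
  set v : ℝ → Space := fun s => α • (-Real.sin (α * s) • p + Real.cos (α * s) • e) with hv
  set F : ℝ → Space := fun s => ξ + (inner ℝ ξ e : ℝ) •
    (-Real.sin (α * s) • p + (Real.cos (α * s) - 1) • e) with hF
  have s1 : ∀ s, Real.sin (α * s) ^ 2 + Real.cos (α * s) ^ 2 = 1 := fun s =>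
    Real.sin_sq_add_cos_sq _
  have dg : ∀ s, HasDerivAt g (v s) s := fun s => by
    refine (((dcos s).smul_const p).add ((dsin s).smul_const e)).congr_deriv ?_
    simp only [hv]; module
  have dv : ∀ s, HasDerivAt v (-(α ^ 2) • g s) s := fun s => by
    refine ((((dsin s).neg.smul_const p).add ((dcos s).smul_const e)).const_smul α).congr_deriv ?_
    simp only [hg]; module
  have vv : ∀ s, (inner ℝ (v s) (v s) : ℝ) = α ^ 2 := fun s => by
    simp only [hv, inner_smul_left, inner_smul_right, inner_add_left, inner_add_right,
      pp, ep, pe, conj_trivial]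
    linear_combination α ^ 2 * s1 s + α * Real.cos (α * s) ^ 2 * αe
  have dF : ∀ s, HasDerivAt F (-(inner ℝ (F s) (v s) : ℝ) • g s) s := fun s => by
    have key : (inner ℝ (F s) (v s) : ℝ) = α * inner ℝ ξ e := by
      simp only [hF, hv, inner_smul_left, inner_smul_right, inner_add_left, inner_add_right,
        pp, ep, pe, hξ, conj_trivial]
      linear_combination α * inner ℝ ξ e * s1 s +
        inner ℝ ξ e * Real.cos (α * s) * (Real.cos (α * s) - 1) * αe
    rw [key]
    refine (((((dsin s).neg.smul_const p).add (((dcos s).sub_const 1).smul_const e)).const_smul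
      (inner ℝ ξ e : ℝ)).const_add ξ).congr_deriv ?_
    simp only [hg]; module
  have gg : ∀ s, ‖g s‖ = 1 := fun s => by
    have : (inner ℝ (g s) (g s) : ℝ) = 1 := by
      simp only [hg, inner_smul_left, inner_smul_right, inner_add_left, inner_add_right,
        pp, ep, pe, conj_trivial]
      rcases ee with h | h
      · simp [h]
      · rw [h]; linear_combination s1 s
    rw [real_inner_self_eq_norm_sq] at this
    exact (pow_eq_one_iff_of_nonneg (norm_nonneg _) two_ne_zero).1 this
  refine ⟨F 1, g, v, F, ⟨?_, ?_, fun s _ => gg s, fun s _ => (dg s).hasDerivWithinAt, fun s _ => ?_,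
    fun s _ => ?_⟩, fun s _ => (dF s).hasDerivWithinAt, ?_, rfl⟩
  · simp [hg]
  · simp only [hg, mul_one]; exact eq.symm
  · rw [vv]; exact (dv s).hasDerivWithinAt
  · have := vv s
    rw [real_inner_self_eq_norm_sq] at this
    exact (sq_eq_sq₀ (norm_nonneg _) (InnerProductGeometry.angle_nonneg p q)).1 this
  · simp [hF]

/-- Every admissible transport has the same value, so the choice in the definition is harmless for
tangent vectors at points that are not antipodal. -/
lemma transport_eq (hp : ‖p‖ = 1) (hq : ‖q‖ = 1) (hc : -1 < (inner ℝ p q : ℝ))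
    (hξ : (inner ℝ ξ p : ℝ) = 0) :
    transport p q ξ = ξ - (inner ℝ ξ q / (1 + inner ℝ p q) : ℝ) • (p + q) := by
  have h := exists_isTransport hp hq hc hξ
  rw [transport, dif_pos h]
  exact h.choose_spec.eq hp hq hc hξ

/-- Insert the closed formula and use tangency ξ·p = η·q = 0; the denominator 1 + p·q is 1/ζ. This
is the link between the quantity in the theorem and the energy that is estimated. -/
lemma normSq_transport_sub (hp : ‖p‖ = 1) (hq : ‖q‖ = 1) (hc : -1 < (inner ℝ p q : ℝ))
    (hξ : (inner ℝ p ξ : ℝ) = 0) (hη : (inner ℝ q η : ℝ) = 0) :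
    ‖transport p q ξ - η‖ ^ 2 =
      2 * density (p - q) ((1 / 2 : ℝ) • (ξ + η)) (ξ - η) := by
  have pp : (inner ℝ p p : ℝ) = 1 := by rw [real_inner_self_eq_norm_sq, hp, one_pow]
  have qq : (inner ℝ q q : ℝ) = 1 := by rw [real_inner_self_eq_norm_sq, hq, one_pow]
  have hξ' : (inner ℝ ξ p : ℝ) = 0 := by rw [real_inner_comm]; exact hξ
  have hη' : (inner ℝ η q : ℝ) = 0 := by rw [real_inner_comm]; exact hη
  have ez : zeta (p - q) = 1 / (1 + inner ℝ p q) := by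
    have : ‖p - q‖ ^ 2 = 2 - 2 * inner ℝ p q := by
      rw [norm_sub_sq_real, hp, hq]; ring
    rw [zeta, this, div_eq_div_iff (by linarith) (by linarith)]
    ring
  rw [transport_eq hp hq hc hξ', density, ez, ← real_inner_self_eq_norm_sq]
  have hne : 1 + (inner ℝ p q : ℝ) ≠ 0 := by linarith
  simp only [inner_smul_left, inner_smul_right, inner_add_left, inner_add_right, inner_sub_left,
    inner_sub_right, pp, qq, hξ, hξ', hη, hη', real_inner_comm p q, real_inner_comm ξ η,
    real_inner_comm q ξ, real_inner_comm p η, conj_trivial]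
  field_simp
  ring

end Transport
end LLHelicity

namespace LLHelicity
set_option linter.unusedSectionVars false

/-! ### The main estimate -/

section Main

variable {M c₀ : ℝ}

lemma jet_bounded {u v : Plane → Space} (hu : SphereMap M u) (hv : SphereMap M v) :
    (jet u v).Bounded (4 * M ^ 2) := by
  have mean : ∀ {f g : Plane → Space}, MemLp f 2 volume → MemLp g 2 volume →
      ∫ x, ‖f x‖ ^ 2 ≤ M ^ 2 → ∫ x, ‖g x‖ ^ 2 ≤ M ^ 2 →
      ∫ x, ‖(1 / 2 : ℝ) • (f x + g x)‖ ^ 2 ≤ 4 * M ^ 2 := by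
    intro f g hf hg bf bg
    have bg' : ∫ x, ‖(-g) x‖ ^ 2 ≤ M ^ 2 := by simpa only [Pi.neg_apply, norm_neg] using bg
    have := integral_normSq_sub_le hf hg.neg bf bg'
    simp only [Pi.neg_apply, sub_neg_eq_add] at this
    have e : ∀ x, ‖(1 / 2 : ℝ) • (f x + g x)‖ ^ 2 = 1 / 4 * ‖f x + g x‖ ^ 2 := fun x => by
      rw [norm_smul, mul_pow]; norm_num
    simp only [e, integral_const_mul]
    nlinarith [sq_nonneg M]
  refine ⟨?_, fun i => mean (hu.mem_one i) (hv.mem_one i) (hu.bound_one i) (hv.bound_one i),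
    fun i => integral_normSq_sub_le (hu.mem_one i) (hv.mem_one i) (hu.bound_one i) (hv.bound_one i),
    fun i j => mean (hu.mem_two i j) (hv.mem_two i j) (hu.bound_two i j) (hv.bound_two i j),
    fun i j => integral_normSq_sub_le (hu.mem_two i j) (hv.mem_two i j) (hu.bound_two i j)
      (hv.bound_two i j)⟩
  have := integral_normSq_sub_le hu.mem hv.mem hu.bound hv.bound
  simpa [jet] using this

lemma inner_gt_of_gap (hc : 0 < c₀) {p q : Space} (hp : ‖p‖ = 1) (hq : ‖q‖ = 1)
    (h : ‖p - q‖ ^ 2 ≤ 4 - c₀) : -1 < (inner ℝ p q : ℝ) := by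
  rw [norm_sub_sq_real, hp, hq] at h
  linarith

lemma normSq_gradDiff {u v : Plane → Space} (hc : 0 < c₀) (hu : SphereMap M u) (hv : SphereMap M v)
    (g : ∀ᵐ x, ‖u x - v x‖ ^ 2 ≤ 4 - c₀) (m : Fin 2) : ∀ᵐ x, ‖gradDiff m u v x‖ ^ 2 =
      2 * density ((jet u v).q x) ((jet u v).dw m x) ((jet u v).dq m x) := by
  filter_upwards [hu.sphere, hv.sphere, g, hu.inner_weakPartial m, hv.inner_weakPartial m]
    with x h1 h2 h3 h4 h5
  exact normSq_transport_sub h1 h2 (inner_gt_of_gap hc h1 h2 h3) h4 h5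

lemma energy_nonneg {u v : Plane → Space} (hc : 0 < c₀) (hu : SphereMap M u) (hv : SphereMap M v)
    (g : ∀ᵐ x, ‖u x - v x‖ ^ 2 ≤ 4 - c₀) (m : Fin 2) : 0 ≤ (jet u v).energy m := by
  refine integral_nonneg_of_ae ?_
  filter_upwards [normSq_gradDiff hc hu hv g m] with x hx
  have := sq_nonneg ‖gradDiff m u v x‖
  rw [hx] at this
  show 0 ≤ density _ _ _
  linarith

lemma eLpNorm_gradDiff {u v : Plane → Space} (hc : 0 < c₀) (hu : SphereMap M u) (hv : SphereMap M v)
    (g : ∀ᵐ x, ‖u x - v x‖ ^ 2 ≤ 4 - c₀) (m : Fin 2) :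
    eLpNorm (gradDiff m u v) 2 volume ^ 2 = ENNReal.ofReal (2 * (jet u v).energy m) := by
  have P := jet_isPair hu hv g
  have id := (Jet.IsPair.integrable_density hc P m).const_mul 2
  have ae := normSq_gradDiff hc hu hv g m
  -- The transport is defined by pointwise choice, so its measurability is not obvious. This
  -- measurable function has almost everywhere the same norm, hence the same L² norm.
  set f : Plane → ℝ := fun x => √(2 * density ((jet u v).q x) ((jet u v).dw m x) ((jet u v).dq m x))
    with hf
  have fm : AEStronglyMeasurable f volume :=
    Real.continuous_sqrt.comp_aestronglyMeasurable id.1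
  have sq : ∀ᵐ x, ‖f x‖ ^ 2 =
      2 * density ((jet u v).q x) ((jet u v).dw m x) ((jet u v).dq m x) := by
    filter_upwards [ae] with x hx
    rw [hf, Real.norm_eq_abs, sq_abs, Real.sq_sqrt]
    rw [← hx]; positivity
  have f2 : MemLp f 2 volume := by
    rw [memLp_two_iff_integrable_sq_norm fm]
    exact id.congr (sq.mono fun x hx => hx.symm)
  have e : eLpNorm (gradDiff m u v) 2 volume = eLpNorm f 2 volume := by
    refine eLpNorm_congr_norm_ae ?_
    filter_upwards [ae, sq] with x h1 h2
    exact (sq_eq_sq₀ (norm_nonneg _) (norm_nonneg _)).1 (h1.trans h2.symm)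
  rw [e, eLpNorm_two_eq f2, ← ENNReal.ofReal_pow (Real.sqrt_nonneg _),
    Real.sq_sqrt (integral_nonneg fun _ => sq_nonneg _), integral_congr_ae sq, integral_const_mul]
  rfl

/-- The three terms of the squared distance. -/
noncomputable def Jet.part (J : Jet) : Fin 3 → ℝ :=
  ![∫ x, ‖J.q x‖ ^ 2, 2 * J.energy 0, 2 * J.energy 1]

lemma Jet.sum_part (J : Jet) : ∑ j, J.part j = J.total := by
  rw [Jet.total, Fin.sum_univ_three, Fin.sum_univ_two, ← add_assoc]
  rfl

lemma Jet.part_nonneg {J : Jet} (h : ∀ m, 0 ≤ J.energy m) (j : Fin 3) : 0 ≤ J.part j := by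
  fin_cases j
  · exact integral_nonneg fun _ => sq_nonneg _
  · exact mul_nonneg zero_le_two (h 0)
  · exact mul_nonneg zero_le_two (h 1)

/-- A crude bound by the H² norms, needed as the upper bound X in the choice of ε. -/
lemma Jet.IsPair.total_le {J : Jet} {K : ℝ} (hc : 0 < c₀) (h : J.IsPair c₀) (hb : J.Bounded K) :
    J.total ≤ K + 2 * ((1 + 4 / c₀) * K) := by
  have key : ∀ m, 2 * J.energy m ≤ (1 + 4 / c₀) * K := fun m => by
    have i := (h.dq_two m).norm.integrable_sq
    have k0 : 0 ≤ 1 + 4 / c₀ := by positivity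
    rw [Jet.energy, ← integral_const_mul]
    refine (integral_mono_ae ((h.integrable_density hc m).const_mul 2)
      (i.const_mul (1 + 4 / c₀)) ?_).trans ?_
    · filter_upwards [h.gap] with x hx
      obtain ⟨z0, z1, z2⟩ := zeta_spec hc hx
      have cs : inner ℝ (J.q x) (J.dq m x) ^ 2 ≤ ‖J.q x‖ ^ 2 * ‖J.dq m x‖ ^ 2 := by
        rw [← mul_pow, ← sq_abs]
        exact pow_le_pow_left₀ (abs_nonneg _) (abs_real_inner_le_norm _ _) 2
      have m1 := mul_le_mul_of_nonneg_left cs z0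
      have m2 := mul_nonneg z0 (sq_nonneg (inner ℝ (J.dw m x) (J.q x)))
      have m3 : zeta (J.q x) * ‖J.q x‖ ^ 2 ≤ 4 * (2 / c₀) := by linarith
      have m4 := mul_le_mul_of_nonneg_right m3 (sq_nonneg ‖J.dq m x‖)
      have e : 4 / c₀ = 2 * (2 / c₀) := by ring
      simp only [density, real_inner_self_eq_norm_sq, e]
      nlinarith
    · rw [integral_const_mul]
      exact mul_le_mul_of_nonneg_left (hb.dq m) k0
  rw [Jet.total, Fin.sum_univ_two]
  linarith [key 0, key 1, hb.q]

/-- The growth of the squared distance of two solutions, with a constant independent of `p`. -/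
lemma exists_growth (b : ℝ) (hc : 0 < c₀) (hM : 0 ≤ M) : ∃ C : ℝ, 0 < C ∧
    ∀ (t₀ T : ℝ) (u v : ℝ → Plane → Space), 0 ≤ T → Evolution b M (Icc t₀ (t₀ + T)) u →
      Evolution b M (Icc t₀ (t₀ + T)) v →
      (∀ t ∈ Icc t₀ (t₀ + T), ∀ᵐ x, ‖u t x - v t x‖ ^ 2 ≤ 4 - c₀) →
      (∀ j, BddAbove ((fun t => (jet (u (t₀ + t)) (v (t₀ + t))).part j) '' Icc 0 T)) ∧
      ∀ p : ℝ, 2 < p → ∑ j, sSup ((fun t => (jet (u (t₀ + t)) (v (t₀ + t))).part j) '' Icc 0 T) ≤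
        ((jet (u t₀) (v t₀)).total ^ (1 / p) + C * T) ^ p := by
  obtain ⟨C, hC, err⟩ := Jet.IsPair.exists_errJet_le (c₀ := c₀) (K := 4 * M ^ 2) hc (by positivity)
  -- The a priori bound for the total; the added 1 ensures X ≥ 1.
  set X : ℝ := 4 * M ^ 2 + 2 * ((1 + 4 / c₀) * (4 * M ^ 2)) + 1 with hX
  have X0 : 0 ≤ 4 * M ^ 2 + 2 * ((1 + 4 / c₀) * (4 * M ^ 2)) := by positivity
  set k₁ : ℝ := 4 * |b| + 2 with hk₁
  set k₂ : ℝ := 200 + 20 * (2 / c₀ + (2 / c₀) ^ 2) * (2 * (1 + |b|)) + 12 * |b| with hk₂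
  have k₁0 : 0 ≤ k₁ := by positivity
  have k₂0 : 0 ≤ k₂ := by positivity
  -- It dominates the rates of all three parts: 2k₁ for the L² distance and 2k₂ for twice an energy.
  set L : ℝ := (2 * k₁ + 2 * k₂) * (3 * C * X) with hL
  have hL0 : 0 ≤ L := by positivity
  -- The 3 counts the parts whose suprema are summed; the 1 makes the constant positive.
  refine ⟨3 * L + 1, by positivity, fun t₀ T u v hT hu hv hg => ?_⟩
  have mem : ∀ t ∈ Icc 0 T, t₀ + t ∈ Icc t₀ (t₀ + T) := fun t ht =>
    ⟨by linarith [ht.1], by linarith [ht.2]⟩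
  have P := fun t ht => jet_isPair (hu.map t ht) (hv.map t ht) (hg t ht)
  have B := fun t ht => jet_bounded (hu.map t ht) (hv.map t ht)
  have E := fun t ht => energy_nonneg hc (hu.map t ht) (hv.map t ht) (hg t ht)
  have tX : ∀ t ∈ Icc t₀ (t₀ + T), (jet (u t) (v t)).total ≤ X := fun t ht =>
    (Jet.IsPair.total_le hc (P t ht) (B t ht)).trans (by linarith)
  have t0 : ∀ t ∈ Icc t₀ (t₀ + T), 0 ≤ (jet (u t) (v t)).total := fun t ht => by
    rw [← Jet.sum_part]; exact Finset.sum_nonneg fun j _ => Jet.part_nonneg (E t ht) j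
  refine ⟨fun j => ⟨X, ?_⟩, fun p hp => ?_⟩
  · rintro _ ⟨t, ht, rfl⟩
    refine le_trans ?_ (tX _ (mem t ht))
    rw [← Jet.sum_part]
    exact Finset.single_le_sum (fun i _ => Jet.part_nonneg (E _ (mem t ht)) i) (Finset.mem_univ j)
  have p0 : 0 < p := by linarith
  have hp1 : 0 < 1 - 1 / p := by
    have : 1 / p < 1 := by rw [div_lt_one p0]; linarith
    linarith
  have main := sum_sSup_le (e := fun j t => (jet (u (t₀ + t)) (v (t₀ + t))).part j) (p := p) (L := L)
    (X := X) hT hp hL0 (fun j t ht => Jet.part_nonneg (E _ (mem t ht)) j)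
    (fun t ht => by rw [Jet.sum_part]; exact tX _ (mem t ht)) ?_
  · refine main.trans ?_
    simp only [add_zero, Jet.sum_part]
    have := t0 t₀ ⟨le_rfl, by linarith⟩
    refine Real.rpow_le_rpow (by positivity) ?_ p0.le
    nlinarith
  · intro j t₁ t₂ Y h1 h2 h3 hY
    have sub : Icc (t₀ + t₁) (t₀ + t₂) ⊆ Icc t₀ (t₀ + T) :=
      Icc_subset_Icc (by linarith) (by linarith)
    have Y0 : 0 ≤ Y := by
      have := hY t₁ ⟨le_rfl, h2⟩
      rw [Jet.sum_part] at this
      exact (t0 _ (mem t₁ ⟨h1, h2.trans h3⟩)).trans this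
    set z : ℝ := 3 * C * X * p * Y ^ (1 - 1 / p) with hz
    have z0 : 0 ≤ z := by positivity
    have bd : ∀ t ∈ Icc (t₀ + t₁) (t₀ + t₂), errJet (jet (u t) (v t)) ≤ z := fun t ht => by
      have ht' := sub ht
      refine (le_rpow_of_log_bound hC (t0 t ht') (tX t ht') (by linarith) hp
        (err _ (P t ht') (B t ht') (E t ht'))).trans ?_
      have := hY (t - t₀) ⟨by linarith [ht.1], by linarith [ht.2]⟩
      rw [Jet.sum_part, add_sub_cancel] at this
      exact mul_le_mul_of_nonneg_left (Real.rpow_le_rpow (t0 t ht') this hp1.le) (by positivity)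
    have hle : t₀ + t₁ ≤ t₀ + t₂ := by linarith
    have hg' := fun t ht => hg t (sub ht)
    have eL : L * p * Y ^ (1 - 1 / p) = 2 * (k₁ * z) + 2 * (k₂ * z) := by rw [hL, hz]; ring
    have d : t₀ + t₂ - (t₀ + t₁) = t₂ - t₁ := by ring
    have n1 : 0 ≤ k₁ * z * (t₂ - t₁) := mul_nonneg (by positivity) (by linarith)
    have n2 : 0 ≤ k₂ * z * (t₂ - t₁) := mul_nonneg (by positivity) (by linarith)
    have en := fun m => energy_sub_le (B := k₂ * z) hle hM (by positivity) (hu.mono sub)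
      (hv.mono sub) hg' hc m fun t ht => mul_le_mul_of_nonneg_left (bd t ht) k₂0
    rw [eL]
    fin_cases j
    · have := l2_sub_le (B := 2 * (k₁ * z)) hle hM (by positivity) (hu.mono sub) (hv.mono sub) hg'
        fun t ht => mul_le_mul_of_nonneg_left (mul_le_mul_of_nonneg_left (bd t ht) k₁0) (by norm_num)
      rw [d] at this
      refine this.trans ?_
      linarith
    · have := en 0
      rw [d] at this
      show 2 * (jet (u (t₀ + t₂)) (v (t₀ + t₂))).energy 0 -
        2 * (jet (u (t₀ + t₁)) (v (t₀ + t₁))).energy 0 ≤ _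
      linarith
    · have := en 1
      rw [d] at this
      show 2 * (jet (u (t₀ + t₂)) (v (t₀ + t₂))).energy 1 -
        2 * (jet (u (t₀ + t₁)) (v (t₀ + t₁))).energy 1 ≤ _
      linarith

end Main
end LLHelicity

namespace LLHelicity
set_option linter.unusedSectionVars false

/-! ### Growth of the distance and uniqueness -/

lemma sq_iSup_le {f : ℝ → ℝ≥0∞} {e : ℝ → ℝ} {I : Set ℝ} (h : ∀ t ∈ I, f t ^ 2 = ENNReal.ofReal (e t))
    (hb : BddAbove (e '' I)) : (⨆ t ∈ I, f t) ^ 2 ≤ ENNReal.ofReal (sSup (e '' I)) := by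
  set S := ENNReal.ofReal (sSup (e '' I)) with hS
  have key : ⨆ t ∈ I, f t ≤ S ^ (1 / 2 : ℝ) := by
    refine iSup₂_le fun t ht => ?_
    have : f t = (f t ^ 2) ^ (1 / 2 : ℝ) := by
      rw [← ENNReal.rpow_natCast, ← ENNReal.rpow_mul]; norm_num
    rw [this, h t ht]
    exact ENNReal.rpow_le_rpow (ENNReal.ofReal_le_ofReal (le_csSup hb ⟨t, ht, rfl⟩)) (by norm_num)
  refine (pow_le_pow_left₀ zero_le key 2).trans_eq ?_
  rw [← ENNReal.rpow_natCast, ← ENNReal.rpow_mul]; norm_num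

lemma normSq_sub_le_of_angle {θ : ℝ} {p q : Space} (hθ : θ ≤ Real.pi) (hp : ‖p‖ = 1)
    (hq : ‖q‖ = 1) (h : InnerProductGeometry.angle p q ≤ θ) :
    ‖p - q‖ ^ 2 ≤ 4 - 2 * (1 + Real.cos θ) := by
  have := Real.cos_le_cos_of_nonneg_of_le_pi (InnerProductGeometry.angle_nonneg p q) hθ h
  rw [InnerProductGeometry.cos_angle, hp, hq, mul_one, div_one] at this
  rw [norm_sub_sq_real, hp, hq]
  linarith

section Pair

variable {M c₀ : ℝ}

lemma SphereMap.eLpNorm_sub {u v : Plane → Space} (hu : SphereMap M u) (hv : SphereMap M v)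
    (g : ∀ᵐ x, ‖u x - v x‖ ^ 2 ≤ 4 - c₀) :
    eLpNorm (fun x => u x - v x) 2 volume ^ 2 = ENNReal.ofReal ((jet u v).part 0) := by
  have q2 : MemLp (fun x => u x - v x) 2 volume := (jet_isPair hu hv g).q_two
  rw [eLpNorm_two_eq q2, ← ENNReal.ofReal_pow (Real.sqrt_nonneg _),
    Real.sq_sqrt (integral_nonneg fun _ => sq_nonneg _)]
  rfl

lemma exists_G_le (b : ℝ) (hc : 0 < c₀) (hM : 0 ≤ M) : ∃ C : ℝ, 0 < C ∧
    ∀ (T : ℝ) (u v : ℝ → Plane → Space), 0 ≤ T → Evolution b M (Icc 0 T) u →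
      Evolution b M (Icc 0 T) v → (∀ t ∈ Icc 0 T, ∀ᵐ x, ‖u t x - v t x‖ ^ 2 ≤ 4 - c₀) →
      G T u v < ⊤ ∧
      ∀ p : ℝ, 2 < p → G T u v ≤ (G 0 u v ^ (1 / p) + ENNReal.ofReal (C * T)) ^ p := by
  obtain ⟨C, hC, key⟩ := exists_growth b hc hM
  refine ⟨C, hC, fun T u v hT hu hv hg => ?_⟩
  have := key 0 T u v hT
  simp only [zero_add] at this
  obtain ⟨bdd, main⟩ := this hu hv hg
  have E := fun t ht => energy_nonneg hc (hu.map t ht) (hv.map t ht) (hg t ht)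
  have n0 := fun t ht => (hu.map t ht).eLpNorm_sub (hv.map t ht) (hg t ht)
  have n1 := fun m t ht => eLpNorm_gradDiff hc (hu.map t ht) (hv.map t ht) (hg t ht) m
  have nn := fun t ht j => Jet.part_nonneg (E t ht) j
  have S0 : ∀ j, 0 ≤ sSup ((fun t => (jet (u t) (v t)).part j) '' Icc 0 T) := fun j =>
    Real.sSup_nonneg (by rintro _ ⟨t, ht, rfl⟩; exact nn t ht j)
  have h0 : (0 : ℝ) ∈ Icc 0 T := ⟨le_rfl, hT⟩
  have t0 : 0 ≤ (jet (u 0) (v 0)).total := by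
    rw [← Jet.sum_part]; exact Finset.sum_nonneg fun j _ => nn 0 h0 j
  have GT : G T u v ≤ ENNReal.ofReal
      (∑ j, sSup ((fun t => (jet (u t) (v t)).part j) '' Icc 0 T)) := by
    rw [ENNReal.ofReal_sum_of_nonneg fun j _ => S0 j, Fin.sum_univ_three, G, Fin.sum_univ_two,
      ← add_assoc]
    exact add_le_add (add_le_add (sq_iSup_le n0 (bdd 0)) (sq_iSup_le (n1 0) (bdd 1)))
      (sq_iSup_le (n1 1) (bdd 2))
  have G0 : G 0 u v = ENNReal.ofReal (jet (u 0) (v 0)).total := by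
    rw [← Jet.sum_part, ENNReal.ofReal_sum_of_nonneg fun j _ => nn 0 h0 j, Fin.sum_univ_three, G,
      Fin.sum_univ_two, ← add_assoc]
    simp only [Icc_self, mem_singleton_iff, iSup_iSup_eq_left]
    rw [n0 0 h0, n1 0 0 h0, n1 1 0 h0]
    rfl
  refine ⟨GT.trans_lt ENNReal.ofReal_lt_top, fun p hp => ?_⟩
  have p0 : 0 ≤ 1 / p := by positivity
  refine (GT.trans (ENNReal.ofReal_le_ofReal (main p hp))).trans_eq ?_
  rw [G0, ENNReal.ofReal_rpow_of_nonneg t0 p0, ← ENNReal.ofReal_add (Real.rpow_nonneg t0 _)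
    (by positivity), ENNReal.ofReal_rpow_of_nonneg (by positivity) (by linarith)]

lemma jet_total_eq_zero {u v : Plane → Space} (h : u =ᵐ[volume] v) : (jet u v).total = 0 := by
  have q0 : ∀ᵐ x, (jet u v).q x = 0 := h.mono fun x hx => sub_eq_zero.2 hx
  have d0 : ∀ m, ∀ᵐ x, (jet u v).dq m x = 0 := fun m =>
    (weakPartial_congr h).mono fun x hx => sub_eq_zero.2 hx
  have e0 : ∀ m, (jet u v).energy m = 0 := fun m => by
    refine integral_eq_zero_of_ae ?_
    filter_upwards [q0, d0 m] with x h1 h2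
    simp [density, h1, h2]
  have i0 : ∫ x, ‖(jet u v).q x‖ ^ 2 = 0 := by
    refine integral_eq_zero_of_ae ?_
    filter_upwards [q0] with x h1
    simp [h1]
  simp [Jet.total, e0, i0]

/-- Along integers p > 2 the right-hand side tends to zero. It can be used because the growth
constant is independent of p. -/
lemma eq_zero_of_le_rpow {y r : ℝ} (h0 : 0 ≤ y) (hr : 0 ≤ r) (hr1 : r < 1)
    (h : ∀ p : ℝ, 2 < p → y ≤ r ^ p) : y = 0 := by
  refine le_antisymm (ge_of_tendsto (tendsto_pow_atTop_nhds_zero_of_lt_one hr hr1) ?_) h0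
  filter_upwards [eventually_gt_atTop 2] with n hn
  have := h n (by exact_mod_cast hn)
  rwa [Real.rpow_natCast] at this

/-- Equality at time s and continuity in L^∞ give |u - v| ≤ 1 for a short time, half from each
solution, so the growth estimate applies with c₀ = 3 and zero initial value. -/
lemma Evolution.exists_ae_eq_of_ae_eq {b : ℝ} {u v : ℝ → Plane → Space} {T : ℝ} (hM : 0 ≤ M)
    (hu : Evolution b M (Icc 0 T) u) (hv : Evolution b M (Icc 0 T) v) {s : ℝ} (hs : s ∈ Ico 0 T)
    (h : u s =ᵐ[volume] v s) : ∃ δ > 0, ∀ t ∈ Icc s (s + δ), t ≤ T → u t =ᵐ[volume] v t := by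
  obtain ⟨C, hC, key⟩ := exists_growth (c₀ := 3) b (by norm_num) hM
  have sI : s ∈ Icc 0 T := ⟨hs.1, hs.2.le⟩
  have ev : ∀ᶠ t in 𝓝[Icc 0 T] s, ∀ᵐ x, ‖u t x - v t x‖ ^ 2 ≤ 4 - 3 := by
    have half : ∀ {w : ℝ → Plane → Space}, Evolution b M (Icc 0 T) w →
        ∀ᶠ t in 𝓝[Icc 0 T] s, ∀ᵐ x, ‖w t x - w s x‖ ≤ 1 / 2 := fun {w} hw => by
      filter_upwards [(hw.tendsto_top s sI).eventually_lt_const (u := ENNReal.ofReal (1 / 2))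
        (by simp)] with t ht
      rw [eLpNorm_exponent_top] at ht
      filter_upwards [ae_le_eLpNormEssSup (f := fun x => w t x - w s x) (μ := volume)] with x hx
      have := hx.trans ht.le
      rwa [← ofReal_norm, ENNReal.ofReal_le_ofReal_iff (by norm_num)] at this
    filter_upwards [half hu, half hv] with t h1 h2
    filter_upwards [h1, h2, h] with x a1 a2 a3
    have e : u t x - v t x = (u t x - u s x) - (v t x - v s x) := by rw [a3]; abel
    have := norm_sub_le (u t x - u s x) (v t x - v s x)
    rw [← e] at this
    nlinarith [norm_nonneg (u t x - v t x)]
  obtain ⟨ε, hε, near⟩ := Metric.mem_nhdsWithin_iff.1 ev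
  -- The first bound stays strictly inside the neighbourhood where the solutions are close; the
  -- second makes C(t - s) ≤ 1/2, so its p-th powers tend to zero.
  set δ := min (ε / 2) (1 / (2 * C)) with hδ
  refine ⟨δ, by positivity, fun t ht htT => ?_⟩
  have sub : Icc s (s + (t - s)) ⊆ Icc 0 T := Icc_subset_Icc hs.1 (by linarith)
  have ts : 0 ≤ t - s := by linarith [ht.1]
  have tε : t - s ≤ ε / 2 := by linarith [ht.2, min_le_left (ε / 2) (1 / (2 * C))]
  have tC : t - s ≤ 1 / (2 * C) := by linarith [ht.2, min_le_right (ε / 2) (1 / (2 * C))]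
  have gap : ∀ r ∈ Icc s (s + (t - s)), ∀ᵐ x, ‖u r x - v r x‖ ^ 2 ≤ 4 - 3 := fun r hr => by
    refine near ⟨?_, sub hr⟩
    rw [Metric.mem_ball, Real.dist_eq, abs_of_nonneg (by linarith [hr.1])]
    linarith [hr.2]
  have map := fun r (hr : r ∈ Icc s (s + (t - s))) => (hu.map r (sub hr))
  have mapv := fun r (hr : r ∈ Icc s (s + (t - s))) => (hv.map r (sub hr))
  obtain ⟨bdd, main⟩ := key s (t - s) u v ts (hu.mono sub) (hv.mono sub) gap
  have nn : ∀ j, ∀ r ∈ Icc 0 (t - s), 0 ≤ (jet (u (s + r)) (v (s + r))).part j := fun j r hr => by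
    have hr' : s + r ∈ Icc s (s + (t - s)) := ⟨by linarith [hr.1], by linarith [hr.2]⟩
    exact Jet.part_nonneg (energy_nonneg (c₀ := 3) (by norm_num) (map _ hr') (mapv _ hr')
      (gap _ hr')) j
  have S0 : ∀ j, 0 ≤ sSup ((fun r => (jet (u (s + r)) (v (s + r))).part j) '' Icc 0 (t - s)) :=
    fun j => Real.sSup_nonneg (by rintro _ ⟨r, hr, rfl⟩; exact nn j r hr)
  have tI : t - s ∈ Icc 0 (t - s) := ⟨ts, le_rfl⟩
  have zero : (jet (u t) (v t)).part 0 = 0 := by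
    have nt := nn 0 _ tI
    rw [add_sub_cancel] at nt
    refine eq_zero_of_le_rpow nt (r := 1 / 2) (by norm_num) (by norm_num) fun p hp => ?_
    have h1 := le_csSup (bdd 0) (mem_image_of_mem _ tI)
    simp only [add_sub_cancel] at h1
    refine h1.trans ((Finset.single_le_sum (fun j _ => S0 j) (Finset.mem_univ 0)).trans
      ((main p hp).trans ?_))
    rw [jet_total_eq_zero h, Real.zero_rpow (by positivity), zero_add]
    refine Real.rpow_le_rpow (by positivity) ?_ (by linarith)
    calc C * (t - s) ≤ C * (1 / (2 * C)) := mul_le_mul_of_nonneg_left tC hC.le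
      _ = 1 / 2 := by field_simp
  have te : t ∈ Icc s (s + (t - s)) := ⟨ht.1, by linarith⟩
  have q2 := (jet_isPair (map t te) (mapv t te) (gap t te)).q_two
  have := (integral_eq_zero_iff_of_nonneg (fun _ => sq_nonneg _) q2.norm.integrable_sq).1 zero
  filter_upwards [this] with x hx
  exact sub_eq_zero.1 (norm_eq_zero.1 (pow_eq_zero_iff two_ne_zero |>.1 hx))

/-- The set of times of agreement is closed by continuity in L², contains 0, and extends to the
right of each of its points before T. -/
lemma Evolution.ae_eq {b : ℝ} {u v : ℝ → Plane → Space} {T : ℝ} (hM : 0 ≤ M)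
    (hu : Evolution b M (Icc 0 T) u) (hv : Evolution b M (Icc 0 T) v) (h : u 0 =ᵐ[volume] v 0)
    {t : ℝ} (ht : t ∈ Icc 0 T) : u t =ᵐ[volume] v t := by
  have tl : ∀ s ∈ Icc 0 T, TL 2 (𝓝[Icc 0 T] s) (fun t x => u t x - v t x)
      (fun x => u s x - v s x) := fun s hs => by
    have := (hu.tl hs).sub (by norm_num) (hv.tl hs)
    simpa using this
  have cont : ContinuousOn (fun t => ∫ x, ‖u t x - v t x‖ ^ 2) (Icc 0 T) := fun s hs =>
    (tl s hs).integral_normSq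
  set S : Set ℝ := {t | u t =ᵐ[volume] v t} with hS
  have iff : ∀ s ∈ Icc 0 T, s ∈ S ↔ ∫ x, ‖u s x - v s x‖ ^ 2 = 0 := fun s hs => by
    have q2 := (tl s hs).mem
    rw [integral_eq_zero_iff_of_nonneg (fun _ => sq_nonneg _) q2.norm.integrable_sq]
    constructor <;> intro k <;> filter_upwards [k] with x hx
    · simp [hx]
    · exact sub_eq_zero.1 (norm_eq_zero.1 (pow_eq_zero_iff two_ne_zero |>.1 hx))
  have closed : IsClosed (S ∩ Icc 0 T) := by
    have := cont.preimage_isClosed_of_isClosed isClosed_Icc (isClosed_singleton (x := (0 : ℝ)))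
    refine (congrArg IsClosed ?_).mp this
    ext s
    simp only [mem_inter_iff, mem_preimage, mem_singleton_iff]
    exact ⟨fun k => ⟨(iff s k.1).2 k.2, k.1⟩, fun k => ⟨k.2, (iff s k.2).1 k.1⟩⟩
  refine closed.Icc_subset_of_forall_exists_gt h (fun s hs y hy => ?_) ht
  obtain ⟨δ, hδ, key⟩ := hu.exists_ae_eq_of_ae_eq hM hv hs.2 hs.1
  have sT := hs.2.2
  have sy : s < y := hy
  refine ⟨min (min y T) (s + δ), key _ ⟨?_, min_le_right _ _⟩
    ((min_le_left _ _).trans (min_le_right _ _)), ?_,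
    (min_le_left _ _).trans (min_le_left _ _)⟩
  · exact le_min (le_min sy.le sT.le) (by linarith)
  · exact lt_min (lt_min sy sT) (by linarith)

end Pair
end LLHelicity

theorem proposition3p1 (b : ℝ) :
    (∀ θ : ℝ, θ < Real.pi → ∃ C : ℝ → ℝ, (∀ M, 0 < C M) ∧
      ∀ (T M : ℝ) (u₀ u₁ : ℝ → LLHelicity.Plane → LLHelicity.Space), 0 < T →
        LLHelicity.IsSolution b T u₀ → LLHelicity.IsSolution b T u₁ →
        (∀ t ∈ Set.Icc 0 T, ∀ᵐ x, InnerProductGeometry.angle (u₀ t x) (u₁ t x) ≤ θ) →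
        LLHelicity.linftyH2 T u₀ + LLHelicity.linftyH2 T u₁ ≤ ENNReal.ofReal M →
          LLHelicity.G T u₀ u₁ < ⊤ ∧
          ∀ p : ℝ, 2 < p →
            LLHelicity.G T u₀ u₁ ≤
              (LLHelicity.G 0 u₀ u₁ ^ (1 / p) + ENNReal.ofReal (C M * T)) ^ p) ∧
    (∀ (T : ℝ) (u₀ u₁ : ℝ → LLHelicity.Plane → LLHelicity.Space), 0 < T →
      LLHelicity.IsSolution b T u₀ → LLHelicity.IsSolution b T u₁ →
      (∀ᵐ x, u₀ 0 x = u₁ 0 x) →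
        ∀ t ∈ Set.Icc 0 T, ∀ᵐ x, u₀ t x = u₁ t x) := by
  refine ⟨fun θ hθ => ?_, fun T u₀ u₁ hT h₀ h₁ h t ht => ?_⟩
  -- The cosine decreases only on [0,π], so a negative θ is replaced by 0; the gap constant is then
  -- 2(1 + cos θ), positive because θ < π.
  · have hθ' : max θ 0 < Real.pi := max_lt hθ Real.pi_pos
    have hc : 0 < 2 * (1 + Real.cos (max θ 0)) := by
      have := Real.cos_lt_cos_of_nonneg_of_le_pi (le_max_right θ 0) le_rfl hθ'
      rw [Real.cos_pi] at this
      linarith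
    -- For negative M the bound is read as 0 in the extended norm, so max M 0 gives the same
    -- hypothesis and supplies the nonnegativity needed.
    choose C hC key using fun M : ℝ => LLHelicity.exists_G_le b hc (le_max_right M 0)
    refine ⟨C, hC, fun T M u₀ u₁ hT h₀ h₁ ha hM => ?_⟩
    have hM' : LLHelicity.linftyH2 T u₀ + LLHelicity.linftyH2 T u₁ ≤ ENNReal.ofReal (max M 0) :=
      hM.trans (ENNReal.ofReal_le_ofReal (le_max_left M 0))
    refine key M T u₀ u₁ hT.le (h₀.evolution hT (le_max_right M 0) (le_self_add.trans hM'))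
      (h₁.evolution hT (le_max_right M 0) (le_add_self.trans hM')) fun t ht => ?_
    filter_upwards [h₀.sphere t ht, h₁.sphere t ht, ha t ht] with x s₀ s₁ a
    exact LLHelicity.normSq_sub_le_of_angle hθ'.le s₀ s₁
      (a.trans (le_max_left θ 0))
  -- Membership in the class makes the norms finite, so a common H² bound exists although none is
  -- prescribed.
  · set N := LLHelicity.linftyH2 T u₀ + LLHelicity.linftyH2 T u₁ with hN
    have top : ENNReal.ofReal N.toReal = N :=
      ENNReal.ofReal_toReal (ENNReal.add_lt_top.2 ⟨h₀.bounded_H2, h₁.bounded_H2⟩).ne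
    exact (h₀.evolution hT ENNReal.toReal_nonneg (le_self_add.trans top.ge)).ae_eq
      ENNReal.toReal_nonneg
      (h₁.evolution hT ENNReal.toReal_nonneg (le_add_self.trans top.ge)) h ht
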